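/- Let $k$ be a field, $n\ge 1$, and let $\delta,\delta_L,\delta_R,\kappa_L,\kappa_R,\kappa_{LR}\in k$ be nonzero. **The algebra $P_n$.** Let $P_n$ be the unital associative $k$-algebra with generators $E_0,E_1,\dots,E_n$ and relations: $E_iE_j=E_jE_i$ if $|i-j|>1$; $E_0^2=\delta_LE_0$; $E_n^2=\delta_RE_n$; $E_i^2=\delta E_i$ for $1\le i\le n-1$; $E_iE_{i+1}E_i=E_i$ and $E_{i+1}E_iE_{i+1}=E_{i+1}$ for $1\le i\le n-2$; if $n\ge2$, also $E_1E_0E_1=\kappa_LE_1$ and $E_{n-1}E_nE_{n-1}=\kappa_RE_{n-1}$; and $IJI=\kappa_{LR}I$, $JIJ=\kappa_{LR}J$, where $I=E_1E_3E_5\cdots$ is the product of all $E_i$ with $i\le n$ odd and $J=E_0E_2E_4\cdots$ is the product of all $E_i$ with $i\le n$ even. **The symplectic blob algebra $b_n$.** A Temperley–Lieb diagram is a non-crossing perfect matching, by lines drawn in a rectangle, of $n$ vertices $1,\dots,n$ on its top edge and $n$ vertices $1',\dots,n'$ on its bottom edge. Lines may carry a sequence of left blobs $L$ and right blobs $R$,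 provided that the lines can be deformed, without crossing, so that simultaneously all left blobs touch the left side and all right blobs touch the right side of the rectangle. Let $B_n$ be the (finite) set of such decorated diagrams in which no line contains consecutive blobs $LL$, $RR$, $LRL$ or $RLR$, and which do not have both a line with both ends on the top edge carrying $L$ and $R$ and a line with both ends on the bottom edge carrying $L$ and $R$. Then $b_n$ is the $k$-algebra with basis $B_n$ in which the product $dd'$ is found by placing $d$ on top of $d'$ and straightening the result by the following rules: on a line, $LL\mapsto\delta_LL$, $RR\mapsto\delta_RR$, $LRL\mapsto\kappa_{LR}L$, $RLR\mapsto\kappa_{LR}R$; a closed loop, once consecutive equal blobs on it have been merged by $LL\mapsto\delta_LL$ and $RR\mapsto\delta_RR$, is removed with a factor $\delta$ if it has no blob, $\kappa_L$ if it has one $L$, $\kappa_R$ if it has one $R$, and $\kappa_{LR}$ if it has one $L$ and one $R$; and if a line joining top vertices $a<b$ and a line joining bottom vertices $c'<d'$ both carry an $L$ and an $R$, they are replaced by a line $a$–$c'$ carrying $L$ and a line $b$–$d'$ carrying $R$, with a factor $\kappa_{LR}$. Let $e$ (respectively $f$) be the identity diagram (all $i$ joined to $i'$) with one left blob on the line $1$–$1'$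 (respectively one right blob on the line $n$–$n'$), and for $1\le i\le n-1$ let $e_i$ be the undecorated diagram with lines $i$–$(i+1)$, $i'$–$(i+1)'$ and $j$–$j'$ for $j\ne i,i+1$. **Theorem.** There is an isomorphism of $k$-algebras $\phi:P_n\to b_n$ with $\phi(E_0)=e$, $\phi(E_i)=e_i$ for $1\le i\le n-1$, and $\phi(E_n)=f$. -/

import Mathlib

namespace SympBlob

/-- The six parameters `δ, δ_L, δ_R, κ_L, κ_R, κ_LR` (with the convention `k_L = k_R = κ_LR`). -/
structure Params (k : Type*) where
  δ : k
  δL : k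
  δR : k
  κL : k
  κR : k
  κLR : k

/-! ### The algebra `P_n` given by generators and relations -/

section Presentation

variable {k : Type*} [Field k]

/-- The free generator `E_i`, `0 ≤ i ≤ n`. -/
abbrev gen (k : Type*) [Field k] {n : ℕ} (i : Fin (n + 1)) : FreeAlgebra k (Fin (n + 1)) :=
  FreeAlgebra.ι k i

/-- `I = E_1 E_3 E_5 ⋯`, the product of all `E_i` with `i ≤ n` odd. -/
def wordI (k : Type*) [Field k] (n : ℕ) : FreeAlgebra k (Fin (n + 1)) :=
  (((List.finRange (n + 1)).filter (fun i : Fin (n + 1) => (i : ℕ) % 2 = 1)).map (gen k)).prod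

/-- `J = E_0 E_2 E_4 ⋯`, the product of all `E_i` with `i ≤ n` even. -/
def wordJ (k : Type*) [Field k] (n : ℕ) : FreeAlgebra k (Fin (n + 1)) :=
  (((List.finRange (n + 1)).filter (fun i : Fin (n + 1) => (i : ℕ) % 2 = 0)).map (gen k)).prod

/-- The defining relations of `P_n`.  The relations involving `κ_L` and `κ_R` are about the
Temperley–Lieb generators `E_1` and `E_{n-1}`, so they are present for `n ≥ 2` only. -/
inductive Rel (q : Params k) (n : ℕ) :
    FreeAlgebra k (Fin (n + 1)) → FreeAlgebra k (Fin (n + 1)) → Prop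
  | comm (i j : Fin (n + 1)) (h : (i : ℕ) + 1 < j) :
      Rel q n (gen k i * gen k j) (gen k j * gen k i)
  | sq_left : Rel q n (gen k 0 * gen k 0) (q.δL • gen k 0)
  | sq_mid (i : Fin (n + 1)) (h₁ : 1 ≤ (i : ℕ)) (h₂ : (i : ℕ) < n) :
      Rel q n (gen k i * gen k i) (q.δ • gen k i)
  | sq_right : Rel q n (gen k (Fin.last n) * gen k (Fin.last n)) (q.δR • gen k (Fin.last n))
  | left (i : Fin (n + 1)) (h₁ : (i : ℕ) = 1) (h₂ : (i : ℕ) < n) :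
      Rel q n (gen k i * gen k 0 * gen k i) (q.κL • gen k i)
  | right (i : Fin (n + 1)) (h₁ : 1 ≤ (i : ℕ)) (h₂ : (i : ℕ) + 1 = n) :
      Rel q n (gen k i * gen k (Fin.last n) * gen k i) (q.κR • gen k i)
  | braid_up (i j : Fin (n + 1)) (h₁ : 1 ≤ (i : ℕ)) (h : (j : ℕ) = i + 1) (h₂ : (j : ℕ) < n) :
      Rel q n (gen k i * gen k j * gen k i) (gen k i)
  | braid_down (i j : Fin (n + 1)) (h₁ : 1 ≤ (i : ℕ)) (h : (j : ℕ) = i + 1) (h₂ : (j : ℕ) < n) :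
      Rel q n (gen k j * gen k i * gen k j) (gen k j)
  | IJI : Rel q n (wordI k n * wordJ k n * wordI k n) (q.κLR • wordI k n)
  | JIJ : Rel q n (wordJ k n * wordI k n * wordJ k n) (q.κLR • wordJ k n)

/-- The algebra `P_n`. -/
abbrev P (q : Params k) (n : ℕ) : Type _ := RingQuot (Rel q n)

/-- The generator `E_i` of `P_n`. -/
def E (q : Params k) {n : ℕ} (i : Fin (n + 1)) : P q n :=
  RingQuot.mkAlgHom k (Rel q n) (gen k i)

end Presentation

/-! ### Decorated diagrams -/

/-- Left and right blobs. -/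
inductive Blob
  | L
  | R
  deriving DecidableEq

open Blob

/-- The vertices of an `(n,n)`-diagram: `inl i` is the `i`-th vertex of the top edge and `inr i`
the `i`-th vertex of the bottom edge, both numbered from `0` and from left to right. -/
abbrev Pt (n : ℕ) : Type := Fin n ⊕ Fin n

/-- Raw data of a decorated diagram without loops: the vertex that each vertex is joined to, and
the blobs met when the line is followed from the given vertex to its other end. -/
@[ext]
structure PreDiagram (n : ℕ) where
  partner : Pt n → Pt n
  word : Pt n → List Blob

/-- The position of a vertex when one goes clockwise around the frame starting from the left side
of the rectangle. -/
def posL {n : ℕ} : Pt n → ℕ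
  | .inl i => i
  | .inr i => n + i.rev

/-- The position of a vertex when one goes clockwise around the frame starting from the right side
of the rectangle. -/
def posR {n : ℕ} : Pt n → ℕ
  | .inl i => n + i
  | .inr i => i.rev

namespace PreDiagram

variable {n : ℕ}

/-- The line at `x` can be deformed to touch the side of the frame from which `pos` counts:
no other line separates it from that side. -/
def Exposed (d : PreDiagram n) (pos : Pt n → ℕ) (x : Pt n) : Prop :=
  ∀ y, ¬ (pos y < pos x ∧ pos y < pos (d.partner x) ∧
    pos x < pos (d.partner y) ∧ pos (d.partner x) < pos (d.partner y))

/-- The lines form a Temperley–Lieb diagram (a non-crossing perfect matching of the vertices), and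
the decorations at the two ends of a line are those of one line, read in opposite directions. -/
structure IsTL (d : PreDiagram n) : Prop where
  invol : ∀ x, d.partner (d.partner x) = x
  ne_self : ∀ x, d.partner x ≠ x
  noncrossing : ∀ x y, posL x < posL y → posL y < posL (d.partner x) →
    posL x < posL (d.partner y) ∧ posL (d.partner y) < posL (d.partner x)
  word_partner : ∀ x, d.word (d.partner x) = (d.word x).reverse

/-- Along one horizontal edge of the frame (`side = Sum.inl`: top, `side = Sum.inr`: bottom), on
the lines with both ends on that edge, no right blob comes before (to the left of) a left blob. -/
structure Ordered (d : PreDiagram n) (side : Fin n → Pt n) : Prop where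
  same_line : ∀ i j, d.partner (side i) = side j → i < j →
    ¬ [R, L].Sublist (d.word (side i))
  two_lines : ∀ i j i' j', d.partner (side i) = side j → d.partner (side i') = side j' →
    i < j → j < i' → i' < j' → ¬ (R ∈ d.word (side i) ∧ L ∈ d.word (side i'))

/-- The loop-free left-right blob pseudo-diagrams.  Lines with a left (right) blob are exposed to
the left (right) side.  All left blobs can touch the left side and all right blobs the right side
*simultaneously*: if there is a propagating line, this is automatic, because a region between
lines that meets both sides does not exist; if there is none, then all outermost lines lie on one
region that meets both sides, and the condition is that at the top as well as at the bottom edge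
the left blobs come before the right blobs. (With a propagating line `Ordered` follows from
exposure.) -/
structure IsLRBlob (d : PreDiagram n) : Prop extends IsTL d where
  exposedL : ∀ x, L ∈ d.word x → d.Exposed posL x
  exposedR : ∀ x, R ∈ d.word x → d.Exposed posR x
  ordered_top : d.Ordered Sum.inl
  ordered_bot : d.Ordered Sum.inr

/-- `B_n'`: the loop-free left-right blob pseudo-diagrams none of whose lines has one of the
features `LL`, `RR`, `LRL`, `RLR`. -/
structure MemB' (d : PreDiagram n) : Prop extends IsLRBlob d where
  no_LL : ∀ x, ¬ [L, L] <:+: d.word x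
  no_RR : ∀ x, ¬ [R, R] <:+: d.word x
  no_LRL : ∀ x, ¬ [L, R, L] <:+: d.word x
  no_RLR : ∀ x, ¬ [R, L, R] <:+: d.word x

/-- The vertex `side i` is the left end of a line decorated by a left and then a right blob, both
ends of which are on the same horizontal edge. -/
def DoubleAt (d : PreDiagram n) (side : Fin n → Pt n) (i : Fin n) : Prop :=
  (∃ j, d.partner (side i) = side j) ∧ d.word (side i) = [L, R]

instance (d : PreDiagram n) (side : Fin n → Pt n) (i : Fin n) : Decidable (d.DoubleAt side i) :=
  inferInstanceAs (Decidable (_ ∧ _))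

/-- `B_n`: the diagrams in `B_n'` without the feature that the topological relation removes, a
line decorated with both blobs at the top together with such a line at the bottom. -/
structure MemB (d : PreDiagram n) : Prop extends MemB' d where
  no_double : ¬ ((∃ i, d.DoubleAt Sum.inl i) ∧ ∃ i, d.DoubleAt Sum.inr i)

/-! ### Concatenation -/

/-- Follow a line in the concatenation of `a` (above) and `b` (below), starting at the `j`-th
vertex of the edge where they are glued and going down into `b` (`down = true`) or up into `a`
(`down = false`).  The result is the list of blobs met and the vertex of the outer frame where the
line ends.  The first argument bounds the number of segments that are followed; an open line meets
each of the `n` glued vertices at most once, so that `n` is enough. -/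
def follow (a b : PreDiagram n) : ℕ → Bool → Fin n → List Blob × Pt n
  | 0, _, j => ([], .inl j)
  | t + 1, true, j =>
      match b.partner (.inl j) with
      | .inr i => (b.word (.inl j), .inr i)
      | .inl i => (b.word (.inl j) ++ (follow a b t false i).1, (follow a b t false i).2)
  | t + 1, false, j =>
      match a.partner (.inr j) with
      | .inl i => (a.word (.inr j), .inl i)
      | .inr i => (a.word (.inr j) ++ (follow a b t true i).1, (follow a b t true i).2)

/-- The blobs and the other end of the line of the concatenation that starts at `x`. -/
def line (a b : PreDiagram n) : Pt n → List Blob × Pt n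
  | .inl i =>
      match a.partner (.inl i) with
      | .inl j => (a.word (.inl i), .inl j)
      | .inr j => (a.word (.inl i) ++ (follow a b n true j).1, (follow a b n true j).2)
  | .inr i =>
      match b.partner (.inr i) with
      | .inr j => (b.word (.inr i), .inr j)
      | .inl j => (b.word (.inr i) ++ (follow a b n false j).1, (follow a b n false j).2)

/-- The open lines of the concatenation, before straightening. -/
def concat (a b : PreDiagram n) : PreDiagram n where
  partner x := (line a b x).2
  word x := (line a b x).1

/-- The glued vertices, two of them adjacent if they are joined by a line of `a` or of `b`. -/
def midGraph (a b : PreDiagram n) : SimpleGraph (Fin n) :=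
  SimpleGraph.fromRel fun i j => a.partner (.inr i) = .inr j ∨ b.partner (.inl i) = .inl j

instance (a b : PreDiagram n) : DecidableRel (midGraph a b).Adj := fun i j =>
  inferInstanceAs (Decidable (i ≠ j ∧ _))

instance (a b : PreDiagram n) : DecidableEq (midGraph a b).ConnectedComponent := fun C D =>
  Quot.recOnSubsingleton₂ C D fun _ _ => decidable_of_iff _ SimpleGraph.ConnectedComponent.eq.symm

/-- A component of the glued vertices is a closed loop if no line leaves it. -/
def IsLoop (a b : PreDiagram n) (C : (midGraph a b).ConnectedComponent) : Prop :=
  ∀ j, (midGraph a b).connectedComponentMk j = C →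
    (∃ i, a.partner (.inr j) = .inr i) ∧ ∃ i, b.partner (.inl j) = .inl i

instance (a b : PreDiagram n) (C : (midGraph a b).ConnectedComponent) : Decidable (IsLoop a b C) :=
  inferInstanceAs (Decidable (∀ _, _ → _ ∧ _))

/-- The number of blobs `g` on a loop.  Every segment of the loop is seen from both of its ends,
whence the division by two. -/
def loopCount (a b : PreDiagram n) (C : (midGraph a b).ConnectedComponent) (g : Blob) : ℕ :=
  (∑ j with (midGraph a b).connectedComponentMk j = C,
    ((a.word (.inr j)).count g + (b.word (.inl j)).count g)) / 2

/-! ### Straightening -/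

section Straightening

variable {k : Type*} [Field k] (q : Params k)

/-- The scalar that replaces a loop with `l` left and `r` right blobs.  On a loop, the left blobs
are contiguous and so are the right blobs, since they have to touch the sides simultaneously; so
`LL ↦ δ_L L` and `RR ↦ δ_R R` leave at most one of each. -/
def loopWeight : ℕ → ℕ → k
  | 0, 0 => q.δ
  | l + 1, 0 => q.δL ^ l * q.κL
  | 0, r + 1 => q.δR ^ r * q.κR
  | l + 1, r + 1 => q.δL ^ l * q.δR ^ r * q.κLR

/-- Put a blob in front of a word without `LL`, `RR`, `LRL`, `RLR` and straighten the result by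
`LL ↦ δ_L L`, `RR ↦ δ_R R`, `LRL ↦ κ_LR L`, `RLR ↦ κ_LR R`. -/
def push : Blob → List Blob → k × List Blob
  | L, L :: w => (q.δL, L :: w)
  | R, R :: w => (q.δR, R :: w)
  | L, R :: L :: w => (q.κLR, L :: w)
  | R, L :: R :: w => (q.κLR, R :: w)
  | g, w => (1, g :: w)

/-- Straighten the word on a line; the result is a scalar and a word with at most two letters. -/
def straightenWord : List Blob → k × List Blob
  | [] => (1, [])
  | g :: w => ((straightenWord w).1 * (push q g (straightenWord w).2).1,
      (push q g (straightenWord w).2).2)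

/-- Straighten the words on all lines. -/
def straightenLines (d : PreDiagram n) : PreDiagram n where
  partner := d.partner
  word x := (straightenWord q (d.word x)).2

/-- The scalar produced by straightening the words on all lines; every line is counted once, at
its first end. -/
def lineScalar (d : PreDiagram n) : k :=
  ∏ x with posL x < posL (d.partner x), (straightenWord q (d.word x)).1

/-- Replace the line at the top with left end `inl i` and the line at the bottom with left end
`inr j` by two propagating lines, of which the left one has a left blob and the right one a right
blob. -/
def reconnect (d : PreDiagram n) (i j : Fin n) : PreDiagram n where
  partner x :=
    if x = .inl i then .inr j
    else if x = .inr j then .inl i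
    else if x = d.partner (.inl i) then d.partner (.inr j)
    else if x = d.partner (.inr j) then d.partner (.inl i)
    else d.partner x
  word x :=
    if x = .inl i ∨ x = .inr j then [L]
    else if x = d.partner (.inl i) ∨ x = d.partner (.inr j) then [R]
    else d.word x

/-- The topological relation: a line with both blobs at the top and a line with both blobs at the
bottom (in a left-right blob diagram there is at most one of either) are replaced by two
propagating lines with a left and a right blob, with a factor `κ_LR`. -/
def topological (d : PreDiagram n) : k × PreDiagram n :=
  match (List.finRange n).find? (fun i => d.DoubleAt Sum.inl i),
      (List.finRange n).find? (fun j => d.DoubleAt Sum.inr j) with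
  | some i, some j => (q.κLR, d.reconnect i j)
  | _, _ => (1, d)

/-- The diagram part of the product: concatenate, straighten all lines, apply the topological
relation. -/
def mulDiagram (a b : PreDiagram n) : PreDiagram n :=
  (topological q (straightenLines q (concat a b))).2

/-- The scalar part of the product. -/
def mulScalar (a b : PreDiagram n) : k :=
  (∏ C : (midGraph a b).ConnectedComponent,
    if IsLoop a b C then loopWeight q (loopCount a b C L) (loopCount a b C R) else 1) *
  lineScalar q (concat a b) *
  (topological q (straightenLines q (concat a b))).1

end Straightening

/-! ### The diagrams of the generators -/

/-- The identity diagram, with prescribed decorations on its (vertical) lines. -/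
def vertical (w : Fin n → List Blob) : PreDiagram n where
  partner := Sum.swap
  word := Sum.elim w fun i => (w i).reverse

/-- The identity diagram. -/
def one (n : ℕ) : PreDiagram n := vertical fun _ => []

/-- The diagram `e`: the identity diagram with a left blob on the first line. -/
def e (n : ℕ) : PreDiagram n := vertical fun i => if (i : ℕ) = 0 then [L] else []

/-- The diagram `f`: the identity diagram with a right blob on the last line. -/
def f (n : ℕ) : PreDiagram n := vertical fun i => if (i : ℕ) + 1 = n then [R] else []

/-- The undecorated diagram joining `a` to `b` at the top and at the bottom, all other lines being
vertical. -/
def cupCap (a b : Fin n) : PreDiagram n where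
  partner
    | .inl i => if i = a then .inl b else if i = b then .inl a else .inr i
    | .inr i => if i = a then .inr b else if i = b then .inr a else .inl i
  word _ := []

/-- The diagram `e_i`, `1 ≤ i ≤ n - 1`, with a cup and a cap at the vertices `i` and `i + 1`
(in the numbering from `1` to `n`). -/
def ei (i : ℕ) (h₁ : 1 ≤ i) (h₂ : i < n) : PreDiagram n :=
  cupCap ⟨i - 1, by omega⟩ ⟨i, h₂⟩

end PreDiagram

/-! ### The symplectic blob algebra -/

section Algebra

variable {k : Type*} [Field k] (q : Params k) {n : ℕ}

/-- The bilinear product on linear combinations of diagrams that is given on diagrams by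
concatenation and straightening. -/
noncomputable def mul :
    (PreDiagram n →₀ k) →ₗ[k] (PreDiagram n →₀ k) →ₗ[k] (PreDiagram n →₀ k) :=
  Finsupp.lift _ k _ fun a => Finsupp.lift _ k _ fun b =>
    Finsupp.single (PreDiagram.mulDiagram q a b) (PreDiagram.mulScalar q a b)

/-- The space underlying the symplectic blob algebra `b_n`, with basis `B_n`; its product is the
restriction of `mul`. -/
def B (k : Type*) [Field k] (n : ℕ) : Submodule k (PreDiagram n →₀ k) :=
  Finsupp.supported k k {d | d.MemB}

/-- A diagram as an element of the space of linear combinations of diagrams. -/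
noncomputable abbrev diag (k : Type*) [Field k] {n : ℕ} (d : PreDiagram n) : PreDiagram n →₀ k :=
  Finsupp.single d 1

end Algebra

end SympBlob

namespace SympBlob

open Blob

namespace PreDiagram

variable {n : ℕ}

/-! ### Tracing lines through a concatenation -/

/-! Both algebras are compared through words in the generators. A word has a value in P_n. It also
has a value on diagrams, a diagram `wdiag` with a scalar `wscalar`, found by multiplying the
identity diagram on the right by one letter after the other. Three facts give the isomorphism.

First, the values on diagrams respect the relations, so that P_n acts from the right on the span of
B_n. Before straightening, right multiplication by a generator is a local change at the bottom edge:
a blob is added (`addBlob`) or two neighbouring vertices are joined (`join`). It commutes with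
concatenation (`concat_ract`), and the loops it closes can be tracked (`loopProd_ract`).
Straightening may be done before or after it (`IsLRBlob.red_ract`), which is associativity in
disguise; the delicate point is the topological relation. Reflection in a horizontal line gives the
same for left multiplication, so equality of words up to a factor (`WEq`) survives multiplication on
both sides, and each relation has to be checked on the identity diagram only. The short relations
are pictures. The relations with I and J pass from m to m + 2 vertices through `iota`, which adds a
cup and a cap on the left.

Second, words reach all diagrams (`IsLRBlob.exists_raw`). If there is a cap, peeling off blobs and
moving an undecorated cap to the left, at the bottom and then at the top, leaves a diagram on two
vertices fewer. If there is none, peeling off blobs leaves the identity.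

Third, words with the same diagram are proportional in P_n (`exists_smul_Ew`). Since all parameters
are nonzero, scalars can be divided out; what remains is a statement about monoids with elements
that satisfy the relations with all parameters equal to 1 (`MonRel`, `Presents`). It is proved by
induction from m to m + 2, starting with one and two vertices. The corner at the idempotent `g 1`
contains elements that satisfy the relations for m (`hatGen_monRel`), and `g 1 * x * g 1` is a
product of these for every word x (`inCorner_eval`); on diagrams, a cup and a cap on the left leave
m vertices. A word that is not one in the two blob generators alone starts and ends with a cap,
which can be moved reversibly to `g 1`. Two words with the same diagram may end with different caps,
but then these caps are disjoint and commute, so that both words absorb both caps.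

Letting P_n act on the identity diagram is now bijective: onto by the second fact, injective by the
third, because the constants of proportionality can be read off from the nonzero scalars of the
diagrams. It is multiplicative because concatenation with the diagram of a word is the action of
that word. -/

theorem swap_eq_iff {x y : Pt n} : x.swap = y ↔ x = y.swap :=
  ⟨fun h => by rw [← h, Sum.swap_swap], fun h => by rw [h, Sum.swap_swap]⟩

/-- The lines form a perfect matching, decorated consistently at the two ends of a line. -/
structure IsMatching (d : PreDiagram n) : Prop where
  invol : ∀ x, d.partner (d.partner x) = x
  ne_self : ∀ x, d.partner x ≠ x
  word_partner : ∀ x, d.word (d.partner x) = (d.word x).reverse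

theorem IsTL.isMatching {d : PreDiagram n} (h : d.IsTL) : d.IsMatching :=
  ⟨h.invol, h.ne_self, h.word_partner⟩

theorem IsMatching.partner_eq_iff {d : PreDiagram n} (h : d.IsMatching) {x y : Pt n} :
    d.partner x = y ↔ d.partner y = x :=
  ⟨fun e => by rw [← e, h.invol], fun e => by rw [← e, h.invol]⟩

theorem IsMatching.partner_inj {d : PreDiagram n} (h : d.IsMatching) {x y : Pt n} :
    d.partner x = d.partner y ↔ x = y :=
  ⟨fun e => by rw [← h.invol x, e, h.invol], fun e => by rw [e]⟩

/-- The line of the concatenation of `a` and `b` that leaves the glued vertex `j` downwards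
(`true`) or upwards (`false`) visits the glued vertices `vs`, meets the blobs `w` and ends
at `y`. -/
inductive Trace (a b : PreDiagram n) : Bool → Fin n → List (Fin n) → List Blob → Pt n → Prop
  | down_out {j i} (h : b.partner (.inl j) = .inr i) :
      Trace a b true j [j] (b.word (.inl j)) (.inr i)
  | down_in {j i vs w y} (h : b.partner (.inl j) = .inl i) (t : Trace a b false i vs w y) :
      Trace a b true j (j :: vs) (b.word (.inl j) ++ w) y
  | up_out {j i} (h : a.partner (.inr j) = .inl i) :
      Trace a b false j [j] (a.word (.inr j)) (.inl i)
  | up_in {j i vs w y} (h : a.partner (.inr j) = .inr i) (t : Trace a b true i vs w y) :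
      Trace a b false j (j :: vs) (a.word (.inr j) ++ w) y

/-- The bound in `follow` plays no role once it covers the vertices visited. `Trace` has no bound,
so properties of lines are proved by induction on traces and carried over by this lemma. -/
theorem Trace.follow_eq {a b : PreDiagram n} {s j vs w y} (t : Trace a b s j vs w y) :
    ∀ m, vs.length ≤ m → follow a b m s j = (w, y) := by
  induction t with
  | down_out h =>
    rintro (_ | m) hm
    · simp at hm
    · simp [follow, h]
  | down_in h t ih =>
    rintro (_ | m) hm
    · simp at hm
    · simp only [List.length_cons, Nat.add_le_add_iff_right] at hm
      simp [follow, h, ih m hm]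
  | up_out h =>
    rintro (_ | m) hm
    · simp at hm
    · simp [follow, h]
  | up_in h t ih =>
    rintro (_ | m) hm
    · simp at hm
    · simp only [List.length_cons, Nat.add_le_add_iff_right] at hm
      simp [follow, h, ih m hm]

/-- The vertex next to the glued vertex `j` below (`true`) or above (`false`); it is glued
if and only if it is of the form `inl i`. -/
def nbr (a b : PreDiagram n) (s : Bool) (j : Fin n) : Pt n :=
  if s then b.partner (.inl j) else (a.partner (.inr j)).swap

section

variable {a b : PreDiagram n} (ha : a.IsMatching) (hb : b.IsMatching)

include ha hb in
theorem nbr_symm {s : Bool} {i j : Fin n} (h : nbr a b s j = .inl i) : nbr a b s i = .inl j := by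
  cases s
  · simp only [nbr, Bool.false_eq_true, if_false, swap_eq_iff, Sum.swap_inl] at h ⊢
    exact ha.partner_eq_iff.1 h
  · simp only [nbr, if_true] at h ⊢
    exact hb.partner_eq_iff.1 h

include ha hb in
theorem nbr_ne {s : Bool} {j : Fin n} : nbr a b s j ≠ .inl j := by
  cases s
  · simp only [nbr, Bool.false_eq_true, if_false, ne_eq, swap_eq_iff, Sum.swap_inl]
    exact ha.ne_self _
  · simp only [nbr, if_true]
    exact hb.ne_self _

include ha hb in
-- Each step is undone by `nbr` with the same direction, and no step stays at its vertex. A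
-- repetition can therefore be traced back to an earlier one, until it reaches the start; there `h0`
-- says that nothing glued lies behind.
theorem path_ne {v : ℕ → Fin n} {σ : ℕ → Bool} (hσ : ∀ p, σ (p + 1) = !σ p) {m : ℕ}
    (hv : ∀ p < m, nbr a b (σ p) (v p) = .inl (v (p + 1)))
    (h0 : ∀ i, nbr a b (!σ 0) (v 0) ≠ .inl i) :
    ∀ q ≤ m, ∀ p < q, v p ≠ v q := by
  intro q
  induction q using Nat.strong_induction_on with
  | _ q ih =>
    intro hq p hp heq
    obtain ⟨r, rfl⟩ : ∃ r, q = r + 1 := ⟨q - 1, by omega⟩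
    have hr := nbr_symm ha hb (hv r (by omega))
    by_cases hpar : σ r = σ p
    · have h1 := hv p (by omega)
      rw [heq, ← hpar, hr] at h1
      have h2 : v r = v (p + 1) := by simpa using h1
      rcases Nat.lt_or_ge (p + 1) r with h3 | h3
      · exact ih r (by omega) (by omega) (p + 1) h3 h2.symm
      · rcases Nat.lt_or_ge p r with h4 | h4
        · obtain rfl : r = p + 1 := by omega
          rw [hσ] at hpar
          cases h : σ p <;> simp [h] at hpar
        · obtain rfl : p = r := by omega
          have := hv p (by omega)
          rw [← h2] at this
          exact nbr_ne ha hb this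
    · have hpar' : σ r = !σ p := by cases h : σ r <;> cases h' : σ p <;> simp_all
      cases p with
      | zero => exact h0 _ (by rw [← hpar', heq]; exact hr)
      | succ p =>
        have h1 := nbr_symm ha hb (hv p (by omega))
        have h2 : σ r = σ p := by rw [hpar', hσ, Bool.not_not]
        rw [heq, ← h2, hr] at h1
        exact ih r (by omega) (by omega) p (by omega) (by simpa using h1.symm)

/-- A line that runs round a closed loop has no trace. The alternative is therefore a path of any
prescribed number of steps, to be excluded by counting. -/
theorem exists_trace_or_path (a b : PreDiagram n) : ∀ (t : ℕ) (s : Bool) (j : Fin n),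
    (∃ vs w y, Trace a b s j vs w y) ∨ ∃ (v : ℕ → Fin n) (σ : ℕ → Bool),
      σ 0 = s ∧ v 0 = j ∧ (∀ p, σ (p + 1) = !σ p) ∧
        ∀ p < t, nbr a b (σ p) (v p) = .inl (v (p + 1)) := by
  intro t
  induction t with
  | zero =>
    intro s j
    exact .inr ⟨fun _ => j, fun p => s ^^ (p % 2 == 1), by simp, rfl, fun p => by
      rcases Nat.mod_two_eq_zero_or_one p with h | h <;> simp [Nat.add_mod, h], by simp⟩
  | succ t ih =>
    intro s j
    rcases hn : nbr a b s j with i | o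
    · rcases ih (!s) i with ⟨vs, w, y, h⟩ | ⟨v, σ, h1, h2, h3, h4⟩
      · left
        cases s
        · simp only [nbr, Bool.false_eq_true, if_false, swap_eq_iff, Sum.swap_inl] at hn
          exact ⟨_, _, _, .up_in hn h⟩
        · simp only [nbr, if_true] at hn
          exact ⟨_, _, _, .down_in hn h⟩
      · right
        refine ⟨fun p => p.casesOn j v, fun p => p.casesOn s σ, rfl, rfl, ?_, ?_⟩
        · rintro (_ | p)
          · exact h1
          · exact h3 p
        · rintro (_ | p) hp
          · simpa [h2] using hn
          · exact h4 p (by omega)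
    · left
      cases s
      · simp only [nbr, Bool.false_eq_true, if_false, swap_eq_iff, Sum.swap_inr] at hn
        exact ⟨_, _, _, .up_out hn⟩
      · simp only [nbr, if_true] at hn
        exact ⟨_, _, _, .down_out hn⟩

include ha hb in
-- Pigeonhole: a line that enters from outside and never leaves would visit `n + 1` distinct glued
-- vertices.
theorem exists_trace {s : Bool} {j : Fin n} (h0 : ∀ i, nbr a b (!s) j ≠ .inl i) :
    ∃ vs w y, Trace a b s j vs w y := by
  rcases exists_trace_or_path a b n s j with h | ⟨v, σ, h1, h2, h3, h4⟩
  · exact h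
  · exfalso
    have hne := path_ne ha hb h3 h4 (by rw [h1, h2]; exact h0)
    have hinj : Function.Injective fun p : Fin (n + 1) => v p := by
      intro p q h
      rcases lt_trichotomy p q with hl | hl | hl
      · exact absurd h (hne q (by omega) p hl)
      · exact hl
      · exact absurd h.symm (hne p (by omega) q hl)
    simpa using Fintype.card_le_of_injective _ hinj

/-- Turns the visited vertices into an indexed path, to which `path_ne` applies. -/
theorem Trace.exists_path {s j vs w y} (t : Trace a b s j vs w y) :
    ∃ (v : ℕ → Fin n) (σ : ℕ → Bool), σ 0 = s ∧ v 0 = j ∧ (∀ p, σ (p + 1) = !σ p) ∧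
      (∀ p, p + 1 < vs.length → nbr a b (σ p) (v p) = .inl (v (p + 1))) ∧
      vs = (List.range vs.length).map v := by
  have key : ∀ (s : Bool) (j i : Fin n) (vs : List (Fin n)), nbr a b s j = .inl i →
      (∃ (v : ℕ → Fin n) (σ : ℕ → Bool), σ 0 = (!s) ∧ v 0 = i ∧ (∀ p, σ (p + 1) = !σ p) ∧
      (∀ p, p + 1 < vs.length → nbr a b (σ p) (v p) = .inl (v (p + 1))) ∧
      vs = (List.range vs.length).map v) →
      ∃ (v : ℕ → Fin n) (σ : ℕ → Bool), σ 0 = s ∧ v 0 = j ∧ (∀ p, σ (p + 1) = !σ p) ∧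
      (∀ p, p + 1 < (j :: vs).length → nbr a b (σ p) (v p) = .inl (v (p + 1))) ∧
      j :: vs = (List.range (j :: vs).length).map v := by
    rintro s j i vs hn ⟨v, σ, h1, h2, h3, h4, h5⟩
    refine ⟨fun p => p.casesOn j v, fun p => p.casesOn s σ, rfl, rfl, ?_, ?_, ?_⟩
    · rintro (_ | p)
      · exact h1
      · exact h3 p
    · rintro (_ | p) hp
      · simpa [h2] using hn
      · exact h4 p (by simpa using hp)
    · rw [List.length_cons, List.range_succ_eq_map, List.map_cons, List.map_map]
      congr 1
  have base : ∀ (s : Bool) (j : Fin n), ∃ (v : ℕ → Fin n) (σ : ℕ → Bool), σ 0 = s ∧ v 0 = j ∧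
      (∀ p, σ (p + 1) = !σ p) ∧
      (∀ p, p + 1 < [j].length → nbr a b (σ p) (v p) = .inl (v (p + 1))) ∧
      [j] = (List.range [j].length).map v := fun s j =>
    ⟨fun _ => j, fun p => s ^^ (p % 2 == 1), by simp, rfl, fun p => by
      rcases Nat.mod_two_eq_zero_or_one p with h | h <;> simp [Nat.add_mod, h], by simp,
      by simp⟩
  induction t with
  | down_out h => exact base _ _
  | up_out h => exact base _ _
  | down_in h t ih => exact key true _ _ _ (by simpa [nbr] using h) ih
  | up_in h t ih => exact key false _ _ _ (by simp [nbr, h]) ih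

include ha hb in
theorem Trace.nodup {s j vs w y} (t : Trace a b s j vs w y)
    (h0 : ∀ i, nbr a b (!s) j ≠ .inl i) : vs.Nodup := by
  obtain ⟨v, σ, h1, h2, h3, h4, h5⟩ := t.exists_path
  rw [h5]
  have hne := path_ne ha hb (m := vs.length - 1) h3 (fun p hp => h4 p (by omega))
    (by rw [h1, h2]; exact h0)
  refine List.Nodup.map_on ?_ List.nodup_range
  intro p hp q hq h
  simp only [List.mem_range] at hp hq
  rcases lt_trichotomy p q with hl | hl | hl
  · exact absurd h (hne q (by omega) p hl)
  · exact hl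
  · exact absurd h.symm (hne p (by omega) q hl)

include ha hb in
theorem Trace.follow_eq_of_entry {s j vs w y} (t : Trace a b s j vs w y)
    (h0 : ∀ i, nbr a b (!s) j ≠ .inl i) : follow a b n s j = (w, y) :=
  t.follow_eq n (by simpa using (t.nodup ha hb h0).length_le_card)

end

/-- The line of the concatenation that starts at the outer vertex `x` visits the glued vertices
`vs`, meets the blobs `w` and ends at `y`. -/
inductive OuterTrace (a b : PreDiagram n) : Pt n → List (Fin n) → List Blob → Pt n → Prop
  | top {i j} (h : a.partner (.inl i) = .inl j) :
      OuterTrace a b (.inl i) [] (a.word (.inl i)) (.inl j)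
  | bot {i j} (h : b.partner (.inr i) = .inr j) :
      OuterTrace a b (.inr i) [] (b.word (.inr i)) (.inr j)
  | down {i j vs w y} (h : a.partner (.inl i) = .inr j) (t : Trace a b true j vs w y) :
      OuterTrace a b (.inl i) vs (a.word (.inl i) ++ w) y
  | up {i j vs w y} (h : b.partner (.inr i) = .inl j) (t : Trace a b false j vs w y) :
      OuterTrace a b (.inr i) vs (b.word (.inr i) ++ w) y

section

variable {a b : PreDiagram n} (ha : a.IsMatching) (hb : b.IsMatching)

include ha in
theorem nbr_false_of_top {i j : Fin n} (h : a.partner (.inl i) = .inr j) (k : Fin n) :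
    nbr a b false j ≠ .inl k := by
  rw [ha.partner_eq_iff] at h
  simp [nbr, h]

include hb in
theorem nbr_true_of_bot {i j : Fin n} (h : b.partner (.inr i) = .inl j) (k : Fin n) :
    nbr a b true j ≠ .inl k := by
  rw [hb.partner_eq_iff] at h
  simp [nbr, h]

include ha hb in
theorem exists_outerTrace (x : Pt n) : ∃ vs w y, OuterTrace a b x vs w y := by
  rcases x with i | i
  · rcases h : a.partner (.inl i) with j | j
    · exact ⟨_, _, _, .top h⟩
    · obtain ⟨vs, w, y, t⟩ := exists_trace ha hb (s := true) (nbr_false_of_top ha h)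
      exact ⟨_, _, _, .down h t⟩
  · rcases h : b.partner (.inr i) with j | j
    · obtain ⟨vs, w, y, t⟩ := exists_trace ha hb (s := false) (nbr_true_of_bot hb h)
      exact ⟨_, _, _, .up h t⟩
    · exact ⟨_, _, _, .bot h⟩

include ha hb in
theorem OuterTrace.line_eq {x vs w y} (t : OuterTrace a b x vs w y) : line a b x = (w, y) := by
  cases t with
  | top h => simp [line, h]
  | bot h => simp [line, h]
  | down h t => simp [line, h, t.follow_eq_of_entry ha hb (nbr_false_of_top ha h)]
  | up h t => simp [line, h, t.follow_eq_of_entry ha hb (nbr_true_of_bot hb h)]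

include ha hb in
theorem OuterTrace.partner_eq {x vs w y} (t : OuterTrace a b x vs w y) :
    (concat a b).partner x = y := by
  simp [concat, t.line_eq ha hb]

include ha hb in
theorem OuterTrace.word_eq {x vs w y} (t : OuterTrace a b x vs w y) :
    (concat a b).word x = w := by
  simp [concat, t.line_eq ha hb]

include ha hb in
theorem exists_outerTrace' (x : Pt n) :
    ∃ vs, OuterTrace a b x vs ((concat a b).word x) ((concat a b).partner x) := by
  obtain ⟨vs, w, y, t⟩ := exists_outerTrace ha hb x
  exact ⟨vs, by rwa [t.word_eq ha hb, t.partner_eq ha hb]⟩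

include ha hb in
theorem OuterTrace.nodup {x vs w y} (t : OuterTrace a b x vs w y) : vs.Nodup := by
  cases t with
  | top h => simp
  | bot h => simp
  | down h t => exact t.nodup ha hb (nbr_false_of_top ha h)
  | up h t => exact t.nodup ha hb (nbr_true_of_bot hb h)

end

/-! ### Reflection in a horizontal line -/

/-- The reflection of a diagram in a horizontal line. -/
def flip (d : PreDiagram n) : PreDiagram n where
  partner x := (d.partner x.swap).swap
  word x := d.word x.swap

@[simp] theorem flip_flip (d : PreDiagram n) : d.flip.flip = d := by
  ext x <;> simp [flip]

theorem IsMatching.flip {d : PreDiagram n} (h : d.IsMatching) : d.flip.IsMatching where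
  invol x := by simp [PreDiagram.flip, h.invol]
  ne_self x := by
    simp only [PreDiagram.flip, ne_eq, swap_eq_iff]
    exact h.ne_self _
  word_partner x := by simp [PreDiagram.flip, h.word_partner]

theorem Trace.flip {a b : PreDiagram n} {s j vs w y} (t : Trace a b s j vs w y) :
    Trace b.flip a.flip (!s) j vs w y.swap := by
  induction t with
  | down_out h => exact .up_out (a := b.flip) (by simp [PreDiagram.flip, h])
  | down_in h t ih => exact .up_in (a := b.flip) (by simp [PreDiagram.flip, h]) ih
  | up_out h => exact .down_out (b := a.flip) (by simp [PreDiagram.flip, h])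
  | up_in h t ih => exact .down_in (b := a.flip) (by simp [PreDiagram.flip, h]) ih

theorem OuterTrace.flip {a b : PreDiagram n} {x vs w y} (t : OuterTrace a b x vs w y) :
    OuterTrace b.flip a.flip x.swap vs w y.swap := by
  cases t with
  | top h => exact .bot (b := a.flip) (by simp [PreDiagram.flip, h])
  | bot h => exact .top (a := b.flip) (by simp [PreDiagram.flip, h])
  | down h t => exact .up (b := a.flip) (by simp [PreDiagram.flip, h]) t.flip
  | up h t => exact .down (a := b.flip) (by simp [PreDiagram.flip, h]) t.flip

/-- A trace turned upside down is a trace for the reflected diagrams in the opposite order; blobs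
and visited vertices are met in the same sequence. -/
theorem flip_concat {a b : PreDiagram n} (ha : a.IsMatching) (hb : b.IsMatching) :
    (concat a b).flip = concat b.flip a.flip := by
  ext1
  · funext x
    obtain ⟨vs, t⟩ := exists_outerTrace' ha hb x.swap
    have := t.flip.partner_eq hb.flip ha.flip
    rw [Sum.swap_swap] at this
    rw [this]; rfl
  · funext x
    obtain ⟨vs, t⟩ := exists_outerTrace' ha hb x.swap
    have := t.flip.word_eq hb.flip ha.flip
    rw [Sum.swap_swap] at this
    rw [this]; rfl

end PreDiagram

end SympBlob

namespace SympBlob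

open Blob

namespace PreDiagram

variable {n : ℕ}

/-! ### Local modifications of diagrams -/

/-- Put a blob on the line at `α`, next to `α`. -/
def addBlob (d : PreDiagram n) (α : Pt n) (g : Blob) : PreDiagram n where
  partner := d.partner
  word x := if x = α then g :: d.word α else if x = d.partner α then d.word x ++ [g] else d.word x

/-- Join the lines that end at `α` and at `β`, and draw an undecorated line from `α` to `β`. -/
def join (d : PreDiagram n) (α β : Pt n) : PreDiagram n where
  partner x :=
    if x = α then β else if x = β then α
    else if x = d.partner α then d.partner β else if x = d.partner β then d.partner α
    else d.partner x
  word x :=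
    if x = α ∨ x = β then []
    else if x = d.partner α then d.word x ++ d.word β
    else if x = d.partner β then d.word x ++ d.word α
    else d.word x

theorem IsMatching.addBlob {d : PreDiagram n} (h : d.IsMatching) (α : Pt n) (g : Blob) :
    (d.addBlob α g).IsMatching where
  invol := h.invol
  ne_self := h.ne_self
  word_partner x := by
    have h1 := h.ne_self α
    have h2 := h.word_partner x
    simp only [PreDiagram.addBlob, h.partner_inj]
    rcases eq_or_ne x α with rfl | hx
    · simp [h1, h2]
    · rcases eq_or_ne x (d.partner α) with rfl | hx'
      · simp [h.invol, h1, h.word_partner]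
      · have h3 : d.partner x ≠ α := fun e => hx' (h.partner_eq_iff.1 e).symm
        simp [hx, hx', h2, h3]

theorem join_comm {d : PreDiagram n} (h : d.IsMatching) (α β : Pt n) :
    d.join α β = d.join β α := by
  ext1
  · funext x
    simp only [join]
    split_ifs <;> simp_all [h.partner_inj]
  · funext x
    simp only [join]
    split_ifs <;> simp_all [h.partner_inj]

section

variable {d : PreDiagram n} {α β x : Pt n}

@[simp] theorem join_partner_left : (d.join α β).partner α = β := by simp [join]

@[simp] theorem join_partner_right : (d.join α β).partner β = α := by
  simp only [join, if_true]; split_ifs <;> simp_all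

@[simp] theorem join_word_left : (d.join α β).word α = [] := by simp [join]

@[simp] theorem join_word_right : (d.join α β).word β = [] := by simp [join]

theorem join_partner_of_left (h1 : d.partner α ≠ α) (h2 : d.partner α ≠ β) :
    (d.join α β).partner (d.partner α) = d.partner β := by
  simp [join, h1, h2]

theorem join_word_of_left (h1 : d.partner α ≠ α) (h2 : d.partner α ≠ β) :
    (d.join α β).word (d.partner α) = d.word (d.partner α) ++ d.word β := by
  simp [join, h1, h2]

theorem join_partner_of_ne (h1 : x ≠ α) (h2 : x ≠ β) (h3 : x ≠ d.partner α)
    (h4 : x ≠ d.partner β) : (d.join α β).partner x = d.partner x := by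
  simp [join, h1, h2, h3, h4]

theorem join_word_of_ne (h1 : x ≠ α) (h2 : x ≠ β) (h3 : x ≠ d.partner α)
    (h4 : x ≠ d.partner β) : (d.join α β).word x = d.word x := by
  simp [join, h1, h2, h3, h4]

end

theorem join_partner_of_right {d : PreDiagram n} (h : d.IsMatching) {α β : Pt n}
    (h2 : d.partner β ≠ α) : (d.join α β).partner (d.partner β) = d.partner α := by
  rw [join_comm h]; exact join_partner_of_left (h.ne_self _) h2

theorem join_word_of_right {d : PreDiagram n} (h : d.IsMatching) {α β : Pt n}
    (h2 : d.partner β ≠ α) :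
    (d.join α β).word (d.partner β) = d.word (d.partner β) ++ d.word α := by
  rw [join_comm h]; exact join_word_of_left (h.ne_self _) h2

theorem IsMatching.join {d : PreDiagram n} (h : d.IsMatching) {α β : Pt n} (hαβ : α ≠ β) :
    (d.join α β).IsMatching := by
  have key : ∀ x, (d.join α β).partner ((d.join α β).partner x) = x ∧
      (d.join α β).partner x ≠ x ∧
      (d.join α β).word ((d.join α β).partner x) = ((d.join α β).word x).reverse := by
    intro x
    by_cases h1 : x = α
    · subst h1; simp [hαβ.symm]
    by_cases h2 : x = β
    · subst h2; simp [hαβ]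
    by_cases h3 : x = d.partner α
    · have h4 : d.partner β ≠ α := fun e => h2 (by rw [h3, h.partner_eq_iff, e])
      subst h3
      rw [join_partner_of_left h1 h2, join_partner_of_right h h4, join_word_of_left h1 h2,
        join_word_of_right h h4]
      refine ⟨rfl, fun e => hαβ (h.partner_inj.1 e).symm, ?_⟩
      simp [h.word_partner]
    by_cases h4 : x = d.partner β
    · have h5 : d.partner α ≠ β := fun e => h1 (by rw [h4, h.partner_eq_iff, e])
      have h6 : d.partner α ≠ α := h.ne_self _
      subst h4
      rw [join_partner_of_right h h1, join_partner_of_left h6 h5, join_word_of_left h6 h5,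
        join_word_of_right h h1]
      refine ⟨rfl, fun e => hαβ (h.partner_inj.1 e), ?_⟩
      simp [h.word_partner]
    · rw [join_partner_of_ne h1 h2 h3 h4, join_partner_of_ne, join_word_of_ne h1 h2 h3 h4,
        join_word_of_ne]
      · exact ⟨h.invol _, h.ne_self _, h.word_partner _⟩
      all_goals first
        | (rw [ne_eq, h.partner_inj]; assumption)
        | (rw [ne_eq, h.partner_eq_iff, eq_comm]; assumption)
  exact ⟨fun x => (key x).1, fun x => (key x).2.1, fun x => (key x).2.2⟩

/-! ### Local modifications at the bottom commute with concatenation -/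

section

variable {a b : PreDiagram n}

/-- The new blob is next to the outer vertex, so a trace can meet it only as its last blob. -/
theorem Trace.addBlob {g : Blob} {i : Fin n} (hb : b.IsMatching)
    {s j vs w y} (t : Trace a b s j vs w y) :
    Trace a (b.addBlob (.inr i) g) s j vs (if y = .inr i then w ++ [g] else w) y := by
  have hw : ∀ v, (b.addBlob (.inr i) g).word (.inl v) =
      if b.partner (.inl v) = .inr i then b.word (.inl v) ++ [g] else b.word (.inl v) := by
    intro v
    have : (Sum.inl v = b.partner (.inr i)) ↔ b.partner (.inl v) = .inr i := by
      rw [eq_comm, hb.partner_eq_iff]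
    simp [PreDiagram.addBlob, this]
  induction t with
  | @down_out j o h =>
    have := Trace.down_out (a := a) (b := b.addBlob (.inr i) g) (j := j) (i := o) h
    rw [hw, h] at this
    exact this
  | up_out h => simpa using Trace.up_out h
  | @down_in j o vs w y h t ih =>
    have := Trace.down_in (b := b.addBlob (.inr i) g) (j := j) (i := o) h ih
    rw [hw, h, if_neg (by simp)] at this
    convert this using 1
    split_ifs <;> simp
  | up_in h t ih =>
    have := Trace.up_in h ih
    convert this using 1
    split_ifs <;> simp

/-- That the concatenation is a matching is a hypothesis here and in `concat_join`. It is never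
proved for arbitrary diagrams: `concat_ractList` passes it on from letter to letter, and
`concat_raw` starts with `concat_one`. -/
theorem concat_addBlob (ha : a.IsMatching) (hb : b.IsMatching) (hc : (concat a b).IsMatching)
    (i : Fin n) (g : Blob) :
    concat a (b.addBlob (.inr i) g) = (concat a b).addBlob (.inr i) g := by
  have key : ∀ x, ∃ vs, OuterTrace a (b.addBlob (.inr i) g) x vs
      (((concat a b).addBlob (.inr i) g).word x)
      (((concat a b).addBlob (.inr i) g).partner x) := by
    intro x
    obtain ⟨vs, t⟩ := exists_outerTrace' ha hb x
    refine ⟨vs, ?_⟩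
    have hx : x = (concat a b).partner (.inr i) ↔ (concat a b).partner x = .inr i := by
      rw [eq_comm, hc.partner_eq_iff]
    have hne := hc.ne_self x
    have e : ((concat a b).addBlob (.inr i) g).word x = if x = .inr i then
        g :: (concat a b).word x else if (concat a b).partner x = .inr i then
        (concat a b).word x ++ [g] else (concat a b).word x := by
      by_cases h : x = .inr i
      · subst h; simp [addBlob]
      · simp [addBlob, hx, h]
    rw [e]
    change OuterTrace _ _ _ _ _ ((concat a b).partner x)
    clear e hx
    generalize hw : (concat a b).word x = w at t ⊢
    generalize (concat a b).partner x = y at t hne ⊢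
    cases t with
    | top h => simpa using OuterTrace.top h
    | @bot o o' h =>
      have := OuterTrace.bot (a := a) (b := b.addBlob (.inr i) g) (i := o) (j := o') h
      convert this using 1
      have h' : Sum.inr o = b.partner (.inr i) ↔ o' = i := by
        rw [eq_comm, hb.partner_eq_iff, h, Sum.inr.injEq]
      by_cases hoi : o = i
      · subst hoi; simp [addBlob]
      · simp [addBlob, hoi, h']
    | down h t =>
      have := OuterTrace.down h (t.addBlob (g := g) (i := i) hb)
      convert this using 1
      rw [if_neg (by simp)]
      split_ifs <;> simp
    | @up o j' vs w' y h t =>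
      have := OuterTrace.up (b := b.addBlob (.inr i) g) h (t.addBlob (g := g) (i := i) hb)
      convert this using 1
      have h' : Sum.inr o ≠ b.partner (.inr i) := by
        rw [ne_eq, eq_comm, hb.partner_eq_iff, h]; simp
      by_cases hoi : o = i
      · subst hoi
        simp [addBlob, hne]
      · simp only [addBlob, Sum.inr.injEq, hoi, if_false, h']
        split_ifs <;> simp
  ext1
  · funext x
    obtain ⟨vs, t⟩ := key x
    exact t.partner_eq ha (hb.addBlob _ _)
  · funext x
    obtain ⟨vs, t⟩ := key x
    exact t.word_eq ha (hb.addBlob _ _)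

section Join

variable {i j : Fin n}

theorem join_inl_of_inner (hb : b.IsMatching) {v u : Fin n} (h : b.partner (.inl v) = .inl u) :
    (b.join (.inr i) (.inr j)).partner (.inl v) = .inl u ∧
      (b.join (.inr i) (.inr j)).word (.inl v) = b.word (.inl v) := by
  have h1 : ∀ o, Sum.inl v ≠ b.partner (.inr o) := fun o => by
    rw [ne_eq, eq_comm, hb.partner_eq_iff, h]; simp
  rw [join_partner_of_ne (by simp) (by simp) (h1 _) (h1 _),
    join_word_of_ne (by simp) (by simp) (h1 _) (h1 _)]
  exact ⟨h, rfl⟩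

theorem join_inl_of_outer (hb : b.IsMatching) {v o : Fin n} (h : b.partner (.inl v) = .inr o)
    (hi : o ≠ i) (hj : o ≠ j) :
    (b.join (.inr i) (.inr j)).partner (.inl v) = .inr o ∧
      (b.join (.inr i) (.inr j)).word (.inl v) = b.word (.inl v) := by
  have h1 : ∀ p, o ≠ p → Sum.inl v ≠ b.partner (.inr p) := fun p hp => by
    rw [ne_eq, eq_comm, hb.partner_eq_iff, h]; simpa using hp
  rw [join_partner_of_ne (by simp) (by simp) (h1 _ hi) (h1 _ hj),
    join_word_of_ne (by simp) (by simp) (h1 _ hi) (h1 _ hj)]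
  exact ⟨h, rfl⟩

theorem join_inl_of_left (hb : b.IsMatching) {v : Fin n} (h : b.partner (.inl v) = .inr i) :
    (b.join (.inr i) (.inr j)).partner (.inl v) = b.partner (.inr j) ∧
      (b.join (.inr i) (.inr j)).word (.inl v) = b.word (.inl v) ++ b.word (.inr j) := by
  rw [hb.partner_eq_iff] at h
  rw [← h, join_partner_of_left (by simp [h]) (by simp [h]),
    join_word_of_left (by simp [h]) (by simp [h])]
  exact ⟨rfl, rfl⟩

theorem Trace.join_of_ne (hb : b.IsMatching) {s v vs w y} (t : Trace a b s v vs w y)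
    (hi : y ≠ .inr i) (hj : y ≠ .inr j) : Trace a (b.join (.inr i) (.inr j)) s v vs w y := by
  induction t with
  | down_out h =>
    obtain ⟨h1, h2⟩ := join_inl_of_outer (i := i) (j := j) hb h (by simpa using hi)
      (by simpa using hj)
    rw [← h2]; exact .down_out h1
  | up_out h => exact .up_out h
  | down_in h t ih =>
    obtain ⟨h1, h2⟩ := join_inl_of_inner (i := i) (j := j) hb h
    rw [← h2]; exact .down_in h1 (ih hi hj)
  | up_in h t ih => exact .up_in h (ih hi hj)

theorem OuterTrace.join_of_ne (hb : b.IsMatching) {x vs w y} (t : OuterTrace a b x vs w y)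
    (hxi : x ≠ .inr i) (hxj : x ≠ .inr j) (hi : y ≠ .inr i) (hj : y ≠ .inr j) :
    OuterTrace a (b.join (.inr i) (.inr j)) x vs w y := by
  cases t with
  | top h => exact .top h
  | @bot o p h =>
    have h1 : ∀ u, (Sum.inr p : Pt n) ≠ Sum.inr u → Sum.inr o ≠ b.partner (.inr u) := fun u hu => by
      rw [ne_eq, eq_comm, hb.partner_eq_iff, h]; simpa using hu
    have h2 := join_partner_of_ne hxi hxj (h1 _ hi) (h1 _ hj)
    have h3 := join_word_of_ne hxi hxj (h1 _ hi) (h1 _ hj)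
    rw [← h3]; exact .bot (h2.trans h)
  | down h t => exact .down h (t.join_of_ne hb hi hj)
  | @up o v _ _ _ h t =>
    have h1 : ∀ u, Sum.inr o ≠ b.partner (.inr u) := fun u => by
      rw [ne_eq, eq_comm, hb.partner_eq_iff, h]; simp
    have h2 := join_partner_of_ne hxi hxj (h1 _) (h1 _)
    have h3 := join_word_of_ne hxi hxj (h1 _) (h1 _)
    rw [← h3]; exact .up (h2.trans h) (t.join_of_ne hb hi hj)

/-- A line that used to stop at `inr i` now runs on along the former line from `inr j`. -/
theorem Trace.join_append (hb : b.IsMatching) {s v vs w y vs' w' y'}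
    (t : Trace a b s v vs w y) (hy : y = .inr i)
    (t' : OuterTrace a b (.inr j) vs' w' y') (hi : y' ≠ .inr i) (hj : y' ≠ .inr j) :
    Trace a (b.join (.inr i) (.inr j)) s v (vs ++ vs') (w ++ w') y' := by
  induction t with
  | @down_out v o h =>
    obtain rfl : o = i := by simpa using hy
    obtain ⟨h1, h2⟩ := join_inl_of_left (i := o) (j := j) hb h
    cases t' with
    | bot h' =>
      rw [← h2, List.append_nil]
      exact .down_out (h1.trans h')
    | up h' t' =>
      rw [← List.append_assoc, ← h2]
      exact .down_in (h1.trans h') (t'.join_of_ne hb hi hj)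
  | up_out h => simp at hy
  | down_in h t ih =>
    obtain ⟨h1, h2⟩ := join_inl_of_inner (i := i) (j := j) hb h
    rw [← h2, List.append_assoc]; exact .down_in h1 (ih hy)
  | up_in h t ih =>
    rw [List.append_assoc]; exact .up_in h (ih hy)

theorem OuterTrace.join_append (hb : b.IsMatching) {x vs w vs' w' y'}
    (t : OuterTrace a b x vs w (.inr i)) (hxi : x ≠ .inr i) (hxj : x ≠ .inr j)
    (t' : OuterTrace a b (.inr j) vs' w' y') (hi : y' ≠ .inr i) (hj : y' ≠ .inr j) :
    OuterTrace a (b.join (.inr i) (.inr j)) x (vs ++ vs') (w ++ w') y' := by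
  cases t with
  | @bot o _ h =>
    have h' := hb.partner_eq_iff.1 h
    have h2 := join_partner_of_left (d := b) (α := .inr i) (β := .inr j) (by rwa [h'])
      (by rwa [h'])
    have h3 := join_word_of_left (d := b) (α := .inr i) (β := .inr j) (by rwa [h'])
      (by rwa [h'])
    rw [h'] at h2 h3
    cases t' with
    | bot h'' =>
      rw [← h3, List.append_nil]; exact .bot (h2.trans h'')
    | up h'' t' =>
      rw [← List.append_assoc, ← h3]
      exact .up (h2.trans h'') (t'.join_of_ne hb hi hj)
  | down h t =>
    rw [List.append_assoc]
    exact .down h (t.join_append hb rfl t' hi hj)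
  | @up o v _ _ _ h t =>
    have h1 : ∀ u, Sum.inr o ≠ b.partner (.inr u) := fun u => by
      rw [ne_eq, eq_comm, hb.partner_eq_iff, h]; simp
    have h2 := join_partner_of_ne hxi hxj (h1 _) (h1 _)
    have h3 := join_word_of_ne hxi hxj (h1 _) (h1 _)
    rw [List.append_assoc, ← h3]
    exact .up (h2.trans h) (t.join_append hb rfl t' hi hj)

/-- If the line from `inr i` ends at `inr j`, the join closes a loop, which both sides forget; its
weight is the subject of `loopProd_join`. Otherwise only the two far ends of the joined lines see a
change. -/
theorem concat_join (ha : a.IsMatching) (hb : b.IsMatching) (hc : (concat a b).IsMatching)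
    (hij : i ≠ j) :
    concat a (b.join (.inr i) (.inr j)) = (concat a b).join (.inr i) (.inr j) := by
  have hij' : (Sum.inr i : Pt n) ≠ .inr j := by simpa using hij
  set c := concat a b with hcdef
  have key : ∀ x, ∃ vs, OuterTrace a (b.join (.inr i) (.inr j)) x vs
      ((c.join (.inr i) (.inr j)).word x) ((c.join (.inr i) (.inr j)).partner x) := by
    intro x
    by_cases hxi : x = .inr i
    · subst hxi
      refine ⟨[], ?_⟩
      have h1 := join_partner_left (d := b) (α := .inr i) (β := .inr j)
      have h2 := join_word_left (d := b) (α := .inr i) (β := .inr j)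
      simp only [join_partner_left, join_word_left]
      rw [← h2]; exact .bot h1
    by_cases hxj : x = .inr j
    · subst hxj
      refine ⟨[], ?_⟩
      have h1 := join_partner_right (d := b) (α := .inr i) (β := .inr j)
      have h2 := join_word_right (d := b) (α := .inr i) (β := .inr j)
      simp only [join_partner_right, join_word_right]
      rw [← h2]; exact .bot h1
    obtain ⟨vs, t⟩ := exists_outerTrace' ha hb x
    by_cases h3 : x = c.partner (.inr i)
    · obtain ⟨vs', t'⟩ := exists_outerTrace' ha hb (.inr j)
      rw [h3] at hxi hxj
      rw [h3, join_partner_of_left hxi hxj, join_word_of_left hxi hxj]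
      rw [h3, ← hcdef, hc.invol] at t
      exact ⟨_, t.join_append hb hxi hxj t' (fun e => hxj (hc.partner_eq_iff.1 e))
        (hc.ne_self _)⟩
    by_cases h4 : x = c.partner (.inr j)
    · obtain ⟨vs', t'⟩ := exists_outerTrace' ha hb (.inr i)
      rw [h4] at hxi hxj
      rw [h4, join_comm hc, join_comm hb, join_partner_of_left hxj hxi,
        join_word_of_left hxj hxi]
      rw [h4, ← hcdef, hc.invol] at t
      exact ⟨_, t.join_append hb hxj hxi t' (fun e => hxi (hc.partner_eq_iff.1 e))
        (hc.ne_self _)⟩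
    · rw [join_partner_of_ne hxi hxj h3 h4, join_word_of_ne hxi hxj h3 h4]
      exact ⟨vs, t.join_of_ne hb hxi hxj (fun e => h3 (hc.partner_eq_iff.1 e).symm)
        (fun e => h4 (hc.partner_eq_iff.1 e).symm)⟩
  ext1
  · funext x
    obtain ⟨vs, t⟩ := key x
    exact t.partner_eq ha (hb.join hij')
  · funext x
    obtain ⟨vs, t⟩ := key x
    exact t.word_eq ha (hb.join hij')

end Join

end

end PreDiagram

end SympBlob

namespace SympBlob

open Blob

namespace PreDiagram

variable {n : ℕ}

/-! ### Closed loops -/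

section

variable {a b : PreDiagram n}

theorem midGraph_adj (ha : a.IsMatching) (hb : b.IsMatching) {u t : Fin n} :
    (midGraph a b).Adj u t ↔ a.partner (.inr u) = .inr t ∨ b.partner (.inl u) = .inl t := by
  simp only [midGraph, SimpleGraph.fromRel_adj]
  constructor
  · rintro ⟨-, h | h⟩
    · exact h
    · exact h.imp ha.partner_eq_iff.1 hb.partner_eq_iff.1
  · refine fun h => ⟨?_, .inl h⟩
    rintro rfl
    exact h.elim (ha.ne_self _) (hb.ne_self _)

/-- `S` is the set of glued vertices of a closed loop. -/
def IsLoopSet (a b : PreDiagram n) (S : Finset (Fin n)) : Prop :=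
  ∃ v, (∀ u, u ∈ S ↔ (midGraph a b).Reachable v u) ∧
    ∀ u ∈ S, (∃ t, a.partner (.inr u) = .inr t) ∧ ∃ t, b.partner (.inl u) = .inl t

open Classical in
/-- The sets of glued vertices of the closed loops. -/
noncomputable def loopSets (a b : PreDiagram n) : Finset (Finset (Fin n)) :=
  {S | IsLoopSet a b S}

theorem mem_loopSets {S : Finset (Fin n)} : S ∈ loopSets a b ↔ IsLoopSet a b S := by
  simp [loopSets]

theorem IsLoopSet.reachable_iff {S : Finset (Fin n)} (h : IsLoopSet a b S) {v u : Fin n}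
    (hv : v ∈ S) : u ∈ S ↔ (midGraph a b).Reachable v u := by
  obtain ⟨v', h1, -⟩ := h
  rw [h1] at hv ⊢
  exact ⟨fun h => hv.symm.trans h, fun h => hv.trans h⟩

theorem IsLoopSet.eq_of_mem {S T : Finset (Fin n)} (hS : IsLoopSet a b S)
    (hT : IsLoopSet a b T) {u : Fin n} (h1 : u ∈ S) (h2 : u ∈ T) : S = T := by
  ext t
  rw [hS.reachable_iff h1, hT.reachable_iff h2]

theorem IsLoopSet.nonempty {S : Finset (Fin n)} (hS : IsLoopSet a b S) : S.Nonempty := by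
  obtain ⟨v, h, -⟩ := hS
  exact ⟨v, (h v).2 .rfl⟩

theorem mem_of_reachable {G : SimpleGraph (Fin n)} {S : Finset (Fin n)} {v u : Fin n}
    (hv : v ∈ S) (hS : ∀ u ∈ S, ∀ t, G.Adj u t → t ∈ S) (h : G.Reachable v u) : u ∈ S := by
  rw [SimpleGraph.reachable_iff_reflTransGen] at h
  induction h with
  | refl => exact hv
  | tail _ h ih => exact hS _ ih _ h

theorem IsLoopSet.congr {b' : PreDiagram n} (ha : a.IsMatching) (hb : b.IsMatching)
    (hb' : b'.IsMatching) {S : Finset (Fin n)} (hS : IsLoopSet a b S)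
    (h : ∀ u ∈ S, b.partner (.inl u) = b'.partner (.inl u)) : IsLoopSet a b' S := by
  obtain ⟨v, h1, h2⟩ := hS
  have hv : v ∈ S := (h1 v).2 .rfl
  refine ⟨v, fun u => ⟨fun hu => ?_, mem_of_reachable hv ?_⟩, fun u hu => ?_⟩
  · have hr := (h1 u).1 hu
    clear hu
    rw [SimpleGraph.reachable_iff_reflTransGen] at hr
    induction hr with
    | refl => exact .rfl
    | @tail u t hu hadj ih =>
      refine ih.trans (SimpleGraph.Adj.reachable ?_)
      rw [midGraph_adj ha hb] at hadj
      rw [midGraph_adj ha hb', ← h u ((h1 u).2 (SimpleGraph.reachable_iff_reflTransGen _ _ |>.2 hu))]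
      exact hadj
  · intro u hu t ht
    rw [midGraph_adj ha hb', ← h u hu, ← midGraph_adj ha hb] at ht
    rw [h1] at hu ⊢
    exact hu.trans ht.reachable
  · rw [← h u hu]; exact h2 u hu

/-- Twice the number of blobs `g` on the segments at the vertices `S`. -/
def blobSum (a b : PreDiagram n) (S : Finset (Fin n)) (g : Blob) : ℕ :=
  ∑ j ∈ S, ((a.word (.inr j)).count g + (b.word (.inl j)).count g)

variable {k : Type*} [Field k] (q : Params k)

/-- The scalar by which the closed loops of a concatenation are replaced. -/
def loopProd (a b : PreDiagram n) : k :=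
  ∏ C : (midGraph a b).ConnectedComponent,
    if IsLoop a b C then loopWeight q (loopCount a b C L) (loopCount a b C R) else 1

/-- The type of components depends on both diagrams. Sets of glued vertices live in one fixed type,
so the loops of different concatenations can be compared. -/
theorem loopProd_eq (a b : PreDiagram n) :
    loopProd q a b = ∏ S ∈ loopSets a b, loopWeight q (blobSum a b S L / 2)
      (blobSum a b S R / 2) := by
  rw [loopProd, ← Finset.prod_filter]
  refine Finset.prod_bij (fun C _ =>
    Finset.univ.filter fun j => (midGraph a b).connectedComponentMk j = C) ?_ ?_ ?_ ?_
  · intro C hC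
    rw [mem_loopSets]
    simp only [Finset.mem_filter, Finset.mem_univ, true_and] at hC
    induction C using SimpleGraph.ConnectedComponent.ind with
    | _ v =>
    refine ⟨v, fun u => ?_, fun u hu => hC u (by simpa using hu)⟩
    simp only [Finset.mem_filter, Finset.mem_univ, true_and, SimpleGraph.ConnectedComponent.eq]
    exact ⟨fun h => h.symm, fun h => h.symm⟩
  · intro C _ C' _ h
    induction C using SimpleGraph.ConnectedComponent.ind with
    | _ v =>
    have : v ∈ ({j | (midGraph a b).connectedComponentMk j =
      (midGraph a b).connectedComponentMk v} : Finset (Fin n)) := by simp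
    rw [h] at this
    simpa using this
  · intro S hS
    rw [mem_loopSets] at hS
    obtain ⟨v, h1, h2⟩ := hS
    have hh : ∀ u, (midGraph a b).connectedComponentMk u = (midGraph a b).connectedComponentMk v ↔
        u ∈ S := fun u => by
      rw [h1, SimpleGraph.ConnectedComponent.eq]
      exact ⟨fun h => h.symm, fun h => h.symm⟩
    refine ⟨(midGraph a b).connectedComponentMk v, ?_, ?_⟩
    · simp only [Finset.mem_filter, Finset.mem_univ, true_and]
      exact fun u hu => h2 u ((hh u).1 hu)
    · ext u; simp [hh]
  · intro C hC
    rfl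

/-- The visited vertices are closed under following segments, except where the line enters and where
it leaves. When the line is closed up, exactly these two exceptions disappear. -/
theorem Trace.mem_cases {s v vs w y} (ha : a.IsMatching) (hb : b.IsMatching)
    (t : Trace a b s v vs w y) : ∀ u ∈ vs,
      ((∃ z ∈ vs, a.partner (.inr u) = .inr z) ∨ (u = v ∧ s = true) ∨
        ∃ o, a.partner (.inr u) = .inl o ∧ y = .inl o) ∧
      ((∃ z ∈ vs, b.partner (.inl u) = .inl z) ∨ (u = v ∧ s = false) ∨
        ∃ o, b.partner (.inl u) = .inr o ∧ y = .inr o) := by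
  have hmem : ∀ {s v vs w y}, Trace a b s v vs w y → v ∈ vs := by
    intro s v vs w y t; cases t <;> simp
  induction t with
  | down_out h => simp [h]
  | up_out h => simp [h]
  | @down_in v v' vs w y h t ih =>
    intro u hu
    rcases List.mem_cons.1 hu with rfl | hu
    · exact ⟨.inr (.inl ⟨rfl, rfl⟩), .inl ⟨v', List.mem_cons_of_mem _ (hmem t), h⟩⟩
    · obtain ⟨h1, h2⟩ := ih u hu
      refine ⟨?_, ?_⟩
      · rcases h1 with ⟨z, hz, h1⟩ | ⟨-, h1⟩ | h1
        · exact .inl ⟨z, List.mem_cons_of_mem _ hz, h1⟩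
        · simp at h1
        · exact .inr (.inr h1)
      · rcases h2 with ⟨z, hz, h1⟩ | ⟨rfl, -⟩ | h1
        · exact .inl ⟨z, List.mem_cons_of_mem _ hz, h1⟩
        · exact .inl ⟨v, List.mem_cons_self, hb.partner_eq_iff.1 h⟩
        · exact .inr (.inr h1)
  | @up_in v v' vs w y h t ih =>
    intro u hu
    rcases List.mem_cons.1 hu with rfl | hu
    · exact ⟨.inl ⟨v', List.mem_cons_of_mem _ (hmem t), h⟩, .inr (.inl ⟨rfl, rfl⟩)⟩
    · obtain ⟨h1, h2⟩ := ih u hu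
      refine ⟨?_, ?_⟩
      · rcases h1 with ⟨z, hz, h1⟩ | ⟨rfl, -⟩ | h1
        · exact .inl ⟨z, List.mem_cons_of_mem _ hz, h1⟩
        · exact .inl ⟨v, List.mem_cons_self, ha.partner_eq_iff.1 h⟩
        · exact .inr (.inr h1)
      · rcases h2 with ⟨z, hz, h1⟩ | ⟨-, h1⟩ | h1
        · exact .inl ⟨z, List.mem_cons_of_mem _ hz, h1⟩
        · simp at h1
        · exact .inr (.inr h1)

theorem Trace.start_mem {s v vs w y} (t : Trace a b s v vs w y) : v ∈ vs := by
  cases t <;> simp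

theorem Trace.exists_exit {s v vs w y} (t : Trace a b s v vs w y) : ∃ u ∈ vs,
    (∃ o, a.partner (.inr u) = .inl o ∧ y = .inl o) ∨
      ∃ o, b.partner (.inl u) = .inr o ∧ y = .inr o := by
  induction t with
  | down_out h => simp [h]
  | up_out h => simp [h]
  | down_in h t ih =>
    obtain ⟨u, hu, h⟩ := ih
    exact ⟨u, List.mem_cons_of_mem _ hu, h⟩
  | up_in h t ih =>
    obtain ⟨u, hu, h⟩ := ih
    exact ⟨u, List.mem_cons_of_mem _ hu, h⟩

theorem Trace.reachable {b' : PreDiagram n} (ha : a.IsMatching) (hb' : b'.IsMatching)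
    (h : ∀ u t, b.partner (.inl u) = .inl t → b'.partner (.inl u) = .inl t)
    {s v vs w y} (t : Trace a b s v vs w y) :
    ∀ u ∈ vs, (midGraph a b').Reachable v u := by
  induction t with
  | down_out _ => simp
  | up_out _ => simp
  | down_in h' t ih =>
    intro u hu
    rcases List.mem_cons.1 hu with rfl | hu
    · exact .rfl
    · exact (SimpleGraph.Adj.reachable ((midGraph_adj ha hb').2 (.inr (h _ _ h')))).trans (ih u hu)
  | up_in h' t ih =>
    intro u hu
    rcases List.mem_cons.1 hu with rfl | hu
    · exact .rfl
    · exact (SimpleGraph.Adj.reachable ((midGraph_adj ha hb').2 (.inl h'))).trans (ih u hu)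

/-- Double counting. Each segment of the trace is seen from both its ends, the last one from its
outer end too, while the segment through which the line enters is seen once without belonging to the
trace. -/
theorem Trace.count_eq (ha : a.IsMatching) (hb : b.IsMatching) (g : Blob)
    {s v vs w y} (t : Trace a b s v vs w y) :
    (vs.map fun u => (a.word (.inr u)).count g + (b.word (.inl u)).count g).sum +
      Sum.elim (fun o => (a.word (.inl o)).count g) (fun o => (b.word (.inr o)).count g) y =
    2 * w.count g + if s then (a.word (.inr v)).count g else (b.word (.inl v)).count g := by
  have hA : ∀ x y, a.partner x = y → (a.word y).count g = (a.word x).count g := by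
    rintro x _ rfl; rw [ha.word_partner, List.count_reverse]
  have hB : ∀ x y, b.partner x = y → (b.word y).count g = (b.word x).count g := by
    rintro x _ rfl; rw [hb.word_partner, List.count_reverse]
  induction t with
  | down_out h => simp [hB _ _ h]; ring
  | up_out h => simp [hA _ _ h]; ring
  | down_in h t ih =>
    simp only [List.map_cons, List.sum_cons, List.count_append, if_true] at ih ⊢
    rw [add_assoc, ih]
    simp [hB _ _ h]; ring
  | up_in h t ih =>
    simp only [List.map_cons, List.sum_cons, List.count_append, if_true] at ih ⊢
    rw [add_assoc, ih]
    simp [hA _ _ h]; ring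

theorem loopProd_addBlob (ha : a.IsMatching) (hb : b.IsMatching) (i : Fin n) (g : Blob) :
    loopProd q a (b.addBlob (.inr i) g) = loopProd q a b := by
  have hb' := hb.addBlob (.inr i) g
  rw [loopProd_eq, loopProd_eq]
  have hs : loopSets a (b.addBlob (.inr i) g) = loopSets a b := by
    ext S
    rw [mem_loopSets, mem_loopSets]
    exact ⟨fun h => h.congr ha hb' hb fun _ _ => rfl, fun h => h.congr ha hb hb' fun _ _ => rfl⟩
  rw [hs]
  refine Finset.prod_congr rfl fun S hS => ?_
  rw [mem_loopSets] at hS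
  obtain ⟨-, -, h⟩ := hS
  have : ∀ g', blobSum a (b.addBlob (.inr i) g) S g' = blobSum a b S g' := fun g' => by
    refine Finset.sum_congr rfl fun u hu => ?_
    obtain ⟨-, t, ht⟩ := h u hu
    have : Sum.inl u ≠ b.partner (.inr i) := by
      rw [ne_eq, eq_comm, hb.partner_eq_iff, ht]; simp
    simp [addBlob, this]
  rw [this, this]

/-- The scalar by which the loop that arises from joining `α` and `β` is replaced; it is `1` if
no loop arises. -/
def joinWeight (d : PreDiagram n) (α β : Pt n) : k :=
  if d.partner α = β then loopWeight q ((d.word α).count L) ((d.word α).count R) else 1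

/-- Joining closes at most one loop, and does so when the line of the concatenation from `inr i`
ends at `inr j`. If `b` itself joins them, the loop is lost already in `b.join`, and the two join
weights agree. If not, the loop runs through the glued vertices and is a new factor of the product.
Weights stand on both sides so that nothing has to be divided by. -/
theorem loopProd_join (ha : a.IsMatching) (hb : b.IsMatching) (hc : (concat a b).IsMatching)
    {i j : Fin n} (hij : i ≠ j) :
    loopProd q a (b.join (.inr i) (.inr j)) * joinWeight q b (.inr i) (.inr j) =
      loopProd q a b * joinWeight q (concat a b) (.inr i) (.inr j) := by
  have hij' : (Sum.inr i : Pt n) ≠ .inr j := by simpa using hij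
  have hb' := hb.join hij'
  set b' := b.join (.inr i) (.inr j) with hb'def
  set c := concat a b with hcdef
  have hin : ∀ u t, b.partner (.inl u) = .inl t → b'.partner (.inl u) = .inl t :=
    fun u t h => (join_inl_of_inner hb h).1
  have hsub : ∀ S, IsLoopSet a b S → IsLoopSet a b' S := by
    intro S hS
    refine hS.congr ha hb hb' fun u hu => ?_
    obtain ⟨-, -, h⟩ := hS
    obtain ⟨-, t, ht⟩ := h u hu
    rw [ht, hin u t ht]
  have hsup : ∀ S, IsLoopSet a b' S → (∀ u ∈ S, b.partner (.inl u) ≠ .inr i ∧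
      b.partner (.inl u) ≠ .inr j) → IsLoopSet a b S := by
    intro S hS h
    refine hS.congr ha hb' hb fun u hu => ?_
    rcases h' : b.partner (.inl u) with t | o
    · exact hin u t h'
    · have := h u hu
      rw [h'] at this
      exact (join_inl_of_outer hb h' (by simpa using this.1) (by simpa using this.2)).1
  have hsum : ∀ S, IsLoopSet a b S → ∀ g, blobSum a b' S g = blobSum a b S g := by
    intro S hS g
    refine Finset.sum_congr rfl fun u hu => ?_
    obtain ⟨-, -, h⟩ := hS
    obtain ⟨-, t, ht⟩ := h u hu
    rw [hb'def, (join_inl_of_inner hb ht).2]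
  by_cases hcij : c.partner (.inr i) = .inr j
  · by_cases hbij : b.partner (.inr i) = .inr j
    · have hw : c.word (.inr i) = b.word (.inr i) :=
        (OuterTrace.bot (a := a) hbij).word_eq ha hb
      have hs : loopSets a b' = loopSets a b := by
        ext S
        rw [mem_loopSets, mem_loopSets]
        refine ⟨fun h => hsup S h fun u _ => ⟨?_, ?_⟩, hsub S⟩
        · rw [ne_eq, hb.partner_eq_iff, hbij]; simp
        · rw [ne_eq, hb.partner_eq_iff, hb.partner_eq_iff.1 hbij]; simp
      rw [joinWeight, joinWeight, if_pos hcij, if_pos hbij, hw, loopProd_eq, loopProd_eq, hs]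
      congr 1
      refine Finset.prod_congr rfl fun S hS => ?_
      rw [mem_loopSets] at hS
      rw [hsum S hS, hsum S hS]
    · obtain ⟨vs, t⟩ := exists_outerTrace' ha hb (.inr i)
      rw [← hcdef, hcij] at t
      have hnd := t.nodup ha hb
      generalize hW : c.word (.inr i) = W at t
      replace t : ∃ X w, b.partner (.inr i) = .inl X ∧ W = b.word (.inr i) ++ w ∧
          Trace a b false X vs w (.inr j) := by
        cases t with
        | bot h => exact absurd h hbij
        | up h t => exact ⟨_, _, h, rfl, t⟩
      obtain ⟨X, w, hX, rfl, t⟩ := t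
      have hX' := hb.partner_eq_iff.1 hX
      obtain ⟨Y, hYvs, ⟨o, -, ho⟩ | ⟨o, hY, ho⟩⟩ := t.exists_exit
      · simp at ho
      obtain rfl : j = o := by simpa using ho
      -- `X` and `Y` are the first and the last glued vertex on the line from `inr i` to `inr j`.
      -- The join connects them directly and so closes this line.
      have hb'X : b'.partner (.inl X) = .inl Y := by
        rw [hb'def, (join_inl_of_left hb hX').1, hb.partner_eq_iff, hY]
      have hb'Y := hb'.partner_eq_iff.1 hb'X
      have hmem := t.mem_cases ha hb
      have hvs : IsLoopSet a b' vs.toFinset := by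
        have hcl : ∀ u ∈ vs, (∃ z ∈ vs, a.partner (.inr u) = .inr z) ∧
            ∃ z ∈ vs, b'.partner (.inl u) = .inl z := by
          intro u hu
          obtain ⟨h1, h2⟩ := hmem u hu
          refine ⟨by simpa using h1, ?_⟩
          rcases h2 with ⟨z, hz, h2⟩ | ⟨rfl, -⟩ | ⟨o, h2, h3⟩
          · exact ⟨z, hz, hin _ _ h2⟩
          · exact ⟨Y, hYvs, hb'X⟩
          · obtain rfl : j = o := by simpa using h3
            have : u = Y := by
              have := hY.trans h2.symm
              rw [hb.partner_inj] at this
              simpa using this.symm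
            subst this
            exact ⟨X, t.start_mem, hb'Y⟩
        refine ⟨X, fun u => ⟨fun hu => ?_, mem_of_reachable ?_ ?_⟩, fun u hu => ?_⟩
        · exact t.reachable ha hb' hin u (by simpa using hu)
        · simpa using t.start_mem
        · intro u hu z hz
          obtain ⟨⟨z1, hz1, h1⟩, z2, hz2, h2⟩ := hcl u (by simpa using hu)
          rw [midGraph_adj ha hb', h1, h2] at hz
          simp only [Sum.inr.injEq, Sum.inl.injEq] at hz
          rcases hz with rfl | rfl
          · simpa using hz1
          · simpa using hz2
        · obtain ⟨⟨z1, hz1, h1⟩, z2, hz2, h2⟩ := hcl u (by simpa using hu)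
          exact ⟨⟨z1, h1⟩, z2, h2⟩
      have hnot : vs.toFinset ∉ loopSets a b := by
        rw [mem_loopSets]
        rintro ⟨-, -, h⟩
        obtain ⟨-, z, hz⟩ := h X (by simpa using t.start_mem)
        rw [hX'] at hz
        simp at hz
      have hs : loopSets a b' = Finset.cons vs.toFinset (loopSets a b) hnot := by
        ext S
        rw [Finset.mem_cons, mem_loopSets, mem_loopSets]
        constructor
        · intro hS
          by_cases hXS : X ∈ S
          · exact .inl (hS.eq_of_mem hvs hXS (by simpa using t.start_mem))
          by_cases hYS : Y ∈ S
          · exact .inl (hS.eq_of_mem hvs hYS (by simpa using hYvs))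
          refine .inr (hsup S hS fun u hu => ⟨fun e => hXS ?_, fun e => hYS ?_⟩)
          · have := e.trans hX'.symm
            rw [hb.partner_inj, Sum.inl.injEq] at this
            rwa [← this]
          · have := e.trans hY.symm
            rw [hb.partner_inj, Sum.inl.injEq] at this
            rwa [← this]
        · rintro (rfl | hS)
          · exact hvs
          · exact hsub S hS
      have hXY : X ≠ Y := by
        rintro rfl
        rw [hX'] at hY
        simp [hij] at hY
      have hcnt : ∀ g, blobSum a b' vs.toFinset g / 2 =
          (b.word (.inr i) ++ w).count g := by
        intro g
        have h1 : blobSum a b vs.toFinset g =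
            (vs.map fun u => (a.word (.inr u)).count g + (b.word (.inl u)).count g).sum := by
          rw [blobSum, List.sum_toFinset _ hnd]
        have h2 := t.count_eq ha hb g
        rw [← h1] at h2
        simp only [Sum.elim_inr, Bool.false_eq_true, if_false] at h2
        have hXw : (b.word (.inr i)).count g = (b.word (.inl X)).count g := by
          rw [← hX', hb.word_partner, List.count_reverse]
        have hYw : (b.word (.inr j)).count g = (b.word (.inl Y)).count g := by
          rw [← hY, hb.word_partner, List.count_reverse]
        -- The new segment from `X` to `Y` carries the words of the two old segments that led
        -- outside. At each of its ends the count grows by the blobs of the other old segment.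
        have h3 : blobSum a b' vs.toFinset g = blobSum a b vs.toFinset g +
            ∑ u ∈ vs.toFinset, ((if u = X then (b.word (.inl Y)).count g else 0) +
              if u = Y then (b.word (.inl X)).count g else 0) := by
          rw [blobSum, blobSum, ← Finset.sum_add_distrib]
          refine Finset.sum_congr rfl fun u hu => ?_
          by_cases hu1 : u = X
          · subst hu1
            rw [hb'def, (join_inl_of_left hb hX').2, List.count_append, hYw]
            simp [hXY]; ring
          by_cases hu2 : u = Y
          · subst hu2
            rw [hb'def, join_comm hb, (join_inl_of_left hb hY).2, List.count_append, hXw]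
            simp [hXY.symm]; ring
          · obtain ⟨z, -, h2⟩ | ⟨h2, -⟩ | ⟨o, h2, h3⟩ := (hmem u (by simpa using hu)).2
            · rw [hb'def, (join_inl_of_inner hb h2).2]; simp [hu1, hu2]
            · exact absurd h2 hu1
            · obtain rfl : j = o := by simpa using h3
              have := hY.trans h2.symm
              rw [hb.partner_inj, Sum.inl.injEq] at this
              exact absurd this.symm hu2
        rw [Finset.sum_add_distrib, Finset.sum_ite_eq', Finset.sum_ite_eq',
          if_pos (by simpa using t.start_mem), if_pos (by simpa using hYvs)] at h3
        rw [List.count_append]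
        omega
      rw [joinWeight, joinWeight, if_pos hcij, if_neg hbij, hW, loopProd_eq, loopProd_eq, hs,
        Finset.prod_cons, hcnt, hcnt, mul_one, mul_comm]
      congr 1
      refine Finset.prod_congr rfl fun S hS => ?_
      rw [mem_loopSets] at hS
      rw [hsum S hS, hsum S hS]
  · have hbij : b.partner (.inr i) ≠ .inr j := fun h =>
      hcij ((OuterTrace.bot (a := a) h).partner_eq ha hb)
    -- A loop of `b'` through the glued vertex next to `inr i` would contain the whole trace
    -- starting there. But this trace leaves at an outer vertex that the join does not affect.
    have aux : ∀ i j : Fin n, b' = b.join (.inr i) (.inr j) → c.partner (.inr i) ≠ .inr j →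
        ∀ S, IsLoopSet a b' S → ∀ u ∈ S, b.partner (.inl u) ≠ .inr i := by
      intro i j hbb hcij S hS X hXS hX
      obtain ⟨vs, t⟩ := exists_outerTrace' ha hb (.inr i)
      rw [← hcdef] at t
      have hne := hc.ne_self (.inr i)
      generalize c.word (.inr i) = W at t
      generalize c.partner (.inr i) = y at t hne hcij
      have hX' := hb.partner_eq_iff.1 hX
      cases t with
      | bot h => rw [hX'] at h; simp at h
      | @up _ X' _ _ _ h t =>
        obtain rfl : X = X' := by rw [hX'] at h; simpa using h
        have hvs : ∀ u ∈ vs, u ∈ S := fun u hu =>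
          (hS.reachable_iff hXS).2 (t.reachable ha hb' hin u hu)
        obtain ⟨-, -, hS'⟩ := hS
        obtain ⟨u, hu, ⟨o, h1, h2⟩ | ⟨o, h1, h2⟩⟩ := t.exists_exit
        · obtain ⟨⟨z, hz⟩, -⟩ := hS' u (hvs u hu)
          rw [h1] at hz; simp at hz
        · obtain ⟨-, z, hz⟩ := hS' u (hvs u hu)
          subst h2
          rw [hbb, (join_inl_of_outer hb h1 (by simpa using hne) (by simpa using hcij)).1] at hz
          simp at hz
    have hs : loopSets a b' = loopSets a b := by
      ext S
      rw [mem_loopSets, mem_loopSets]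
      exact ⟨fun h => hsup S h fun u hu => ⟨aux i j hb'def hcij S h u hu,
        aux j i (hb'def.trans (join_comm hb _ _))
          (fun e => hcij (hc.partner_eq_iff.1 e)) S h u hu⟩, hsub S⟩
    rw [joinWeight, joinWeight, if_neg hcij, if_neg hbij, loopProd_eq, loopProd_eq, hs]
    congr 1
    refine Finset.prod_congr rfl fun S hS => ?_
    rw [mem_loopSets] at hS
    rw [hsum S hS, hsum S hS]

/-! ### The identity diagram -/

theorem isMatching_one : (one n).IsMatching where
  invol x := by simp [one, vertical]
  ne_self x := by rcases x with i | i <;> simp [one, vertical]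
  word_partner x := by rcases x with i | i <;> simp [one, vertical]

theorem concat_one (ha : a.IsMatching) : concat a (one n) = a := by
  have hp : ∀ i, (one n).partner (.inl i) = .inr i := fun i => rfl
  have hp' : ∀ i, (one n).partner (.inr i) = .inl i := fun i => rfl
  have hw : ∀ x, (one n).word x = [] := fun x => by rcases x with i | i <;> simp [one, vertical]
  have key : ∀ x, ∃ vs, OuterTrace a (one n) x vs (a.word x) (a.partner x) := by
    rintro (i | i)
    · rcases h : a.partner (.inl i) with j | j
      · exact ⟨_, .top h⟩
      · have := OuterTrace.down h (Trace.down_out (a := a) (hp j))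
        rw [hw, List.append_nil] at this
        exact ⟨_, this⟩
    · rcases h : a.partner (.inr i) with j | j
      · have := OuterTrace.up (hp' i) (Trace.up_out (b := one n) h)
        rw [hw, List.nil_append] at this
        exact ⟨_, this⟩
      · have := OuterTrace.up (hp' i) (Trace.up_in h (Trace.down_out (a := a) (hp j)))
        rw [hw, hw, List.append_nil, List.nil_append] at this
        exact ⟨_, this⟩
  ext1
  · funext x
    obtain ⟨vs, t⟩ := key x
    exact t.partner_eq ha isMatching_one
  · funext x
    obtain ⟨vs, t⟩ := key x
    exact t.word_eq ha isMatching_one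

theorem loopProd_one (a : PreDiagram n) : loopProd q a (one n) = 1 := by
  rw [loopProd_eq]
  refine Finset.prod_eq_one fun S hS => ?_
  rw [mem_loopSets] at hS
  obtain ⟨u, hu⟩ := hS.nonempty
  obtain ⟨-, -, h⟩ := hS
  obtain ⟨-, z, hz⟩ := h u hu
  simp [one, vertical] at hz

end

end PreDiagram

end SympBlob

/-! ### Reflection fixes the elementary diagrams -/

namespace SympBlob

open Blob

namespace PreDiagram

variable {n : ℕ}

theorem flip_addBlob_vertical (i : Fin n) (g : Blob) :
    ((one n).addBlob (.inr i) g).flip = (one n).addBlob (.inr i) g := by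
  ext1
  · funext x; rcases x with x | x <;> rfl
  · funext x
    rcases x with x | x <;> simp [flip, addBlob, one, vertical]

theorem flip_join_vertical (i j : Fin n) :
    ((one n).join (.inr i) (.inr j)).flip = (one n).join (.inr i) (.inr j) := by
  ext1
  · funext x
    rcases x with x | x <;> simp [flip, join, one, vertical] <;> split_ifs <;> simp_all
  · funext x
    rcases x with x | x <;> simp [flip, join, one, vertical]

theorem flip_one : (one n).flip = one n := by
  ext1
  · funext x; rcases x with x | x <;> rfl
  · funext x; rcases x with x | x <;> simp [flip, one, vertical]

variable [NeZero n]

/-! ### Right multiplication by generators, before straightening -/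

/-- The diagram `d`, multiplied on the right by the `i`-th generator, without loops and before
straightening. -/
def ract (d : PreDiagram n) (i : Fin (n + 1)) : PreDiagram n :=
  if i = 0 then d.addBlob (.inr 0) L
  else if h : (i : ℕ) < n then d.join (.inr ⟨i - 1, by omega⟩) (.inr ⟨i, h⟩)
  else d.addBlob (.inr (Fin.rev 0)) R

/-- Right multiplication by a word in the generators, without loops and before straightening. -/
def ractList (d : PreDiagram n) (l : List (Fin (n + 1))) : PreDiagram n := l.foldl ract d

@[simp] theorem ractList_nil (d : PreDiagram n) : d.ractList [] = d := rfl

@[simp] theorem ractList_cons (d : PreDiagram n) (i l) :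
    d.ractList (i :: l) = (d.ract i).ractList l := rfl

theorem ractList_append (d : PreDiagram n) (l l') :
    d.ractList (l ++ l') = (d.ractList l).ractList l' := List.foldl_append

theorem IsMatching.ract {d : PreDiagram n} (h : d.IsMatching) (i : Fin (n + 1)) :
    (d.ract i).IsMatching := by
  unfold PreDiagram.ract
  split_ifs with h1 h2
  · exact h.addBlob _ _
  · refine h.join ?_
    have : (i : ℕ) ≠ 0 := fun e => h1 (Fin.ext e)
    simp only [ne_eq, Sum.inr.injEq, Fin.mk.injEq]
    omega
  · exact h.addBlob _ _

theorem IsMatching.ractList {d : PreDiagram n} (h : d.IsMatching) (l : List (Fin (n + 1))) :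
    (d.ractList l).IsMatching := by
  induction l generalizing d with
  | nil => exact h
  | cons i l ih => exact ih (h.ract i)

theorem concat_ract {a b : PreDiagram n} (ha : a.IsMatching) (hb : b.IsMatching)
    (hc : (concat a b).IsMatching) (i : Fin (n + 1)) :
    concat a (b.ract i) = (concat a b).ract i := by
  unfold ract
  split_ifs with h1 h2
  · exact concat_addBlob ha hb hc _ _
  · refine concat_join ha hb hc ?_
    have : (i : ℕ) ≠ 0 := fun e => h1 (Fin.ext e)
    simp only [ne_eq, Fin.mk.injEq]
    omega
  · exact concat_addBlob ha hb hc _ _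

theorem concat_ractList {a b : PreDiagram n} (ha : a.IsMatching) (hb : b.IsMatching)
    (hc : (concat a b).IsMatching) (l : List (Fin (n + 1))) :
    concat a (b.ractList l) = (concat a b).ractList l := by
  induction l generalizing b with
  | nil => rfl
  | cons i l ih =>
    have h := concat_ract ha hb hc i
    rw [ractList_cons, ih (hb.ract i) (h ▸ hc.ract i), h, ractList_cons]

/-- The diagram of a word in the generators, without loops and before straightening. -/
def raw (l : List (Fin (n + 1))) : PreDiagram n := (one n).ractList l

theorem isMatching_raw (l : List (Fin (n + 1))) : (raw l).IsMatching := isMatching_one.ractList l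

theorem concat_raw {a : PreDiagram n} (ha : a.IsMatching) (l : List (Fin (n + 1))) :
    concat a (raw l) = a.ractList l := by
  have h := concat_one ha
  rw [raw, concat_ractList ha isMatching_one (h.symm ▸ ha), h]

theorem concat_raw_raw (l l' : List (Fin (n + 1))) : concat (raw l) (raw l') = raw (l ++ l') := by
  rw [concat_raw (isMatching_raw l), raw, raw, ractList_append]

theorem flip_raw_singleton (i : Fin (n + 1)) : (raw [i]).flip = raw [i] := by
  simp only [raw, ractList_cons, ractList_nil, ract]
  split_ifs
  · exact flip_addBlob_vertical _ _
  · exact flip_join_vertical _ _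
  · exact flip_addBlob_vertical _ _

/-- The generators are symmetric, so reflection only reverses words. All statements about left
multiplication are derived from this. -/
theorem flip_raw (l : List (Fin (n + 1))) : (raw l).flip = raw l.reverse := by
  induction l with
  | nil => exact flip_one
  | cons i l ih =>
    rw [List.reverse_cons, ← concat_raw_raw, ← ih, ← flip_raw_singleton i,
      ← flip_concat (isMatching_raw _) (isMatching_raw _), concat_raw_raw]; rfl

section Weight

variable {k : Type*} [Field k] (q : Params k)

/-- The scalar that replaces the loop produced by right multiplication by the `i`-th generator. -/
def rweight (d : PreDiagram n) (i : Fin (n + 1)) : k :=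
  if i = 0 then 1
  else if h : (i : ℕ) < n then joinWeight q d (.inr ⟨i - 1, by omega⟩) (.inr ⟨i, h⟩)
  else 1

/-- The scalar that replaces the loops produced by right multiplication by a word. -/
def rweightList (d : PreDiagram n) : List (Fin (n + 1)) → k
  | [] => 1
  | i :: l => rweight q d i * rweightList (d.ract i) l

theorem rweightList_append (d : PreDiagram n) (l l' : List (Fin (n + 1))) :
    rweightList q d (l ++ l') = rweightList q d l * rweightList q (d.ractList l) l' := by
  induction l generalizing d with
  | nil => simp [rweightList]
  | cons i l ih => simp [rweightList, ih, mul_assoc]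

theorem loopProd_ract {a b : PreDiagram n} (ha : a.IsMatching) (hb : b.IsMatching)
    (hc : (concat a b).IsMatching) (i : Fin (n + 1)) :
    loopProd q a (b.ract i) * rweight q b i = loopProd q a b * rweight q (concat a b) i := by
  unfold ract rweight
  split_ifs with h1 h2
  · rw [loopProd_addBlob q ha hb]
  · refine loopProd_join q ha hb hc ?_
    have : (i : ℕ) ≠ 0 := fun e => h1 (Fin.ext e)
    simp only [ne_eq, Fin.mk.injEq]
    omega
  · rw [loopProd_addBlob q ha hb]

theorem loopProd_ractList {a b : PreDiagram n} (ha : a.IsMatching) (hb : b.IsMatching)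
    (hc : (concat a b).IsMatching) (l : List (Fin (n + 1))) :
    loopProd q a (b.ractList l) * rweightList q b l =
      loopProd q a b * rweightList q (concat a b) l := by
  induction l generalizing b with
  | nil => rfl
  | cons i l ih =>
    have h := concat_ract ha hb hc i
    have h1 := ih (hb.ract i) (h ▸ hc.ract i)
    rw [ractList_cons, rweightList, rweightList, mul_left_comm, h1, h, ← mul_assoc, ← mul_assoc,
      ← loopProd_ract q ha hb hc i]
    ring

/-- Loops closed when `l` acts on `a` are either closed already while `raw l` is built up from the
identity, or arise when `a` is put on top of it. -/
theorem loopProd_raw {a : PreDiagram n} (ha : a.IsMatching) (l : List (Fin (n + 1))) :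
    loopProd q a (raw l) * rweightList q (one n) l = rweightList q a l := by
  have h := concat_one ha
  rw [raw, loopProd_ractList q ha isMatching_one (h.symm ▸ ha), h, loopProd_one, one_mul]

end Weight

/-! ### The diagrams of the generators -/

theorem raw_zero : raw [0] = e n := by
  ext1
  · funext x; rcases x with x | x <;> rfl
  · funext x
    rcases x with x | x <;>
      simp [raw, ract, addBlob, one, vertical, e] <;> split_ifs <;> rfl

theorem raw_last : raw [Fin.last n] = f n := by
  have h0 : Fin.last n ≠ 0 := by
    simp only [ne_eq, Fin.ext_iff, Fin.val_last, Fin.coe_ofNat_eq_mod, Nat.zero_mod]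
    exact NeZero.ne n
  have hn := NeZero.pos n
  have hr : ∀ x : Fin n, x = Fin.rev 0 ↔ (x : ℕ) + 1 = n := by
    intro x
    simp only [Fin.ext_iff, Fin.val_rev, Fin.coe_ofNat_eq_mod, Nat.zero_mod]
    omega
  have hl : ¬ ((Fin.last n : ℕ) < n) := by simp
  simp only [raw, ractList_cons, ractList_nil, ract, h0, if_false, hl, dif_neg, not_false_eq_true]
  ext1
  · funext x; rcases x with x | x <;> rfl
  · funext x
    rcases x with x | x <;> simp [addBlob, one, vertical, f, hr] <;> split_ifs <;> rfl

theorem raw_mid (i : Fin (n + 1)) (h₁ : 1 ≤ (i : ℕ)) (h₂ : (i : ℕ) < n) :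
    raw [i] = ei (i : ℕ) h₁ h₂ := by
  have h0 : i ≠ 0 := by rintro rfl; simp at h₁
  simp only [raw, ractList_cons, ractList_nil, ract, h0, if_false, h₂, dif_pos]
  ext1
  · funext x
    rcases x with x | x <;> simp [join, one, vertical, ei, cupCap]
  · funext x
    rcases x with x | x <;> simp [join, one, vertical, ei, cupCap]

end PreDiagram

end SympBlob

namespace SympBlob

open Blob

namespace PreDiagram

variable {n : ℕ}

/-! ### Planarity -/

theorem posL_inl (i : Fin n) : posL (.inl i) = (i : ℕ) := rfl

theorem posL_inr (i : Fin n) : posL (.inr i) = n + (n - (i + 1)) := by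
  simp [posL, Fin.val_rev]

theorem posR_inl (i : Fin n) : posR (.inl i) = n + (i : ℕ) := rfl

theorem posR_inr (i : Fin n) : posR (.inr i) = n - (i + 1) := by
  simp [posR, Fin.val_rev]

/-- The positions seen from the right are those seen from the left, rotated by half a turn around
the frame. -/
theorem posR_eq (x : Pt n) :
    (posL x < n ∧ posR x = posL x + n) ∨ (n ≤ posL x ∧ posL x < 2 * n ∧ posL x = posR x + n) := by
  rcases x with i | i
  · rw [posL_inl, posR_inl]; omega
  · rw [posL_inr, posR_inr]; omega

theorem posL_injective : Function.Injective (posL : Pt n → ℕ) := by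
  rintro (i | i) (j | j) h <;> simp only [posL_inl, posL_inr] at h
  · rw [Fin.ext h]
  · omega
  · omega
  · have : i = j := by omega
    rw [this]

theorem posR_injective : Function.Injective (posR : Pt n → ℕ) := by
  rintro (i | i) (j | j) h <;> simp only [posR_inl, posR_inr] at h
  · have : i = j := by omega
    rw [this]
  · omega
  · omega
  · have : i = j := by omega
    rw [this]

/-- The position of `u` is strictly between those of the two ends of the line at `y`. -/
def Btw (d : PreDiagram n) (pos : Pt n → ℕ) (y u : Pt n) : Prop :=
  (pos y < pos u ∧ pos u < pos (d.partner y)) ∨ (pos (d.partner y) < pos u ∧ pos u < pos y)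

/-- No two lines cross. -/
def NonCross (d : PreDiagram n) (pos : Pt n → ℕ) : Prop :=
  ∀ y u, u ≠ y → u ≠ d.partner y → (d.Btw pos y u ↔ d.Btw pos y (d.partner u))

section

variable {d : PreDiagram n} {pos : Pt n → ℕ}

theorem not_btw_self {y : Pt n} : ¬ d.Btw pos y y := by simp [Btw]

theorem not_btw_partner {y : Pt n} : ¬ d.Btw pos y (d.partner y) := by simp [Btw]

theorem btw_partner (hd : d.IsMatching) {y u : Pt n} :
    d.Btw pos (d.partner y) u ↔ d.Btw pos y u := by
  simp only [Btw, hd.invol]; tauto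

/-- `Exposed` forbids lines that enclose both ends of the given line. For non-crossing lines it is
enough to look at one end, and `Btw` does not depend on which end of the enclosing line is named. -/
theorem exposed_iff (hd : d.IsMatching) (hnc : d.NonCross pos) {x : Pt n} :
    d.Exposed pos x ↔ ∀ y, ¬ d.Btw pos y x := by
  constructor
  · intro h y hy
    have h1 : x ≠ y := by rintro rfl; exact not_btw_self hy
    have h2 : x ≠ d.partner y := by rintro rfl; exact not_btw_partner hy
    have h3 := (hnc y x h1 h2).1 hy
    rcases hy with hy | hy <;> rcases h3 with h3 | h3
    · exact h y ⟨hy.1, h3.1, hy.2, h3.2⟩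
    · omega
    · omega
    · exact h (d.partner y) ⟨hy.1, h3.1, by rw [hd.invol]; exact hy.2,
        by rw [hd.invol]; exact h3.2⟩
  · exact fun h y hy => h y (.inl ⟨hy.1, hy.2.2.1⟩)

theorem isTL_iff : d.IsTL ↔ d.IsMatching ∧ d.NonCross posL := by
  constructor
  · intro h
    have hd := h.isMatching
    have key : ∀ y u, posL y < posL (d.partner y) → u ≠ y → u ≠ d.partner y →
        d.Btw posL y u → d.Btw posL y (d.partner u) := by
      intro y u hy h1 h2 hb
      rcases hb with hb | hb
      · exact .inl (h.noncrossing y u hb.1 hb.2)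
      · omega
    refine ⟨hd, ?_⟩
    have key2 : ∀ y u, u ≠ y → u ≠ d.partner y → d.Btw posL y u → d.Btw posL y (d.partner u) := by
      intro y u h1 h2 hb
      rcases lt_trichotomy (posL y) (posL (d.partner y)) with hy | hy | hy
      · exact key y u hy h1 h2 hb
      · exact absurd (posL_injective hy).symm (hd.ne_self y)
      · rw [← btw_partner hd] at hb ⊢
        exact key _ u (by rwa [hd.invol]) h2 (by rwa [hd.invol]) hb
    intro y u h1 h2
    refine ⟨key2 y u h1 h2, fun hb => ?_⟩
    have := key2 y (d.partner u) (fun e => h2 (hd.partner_eq_iff.1 e).symm)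
      (fun e => h1 (hd.partner_inj.1 e)) hb
    rwa [hd.invol] at this
  · rintro ⟨hd, h⟩
    refine ⟨hd.invol, hd.ne_self, fun x y h1 h2 => ?_, hd.word_partner⟩
    have := (h x y (by rintro rfl; omega) (by rintro rfl; omega)).1 (.inl ⟨h1, h2⟩)
    rcases this with h | h
    · exact h
    · omega

/-- Crossing is invariant under cyclic rotation of the positions. -/
theorem NonCross.posR (hd : d.IsMatching) (h : d.NonCross posL) : d.NonCross posR := by
  intro y u h1 h2
  have hb := h y u h1 h2
  have hne : ∀ {x z : Pt n}, x ≠ z → posL x ≠ posL z := fun e e' => e (posL_injective e')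
  have h3 := hne h1
  have h4 := hne h2
  have h5 := hne (fun e => h2 (hd.partner_eq_iff.1 e).symm : d.partner u ≠ y)
  have h6 := hne (fun e => h1 (hd.partner_inj.1 e) : d.partner u ≠ d.partner y)
  have e1 := posR_eq y
  have e2 := posR_eq u
  have e3 := posR_eq (d.partner y)
  have e4 := posR_eq (d.partner u)
  unfold Btw at hb ⊢
  generalize posL y = a at *
  generalize posL u = b at *
  generalize posL (d.partner y) = a' at *
  generalize posL (d.partner u) = b' at *
  rcases e1 with e1 | e1 <;> rcases e2 with e2 | e2 <;> rcases e3 with e3 | e3 <;>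
    rcases e4 with e4 | e4 <;> omega

/-- The cases of the far ends include that `α` and `β` were not joined before; otherwise the far
ends are `β` and `α` themselves. -/
theorem join_cases (hd : d.IsMatching) {α β : Pt n} (x : Pt n) :
    (x = α ∧ (d.join α β).partner x = β ∧ (d.join α β).word x = []) ∨
    (x = β ∧ (d.join α β).partner x = α ∧ (d.join α β).word x = []) ∨
    ((d.partner α ≠ β ∧ x = d.partner α) ∧
      (d.join α β).partner x = d.partner β ∧ (d.join α β).word x = d.word x ++ d.word β) ∨
    ((d.partner α ≠ β ∧ x = d.partner β) ∧
      (d.join α β).partner x = d.partner α ∧ (d.join α β).word x = d.word x ++ d.word α) ∨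
    ((x ≠ α ∧ x ≠ β ∧ x ≠ d.partner α ∧ x ≠ d.partner β) ∧
      (d.join α β).partner x = d.partner x ∧ (d.join α β).word x = d.word x) := by
  by_cases h1 : x = α
  · subst h1; simp
  by_cases h2 : x = β
  · subst h2; simp
  by_cases h3 : x = d.partner α
  · subst h3
    exact .inr (.inr (.inl ⟨⟨h2, rfl⟩, join_partner_of_left h1 h2, join_word_of_left h1 h2⟩))
  by_cases h4 : x = d.partner β
  · subst h4
    refine .inr (.inr (.inr (.inl ⟨⟨fun e => h1 ?_, rfl⟩, join_partner_of_right hd h1,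
      join_word_of_right hd h1⟩)))
    exact hd.partner_eq_iff.1 e
  · exact .inr (.inr (.inr (.inr ⟨⟨h1, h2, h3, h4⟩, join_partner_of_ne h1 h2 h3 h4,
      join_word_of_ne h1 h2 h3 h4⟩)))

section Join

variable {α β : Pt n} (hd : d.IsMatching) (hpos : Function.Injective pos)
  (hαβ : pos α = pos β + 1)

include hpos hαβ

theorem btw_adj {y : Pt n} (h1 : y ≠ α) (h2 : y ≠ β) (h3 : d.partner y ≠ α)
    (h4 : d.partner y ≠ β) : d.Btw pos y α ↔ d.Btw pos y β := by
  have := hpos.ne h1; have := hpos.ne h2; have := hpos.ne h3; have := hpos.ne h4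
  unfold Btw
  omega

include hd

/-- The new line separates what exactly one of the two old lines separates. -/
theorem btw_join_iff (hne : d.partner α ≠ β) {u : Pt n} (h1 : u ≠ α) (h2 : u ≠ β)
    (h3 : u ≠ d.partner α) (h4 : u ≠ d.partner β) :
    (d.join α β).Btw pos (d.partner α) u ↔ ¬ (d.Btw pos α u ↔ d.Btw pos β u) := by
  have := hpos.ne h1; have := hpos.ne h2; have := hpos.ne h3; have := hpos.ne h4
  have h5 := hpos.ne hne
  have h6 := hpos.ne (hd.ne_self α)
  have h7 := hpos.ne (hd.ne_self β)
  have h8 : pos (d.partner β) ≠ pos α := fun e => hne (hd.partner_eq_iff.1 (hpos e))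
  unfold Btw
  rw [join_partner_of_left (hd.ne_self α) hne]
  omega

/-- Nothing lies between the neighbours `α` and `β`, so the new line between them separates nothing,
and any other line separates both or neither. A vertex is separated by the line through the far ends
if exactly one of the two old lines separated it, and each old line treats both ends of a third line
alike. -/
theorem NonCross.join (h : d.NonCross pos) : (d.join α β).NonCross pos := by
  have hαβ' : α ≠ β := by rintro rfl; omega
  have hd' := hd.join hαβ'
  have hcap : ∀ u, ¬ (d.join α β).Btw pos α u := by
    intro u; simp only [Btw, join_partner_left]; omega
  have hcap' : ∀ u, ¬ (d.join α β).Btw pos β u := by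
    intro u; simp only [Btw, join_partner_right]; omega
  have hother : ∀ y u, y ≠ α ∧ y ≠ β ∧ y ≠ d.partner α ∧ y ≠ d.partner β →
      ((d.join α β).Btw pos y u ↔ d.Btw pos y u) := by
    rintro y u ⟨h1, h2, h3, h4⟩
    simp only [Btw, join_partner_of_ne h1 h2 h3 h4]
  have hadj : ∀ y, y ≠ α ∧ y ≠ β ∧ y ≠ d.partner α ∧ y ≠ d.partner β →
      (d.Btw pos y α ↔ d.Btw pos y β) := by
    rintro y ⟨h1, h2, h3, h4⟩
    refine btw_adj hpos hαβ h1 h2 ?_ ?_ <;> rw [ne_eq, hd.partner_eq_iff, eq_comm] <;> assumption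
  have hnew : ∀ u, d.partner α ≠ β → u ≠ d.partner α → u ≠ d.partner β →
      ((d.join α β).Btw pos (d.partner α) u ↔
        (d.join α β).Btw pos (d.partner α) ((d.join α β).partner u)) := by
    intro u hne h3 h4
    have hA : (d.join α β).Btw pos (d.partner α) α ↔ (d.join α β).Btw pos (d.partner α) β := by
      refine btw_adj hpos hαβ (hd.ne_self _) hne ?_ ?_ <;>
        rw [join_partner_of_left (hd.ne_self _) hne]
      · exact fun e => hne (hd.partner_eq_iff.1 e)
      · exact hd.ne_self _
    rcases join_cases (β := β) (α := α) hd u with hu | hu | hu | hu | hu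
    · rw [hu.2.1, hu.1]; exact hA
    · rw [hu.2.1, hu.1]; exact hA.symm
    · exact absurd hu.1.2 h3
    · exact absurd hu.1.2 h4
    · obtain ⟨⟨h1, h2, -, -⟩, hu, -⟩ := hu
      have h5 : d.partner u ≠ α := fun e => h3 (hd.partner_eq_iff.1 e).symm
      have h6 : d.partner u ≠ β := fun e => h4 (hd.partner_eq_iff.1 e).symm
      have h7 : d.partner u ≠ d.partner α := fun e => h1 (hd.partner_inj.1 e)
      have h8 : d.partner u ≠ d.partner β := fun e => h2 (hd.partner_inj.1 e)
      rw [hu, btw_join_iff hd hpos hαβ hne h1 h2 h3 h4, btw_join_iff hd hpos hαβ hne h5 h6 h7 h8,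
        h α u h1 h3, h β u h2 h4]
  intro y u h1 h2
  rcases join_cases (β := β) (α := α) hd y with hy | hy | hy | hy | hy
  · rw [hy.1]; simp [hcap]
  · rw [hy.1]; simp [hcap']
  · rw [hy.2.1] at h2
    rw [hy.1.2] at h1 ⊢
    exact hnew u hy.1.1 h1 h2
  · rw [hy.2.1] at h2
    rw [hy.1.2] at h1 ⊢
    have hP : (d.join α β).partner (d.partner α) = d.partner β :=
      join_partner_of_left (hd.ne_self _) hy.1.1
    rw [← hP, btw_partner hd', btw_partner hd']
    exact hnew u hy.1.1 h2 h1
  · rw [hother y _ hy.1, hother y _ hy.1]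
    rcases join_cases (β := β) (α := α) hd u with hu | hu | hu | hu | hu
    · rw [hu.2.1, hu.1]; exact hadj y hy.1
    · rw [hu.2.1, hu.1]; exact (hadj y hy.1).symm
    · have e1 := h y α hy.1.1.symm (fun e => hy.1.2.2.1 (hd.partner_eq_iff.1 e.symm).symm)
      have e2 := h y β hy.1.2.1.symm (fun e => hy.1.2.2.2 (hd.partner_eq_iff.1 e.symm).symm)
      rw [hu.2.1, hu.1.2, ← e1, ← e2]; exact hadj y hy.1
    · have e1 := h y α hy.1.1.symm (fun e => hy.1.2.2.1 (hd.partner_eq_iff.1 e.symm).symm)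
      have e2 := h y β hy.1.2.1.symm (fun e => hy.1.2.2.2 (hd.partner_eq_iff.1 e.symm).symm)
      rw [hu.2.1, hu.1.2, ← e1, ← e2]; exact (hadj y hy.1).symm
    · rw [hy.2.1] at h2
      rw [hu.2.1]
      exact h y u h1 h2

/-- A line that carries `g` is separated by no old line, hence not by the merged line either. The
merged line carries `g` only if one of its pieces did; a third line that hides it would have hidden
`α` and `β`, and so that piece. The statement is for any `pos`, so it serves both sides of the
frame. -/
theorem exposed_join (h : d.NonCross pos) {g : Blob} (hg : ∀ x, g ∈ d.word x → d.Exposed pos x) :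
    ∀ x, g ∈ (d.join α β).word x → (d.join α β).Exposed pos x := by
  have hαβ' : α ≠ β := by rintro rfl; omega
  have hd' := hd.join hαβ'
  have h' := h.join hd hpos hαβ
  have hmem : ∀ x, g ∈ d.word (d.partner x) ↔ g ∈ d.word x := fun x => by
    rw [hd.word_partner, List.mem_reverse]
  have hex : ∀ x y, g ∈ d.word x → ¬ d.Btw pos y x := fun x y hx =>
    (exposed_iff hd h).1 (hg x hx) y
  have main : ∀ x, (∀ y, ¬ (d.join α β).Btw pos y x) → (d.join α β).Exposed pos x :=
    fun x => (exposed_iff hd' h').2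
  have hadj : ∀ y, y ≠ α ∧ y ≠ β ∧ y ≠ d.partner α ∧ y ≠ d.partner β →
      (d.Btw pos y α ↔ d.Btw pos y β) := by
    rintro y ⟨h1, h2, h3, h4⟩
    refine btw_adj hpos hαβ h1 h2 ?_ ?_ <;> rw [ne_eq, hd.partner_eq_iff, eq_comm] <;> assumption
  have hnew : d.partner α ≠ β → (g ∈ d.word α ∨ g ∈ d.word β) →
      ∀ y, ¬ (d.join α β).Btw pos y (d.partner α) ∧ ¬ (d.join α β).Btw pos y (d.partner β) := by
    intro hne hor y
    have hP : (d.join α β).partner (d.partner α) = d.partner β :=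
      join_partner_of_left (hd.ne_self _) hne
    rcases join_cases (β := β) (α := α) hd y with hy | hy | hy | hy | hy
    · simp only [Btw, join_partner_left, hy.1]; omega
    · simp only [Btw, join_partner_right, hy.1]; omega
    · rw [hy.1.2]; exact ⟨not_btw_self, hP ▸ not_btw_partner⟩
    · rw [hy.1.2, ← hP, btw_partner hd', btw_partner hd']; exact ⟨not_btw_self, not_btw_partner⟩
    · have e0 := hadj y hy.1
      have e1 := h y α hy.1.1.symm (fun e => hy.1.2.2.1 (hd.partner_eq_iff.1 e.symm).symm)
      have e2 := h y β hy.1.2.1.symm (fun e => hy.1.2.2.2 (hd.partner_eq_iff.1 e.symm).symm)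
      have e3 : ¬ d.Btw pos y α := by
        rcases hor with hor | hor
        · exact hex α y hor
        · rw [e0]; exact hex β y hor
      have e4 : ∀ u, (d.join α β).Btw pos y u ↔ d.Btw pos y u := fun u => by
        simp only [Btw, hy.2.1]
      rw [e4, e4, ← e1, ← e2, ← e0]
      exact ⟨e3, e3⟩
  intro x hx
  rcases join_cases (β := β) (α := α) hd x with hc | hc | hc | hc | hc
  · rw [hc.2.2] at hx; simp at hx
  · rw [hc.2.2] at hx; simp at hx
  · rw [hc.2.2, hc.1.2, List.mem_append, hmem] at hx
    rw [hc.1.2]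
    exact main _ fun y => (hnew hc.1.1 hx y).1
  · rw [hc.2.2, hc.1.2, List.mem_append, hmem] at hx
    rw [hc.1.2]
    exact main _ fun y => (hnew hc.1.1 hx.symm y).2
  · rw [hc.2.2] at hx
    refine main _ fun y hy => ?_
    have hxo : d.partner α ≠ β → ¬ (d.join α β).Btw pos (d.partner α) x := fun hne => by
      rw [btw_join_iff hd hpos hαβ hne hc.1.1 hc.1.2.1 hc.1.2.2.1 hc.1.2.2.2]
      simp [hex x _ hx]
    rcases join_cases (β := β) (α := α) hd y with hy' | hy' | hy' | hy' | hy'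
    · simp only [Btw, join_partner_left, hy'.1] at hy; omega
    · simp only [Btw, join_partner_right, hy'.1] at hy; omega
    · rw [hy'.1.2] at hy; exact hxo hy'.1.1 hy
    · have hP : (d.join α β).partner (d.partner α) = d.partner β :=
        join_partner_of_left (hd.ne_self _) hy'.1.1
      rw [hy'.1.2, ← hP, btw_partner hd'] at hy
      exact hxo hy'.1.1 hy
    · simp only [Btw, hy'.2.1] at hy
      exact hex x y hx hy

end Join

end

end PreDiagram

end SympBlob

/-! ### Joining neighbours at the bottom keeps the blobs in order -/

namespace SympBlob

open Blob

namespace PreDiagram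

variable {n : ℕ}

theorem not_RL_append {u v : List Blob} (h1 : ¬ [R, L].Sublist u) (h2 : ¬ [R, L].Sublist v)
    (h3 : ¬ (R ∈ u ∧ L ∈ v)) : ¬ [R, L].Sublist (u ++ v) := by
  rw [List.sublist_append_iff]
  rintro ⟨l₁, l₂, h, hu, hv⟩
  match l₁, h with
  | [], h => simp only [List.nil_append] at h; subst h; exact h2 hv
  | [x], h =>
    simp only [List.cons_append, List.nil_append, List.cons.injEq] at h
    obtain ⟨rfl, rfl⟩ := h
    exact h3 ⟨List.singleton_sublist.1 hu, List.singleton_sublist.1 hv⟩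
  | x :: y :: l, h =>
    simp only [List.cons_append, List.cons.injEq, List.nil_eq, List.append_eq_nil_iff] at h
    obtain ⟨rfl, rfl, rfl, -⟩ := h
    exact h1 hu

theorem not_RL_of_not_R {u : List Blob} (h : R ∉ u) : ¬ [R, L].Sublist u :=
  fun hs => h (hs.subset (by simp))

theorem not_RL_of_not_L {u : List Blob} (h : L ∉ u) : ¬ [R, L].Sublist u :=
  fun hs => h (hs.subset (by simp))

theorem eq_nil_of_not_mem {u : List Blob} (h1 : L ∉ u) (h2 : R ∉ u) : u = [] := by
  rcases u with _ | ⟨_ | _, u⟩ <;> simp_all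

section

variable {d : PreDiagram n}

theorem IsLRBlob.isMatching (h : d.IsLRBlob) : d.IsMatching := h.toIsTL.isMatching

theorem IsLRBlob.nonCross (h : d.IsLRBlob) : d.NonCross posL := (isTL_iff.1 h.toIsTL).2

theorem IsLRBlob.not_btwL (h : d.IsLRBlob) {x : Pt n} (hx : L ∈ d.word x) (y : Pt n) :
    ¬ d.Btw posL y x :=
  (exposed_iff h.isMatching h.nonCross).1 (h.exposedL x hx) y

theorem IsLRBlob.not_btwR (h : d.IsLRBlob) {x : Pt n} (hx : R ∈ d.word x) (y : Pt n) :
    ¬ d.Btw posR y x :=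
  (exposed_iff h.isMatching (h.nonCross.posR h.isMatching)).1 (h.exposedR x hx) y

section Join

variable {i₀ i₁ : Fin n} (h : d.IsLRBlob) (hi : (i₁ : ℕ) = i₀ + 1)

include h hi

/-- A new line at the top is made of two propagating lines. Each hides the other from one side, so
the left piece has no right blob and the right piece no left blob. In the same way a propagating
line forbids left blobs to its right and right blobs to its left. -/
theorem IsLRBlob.ordered_top_join : (d.join (.inr i₀) (.inr i₁)).Ordered Sum.inl where
  same_line i j hij hlt := by
    have hd := h.isMatching
    rcases join_cases (α := .inr i₀) (β := .inr i₁) hd (.inl i) with hc | hc | hc | hc | hc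
    · simp at hc
    · simp at hc
    · obtain ⟨⟨-, h1⟩, h2, h3⟩ := hc
      rw [h2] at hij
      have hR : R ∉ d.word (.inl i) := fun hR => h.not_btwR hR (.inr i₁) (by
        simp only [Btw, hij, posR_inr, posR_inl]; omega)
      have hL : L ∉ d.word (.inr i₁) := fun hL => h.not_btwL hL (.inr i₀) (by
        simp only [Btw, ← h1, posL_inr, posL_inl]; omega)
      rw [h3]
      exact not_RL_append (not_RL_of_not_R hR) (not_RL_of_not_L hL) fun hh => hL hh.2
    · obtain ⟨⟨-, h1⟩, h2, h3⟩ := hc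
      rw [h2] at hij
      have := h.nonCross (.inr i₀) (.inr i₁) (by simp; omega) (by rw [hij]; simp)
      rw [← h1] at this
      simp only [Btw, hij, posL_inr, posL_inl] at this
      omega
    · rw [hc.2.1] at hij
      rw [hc.2.2]
      exact h.ordered_top.same_line i j hij hlt
  two_lines i j i' j' hij hij' h1 h2 h3 := by
    have hd := h.isMatching
    rintro ⟨hR, hL⟩
    have A : ∀ j, d.partner (.inr i₀) = .inl j → j < i' → L ∉ d.word (.inl i') :=
      fun j h1 h2 hL => h.not_btwL hL (.inr i₀) (by
        simp only [Btw, h1, posL_inr, posL_inl]; omega)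
    have B : ∀ j, d.partner (.inr i₁) = .inl j → i < j → R ∉ d.word (.inl i) :=
      fun j h1 h2 hR => h.not_btwR hR (.inr i₁) (by
        simp only [Btw, h1, posR_inr, posR_inl]; omega)
    rcases join_cases (α := .inr i₀) (β := .inr i₁) hd (.inl i) with hc | hc | hc | hc | hc
    · simp at hc
    · simp at hc
    all_goals
      rcases join_cases (α := .inr i₀) (β := .inr i₁) hd (.inl i') with hc' | hc' | hc' | hc' | hc'
    any_goals
      simp at hc'
      done
    all_goals
      rw [hc.2.1] at hij
      rw [hc'.2.1] at hij'
      rw [hc.2.2] at hR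
      rw [hc'.2.2] at hL
    · have := hc.1.2.trans hc'.1.2.symm
      simp at this; omega
    · have := hij.symm.trans hc'.1.2.symm
      simp at this; omega
    · exact A i hc.1.2.symm (by omega) hL
    · have := hij.symm.trans hc'.1.2.symm
      simp at this; omega
    · have := hc.1.2.trans hc'.1.2.symm
      simp at this; omega
    · exact A j hij (by omega) hL
    · exact B j' hij' (by omega) hR
    · exact B i' hc'.1.2.symm (by omega) hR
    · exact h.ordered_top.two_lines i j i' j' hij hij' h1 h2 h3 ⟨hR, hL⟩

/-- A new line at the bottom between two far ends is made of two caps. If they were side by side,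
their words are concatenated in the right order. If they were nested, the inner one is hidden from
both sides and carries no blob. -/
theorem IsLRBlob.ordered_bot_join : (d.join (.inr i₀) (.inr i₁)).Ordered Sum.inr where
  same_line i j hij hlt := by
    have hd := h.isMatching
    have hne : Sum.inr i₁ ≠ (Sum.inr i₀ : Pt n) := by simp; omega
    rcases join_cases (α := .inr i₀) (β := .inr i₁) hd (.inr i) with hc | hc | hc | hc | hc
    · rw [hc.2.2]; simp
    · rw [hc.2.2]; simp
    · obtain ⟨⟨h0, h1⟩, h2, h3⟩ := hc
      rw [h2] at hij
      have h4 := h.nonCross (.inr i₀) (.inr i₁) hne (Ne.symm h0)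
      rw [hij] at h4
      have n1 := hd.ne_self (.inr i₀)
      have n2 := hd.ne_self (.inr i₁)
      have n3 : d.partner (.inr i₁) ≠ .inr i₀ := fun e => h0 (hd.partner_eq_iff.1 e)
      simp only [Btw, ← h1, posL_inr] at h4
      rw [← h1] at n1 h0
      rw [hij] at n2 n3
      simp only [ne_eq, Sum.inr.injEq, Fin.ext_iff] at n1 n2 n3 h0
      have h1' := hd.partner_eq_iff.1 h1.symm
      rw [h3]
      exact not_RL_append (h.ordered_bot.same_line i i₀ h1' (by omega))
        (h.ordered_bot.same_line i₁ j hij (by omega))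
        (h.ordered_bot.two_lines i i₀ i₁ j h1' hij (by omega) (by omega) (by omega))
    · obtain ⟨⟨h0, h1⟩, h2, h3⟩ := hc
      rw [h2] at hij
      have h4 := h.nonCross (.inr i₀) (.inr i₁) hne (Ne.symm h0)
      rw [← h1] at h4
      have n1 := hd.ne_self (.inr i₀)
      have n2 := hd.ne_self (.inr i₁)
      have n3 : d.partner (.inr i₁) ≠ .inr i₀ := fun e => h0 (hd.partner_eq_iff.1 e)
      simp only [Btw, hij, posL_inr] at h4
      rw [← h1] at n2 n3
      rw [hij] at n1 h0
      simp only [ne_eq, Sum.inr.injEq, Fin.ext_iff] at n1 n2 n3 h0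
      have h1' := hd.partner_eq_iff.1 h1.symm
      rw [h3]
      -- Nested caps: for `j < i₀` the cap from `i` to `i₁` encloses the one from `j` to `i₀`;
      -- otherwise the cap from `i₀` to `j` encloses the one from `i₁` to `i`.
      rcases Nat.lt_or_ge j i₀ with hlt' | hge
      · have hL : L ∉ d.word (.inr i₀) := fun hL => h.not_btwL hL (.inr i₁) (by
          simp only [Btw, ← h1, posL_inr]; omega)
        have hR : R ∉ d.word (.inr i₀) := fun hR => h.not_btwR hR (.inr i₁) (by
          simp only [Btw, ← h1, posR_inr]; omega)
        rw [eq_nil_of_not_mem hL hR, List.append_nil]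
        exact h.ordered_bot.same_line i i₁ h1' (by omega)
      · have hL : L ∉ d.word (.inr i) := fun hL => h.not_btwL hL (.inr i₀) (by
          simp only [Btw, hij, posL_inr]; omega)
        have hR : R ∉ d.word (.inr i) := fun hR => h.not_btwR hR (.inr i₀) (by
          simp only [Btw, hij, posR_inr]; omega)
        rw [eq_nil_of_not_mem hL hR, List.nil_append]
        exact h.ordered_bot.same_line i₀ j hij (by omega)
    · rw [hc.2.1] at hij
      rw [hc.2.2]
      exact h.ordered_bot.same_line i j hij hlt
  two_lines i j i' j' hij hij' hlt1 hlt2 hlt3 := by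
    have hd := h.isMatching
    have hne : Sum.inr i₁ ≠ (Sum.inr i₀ : Pt n) := by simp; omega
    rintro ⟨hR, hL⟩
    rcases join_cases (α := .inr i₀) (β := .inr i₁) hd (.inr i) with hc | hc | hc | hc | hc
    · rw [hc.2.2] at hR; simp at hR
    · rw [hc.2.2] at hR; simp at hR
    all_goals
      rcases join_cases (α := .inr i₀) (β := .inr i₁) hd (.inr i') with hc' | hc' | hc' | hc' | hc'
    any_goals
      rw [hc'.2.2] at hL
      simp at hL
      done
    all_goals
      rw [hc.2.1] at hij
      rw [hc'.2.1] at hij'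
      rw [hc.2.2] at hR
      rw [hc'.2.2] at hL
    · have := hc.1.2.trans hc'.1.2.symm
      simp at this; omega
    · have := hij.symm.trans hc'.1.2.symm
      simp at this; omega
    · obtain ⟨⟨h0, h1⟩, h2, h3⟩ := hc
      have h4 := h.nonCross (.inr i₀) (.inr i₁) hne (Ne.symm h0)
      rw [hij] at h4
      have n1 := hd.ne_self (.inr i₀)
      have n2 := hd.ne_self (.inr i₁)
      have n3 : d.partner (.inr i₁) ≠ .inr i₀ := fun e => h0 (hd.partner_eq_iff.1 e)
      simp only [Btw, ← h1, posL_inr] at h4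
      rw [← h1] at n1 h0
      rw [hij] at n2 n3
      simp only [ne_eq, Sum.inr.injEq, Fin.ext_iff] at n1 n2 n3 h0
      have h1' := hd.partner_eq_iff.1 h1.symm
      rw [List.mem_append] at hR
      rcases hR with hR | hR
      · exact h.ordered_bot.two_lines i i₀ i' j' h1' hij' (by omega) (by omega) hlt3 ⟨hR, hL⟩
      · exact h.ordered_bot.two_lines i₁ j i' j' hij hij' (by omega) (by omega) hlt3 ⟨hR, hL⟩
    · have := hij.symm.trans hc'.1.2.symm
      simp at this; omega
    · have := hc.1.2.trans hc'.1.2.symm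
      simp at this; omega
    · obtain ⟨⟨h0, h1⟩, h2, h3⟩ := hc
      have h4 := h.nonCross (.inr i₀) (.inr i₁) hne (Ne.symm h0)
      rw [← h1] at h4
      have n1 := hd.ne_self (.inr i₀)
      have n2 := hd.ne_self (.inr i₁)
      have n3 : d.partner (.inr i₁) ≠ .inr i₀ := fun e => h0 (hd.partner_eq_iff.1 e)
      simp only [Btw, hij, posL_inr] at h4
      rw [← h1] at n2 n3
      rw [hij] at n1 h0
      simp only [ne_eq, Sum.inr.injEq, Fin.ext_iff] at n1 n2 n3 h0
      have h1' := hd.partner_eq_iff.1 h1.symm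
      have m1 := hc'.1.1
      have m2 := hc'.1.2.1
      simp only [ne_eq, Sum.inr.injEq, Fin.ext_iff] at m1 m2
      rw [List.mem_append] at hR
      rcases Nat.lt_or_ge j i₀ with hlt' | hge
      · rcases hR with hR | hR
        · rcases Nat.lt_or_ge i' i₁ with hlt'' | hge'
          · exact h.not_btwL hL (.inr i₁) (by simp only [Btw, ← h1, posL_inr]; omega)
          · exact h.ordered_bot.two_lines i i₁ i' j' h1' hij' (by omega) (by omega) hlt3 ⟨hR, hL⟩
        · exact h.not_btwR hR (.inr i₁) (by simp only [Btw, ← h1, posR_inr]; omega)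
      · rcases hR with hR | hR
        · exact h.not_btwR hR (.inr i₀) (by simp only [Btw, hij, posR_inr]; omega)
        · exact h.ordered_bot.two_lines i₀ j i' j' hij hij' (by omega) (by omega) hlt3 ⟨hR, hL⟩
    · obtain ⟨⟨h0, h1⟩, h2, h3⟩ := hc'
      have h4 := h.nonCross (.inr i₀) (.inr i₁) hne (Ne.symm h0)
      rw [hij'] at h4
      have n1 := hd.ne_self (.inr i₀)
      have n2 := hd.ne_self (.inr i₁)
      have n3 : d.partner (.inr i₁) ≠ .inr i₀ := fun e => h0 (hd.partner_eq_iff.1 e)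
      simp only [Btw, ← h1, posL_inr] at h4
      rw [← h1] at n1 h0
      rw [hij'] at n2 n3
      simp only [ne_eq, Sum.inr.injEq, Fin.ext_iff] at n1 n2 n3 h0
      have h1' := hd.partner_eq_iff.1 h1.symm
      rw [List.mem_append] at hL
      rcases hL with hL | hL
      · exact h.ordered_bot.two_lines i j i' i₀ hij h1' hlt1 hlt2 (by omega) ⟨hR, hL⟩
      · exact h.ordered_bot.two_lines i j i₁ j' hij hij' hlt1 (by omega) (by omega) ⟨hR, hL⟩
    · obtain ⟨⟨h0, h1⟩, h2, h3⟩ := hc'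
      have h4 := h.nonCross (.inr i₀) (.inr i₁) hne (Ne.symm h0)
      rw [← h1] at h4
      have n1 := hd.ne_self (.inr i₀)
      have n2 := hd.ne_self (.inr i₁)
      have n3 : d.partner (.inr i₁) ≠ .inr i₀ := fun e => h0 (hd.partner_eq_iff.1 e)
      simp only [Btw, hij', posL_inr] at h4
      rw [← h1] at n2 n3
      rw [hij'] at n1 h0
      simp only [ne_eq, Sum.inr.injEq, Fin.ext_iff] at n1 n2 n3 h0
      have h1' := hd.partner_eq_iff.1 h1.symm
      have m1 := hc.1.1
      have m2 := hc.1.2.1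
      simp only [ne_eq, Sum.inr.injEq, Fin.ext_iff] at m1 m2
      rw [List.mem_append] at hL
      rcases Nat.lt_or_ge j' i₀ with hlt' | hge
      · rcases hL with hL | hL
        · exact h.ordered_bot.two_lines i j i' i₁ hij h1' hlt1 hlt2 (by omega) ⟨hR, hL⟩
        · exact h.not_btwL hL (.inr i₁) (by simp only [Btw, ← h1, posL_inr]; omega)
      · rcases hL with hL | hL
        · exact h.not_btwL hL (.inr i₀) (by simp only [Btw, hij', posL_inr]; omega)
        · rcases Nat.lt_or_ge i i₀ with hlt'' | hge'
          · have := h.nonCross (.inr i₀) (.inr i) hc.1.1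
              (by rw [hij', ne_eq, Sum.inr.injEq, Fin.ext_iff]; omega)
            have m3 : j ≠ i₀ := by
              rintro rfl
              have := (hd.partner_eq_iff.1 hij).symm.trans hij'
              simp at this; omega
            rw [hij] at this
            simp only [Btw, hij', posL_inr] at this
            rw [ne_eq, Fin.ext_iff] at m3
            exact h.ordered_bot.two_lines i j i₀ j' hij hij' hlt1 (by rw [Fin.lt_def]; omega)
              (by omega) ⟨hR, hL⟩
          · exact h.not_btwR hR (.inr i₀) (by simp only [Btw, hij', posR_inr]; omega)
    · exact h.ordered_bot.two_lines i j i' j' hij hij' hlt1 hlt2 hlt3 ⟨hR, hL⟩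

theorem IsLRBlob.join : (d.join (.inr i₀) (.inr i₁)).IsLRBlob := by
  have hd := h.isMatching
  have hp : posL (.inr i₀ : Pt n) = posL (.inr i₁) + 1 := by
    simp only [posL_inr]; omega
  have hp' : posR (.inr i₀ : Pt n) = posR (.inr i₁) + 1 := by
    simp only [posR_inr]; omega
  have hnc := h.nonCross.join hd posL_injective hp
  have hm := hd.join (α := .inr i₀) (β := .inr i₁) (by simp; omega)
  refine { isTL_iff.2 ⟨hm, hnc⟩ with
    exposedL := exposed_join hd posL_injective hp h.nonCross h.exposedL
    exposedR := exposed_join hd posR_injective hp' (h.nonCross.posR hd) h.exposedR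
    ordered_top := h.ordered_top_join hi
    ordered_bot := h.ordered_bot_join hi }

end Join

end

end PreDiagram

end SympBlob

namespace SympBlob

open Blob

namespace PreDiagram

variable {n : ℕ}

/-! ### Straightening words -/

section Words

variable {k : Type*} [Field k] (q : Params k)

theorem push_sublist (g : Blob) (w : List Blob) : (push q g w).2.Sublist (g :: w) := by
  unfold push
  split <;> simp

/-- Straightening only deletes blobs, so exposure and order are inherited. -/
theorem straightenWord_sublist (w : List Blob) : (straightenWord q w).2.Sublist w := by
  induction w with
  | nil => simp [straightenWord]
  | cons g w ih => exact (push_sublist q g _).trans (ih.cons_cons g)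

/-- The words without `LL`, `RR`, `LRL`, `RLR`. -/
def IsNormal (w : List Blob) : Prop := w = [] ∨ w = [L] ∨ w = [R] ∨ w = [L, R] ∨ w = [R, L]

theorem IsNormal.push {w : List Blob} (h : IsNormal w) (g : Blob) : IsNormal (push q g w).2 := by
  rcases h with rfl | rfl | rfl | rfl | rfl <;> cases g <;> simp [PreDiagram.push, IsNormal]

theorem isNormal_straightenWord (w : List Blob) : IsNormal (straightenWord q w).2 := by
  induction w with
  | nil => exact .inl rfl
  | cons g w ih => exact ih.push q g

theorem IsNormal.straightenWord_eq {w : List Blob} (h : IsNormal w) :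
    straightenWord q w = (1, w) := by
  rcases h with rfl | rfl | rfl | rfl | rfl <;> simp [straightenWord, PreDiagram.push]

theorem isNormal_iff {w : List Blob} : IsNormal w ↔
    ¬ [L, L] <:+: w ∧ ¬ [R, R] <:+: w ∧ ¬ [L, R, L] <:+: w ∧ ¬ [R, L, R] <:+: w := by
  constructor
  · rintro (rfl | rfl | rfl | rfl | rfl) <;> decide
  · rintro ⟨h1, h2, h3, h4⟩
    match w with
    | [] => exact .inl rfl
    | [L] => exact .inr (.inl rfl)
    | [R] => exact .inr (.inr (.inl rfl))
    | [L, R] => exact .inr (.inr (.inr (.inl rfl)))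
    | [R, L] => exact .inr (.inr (.inr (.inr rfl)))
    | L :: L :: w => exact absurd ⟨[], w, rfl⟩ h1
    | R :: R :: w => exact absurd ⟨[], w, rfl⟩ h2
    | L :: R :: L :: w => exact absurd ⟨[], w, rfl⟩ h3
    | R :: L :: R :: w => exact absurd ⟨[], w, rfl⟩ h4
    | L :: R :: R :: w => exact absurd ⟨[L], w, rfl⟩ h2
    | R :: L :: L :: w => exact absurd ⟨[R], w, rfl⟩ h1

theorem straightenWord_append_snd (u v : List Blob) :
    straightenWord q (u ++ v) = ((straightenWord q v).1 *
      (straightenWord q (u ++ (straightenWord q v).2)).1,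
      (straightenWord q (u ++ (straightenWord q v).2)).2) := by
  induction u with
  | nil =>
    simp [(isNormal_straightenWord q v).straightenWord_eq]
  | cons g u ih =>
    simp only [List.cons_append, straightenWord]
    rw [ih]
    simp [mul_assoc]

/-- Confluence of the rules in its basic form: a blob pushed from the left and a blob pushed from
the right may be straightened in either order. This is checked on the five straight words. -/
theorem straightenWord_concat (w : List Blob) (g : Blob) :
    straightenWord q (w ++ [g]) = ((straightenWord q w).1 *
      (push q g (straightenWord q w).2.reverse).1,
      (push q g (straightenWord q w).2.reverse).2.reverse) := by
  induction w with
  | nil => cases g <;> simp [straightenWord, push]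
  | cons h w ih =>
    simp only [List.cons_append, straightenWord]
    rw [ih]
    have := isNormal_straightenWord q w
    generalize (straightenWord q w).1 = s
    generalize (straightenWord q w).2 = v at this
    rcases this with rfl | rfl | rfl | rfl | rfl <;> cases g <;> cases h <;> simp [push, mul_comm, mul_left_comm]

theorem straightenWord_reverse (w : List Blob) :
    straightenWord q w.reverse = ((straightenWord q w).1, (straightenWord q w).2.reverse) := by
  induction w with
  | nil => simp [straightenWord]
  | cons g w ih =>
    rw [List.reverse_cons, straightenWord_concat, ih, List.reverse_reverse]
    simp [straightenWord]

/-- The recursion starts at the right end, so straightening the front beforehand is not covered by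
it directly; reversal turns the front into the back. -/
theorem straightenWord_append_fst (u v : List Blob) :
    straightenWord q (u ++ v) = ((straightenWord q u).1 *
      (straightenWord q ((straightenWord q u).2 ++ v)).1,
      (straightenWord q ((straightenWord q u).2 ++ v)).2) := by
  have := straightenWord_reverse q (v.reverse ++ u.reverse)
  rw [List.reverse_append, List.reverse_reverse, List.reverse_reverse,
    straightenWord_append_snd q v.reverse, straightenWord_reverse] at this
  rw [this]
  have h2 := straightenWord_reverse q (v.reverse ++ (straightenWord q u).2.reverse)
  rw [List.reverse_append, List.reverse_reverse, List.reverse_reverse] at h2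
  rw [h2]

/-- Straightening of a product of two words. -/
theorem straightenWord_append (u v : List Blob) :
    straightenWord q (u ++ v) = ((straightenWord q u).1 * (straightenWord q v).1 *
      (straightenWord q ((straightenWord q u).2 ++ (straightenWord q v).2)).1,
      (straightenWord q ((straightenWord q u).2 ++ (straightenWord q v).2)).2) := by
  rw [straightenWord_append_fst, straightenWord_append_snd, mul_assoc]

theorem eq_replicate_of_sorted {w : List Blob} (h : ¬ [R, L].Sublist w) :
    ∃ a b, w = List.replicate a L ++ List.replicate b R := by
  induction w with
  | nil => exact ⟨0, 0, rfl⟩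
  | cons x w ih =>
    obtain ⟨a, b, rfl⟩ := ih fun e => h (e.cons x)
    cases x
    · exact ⟨a + 1, b, by simp [List.replicate_succ]⟩
    · rcases a with _ | a
      · exact ⟨0, b + 1, by simp [List.replicate_succ]⟩
      · exact absurd (List.cons_sublist_cons.2 (List.singleton_sublist.2 (by simp))) h

theorem straightenWord_replicate_R (b : ℕ) :
    straightenWord q (List.replicate (b + 1) R) = (q.δR ^ b, [R]) := by
  induction b with
  | zero => simp [straightenWord, push]
  | succ b ih =>
    rw [List.replicate_succ, straightenWord, ih]
    simp [push, pow_succ]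

theorem straightenWord_replicate_L (a : ℕ) {v t : List Blob} {s : k}
    (hv : straightenWord q v = (s, t)) (ht : t = [] ∨ t = [R]) :
    straightenWord q (List.replicate (a + 1) L ++ v) = (s * q.δL ^ a, L :: t) := by
  induction a with
  | zero => rcases ht with rfl | rfl <;> simp [straightenWord, push, hv]
  | succ a ih =>
    rw [List.replicate_succ, List.cons_append, straightenWord, ih]
    simp [push, pow_succ, mul_assoc]

/-- `loopWeight` only counts blobs, which is right for words of the form `L⋯LR⋯R`. For `[L, R, L]`
the left-hand side would be `δL * κLR` and the right-hand side `κLR * κL`. -/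
theorem loopWeight_straightenWord {w : List Blob} (h : ¬ [R, L].Sublist w) :
    loopWeight q (w.count L) (w.count R) = (straightenWord q w).1 *
      loopWeight q ((straightenWord q w).2.count L) ((straightenWord q w).2.count R) := by
  obtain ⟨a, b, rfl⟩ := eq_replicate_of_sorted h
  have hL : (List.replicate a L ++ List.replicate b R).count L = a := by
    simp [List.count_replicate]
  have hR : (List.replicate a L ++ List.replicate b R).count R = b := by
    simp [List.count_replicate]
  rw [hL, hR]
  have h0 : straightenWord q ([] : List Blob) = (1, []) := rfl
  rcases a with _ | a <;> rcases b with _ | b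
  · simp [h0]
  · simp [straightenWord_replicate_R, loopWeight]
  · rw [List.replicate_zero, straightenWord_replicate_L q a h0 (.inl rfl)]
    simp [loopWeight]
  · rw [straightenWord_replicate_L q a (straightenWord_replicate_R q b) (.inr rfl)]
    simp [loopWeight, mul_comm]

end Words

end PreDiagram

end SympBlob

namespace SympBlob

open Blob

namespace PreDiagram

variable {n : ℕ}

/-! ### Validity is preserved -/

section

variable {d : PreDiagram n}

theorem mem_addBlob_word {α : Pt n} {g g' : Blob} {x : Pt n}
    (h : g' ∈ (d.addBlob α g).word x) :
    g' ∈ d.word x ∨ (g' = g ∧ (x = α ∨ x = d.partner α)) := by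
  simp only [addBlob] at h
  split_ifs at h with h1 h2
  · subst h1
    rcases List.mem_cons.1 h with h | h
    · exact .inr ⟨h, .inl rfl⟩
    · exact .inl h
  · rcases List.mem_append.1 h with h | h
    · exact .inl h
    · exact .inr ⟨by simpa using h, .inr h2⟩
  · exact .inl h

theorem IsLRBlob.addBlobL [NeZero n] (h : d.IsLRBlob) : (d.addBlob (.inr 0) L).IsLRBlob := by
  have hd := h.isMatching
  have hm := hd.addBlob (.inr 0) L
  have hnc : (d.addBlob (.inr 0) L).NonCross posL := h.nonCross
  have h0 : ((0 : Fin n) : ℕ) = 0 := Fin.val_zero n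
  -- Seen from the left side, `inr 0` is the last vertex, so no line can enclose it.
  have hlast : d.Exposed posL (.inr 0) ∧ d.Exposed posL (d.partner (.inr 0)) := by
    have : ∀ y, posL (y : Pt n) ≤ posL (.inr 0 : Pt n) := by
      rintro (i | i)
      · rw [posL_inl, posL_inr]; omega
      · rw [posL_inr, posL_inr]; omega
    constructor
    · intro y hy
      have := this (d.partner y)
      omega
    · intro y hy
      rw [hd.invol] at hy
      have := this (d.partner y)
      omega
  refine { isTL_iff.2 ⟨hm, hnc⟩ with
    exposedL := ?_, exposedR := ?_, ordered_top := ⟨?_, ?_⟩, ordered_bot := ⟨?_, ?_⟩ }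
  · intro x hx
    rcases mem_addBlob_word hx with hx | ⟨-, rfl | rfl⟩
    · exact h.exposedL x hx
    · exact hlast.1
    · exact hlast.2
  · intro x hx
    rcases mem_addBlob_word hx with hx | ⟨hx, -⟩
    · exact h.exposedR x hx
    · simp at hx
  · intro i j hij hlt
    have hij : d.partner (.inl i) = .inl j := hij
    have : (d.addBlob (.inr 0) L).word (.inl i) = d.word (.inl i) := by
      have : Sum.inl i ≠ d.partner (.inr 0) := by
        rw [ne_eq, eq_comm, hd.partner_eq_iff, hij]; simp
      simp [addBlob, this]
    rw [this]
    exact h.ordered_top.same_line i j hij hlt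
  · rintro i j i' j' hij hij' h1 h2 h3 ⟨hR, hL⟩
    have hij : d.partner (.inl i) = .inl j := hij
    have hij' : d.partner (.inl i') = .inl j' := hij'
    refine h.ordered_top.two_lines i j i' j' hij hij' h1 h2 h3 ⟨?_, ?_⟩
    · simpa using mem_addBlob_word hR
    · rcases mem_addBlob_word hL with hL | ⟨-, hL | hL⟩
      · exact hL
      · simp at hL
      · rw [eq_comm, hd.partner_eq_iff, hij'] at hL; simp at hL
  · intro i j hij hlt
    have hij : d.partner (.inr i) = .inr j := hij
    have h1 : Sum.inr i ≠ d.partner (.inr 0) := by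
      rw [ne_eq, eq_comm, hd.partner_eq_iff, hij]
      simp only [Sum.inr.injEq]; rintro rfl
      simp at hlt
    have h2 := h.ordered_bot.same_line i j hij hlt
    by_cases h3 : i = 0
    · subst h3
      simpa [addBlob, List.cons_sublist_cons'] using h2
    · simpa [addBlob, h1, h3] using h2
  · rintro i j i' j' hij hij' h1 h2 h3 ⟨hR, hL⟩
    have hij : d.partner (.inr i) = .inr j := hij
    have hij' : d.partner (.inr i') = .inr j' := hij'
    refine h.ordered_bot.two_lines i j i' j' hij hij' h1 h2 h3 ⟨?_, ?_⟩
    · simpa using mem_addBlob_word hR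
    · rcases mem_addBlob_word hL with hL | ⟨-, hL | hL⟩
      · exact hL
      · simp only [Sum.inr.injEq] at hL
        omega
      · rw [eq_comm, hd.partner_eq_iff, hij'] at hL
        simp only [Sum.inr.injEq] at hL
        omega

theorem not_RL_concat_R {w : List Blob} (h : ¬ [R, L].Sublist w) : ¬ [R, L].Sublist (w ++ [R]) :=
  not_RL_append h (not_RL_of_not_L (by simp)) (by simp)

theorem IsLRBlob.addBlobR [NeZero n] (h : d.IsLRBlob) :
    (d.addBlob (.inr (Fin.rev 0)) R).IsLRBlob := by
  have hd := h.isMatching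
  set l : Fin n := Fin.rev 0 with hl
  have hm := hd.addBlob (.inr l) R
  have hnc : (d.addBlob (.inr l) R).NonCross posL := h.nonCross
  have h0 : (l : ℕ) + 1 = n := by
    have := NeZero.pos n
    simp only [hl, Fin.val_rev, Fin.val_zero]; omega
  -- Seen from the right side, the last bottom vertex has position 0, so no line can enclose it.
  have hlast : d.Exposed posR (.inr l) ∧ d.Exposed posR (d.partner (.inr l)) := by
    have : posR (.inr l : Pt n) = 0 := by rw [posR_inr]; omega
    constructor
    · intro y hy; omega
    · intro y hy
      rw [hd.invol] at hy; omega
  refine { isTL_iff.2 ⟨hm, hnc⟩ with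
    exposedL := ?_, exposedR := ?_, ordered_top := ⟨?_, ?_⟩, ordered_bot := ⟨?_, ?_⟩ }
  · intro x hx
    rcases mem_addBlob_word hx with hx | ⟨hx, -⟩
    · exact h.exposedL x hx
    · simp at hx
  · intro x hx
    rcases mem_addBlob_word hx with hx | ⟨-, rfl | rfl⟩
    · exact h.exposedR x hx
    · exact hlast.1
    · exact hlast.2
  · intro i j hij hlt
    have hij : d.partner (.inl i) = .inl j := hij
    have : (d.addBlob (.inr l) R).word (.inl i) = d.word (.inl i) := by
      have : Sum.inl i ≠ d.partner (.inr l) := by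
        rw [ne_eq, eq_comm, hd.partner_eq_iff, hij]; simp
      simp [addBlob, this]
    rw [this]
    exact h.ordered_top.same_line i j hij hlt
  · rintro i j i' j' hij hij' h1 h2 h3 ⟨hR, hL⟩
    have hij : d.partner (.inl i) = .inl j := hij
    have hij' : d.partner (.inl i') = .inl j' := hij'
    refine h.ordered_top.two_lines i j i' j' hij hij' h1 h2 h3 ⟨?_, ?_⟩
    · rcases mem_addBlob_word hR with hL | ⟨-, hL | hL⟩
      · exact hL
      · simp at hL
      · rw [eq_comm, hd.partner_eq_iff, hij] at hL; simp at hL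
    · simpa using mem_addBlob_word hL
  · intro i j hij hlt
    have hij : d.partner (.inr i) = .inr j := hij
    have h1 : i ≠ l := by rintro rfl; omega
    have h2 := h.ordered_bot.same_line i j hij hlt
    by_cases h3 : j = l
    · rw [h3, hd.partner_eq_iff] at hij
      have : (d.addBlob (.inr l) R).word (.inr i) = d.word (.inr i) ++ [R] := by
        simp [addBlob, h1, hij]
      rw [this]
      exact not_RL_concat_R h2
    · have h4 : Sum.inr i ≠ d.partner (.inr l) := by
        rw [ne_eq, eq_comm, hd.partner_eq_iff, hij]; simpa using h3
      simpa [addBlob, h1, h4] using h2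
  · rintro i j i' j' hij hij' h1 h2 h3 ⟨hR, hL⟩
    have hij : d.partner (.inr i) = .inr j := hij
    have hij' : d.partner (.inr i') = .inr j' := hij'
    refine h.ordered_bot.two_lines i j i' j' hij hij' h1 h2 h3 ⟨?_, ?_⟩
    · rcases mem_addBlob_word hR with hL | ⟨-, hL | hL⟩
      · exact hL
      · simp only [Sum.inr.injEq] at hL
        omega
      · rw [eq_comm, hd.partner_eq_iff, hij] at hL
        simp only [Sum.inr.injEq] at hL
        omega
    · simpa using mem_addBlob_word hL

theorem IsLRBlob.ract [NeZero n] (h : d.IsLRBlob) (i : Fin (n + 1)) : (d.ract i).IsLRBlob := by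
  unfold PreDiagram.ract
  split_ifs with h1 h2
  · exact h.addBlobL
  · refine h.join ?_
    have : (i : ℕ) ≠ 0 := fun e => h1 (Fin.ext e)
    simp only
    omega
  · exact h.addBlobR

theorem isLRBlob_one : (one n).IsLRBlob := by
  have hw : ∀ x, (one n).word x = [] := fun x => by rcases x with i | i <;> simp [one, vertical]
  have hnc : (one n).NonCross posL := by
    rintro (i | i) (j | j) h1 h2 <;>
      simp only [one, vertical, Btw, Sum.swap_inl, Sum.swap_inr, posL_inl, posL_inr, ne_eq,
        Sum.inl.injEq, Sum.inr.injEq, Fin.ext_iff] at h1 h2 ⊢ <;> omega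
  refine { isTL_iff.2 ⟨isMatching_one, hnc⟩ with
    exposedL := fun x hx => ?_, exposedR := fun x hx => ?_
    ordered_top := ⟨?_, ?_⟩, ordered_bot := ⟨?_, ?_⟩ }
  · rw [hw] at hx; simp at hx
  · rw [hw] at hx; simp at hx
  all_goals
    intros
    simp [hw]

theorem IsLRBlob.ractList [NeZero n] (h : d.IsLRBlob) (l : List (Fin (n + 1))) :
    (d.ractList l).IsLRBlob := by
  induction l generalizing d with
  | nil => exact h
  | cons i l ih => exact ih (h.ract i)

variable {k : Type*} [Field k] (q : Params k)

theorem IsMatching.straightenLines (h : d.IsMatching) : (straightenLines q d).IsMatching where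
  invol := h.invol
  ne_self := h.ne_self
  word_partner x := by
    change (straightenWord q (d.word (d.partner x))).2 = _
    rw [h.word_partner, straightenWord_reverse]; rfl

theorem IsLRBlob.straightenLines (h : d.IsLRBlob) : (straightenLines q d).IsLRBlob := by
  have hs : ∀ x, ((PreDiagram.straightenLines q d).word x).Sublist (d.word x) :=
    fun x => straightenWord_sublist q _
  have hnc : (PreDiagram.straightenLines q d).NonCross posL := h.nonCross
  refine { isTL_iff.2 ⟨h.isMatching.straightenLines q, hnc⟩ with
    exposedL := ?_, exposedR := ?_, ordered_top := ⟨?_, ?_⟩, ordered_bot := ⟨?_, ?_⟩ }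
  · exact fun x hx => h.exposedL x ((hs x).subset hx)
  · exact fun x hx => h.exposedR x ((hs x).subset hx)
  · exact fun i j hij hlt hsub => h.ordered_top.same_line i j hij hlt (hsub.trans (hs _))
  · exact fun i j i' j' hij hij' h1 h2 h3 hh => h.ordered_top.two_lines i j i' j' hij hij' h1 h2 h3
      ⟨(hs _).subset hh.1, (hs _).subset hh.2⟩
  · exact fun i j hij hlt hsub => h.ordered_bot.same_line i j hij hlt (hsub.trans (hs _))
  · exact fun i j i' j' hij hij' h1 h2 h3 hh => h.ordered_bot.two_lines i j i' j' hij hij' h1 h2 h3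
      ⟨(hs _).subset hh.1, (hs _).subset hh.2⟩

/-! ### Lines with both blobs -/

theorem IsLRBlob.double_top (h : d.IsLRBlob) {i : Fin n} (hi : d.DoubleAt Sum.inl i) :
    ∃ j, i < j ∧ d.partner (.inl i) = .inl j ∧ d.word (.inl i) = [L, R] ∧
      d.partner (.inl j) = .inl i ∧ d.word (.inl j) = [R, L] := by
  obtain ⟨⟨j, hj⟩, hw⟩ := hi
  have hj' := h.isMatching.partner_eq_iff.1 hj
  have hw' : d.word (.inl j) = [R, L] := by rw [← hj, h.isMatching.word_partner, hw]; rfl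
  refine ⟨j, ?_, hj, hw, hj', hw'⟩
  rcases lt_trichotomy i j with hlt | rfl | hlt
  · exact hlt
  · exact absurd hj (h.isMatching.ne_self _)
  · exact absurd (by rw [hw']) (h.ordered_top.same_line j i hj' hlt)

theorem IsLRBlob.double_bot (h : d.IsLRBlob) {i : Fin n} (hi : d.DoubleAt Sum.inr i) :
    ∃ j, i < j ∧ d.partner (.inr i) = .inr j ∧ d.word (.inr i) = [L, R] ∧
      d.partner (.inr j) = .inr i ∧ d.word (.inr j) = [R, L] := by
  obtain ⟨⟨j, hj⟩, hw⟩ := hi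
  have hj' := h.isMatching.partner_eq_iff.1 hj
  have hw' : d.word (.inr j) = [R, L] := by rw [← hj, h.isMatching.word_partner, hw]; rfl
  refine ⟨j, ?_, hj, hw, hj', hw'⟩
  rcases lt_trichotomy i j with hlt | rfl | hlt
  · exact hlt
  · exact absurd hj (h.isMatching.ne_self _)
  · exact absurd (by rw [hw']) (h.ordered_bot.same_line j i hj' hlt)

/-- Of two such lines side by side, the left one would have a right blob before a left blob of the
right one; of two nested ones the inner would be hidden. -/
theorem IsLRBlob.double_top_unique (h : d.IsLRBlob) {i i' : Fin n} (hi : d.DoubleAt Sum.inl i)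
    (hi' : d.DoubleAt Sum.inl i') : i = i' := by
  have key : ∀ i i', d.DoubleAt Sum.inl i → d.DoubleAt Sum.inl i' → ¬ i < i' := by
    intro i i' hi hi' hlt
    obtain ⟨j, h1, h2, h3, -, -⟩ := h.double_top hi
    obtain ⟨j', h1', h2', h3', -, -⟩ := h.double_top hi'
    rcases lt_trichotomy j i' with hl | rfl | hl
    · exact h.ordered_top.two_lines i j i' j' h2 h2' h1 hl h1' (by simp [h3, h3'])
    · rw [h.isMatching.partner_eq_iff, h2'] at h2
      simp at h2; omega
    · exact h.not_btwL (x := .inl i') (by simp [h3']) (.inl i)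
        (by simp only [Btw, h2, posL_inl]; omega)
  rcases lt_trichotomy i i' with hl | hl | hl
  · exact absurd hl (key i i' hi hi')
  · exact hl
  · exact absurd hl (key i' i hi' hi)

theorem IsLRBlob.double_bot_unique (h : d.IsLRBlob) {i i' : Fin n} (hi : d.DoubleAt Sum.inr i)
    (hi' : d.DoubleAt Sum.inr i') : i = i' := by
  have key : ∀ i i', d.DoubleAt Sum.inr i → d.DoubleAt Sum.inr i' → ¬ i < i' := by
    intro i i' hi hi' hlt
    obtain ⟨j, h1, h2, h3, -, -⟩ := h.double_bot hi
    obtain ⟨j', h1', h2', h3', -, -⟩ := h.double_bot hi'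
    rcases lt_trichotomy j i' with hl | rfl | hl
    · exact h.ordered_bot.two_lines i j i' j' h2 h2' h1 hl h1' (by simp [h3, h3'])
    · rw [h.isMatching.partner_eq_iff, h2'] at h2
      simp at h2; omega
    · exact h.not_btwL (x := .inr i') (by simp [h3']) (.inr i)
        (by simp only [Btw, h2, posL_inr]; omega)
  rcases lt_trichotomy i i' with hl | hl | hl
  · exact absurd hl (key i i' hi hi')
  · exact hl
  · exact absurd hl (key i' i hi' hi)

end

end PreDiagram

end SympBlob

namespace SympBlob

open Blob

namespace PreDiagram

variable {n : ℕ}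

/-! ### The topological relation preserves validity -/

/-- There are lines with both blobs at the top, with ends `i < i'`, and at the bottom, with ends
`j < j'`. -/
structure IsDouble (d : PreDiagram n) (i i' j j' : Fin n) : Prop where
  lt_top : i < i'
  lt_bot : j < j'
  top : d.partner (.inl i) = .inl i'
  top' : d.partner (.inl i') = .inl i
  bot : d.partner (.inr j) = .inr j'
  bot' : d.partner (.inr j') = .inr j
  word_top : d.word (.inl i) = [L, R]
  word_top' : d.word (.inl i') = [R, L]
  word_bot : d.word (.inr j) = [L, R]
  word_bot' : d.word (.inr j') = [R, L]

section

variable {d : PreDiagram n}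

theorem IsLRBlob.isDouble (h : d.IsLRBlob) {i j : Fin n} (hi : d.DoubleAt Sum.inl i)
    (hj : d.DoubleAt Sum.inr j) : ∃ i' j', d.IsDouble i i' j j' := by
  obtain ⟨i', h1, h2, h3, h4, h5⟩ := h.double_top hi
  obtain ⟨j', k1, k2, k3, k4, k5⟩ := h.double_bot hj
  exact ⟨i', j', h1, k1, h2, h4, k2, k4, h3, h5, k3, k5⟩

variable {i i' j j' : Fin n}

theorem IsDouble.doubleAt_top (h : d.IsDouble i i' j j') : d.DoubleAt Sum.inl i :=
  ⟨⟨i', h.top⟩, h.word_top⟩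

theorem IsDouble.doubleAt_bot (h : d.IsDouble i i' j j') : d.DoubleAt Sum.inr j :=
  ⟨⟨j', h.bot⟩, h.word_bot⟩

theorem IsDouble.reconnect_cases (hD : d.IsDouble i i' j j') (x : Pt n) :
    (x = .inl i ∧ (d.reconnect i j).partner x = .inr j ∧ (d.reconnect i j).word x = [L]) ∨
    (x = .inr j ∧ (d.reconnect i j).partner x = .inl i ∧ (d.reconnect i j).word x = [L]) ∨
    (x = .inl i' ∧ (d.reconnect i j).partner x = .inr j' ∧ (d.reconnect i j).word x = [R]) ∨
    (x = .inr j' ∧ (d.reconnect i j).partner x = .inl i' ∧ (d.reconnect i j).word x = [R]) ∨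
    ((x ≠ .inl i ∧ x ≠ .inr j ∧ x ≠ .inl i' ∧ x ≠ .inr j') ∧
      (d.reconnect i j).partner x = d.partner x ∧ (d.reconnect i j).word x = d.word x) := by
  have h1 := hD.lt_top.ne
  have h2 := hD.lt_bot.ne
  by_cases e1 : x = .inl i
  · subst e1; simp [reconnect]
  by_cases e2 : x = .inr j
  · subst e2; simp [reconnect]
  by_cases e3 : x = .inl i'
  · subst e3; simp [reconnect, hD.top, hD.bot, h1.symm]
  by_cases e4 : x = .inr j'
  · subst e4; simp [reconnect, hD.top, hD.bot, h2.symm]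
  · simp [reconnect, hD.top, hD.bot, e1, e2, e3, e4]

theorem IsDouble.partner_ne (hd : d.IsMatching) (hD : d.IsDouble i i' j j') {x : Pt n}
    (hx : x ≠ .inl i ∧ x ≠ .inr j ∧ x ≠ .inl i' ∧ x ≠ .inr j') :
    d.partner x ≠ .inl i ∧ d.partner x ≠ .inr j ∧ d.partner x ≠ .inl i' ∧
      d.partner x ≠ .inr j' := by
  refine ⟨?_, ?_, ?_, ?_⟩ <;> rw [ne_eq, hd.partner_eq_iff]
  · rw [hD.top, eq_comm]; exact hx.2.2.1
  · rw [hD.bot, eq_comm]; exact hx.2.2.2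
  · rw [hD.top', eq_comm]; exact hx.1
  · rw [hD.bot', eq_comm]; exact hx.2.1

theorem IsDouble.isMatching_reconnect (hd : d.IsMatching) (hD : d.IsDouble i i' j j') :
    (d.reconnect i j).IsMatching := by
  have key : ∀ x, (d.reconnect i j).partner ((d.reconnect i j).partner x) = x ∧
      (d.reconnect i j).partner x ≠ x ∧
      (d.reconnect i j).word ((d.reconnect i j).partner x) =
        ((d.reconnect i j).word x).reverse := by
    have h1 := hD.lt_top.ne
    have h2 := hD.lt_bot.ne
    intro x
    rcases hD.reconnect_cases x with hx | hx | hx | hx | hx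
    · rw [hx.2.1, hx.2.2, hx.1]; simp [reconnect]
    · rw [hx.2.1, hx.2.2, hx.1]; simp [reconnect]
    · rw [hx.2.1, hx.2.2, hx.1]; simp [reconnect, hD.top, hD.bot, h2.symm]
    · rw [hx.2.1, hx.2.2, hx.1]; simp [reconnect, hD.top, hD.bot, h1.symm]
    · rw [hx.2.1, hx.2.2]
      have hp := hD.partner_ne hd hx.1
      rcases hD.reconnect_cases (d.partner x) with hy | hy | hy | hy | hy
      · exact absurd hy.1 hp.1
      · exact absurd hy.1 hp.2.1
      · exact absurd hy.1 hp.2.2.1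
      · exact absurd hy.1 hp.2.2.2
      · rw [hy.2.1, hy.2.2]
        exact ⟨hd.invol x, hd.ne_self x, hd.word_partner x⟩
  exact ⟨fun x => (key x).1, fun x => (key x).2.1, fun x => (key x).2.2⟩

/-- No line separates an end of a line with both blobs from the left or the right side. -/
theorem IsDouble.not_btw (h : d.IsLRBlob) (hD : d.IsDouble i i' j j') (y : Pt n) :
    (¬ d.Btw posL y (.inl i) ∧ ¬ d.Btw posL y (.inl i') ∧ ¬ d.Btw posL y (.inr j) ∧
      ¬ d.Btw posL y (.inr j')) ∧
    (¬ d.Btw posR y (.inl i) ∧ ¬ d.Btw posR y (.inl i') ∧ ¬ d.Btw posR y (.inr j) ∧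
      ¬ d.Btw posR y (.inr j')) := by
  refine ⟨⟨?_, ?_, ?_, ?_⟩, ?_, ?_, ?_, ?_⟩
  · exact h.not_btwL (by simp [hD.word_top]) y
  · exact h.not_btwL (by simp [hD.word_top']) y
  · exact h.not_btwL (by simp [hD.word_bot]) y
  · exact h.not_btwL (by simp [hD.word_bot']) y
  · exact h.not_btwR (by simp [hD.word_top]) y
  · exact h.not_btwR (by simp [hD.word_top']) y
  · exact h.not_btwR (by simp [hD.word_bot]) y
  · exact h.not_btwR (by simp [hD.word_bot']) y

/-- If there are lines with both blobs at the top and at the bottom, then there are no propagating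
lines. -/
theorem IsDouble.not_propagating (h : d.IsLRBlob) (hD : d.IsDouble i i' j j') {a b : Fin n}
    (hab : d.partner (.inl a) = .inr b) : False := by
  obtain ⟨⟨h1, h2, h3, h4⟩, h5, h6, h7, h8⟩ := hD.not_btw h (.inl a)
  have n1 : a ≠ i := by rintro rfl; rw [hD.top] at hab; simp at hab
  have n2 : a ≠ i' := by rintro rfl; rw [hD.top'] at hab; simp at hab
  simp only [Btw, hab, posL_inl, posL_inr, posR_inl, posR_inr] at *
  omega

theorem IsDouble.not_propagating' (h : d.IsLRBlob) (hD : d.IsDouble i i' j j') {a b : Fin n}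
    (hab : d.partner (.inr a) = .inl b) : False :=
  hD.not_propagating h (h.isMatching.partner_eq_iff.1 hab)

theorem IsDouble.reconnect_partner (hD : d.IsDouble i i' j j') :
    (d.reconnect i j).partner (.inl i) = .inr j ∧ (d.reconnect i j).partner (.inr j) = .inl i ∧
    (d.reconnect i j).partner (.inl i') = .inr j' ∧
    (d.reconnect i j).partner (.inr j') = .inl i' := by
  simp [reconnect, hD.top, hD.bot, hD.lt_top.ne', hD.lt_bot.ne']

theorem IsDouble.reconnect_word (hD : d.IsDouble i i' j j') :
    (d.reconnect i j).word (.inl i) = [L] ∧ (d.reconnect i j).word (.inr j) = [L] ∧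
    (d.reconnect i j).word (.inl i') = [R] ∧ (d.reconnect i j).word (.inr j') = [R] := by
  simp [reconnect, hD.top, hD.bot, hD.lt_top.ne', hD.lt_bot.ne']

/-- No line separates any of the four ends from the sides, so every other line keeps both its ends
within one of the gaps between these ends. -/
theorem IsDouble.nonCross_reconnect (h : d.IsLRBlob) (hD : d.IsDouble i i' j j') :
    (d.reconnect i j).NonCross posL := by
  have hd := h.isMatching
  have hm := hD.isMatching_reconnect hd
  have hl := hD.lt_top
  have hl' := hD.lt_bot
  have old : ∀ x, (x ≠ Sum.inl i ∧ x ≠ Sum.inr j ∧ x ≠ Sum.inl i' ∧ x ≠ Sum.inr j') →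
      posL x ≠ posL (Sum.inl i : Pt n) ∧ posL x ≠ posL (Sum.inr j : Pt n) ∧
      posL x ≠ posL (Sum.inl i' : Pt n) ∧ posL x ≠ posL (Sum.inr j' : Pt n) :=
    fun x hx => ⟨posL_injective.ne hx.1, posL_injective.ne hx.2.1, posL_injective.ne hx.2.2.1,
      posL_injective.ne hx.2.2.2⟩
  obtain ⟨p1, p2, p3, p4⟩ := hD.reconnect_partner
  have hA : ∀ u, u ≠ .inl i → u ≠ .inr j → ((d.reconnect i j).Btw posL (.inl i) u ↔
      (d.reconnect i j).Btw posL (.inl i) ((d.reconnect i j).partner u)) := by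
    intro u h1 h2
    rcases hD.reconnect_cases u with hu | hu | hu | hu | hu
    · exact absurd hu.1 h1
    · exact absurd hu.1 h2
    · rw [hu.2.1, hu.1]
      simp only [Btw, p1, posL_inl, posL_inr]
      clear old
      omega
    · rw [hu.2.1, hu.1]
      simp only [Btw, p1, posL_inl, posL_inr]
      clear old
      omega
    · obtain ⟨⟨b1, b2, b3, b4⟩, -⟩ := hD.not_btw h u
      have o1 := old u hu.1
      have o2 := old _ (hD.partner_ne hd hu.1)
      rw [hu.2.1]
      simp only [Btw, p1] at b1 b3 ⊢
      clear old
      omega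
  have hB : ∀ u, u ≠ .inl i' → u ≠ .inr j' → ((d.reconnect i j).Btw posL (.inl i') u ↔
      (d.reconnect i j).Btw posL (.inl i') ((d.reconnect i j).partner u)) := by
    intro u h1 h2
    rcases hD.reconnect_cases u with hu | hu | hu | hu | hu
    · rw [hu.2.1, hu.1]
      simp only [Btw, p3, posL_inl, posL_inr]
      clear old
      omega
    · rw [hu.2.1, hu.1]
      simp only [Btw, p3, posL_inl, posL_inr]
      clear old
      omega
    · exact absurd hu.1 h1
    · exact absurd hu.1 h2
    · obtain ⟨⟨b1, b2, b3, b4⟩, -⟩ := hD.not_btw h u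
      have o1 := old u hu.1
      have o2 := old _ (hD.partner_ne hd hu.1)
      rw [hu.2.1]
      simp only [Btw, p3] at b2 b4 ⊢
      clear old
      omega
  intro y u h1 h2
  rcases hD.reconnect_cases y with hy | hy | hy | hy | hy
  · rw [hy.2.1] at h2
    rw [hy.1] at h1 ⊢
    exact hA u h1 h2
  · rw [hy.2.1] at h2
    rw [hy.1] at h1 ⊢
    rw [← p1, btw_partner hm, btw_partner hm]
    exact hA u h2 h1
  · rw [hy.2.1] at h2
    rw [hy.1] at h1 ⊢
    exact hB u h1 h2
  · rw [hy.2.1] at h2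
    rw [hy.1] at h1 ⊢
    rw [← p3, btw_partner hm, btw_partner hm]
    exact hB u h2 h1
  · have hb : ∀ v, (d.reconnect i j).Btw posL y v ↔ d.Btw posL y v := fun v => by
      simp only [Btw, hy.2.1]
    obtain ⟨⟨b1, b2, b3, b4⟩, -⟩ := hD.not_btw h y
    rw [hb, hb]
    rcases hD.reconnect_cases u with hu | hu | hu | hu | hu
    · rw [hu.2.1, hu.1]; tauto
    · rw [hu.2.1, hu.1]; tauto
    · rw [hu.2.1, hu.1]; tauto
    · rw [hu.2.1, hu.1]; tauto
    · rw [hy.2.1] at h2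
      rw [hu.2.1]
      exact h.nonCross y u h1 h2

/-- There are no propagating lines, so the line at `a` has both ends at the top. Inside the line
with both blobs it would be hidden, around it would hide that line, and to the right of it a left
blob would come after a right blob. -/
theorem IsDouble.top_left (h : d.IsLRBlob) (hD : d.IsDouble i i' j j') {a : Fin n}
    (ha : L ∈ d.word (.inl a)) (h1 : a ≠ i) (h2 : a ≠ i') : a < i := by
  have hd := h.isMatching
  have hl := hD.lt_top
  have key : ∀ c, L ∈ d.word (.inl c) → ¬ (i < c ∧ c < i') := fun c hc hlt =>
    h.not_btwL hc (.inl i) (by simp only [Btw, hD.top, posL_inl]; omega)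
  obtain ⟨b, hb⟩ : ∃ b, d.partner (.inl a) = .inl b := by
    rcases hb : d.partner (.inl a) with b | b
    · exact ⟨b, rfl⟩
    · exact (hD.not_propagating h hb).elim
  have hLb : L ∈ d.word (.inl b) := by rwa [← hb, hd.word_partner, List.mem_reverse]
  have hb' := hd.partner_eq_iff.1 hb
  have ne1 : b ≠ i := by rintro rfl; rw [hD.top] at hb'; simp at hb'; omega
  have ne2 : b ≠ i' := by rintro rfl; rw [hD.top'] at hb'; simp at hb'; omega
  have k1 := key a ha
  have k2 := key b hLb
  by_contra hlt
  rcases lt_or_gt_of_ne ne1 with hbi | hbi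
  · refine h.not_btwL (x := .inl i) (by simp [hD.word_top]) (.inl a) ?_
    simp only [Btw, hb, posL_inl]; omega
  · have hR : R ∈ d.word (.inl i) := by simp [hD.word_top]
    have hab : a ≠ b := by rintro rfl; exact hd.ne_self _ hb
    rcases lt_or_gt_of_ne hab with hab | hab
    · exact h.ordered_top.two_lines i i' a b hD.top hb hl (by omega) hab ⟨hR, ha⟩
    · exact h.ordered_top.two_lines i i' b a hD.top hb' hl (by omega) hab ⟨hR, hLb⟩

theorem IsDouble.top_right (h : d.IsLRBlob) (hD : d.IsDouble i i' j j') {a : Fin n}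
    (ha : R ∈ d.word (.inl a)) (h1 : a ≠ i) (h2 : a ≠ i') : i' < a := by
  have hd := h.isMatching
  have hl := hD.lt_top
  have key : ∀ c, R ∈ d.word (.inl c) → ¬ (i < c ∧ c < i') := fun c hc hlt =>
    h.not_btwR hc (.inl i) (by simp only [Btw, hD.top, posR_inl]; omega)
  obtain ⟨b, hb⟩ : ∃ b, d.partner (.inl a) = .inl b := by
    rcases hb : d.partner (.inl a) with b | b
    · exact ⟨b, rfl⟩
    · exact (hD.not_propagating h hb).elim
  have hLb : R ∈ d.word (.inl b) := by rwa [← hb, hd.word_partner, List.mem_reverse]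
  have hb' := hd.partner_eq_iff.1 hb
  have ne1 : b ≠ i := by rintro rfl; rw [hD.top] at hb'; simp at hb'; omega
  have ne2 : b ≠ i' := by rintro rfl; rw [hD.top'] at hb'; simp at hb'; omega
  have k1 := key a ha
  have k2 := key b hLb
  by_contra hlt
  rcases lt_or_gt_of_ne ne2 with hbi | hbi
  · have hL : L ∈ d.word (.inl i) := by simp [hD.word_top]
    have hab : a ≠ b := by rintro rfl; exact hd.ne_self _ hb
    rcases lt_or_gt_of_ne hab with hab | hab
    · exact h.ordered_top.two_lines a b i i' hb hD.top hab (by omega) hl ⟨ha, hL⟩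
    · exact h.ordered_top.two_lines b a i i' hb' hD.top hab (by omega) hl ⟨hLb, hL⟩
  · refine h.not_btwR (x := .inl i') (by simp [hD.word_top']) (.inl a) ?_
    simp only [Btw, hb, posR_inl]; omega

theorem IsDouble.bot_left (h : d.IsLRBlob) (hD : d.IsDouble i i' j j') {a : Fin n}
    (ha : L ∈ d.word (.inr a)) (h1 : a ≠ j) (h2 : a ≠ j') : a < j := by
  have hd := h.isMatching
  have hl := hD.lt_bot
  have key : ∀ c, L ∈ d.word (.inr c) → ¬ (j < c ∧ c < j') := fun c hc hlt =>
    h.not_btwL hc (.inr j) (by simp only [Btw, hD.bot, posL_inr]; omega)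
  obtain ⟨b, hb⟩ : ∃ b, d.partner (.inr a) = .inr b := by
    rcases hb : d.partner (.inr a) with b | b
    · exact (hD.not_propagating' h hb).elim
    · exact ⟨b, rfl⟩
  have hLb : L ∈ d.word (.inr b) := by rwa [← hb, hd.word_partner, List.mem_reverse]
  have hb' := hd.partner_eq_iff.1 hb
  have ne1 : b ≠ j := by rintro rfl; rw [hD.bot] at hb'; simp at hb'; omega
  have ne2 : b ≠ j' := by rintro rfl; rw [hD.bot'] at hb'; simp at hb'; omega
  have k1 := key a ha
  have k2 := key b hLb
  by_contra hlt
  rcases lt_or_gt_of_ne ne1 with hbi | hbi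
  · refine h.not_btwL (x := .inr j) (by simp [hD.word_bot]) (.inr a) ?_
    simp only [Btw, hb, posL_inr]; omega
  · have hR : R ∈ d.word (.inr j) := by simp [hD.word_bot]
    have hab : a ≠ b := by rintro rfl; exact hd.ne_self _ hb
    rcases lt_or_gt_of_ne hab with hab | hab
    · exact h.ordered_bot.two_lines j j' a b hD.bot hb hl (by omega) hab ⟨hR, ha⟩
    · exact h.ordered_bot.two_lines j j' b a hD.bot hb' hl (by omega) hab ⟨hR, hLb⟩

theorem IsDouble.bot_right (h : d.IsLRBlob) (hD : d.IsDouble i i' j j') {a : Fin n}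
    (ha : R ∈ d.word (.inr a)) (h1 : a ≠ j) (h2 : a ≠ j') : j' < a := by
  have hd := h.isMatching
  have hl := hD.lt_bot
  have key : ∀ c, R ∈ d.word (.inr c) → ¬ (j < c ∧ c < j') := fun c hc hlt =>
    h.not_btwR hc (.inr j) (by simp only [Btw, hD.bot, posR_inr]; omega)
  obtain ⟨b, hb⟩ : ∃ b, d.partner (.inr a) = .inr b := by
    rcases hb : d.partner (.inr a) with b | b
    · exact (hD.not_propagating' h hb).elim
    · exact ⟨b, rfl⟩
  have hLb : R ∈ d.word (.inr b) := by rwa [← hb, hd.word_partner, List.mem_reverse]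
  have hb' := hd.partner_eq_iff.1 hb
  have ne1 : b ≠ j := by rintro rfl; rw [hD.bot] at hb'; simp at hb'; omega
  have ne2 : b ≠ j' := by rintro rfl; rw [hD.bot'] at hb'; simp at hb'; omega
  have k1 := key a ha
  have k2 := key b hLb
  by_contra hlt
  rcases lt_or_gt_of_ne ne2 with hbi | hbi
  · have hL : L ∈ d.word (.inr j) := by simp [hD.word_bot]
    have hab : a ≠ b := by rintro rfl; exact hd.ne_self _ hb
    rcases lt_or_gt_of_ne hab with hab | hab
    · exact h.ordered_bot.two_lines a b j j' hb hD.bot hab (by omega) hl ⟨ha, hL⟩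
    · exact h.ordered_bot.two_lines b a j j' hb' hD.bot hab (by omega) hl ⟨hLb, hL⟩
  · refine h.not_btwR (x := .inr j') (by simp [hD.word_bot']) (.inr a) ?_
    simp only [Btw, hb, posR_inr]; omega

theorem IsDouble.isLRBlob_reconnect (h : d.IsLRBlob) (hD : d.IsDouble i i' j j') :
    (d.reconnect i j).IsLRBlob := by
  have hd := h.isMatching
  have hm := hD.isMatching_reconnect hd
  have hnc := hD.nonCross_reconnect h
  have hl := hD.lt_top
  have hl' := hD.lt_bot
  obtain ⟨p1, p2, p3, p4⟩ := hD.reconnect_partner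
  obtain ⟨w1, w2, w3, w4⟩ := hD.reconnect_word
  -- Left blobs lie at or beyond the new left line, and below right blobs at or beyond the new right
  -- line. Hence the new lines hide none of them.
  have pL : ∀ x, L ∈ (d.reconnect i j).word x → posL x ≤ i ∨ posL (.inr j : Pt n) ≤ posL x := by
    intro x hx
    rcases hD.reconnect_cases x with hu | hu | hu | hu | hu
    · rw [hu.1]; exact .inl le_rfl
    · rw [hu.1]; exact .inr le_rfl
    · simp [hu.2.2] at hx
    · simp [hu.2.2] at hx
    · rw [hu.2.2] at hx
      rcases x with a | a
      · have := hD.top_left h hx (by rintro rfl; exact hu.1.1 rfl)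
          (by rintro rfl; exact hu.1.2.2.1 rfl)
        exact .inl (by rw [posL_inl]; omega)
      · have := hD.bot_left h hx (by rintro rfl; exact hu.1.2.1 rfl)
          (by rintro rfl; exact hu.1.2.2.2 rfl)
        exact .inr (by simp only [posL_inr]; omega)
  have pR : ∀ x, R ∈ (d.reconnect i j).word x →
      posR x ≤ posR (.inr j' : Pt n) ∨ posR (.inl i' : Pt n) ≤ posR x := by
    intro x hx
    rcases hD.reconnect_cases x with hu | hu | hu | hu | hu
    · simp [hu.2.2] at hx
    · simp [hu.2.2] at hx
    · rw [hu.1]; exact .inr le_rfl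
    · rw [hu.1]; exact .inl le_rfl
    · rw [hu.2.2] at hx
      rcases x with a | a
      · have := hD.top_right h hx (by rintro rfl; exact hu.1.1 rfl)
          (by rintro rfl; exact hu.1.2.2.1 rfl)
        exact .inr (by simp only [posR_inl]; omega)
      · have := hD.bot_right h hx (by rintro rfl; exact hu.1.2.1 rfl)
          (by rintro rfl; exact hu.1.2.2.2 rfl)
        exact .inl (by simp only [posR_inr]; omega)
  have exL : ∀ x, L ∈ (d.reconnect i j).word x → ∀ y, ¬ (d.reconnect i j).Btw posL y x := by
    intro x hx y
    have hp := pL x hx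
    rcases hD.reconnect_cases y with hy | hy | hy | hy | hy
    iterate 4
      rw [Btw, hy.2.1, hy.1]
      simp only [posL_inl, posL_inr] at hp ⊢
      omega
    · have hb : ∀ v, (d.reconnect i j).Btw posL y v ↔ d.Btw posL y v := fun v => by
        simp only [Btw, hy.2.1]
      rw [hb]
      obtain ⟨⟨b1, b2, b3, b4⟩, -⟩ := hD.not_btw h y
      rcases hD.reconnect_cases x with hu | hu | hu | hu | hu
      · rw [hu.1]; exact b1
      · rw [hu.1]; exact b3
      · rw [hu.1]; exact b2
      · rw [hu.1]; exact b4
      · rw [hu.2.2] at hx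
        exact h.not_btwL hx y
  have exR : ∀ x, R ∈ (d.reconnect i j).word x → ∀ y, ¬ (d.reconnect i j).Btw posR y x := by
    intro x hx y
    have hp := pR x hx
    rcases hD.reconnect_cases y with hy | hy | hy | hy | hy
    iterate 4
      rw [Btw, hy.2.1, hy.1]
      simp only [posR_inl, posR_inr] at hp ⊢
      omega
    · have hb : ∀ v, (d.reconnect i j).Btw posR y v ↔ d.Btw posR y v := fun v => by
        simp only [Btw, hy.2.1]
      rw [hb]
      obtain ⟨-, b1, b2, b3, b4⟩ := hD.not_btw h y
      rcases hD.reconnect_cases x with hu | hu | hu | hu | hu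
      · rw [hu.1]; exact b1
      · rw [hu.1]; exact b3
      · rw [hu.1]; exact b2
      · rw [hu.1]; exact b4
      · rw [hu.2.2] at hx
        exact h.not_btwR hx y
  have top : ∀ a b, (d.reconnect i j).partner (.inl a) = .inl b →
      d.partner (.inl a) = .inl b ∧ (d.reconnect i j).word (.inl a) = d.word (.inl a) := by
    intro a b hab
    rcases hD.reconnect_cases (.inl a) with hu | hu | hu | hu | hu
    · rw [hu.2.1] at hab; simp at hab
    · simp at hu
    · rw [hu.2.1] at hab; simp at hab
    · simp at hu
    · rw [hu.2.1] at hab; exact ⟨hab, hu.2.2⟩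
  have bot : ∀ a b, (d.reconnect i j).partner (.inr a) = .inr b →
      d.partner (.inr a) = .inr b ∧ (d.reconnect i j).word (.inr a) = d.word (.inr a) := by
    intro a b hab
    rcases hD.reconnect_cases (.inr a) with hu | hu | hu | hu | hu
    · simp at hu
    · rw [hu.2.1] at hab; simp at hab
    · simp at hu
    · rw [hu.2.1] at hab; simp at hab
    · rw [hu.2.1] at hab; exact ⟨hab, hu.2.2⟩
  refine { isTL_iff.2 ⟨hm, hnc⟩ with
    exposedL := fun x hx => (exposed_iff hm hnc).2 (exL x hx)
    exposedR := fun x hx => (exposed_iff hm (hnc.posR hm)).2 (exR x hx)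
    ordered_top := ⟨?_, ?_⟩, ordered_bot := ⟨?_, ?_⟩ }
  · intro a b hab hlt
    rw [(top a b hab).2]
    exact h.ordered_top.same_line a b (top a b hab).1 hlt
  · intro a b a' b' hab hab' h1 h2 h3
    rw [(top a b hab).2, (top a' b' hab').2]
    exact h.ordered_top.two_lines a b a' b' (top a b hab).1 (top a' b' hab').1 h1 h2 h3
  · intro a b hab hlt
    rw [(bot a b hab).2]
    exact h.ordered_bot.same_line a b (bot a b hab).1 hlt
  · intro a b a' b' hab hab' h1 h2 h3
    rw [(bot a b hab).2, (bot a' b' hab').2]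
    exact h.ordered_bot.two_lines a b a' b' (bot a b hab).1 (bot a' b' hab').1 h1 h2 h3

/-- There was only one line with both blobs at the top, so a single application of the topological
relation suffices. -/
theorem IsDouble.not_doubleAt_reconnect (h : d.IsLRBlob) (hD : d.IsDouble i i' j j') (a : Fin n) :
    ¬ (d.reconnect i j).DoubleAt Sum.inl a := by
  rintro ⟨⟨b, hb⟩, hw⟩
  rcases hD.reconnect_cases (.inl a) with hu | hu | hu | hu | hu
  · simp [hu.2.2] at hw
  · simp at hu
  · simp [hu.2.2] at hw
  · simp at hu
  · rw [hu.2.1] at hb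
    rw [hu.2.2] at hw
    have := h.double_top_unique ⟨⟨b, hb⟩, hw⟩ hD.doubleAt_top
    exact hu.1.1 (by rw [this])

/-! ### Reduction of a pseudo-diagram to a diagram in the basis -/

variable {k : Type*} [Field k] (q : Params k)

/-- Either the topological relation does not apply, or it does at a unique place. -/
theorem IsLRBlob.topological_cases (h : d.IsLRBlob) :
    (¬ ((∃ i, d.DoubleAt Sum.inl i) ∧ ∃ i, d.DoubleAt Sum.inr i) ∧ topological q d = (1, d)) ∨
    ∃ i i' j j', d.IsDouble i i' j j' ∧ topological q d = (q.κLR, d.reconnect i j) := by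
  rcases hi : (List.finRange n).find? (fun i => d.DoubleAt Sum.inl i) with _ | i
  · left
    refine ⟨fun ⟨⟨i, h1⟩, _⟩ => ?_, by simp [topological, hi]⟩
    rw [List.find?_eq_none] at hi
    simpa [h1] using hi i (List.mem_finRange i)
  · rcases hj : (List.finRange n).find? (fun i => d.DoubleAt Sum.inr i) with _ | j
    · left
      refine ⟨fun ⟨_, ⟨j, h1⟩⟩ => ?_, by simp [topological, hi, hj]⟩
      rw [List.find?_eq_none] at hj
      simpa [h1] using hj j (List.mem_finRange j)
    · right
      obtain ⟨i', j', hD⟩ := h.isDouble (by simpa using List.find?_some hi)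
        (by simpa using List.find?_some hj)
      exact ⟨i, i', j, j', hD, by simp [topological, hi, hj]⟩

theorem IsDouble.topological_eq (h : d.IsLRBlob) (hD : d.IsDouble i i' j j') :
    topological q d = (q.κLR, d.reconnect i j) := by
  rcases h.topological_cases q with hc | ⟨a, a', b, b', hD', hc⟩
  · exact absurd ⟨⟨i, hD.doubleAt_top⟩, ⟨j, hD.doubleAt_bot⟩⟩ hc.1
  · rw [hc, h.double_top_unique hD.doubleAt_top hD'.doubleAt_top,
      h.double_bot_unique hD.doubleAt_bot hD'.doubleAt_bot]

theorem topological_of_not (h : d.IsLRBlob)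
    (hD : ¬ ((∃ i, d.DoubleAt Sum.inl i) ∧ ∃ i, d.DoubleAt Sum.inr i)) :
    topological q d = (1, d) := by
  rcases h.topological_cases q with hc | ⟨a, a', b, b', hD', hc⟩
  · exact hc.2
  · exact absurd ⟨⟨a, hD'.doubleAt_top⟩, ⟨b, hD'.doubleAt_bot⟩⟩ hD

/-- The diagram to which a pseudo-diagram straightens. -/
def red (d : PreDiagram n) : PreDiagram n := (topological q (straightenLines q d)).2

/-- The scalar with which a pseudo-diagram straightens. -/
def redScalar (d : PreDiagram n) : k :=
  lineScalar q d * (topological q (straightenLines q d)).1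

/-- All words are straight. -/
def Normal (d : PreDiagram n) : Prop := ∀ x, IsNormal (d.word x)

theorem normal_straightenLines : (straightenLines q d).Normal := fun x =>
  isNormal_straightenWord q (d.word x)

theorem Normal.straightenLines_eq (h : d.Normal) : straightenLines q d = d := by
  ext1
  · rfl
  · funext x
    change (straightenWord q (d.word x)).2 = _
    rw [(h x).straightenWord_eq]

theorem Normal.lineScalar_eq (h : d.Normal) : lineScalar q d = 1 :=
  Finset.prod_eq_one fun x _ => by rw [(h x).straightenWord_eq]

theorem IsDouble.normal_reconnect (hD : d.IsDouble i i' j j') (h : d.Normal) :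
    (d.reconnect i j).Normal := by
  intro x
  rcases hD.reconnect_cases x with hu | hu | hu | hu | hu
  iterate 4 rw [hu.2.2]; simp [IsNormal]
  · rw [hu.2.2]; exact h x

theorem memB_iff : d.MemB ↔ d.IsLRBlob ∧ d.Normal ∧
    ¬ ((∃ i, d.DoubleAt Sum.inl i) ∧ ∃ i, d.DoubleAt Sum.inr i) := by
  constructor
  · exact fun h => ⟨h.toIsLRBlob, fun x => isNormal_iff.2
      ⟨h.no_LL x, h.no_RR x, h.no_LRL x, h.no_RLR x⟩, h.no_double⟩
  · rintro ⟨h1, h2, h3⟩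
    have h4 := fun x => isNormal_iff.1 (h2 x)
    exact { h1 with
      no_LL := fun x => (h4 x).1, no_RR := fun x => (h4 x).2.1, no_LRL := fun x => (h4 x).2.2.1
      no_RLR := fun x => (h4 x).2.2.2, no_double := h3 }

theorem IsLRBlob.memB_topological (h : d.IsLRBlob) (hn : d.Normal) :
    (topological q d).2.MemB := by
  rcases h.topological_cases q with hc | ⟨i, i', j, j', hD, hc⟩
  · rw [hc.2]; exact memB_iff.2 ⟨h, hn, hc.1⟩
  · rw [hc]
    exact memB_iff.2 ⟨hD.isLRBlob_reconnect h, hD.normal_reconnect hn,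
      fun hh => hh.1.elim (hD.not_doubleAt_reconnect h)⟩

theorem IsLRBlob.memB_red (h : d.IsLRBlob) : (red q d).MemB :=
  (h.straightenLines q).memB_topological q (normal_straightenLines q)

theorem MemB.red_eq (h : d.MemB) : red q d = d := by
  obtain ⟨h1, h2, h3⟩ := memB_iff.1 h
  rw [red, h2.straightenLines_eq, topological_of_not q h1 h3]

theorem MemB.redScalar_eq (h : d.MemB) : redScalar q d = 1 := by
  obtain ⟨h1, h2, h3⟩ := memB_iff.1 h
  rw [redScalar, h2.straightenLines_eq, topological_of_not q h1 h3, h2.lineScalar_eq, mul_one]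

end

end PreDiagram

end SympBlob

namespace SympBlob

open Blob

namespace PreDiagram

variable {n : ℕ}

/-! ### Straightening of the lines is compatible with right multiplication -/

section

variable {d : PreDiagram n} {k : Type*} [Field k] (q : Params k)

/-- The scalar produced by straightening the words on the lines outside `F`. -/
def restScalar (d : PreDiagram n) (F : Finset (Pt n)) : k :=
  ∏ x with posL x < posL (d.partner x) ∧ x ∉ F, (straightenWord q (d.word x)).1

theorem restScalar_empty : restScalar q d ∅ = lineScalar q d := by
  simp [restScalar, lineScalar]

/-- Peels off one line, named by either of its ends; `F` collects the ends of the lines already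
peeled off. -/
theorem restScalar_split (hd : d.IsMatching) {F : Finset (Pt n)} {x : Pt n} (h1 : x ∉ F)
    (h2 : d.partner x ∉ F) : restScalar q d F =
      (straightenWord q (d.word x)).1 * restScalar q d (insert x (insert (d.partner x) F)) := by
  have key : ∀ x, x ∉ F → d.partner x ∉ F → posL x < posL (d.partner x) → restScalar q d F =
      (straightenWord q (d.word x)).1 * restScalar q d (insert x (insert (d.partner x) F)) := by
    intro x h1 h2 hlt
    unfold restScalar
    rw [← Finset.mul_prod_erase (a := x) _ _ (by simp [h1, hlt])]
    congr 1
    refine Finset.prod_congr ?_ fun _ _ => rfl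
    ext y
    simp only [Finset.mem_erase, Finset.mem_filter, Finset.mem_univ, true_and, Finset.mem_insert,
      not_or]
    refine ⟨fun h => ⟨h.2.1, h.1, ?_, h.2.2⟩, fun h => ⟨h.2.1, h.1, h.2.2.2⟩⟩
    rintro rfl
    rw [hd.invol] at h
    omega
  rcases lt_trichotomy (posL x) (posL (d.partner x)) with hlt | he | hlt
  · exact key x h1 h2 hlt
  · exact absurd (posL_injective he).symm (hd.ne_self x)
  · rw [key (d.partner x) h2 (by rwa [hd.invol]) (by rwa [hd.invol]), hd.invol, hd.word_partner,
      straightenWord_reverse, Finset.insert_comm]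

theorem restScalar_congr {d' : PreDiagram n} {F : Finset (Pt n)}
    (h : ∀ x ∉ F, d.partner x = d'.partner x ∧ d.word x = d'.word x) :
    restScalar q d F = restScalar q d' F := by
  unfold restScalar
  refine Finset.prod_congr ?_ fun x hx => ?_
  · ext x
    simp only [Finset.mem_filter, Finset.mem_univ, true_and]
    refine ⟨fun hx => ?_, fun hx => ?_⟩
    · rw [← (h x hx.2).1]; exact hx
    · rw [(h x hx.2).1]; exact hx
  · rw [(h x (Finset.mem_filter.1 hx).2.2).2]

theorem restScalar_eq_one {F : Finset (Pt n)} (h : ∀ x ∉ F, IsNormal (d.word x)) :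
    restScalar q d F = 1 :=
  Finset.prod_eq_one fun x hx => by
    rw [(h x (Finset.mem_filter.1 hx).2.2).straightenWord_eq]

theorem lineScalar_split (hd : d.IsMatching) (x : Pt n) :
    lineScalar q d = (straightenWord q (d.word x)).1 * restScalar q d {x, d.partner x} := by
  rw [← restScalar_empty, restScalar_split q hd (x := x) (by simp) (by simp)]; rfl

theorem addBlob_word_left (α : Pt n) (g : Blob) : (d.addBlob α g).word α = g :: d.word α := by
  simp [addBlob]

theorem addBlob_word_of_ne {α x : Pt n} (g : Blob) (h1 : x ≠ α) (h2 : x ≠ d.partner α) :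
    (d.addBlob α g).word x = d.word x := by
  simp [addBlob, h1, h2]

theorem lineScalar_addBlob (hd : d.IsMatching) (α : Pt n) (g : Blob) :
    lineScalar q (d.addBlob α g) =
      (straightenWord q (g :: d.word α)).1 * restScalar q d {α, d.partner α} := by
  rw [lineScalar_split q (hd.addBlob α g) α, addBlob_word_left]
  congr 1
  refine restScalar_congr q fun x hx => ⟨rfl, ?_⟩
  simp only [Finset.mem_insert, Finset.mem_singleton, not_or] at hx
  exact addBlob_word_of_ne g hx.1 hx.2

theorem lineScalar_join_of_eq (hd : d.IsMatching) {α β : Pt n} (h : d.partner α = β) :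
    lineScalar q (d.join α β) = restScalar q d {α, β} := by
  have hne : α ≠ β := by rintro rfl; exact hd.ne_self _ h
  rw [lineScalar_split q (hd.join hne) α, join_word_left, join_partner_left]
  simp only [straightenWord, one_mul]
  refine restScalar_congr q fun x hx => ?_
  simp only [Finset.mem_insert, Finset.mem_singleton, not_or] at hx
  have h' := hd.partner_eq_iff.1 h
  exact ⟨join_partner_of_ne hx.1 hx.2 (h ▸ hx.2) (h' ▸ hx.1),
    join_word_of_ne hx.1 hx.2 (h ▸ hx.2) (h' ▸ hx.1)⟩

theorem lineScalar_join_of_ne (hd : d.IsMatching) {α β : Pt n} (hne : α ≠ β)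
    (h : d.partner α ≠ β) :
    lineScalar q (d.join α β) = (straightenWord q (d.word (d.partner α) ++ d.word β)).1 *
      restScalar q d {d.partner α, d.partner β, α, β} := by
  have hm := hd.join hne
  have h1 : d.partner β ≠ α := fun e => h (hd.partner_eq_iff.1 e)
  rw [lineScalar_split q hm α, join_word_left, join_partner_left,
    restScalar_split q hm (x := d.partner α) (by simp [hd.ne_self, h])
    (by rw [join_partner_of_left (hd.ne_self _) h]; simp [hd.ne_self, h1]),
    join_partner_of_left (hd.ne_self _) h, join_word_of_left (hd.ne_self _) h]
  simp only [straightenWord, one_mul]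
  congr 1
  refine restScalar_congr q fun x hx => ?_
  simp only [Finset.mem_insert, Finset.mem_singleton, not_or] at hx
  exact ⟨join_partner_of_ne hx.2.2.1 hx.2.2.2 hx.1 hx.2.1,
    join_word_of_ne hx.2.2.1 hx.2.2.2 hx.1 hx.2.1⟩

theorem lineScalar_split_two (hd : d.IsMatching) {α β : Pt n} (hne : α ≠ β)
    (h : d.partner α ≠ β) :
    lineScalar q d = (straightenWord q (d.word (d.partner α))).1 *
      (straightenWord q (d.word β)).1 * restScalar q d {d.partner α, d.partner β, α, β} := by
  have h1 : d.partner β ≠ α := fun e => h (hd.partner_eq_iff.1 e)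
  rw [lineScalar_split q hd (d.partner α), hd.invol, restScalar_split q hd (x := β)
    (by simp [hne.symm, h.symm]) (by simp [h1, hd.partner_inj, hne.symm]), mul_assoc]
  congr 3
  ext x
  simp only [Finset.mem_insert, Finset.mem_singleton]
  tauto

theorem straightenLines_partner (d : PreDiagram n) (x : Pt n) :
    (straightenLines q d).partner x = d.partner x := rfl

theorem straightenLines_word (d : PreDiagram n) (x : Pt n) :
    (straightenLines q d).word x = (straightenWord q (d.word x)).2 := rfl

theorem straightenLines_addBlob (α : Pt n) (g : Blob) :
    straightenLines q ((straightenLines q d).addBlob α g) = straightenLines q (d.addBlob α g) := by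
  ext1
  · rfl
  · funext x
    change (straightenWord q (if x = α then g :: (straightenWord q (d.word α)).2
      else if x = d.partner α then (straightenWord q (d.word x)).2 ++ [g]
      else (straightenWord q (d.word x)).2)).2 = (straightenWord q (if x = α then g :: d.word α
      else if x = d.partner α then d.word x ++ [g] else d.word x)).2
    split_ifs
    · exact (congrArg Prod.snd (straightenWord_append_snd q [g] (d.word α))).symm
    · exact (congrArg Prod.snd (straightenWord_append_fst q (d.word x) [g])).symm
    · rw [(isNormal_straightenWord q _).straightenWord_eq]

theorem straightenLines_join (α β : Pt n) :
    straightenLines q ((straightenLines q d).join α β) = straightenLines q (d.join α β) := by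
  ext1
  · rfl
  · funext x
    change (straightenWord q (if x = α ∨ x = β then []
      else if x = d.partner α then (straightenWord q (d.word x)).2 ++ (straightenWord q (d.word β)).2
      else if x = d.partner β then (straightenWord q (d.word x)).2 ++ (straightenWord q (d.word α)).2
      else (straightenWord q (d.word x)).2)).2 = (straightenWord q (if x = α ∨ x = β then []
      else if x = d.partner α then d.word x ++ d.word β
      else if x = d.partner β then d.word x ++ d.word α else d.word x)).2
    split_ifs
    · rfl
    · exact (congrArg Prod.snd (straightenWord_append q (d.word x) (d.word β))).symm
    · exact (congrArg Prod.snd (straightenWord_append q (d.word x) (d.word α))).symm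
    · rw [(isNormal_straightenWord q _).straightenWord_eq]

theorem lineScalar_addBlob_straightenLines (hd : d.IsMatching) (α : Pt n) (g : Blob) :
    lineScalar q (d.addBlob α g) =
      lineScalar q d * lineScalar q ((straightenLines q d).addBlob α g) := by
  rw [lineScalar_addBlob q hd, lineScalar_addBlob q (hd.straightenLines q),
    lineScalar_split q hd α, restScalar_eq_one q (fun x _ => normal_straightenLines q x),
    straightenLines_word, mul_one]
  have := congrArg Prod.fst (straightenWord_append_snd q [g] (d.word α))
  simp only [List.cons_append, List.nil_append] at this
  rw [this]
  ring

/-- If the join closes a loop, the word on it must be sorted for `loopWeight_straightenWord`;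
`IsLRBlob` guarantees this for caps at the bottom. -/
theorem lineScalar_join_straightenLines (hd : d.IsMatching) {α β : Pt n} (hne : α ≠ β)
    (hs : d.partner α = β → ¬ [R, L].Sublist (d.word α)) :
    joinWeight q d α β * lineScalar q (d.join α β) = lineScalar q d *
      (joinWeight q (straightenLines q d) α β *
        lineScalar q ((straightenLines q d).join α β)) := by
  have hsd := hd.straightenLines q
  by_cases h : d.partner α = β
  · rw [joinWeight, joinWeight, straightenLines_partner, if_pos h, if_pos h,
      lineScalar_join_of_eq q hd h, lineScalar_join_of_eq q hsd h, lineScalar_split q hd α,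
      restScalar_eq_one q (fun x _ => normal_straightenLines q x), straightenLines_word,
      loopWeight_straightenWord q (hs h), h]
    ring
  · rw [joinWeight, joinWeight, straightenLines_partner, if_neg h, if_neg h,
      lineScalar_join_of_ne q hd hne h, lineScalar_join_of_ne q hsd hne h,
      lineScalar_split_two q hd hne h,
      restScalar_eq_one q (fun x _ => normal_straightenLines q x)]
    simp only [straightenLines_word, straightenLines_partner]
    rw [congrArg Prod.fst (straightenWord_append q (d.word (d.partner α)) (d.word β))]
    ring

variable [NeZero n]

/-- Describes the three kinds of generators together with their loop weights, so that proofs by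
cases need not unfold `ract` and `rweight` separately. -/
theorem ract_cases (i : Fin (n + 1)) :
    (i = 0 ∧ (∀ d : PreDiagram n, d.ract i = d.addBlob (.inr 0) L) ∧
      ∀ d : PreDiagram n, rweight q d i = 1) ∨
    (i = Fin.last n ∧ (∀ d : PreDiagram n, d.ract i = d.addBlob (.inr (Fin.rev 0)) R) ∧
      ∀ d : PreDiagram n, rweight q d i = 1) ∨
    ∃ a b : Fin n, ((a : ℕ) + 1 = i ∧ (b : ℕ) = i) ∧
      (∀ d : PreDiagram n, d.ract i = d.join (.inr a) (.inr b)) ∧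
      ∀ d : PreDiagram n, rweight q d i = joinWeight q d (.inr a) (.inr b) := by
  unfold ract rweight
  by_cases h1 : i = 0
  · simp [h1]
  · have h0 : (i : ℕ) ≠ 0 := fun e => h1 (Fin.ext e)
    by_cases h2 : (i : ℕ) < n
    · exact .inr (.inr ⟨⟨i - 1, by omega⟩, ⟨i, h2⟩, ⟨by simp; omega, rfl⟩, by simp [h1, h2],
        by simp [h1, h2]⟩)
    · exact .inr (.inl ⟨Fin.ext (by simp; omega), by simp [h1, h2], by simp [h1, h2]⟩)

theorem straightenLines_ract (i : Fin (n + 1)) :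
    straightenLines q ((straightenLines q d).ract i) = straightenLines q (d.ract i) := by
  rcases ract_cases q i with ⟨-, h, -⟩ | ⟨-, h, -⟩ | ⟨a, b, -, h, -⟩ <;> rw [h, h]
  · exact straightenLines_addBlob q _ _
  · exact straightenLines_addBlob q _ _
  · exact straightenLines_join q _ _

theorem lineScalar_ract (h : d.IsLRBlob) (i : Fin (n + 1)) :
    rweight q d i * lineScalar q (d.ract i) = lineScalar q d *
      (rweight q (straightenLines q d) i * lineScalar q ((straightenLines q d).ract i)) := by
  have hd := h.isMatching
  rcases ract_cases q i with ⟨-, h1, h2⟩ | ⟨-, h1, h2⟩ | ⟨a, b, hab, h1, h2⟩ <;>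
    rw [h1, h1, h2, h2]
  · rw [lineScalar_addBlob_straightenLines q hd]; ring
  · rw [lineScalar_addBlob_straightenLines q hd]; ring
  · refine lineScalar_join_straightenLines q hd (by simp [Fin.ext_iff]; omega) fun e => ?_
    exact h.ordered_bot.same_line a b e (by rw [Fin.lt_def]; omega)

end

end PreDiagram

end SympBlob

namespace SympBlob

open Blob

namespace PreDiagram

variable {n : ℕ}

/-! ### The topological relation is compatible with right multiplication -/

section

variable {d : PreDiagram n} {k : Type*} [Field k] (q : Params k) {i i' j j' : Fin n}

theorem IsDouble.eq_reconnect (hD : d.IsDouble i i' j j') {c : PreDiagram n}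
    (h1 : c.partner (.inl i) = .inr j ∧ c.word (.inl i) = [L])
    (h2 : c.partner (.inr j) = .inl i ∧ c.word (.inr j) = [L])
    (h3 : c.partner (.inl i') = .inr j' ∧ c.word (.inl i') = [R])
    (h4 : c.partner (.inr j') = .inl i' ∧ c.word (.inr j') = [R])
    (h5 : ∀ x, x ≠ .inl i → x ≠ .inr j → x ≠ .inl i' → x ≠ .inr j' →
      c.partner x = d.partner x ∧ c.word x = d.word x) : c = d.reconnect i j := by
  have key : ∀ x, c.partner x = (d.reconnect i j).partner x ∧
      c.word x = (d.reconnect i j).word x := by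
    intro x
    rcases hD.reconnect_cases x with hu | hu | hu | hu | hu
    · rw [hu.2.1, hu.2.2, hu.1]; exact h1
    · rw [hu.2.1, hu.2.2, hu.1]; exact h2
    · rw [hu.2.1, hu.2.2, hu.1]; exact h3
    · rw [hu.2.1, hu.2.2, hu.1]; exact h4
    · rw [hu.2.1, hu.2.2]; exact h5 x hu.1.1 hu.1.2.1 hu.1.2.2.1 hu.1.2.2.2
  ext1
  · funext x; exact (key x).1
  · funext x; exact (key x).2

theorem IsDouble.straightenLines (hD : d.IsDouble i i' j j') :
    (straightenLines q d).IsDouble i i' j j' where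
  lt_top := hD.lt_top
  lt_bot := hD.lt_bot
  top := hD.top
  top' := hD.top'
  bot := hD.bot
  bot' := hD.bot'
  word_top := by rw [straightenLines_word, hD.word_top, IsNormal.straightenWord_eq]; simp [IsNormal]
  word_top' := by
    rw [straightenLines_word, hD.word_top', IsNormal.straightenWord_eq]; simp [IsNormal]
  word_bot := by rw [straightenLines_word, hD.word_bot, IsNormal.straightenWord_eq]; simp [IsNormal]
  word_bot' := by
    rw [straightenLines_word, hD.word_bot', IsNormal.straightenWord_eq]; simp [IsNormal]

theorem IsDouble.straightenLines_reconnect (hD : d.IsDouble i i' j j') :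
    PreDiagram.straightenLines q (d.reconnect i j) =
      (PreDiagram.straightenLines q d).reconnect i j := by
  obtain ⟨p1, p2, p3, p4⟩ := hD.reconnect_partner
  obtain ⟨w1, w2, w3, w4⟩ := hD.reconnect_word
  have hL : (straightenWord q [L]).2 = [L] := rfl
  have hR : (straightenWord q [R]).2 = [R] := rfl
  refine (hD.straightenLines q).eq_reconnect ?_ ?_ ?_ ?_ ?_
  · rw [straightenLines_word, w1]; exact ⟨p1, hL⟩
  · rw [straightenLines_word, w2]; exact ⟨p2, hL⟩
  · rw [straightenLines_word, w3]; exact ⟨p3, hR⟩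
  · rw [straightenLines_word, w4]; exact ⟨p4, hR⟩
  · intro x h1 h2 h3 h4
    rcases hD.reconnect_cases x with hu | hu | hu | hu | hu
    · exact absurd hu.1 h1
    · exact absurd hu.1 h2
    · exact absurd hu.1 h3
    · exact absurd hu.1 h4
    · exact ⟨hu.2.1, by rw [straightenLines_word, hu.2.2, straightenLines_word]⟩

/-- If the lines of `c` straighten to what the topological relation makes of `d`, then `c` and `d`
reduce to the same diagram. -/
theorem red_eq_of_reconnect {c : PreDiagram n} (h : d.IsLRBlob)
    (hD : (straightenLines q d).IsDouble i i' j j')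
    (hc : straightenLines q c = (straightenLines q d).reconnect i j) {s t : k}
    (hs : s * lineScalar q d = t * lineScalar q c) :
    red q d = red q c ∧ s * redScalar q d = q.κLR * (t * redScalar q c) := by
  have hv := h.straightenLines q
  have h1 := hD.topological_eq q hv
  have h2 := topological_of_not q (hD.isLRBlob_reconnect hv)
    (fun hh => hh.1.elim (hD.not_doubleAt_reconnect hv))
  rw [← hc] at h1 h2
  refine ⟨by rw [red, red, h1, h2], ?_⟩
  rw [redScalar, redScalar, h1, h2, mul_one, mul_left_comm, ← hs]
  ring

section

variable (h : d.IsLRBlob) (hn : d.Normal) (hD : d.IsDouble i i' j j')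

include h hn hD

/-- The blob is put on a line other than those with both blobs, so adding it commutes with
reconnecting. -/
theorem IsDouble.addBlob_of_ne {a : Fin n} (g : Blob) (ha : a ≠ j) (ha' : a ≠ j')
    (hv : (d.addBlob (.inr a) g).IsLRBlob) :
    red q (d.addBlob (.inr a) g) = red q ((d.reconnect i j).addBlob (.inr a) g) ∧
    redScalar q (d.addBlob (.inr a) g) =
      q.κLR * redScalar q ((d.reconnect i j).addBlob (.inr a) g) := by
  have hd := h.isMatching
  have hold : (Sum.inr a : Pt n) ≠ .inl i ∧ Sum.inr a ≠ (Sum.inr j : Pt n) ∧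
      Sum.inr a ≠ (Sum.inl i' : Pt n) ∧ Sum.inr a ≠ (Sum.inr j' : Pt n) := by simp [ha, ha']
  have hold' := hD.partner_ne hd hold
  have hA : (d.reconnect i j).partner (.inr a) = d.partner (.inr a) ∧
      (d.reconnect i j).word (.inr a) = d.word (.inr a) := by
    rcases hD.reconnect_cases (.inr a) with hu | hu | hu | hu | hu
    · exact absurd hu.1 hold.1
    · exact absurd hu.1 hold.2.1
    · exact absurd hu.1 hold.2.2.1
    · exact absurd hu.1 hold.2.2.2
    · exact hu.2
  have hne : ∀ x, x = .inl i ∨ x = .inr j ∨ x = .inl i' ∨ x = .inr j' →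
      x ≠ .inr a ∧ x ≠ d.partner (.inr a) := by
    rintro x (rfl | rfl | rfl | rfl)
    · exact ⟨hold.1.symm, hold'.1.symm⟩
    · exact ⟨hold.2.1.symm, hold'.2.1.symm⟩
    · exact ⟨hold.2.2.1.symm, hold'.2.2.1.symm⟩
    · exact ⟨hold.2.2.2.symm, hold'.2.2.2.symm⟩
  have hw : ∀ x, x = .inl i ∨ x = .inr j ∨ x = .inl i' ∨ x = .inr j' →
      (d.addBlob (.inr a) g).word x = d.word x := fun x hx =>
    addBlob_word_of_ne g (hne x hx).1 (hne x hx).2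
  have hw' : ∀ x, x = .inl i ∨ x = .inr j ∨ x = .inl i' ∨ x = .inr j' →
      ((d.reconnect i j).addBlob (.inr a) g).word x = (d.reconnect i j).word x := fun x hx =>
    addBlob_word_of_ne g (hne x hx).1 (by rw [hA.1]; exact (hne x hx).2)
  have hD' : (d.addBlob (.inr a) g).IsDouble i i' j j' :=
    ⟨hD.lt_top, hD.lt_bot, hD.top, hD.top', hD.bot, hD.bot', by rw [hw _ (by simp), hD.word_top],
      by rw [hw _ (by simp), hD.word_top'], by rw [hw _ (by simp), hD.word_bot],
      by rw [hw _ (by simp), hD.word_bot']⟩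
  have hcomm : (d.reconnect i j).addBlob (.inr a) g = (d.addBlob (.inr a) g).reconnect i j := by
    obtain ⟨p1, p2, p3, p4⟩ := hD.reconnect_partner
    obtain ⟨w1, w2, w3, w4⟩ := hD.reconnect_word
    refine hD'.eq_reconnect ⟨p1, ?_⟩ ⟨p2, ?_⟩ ⟨p3, ?_⟩ ⟨p4, ?_⟩ fun x h1 h2 h3 h4 => ?_
    · rw [hw' _ (by simp), w1]
    · rw [hw' _ (by simp), w2]
    · rw [hw' _ (by simp), w3]
    · rw [hw' _ (by simp), w4]
    · rcases hD.reconnect_cases x with hu | hu | hu | hu | hu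
      · exact absurd hu.1 h1
      · exact absurd hu.1 h2
      · exact absurd hu.1 h3
      · exact absurd hu.1 h4
      · exact ⟨hu.2.1, by simp [addBlob, hA, hu.2.2]⟩
  have := red_eq_of_reconnect (s := 1) (t := 1) q hv (hD'.straightenLines q)
    (c := (d.reconnect i j).addBlob (.inr a) g)
    (by rw [hcomm, hD'.straightenLines_reconnect q]) ?_
  · simpa using this
  · have hn' := hD.normal_reconnect hn
    rw [lineScalar_addBlob q hd, lineScalar_addBlob q (hD.isMatching_reconnect hd), hA.2,
      restScalar_eq_one q (fun x _ => hn x), restScalar_eq_one q (fun x _ => hn' x)]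

/-- The extra left blob meets a left blob on either side of the relation, in `LLR` or in `LL`, and
both straighten with the factor `δL`. -/
theorem IsDouble.addBlob_left (hv : (d.addBlob (.inr j) L).IsLRBlob) :
    red q (d.addBlob (.inr j) L) = red q ((d.reconnect i j).addBlob (.inr j) L) ∧
    redScalar q (d.addBlob (.inr j) L) =
      q.κLR * redScalar q ((d.reconnect i j).addBlob (.inr j) L) := by
  have hd := h.isMatching
  have hn' := hD.normal_reconnect hn
  obtain ⟨p1, p2, p3, p4⟩ := hD.reconnect_partner
  obtain ⟨w1, w2, w3, w4⟩ := hD.reconnect_word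
  have e1 : PreDiagram.straightenLines q (d.addBlob (.inr j) L) = d := by
    ext1
    · rfl
    · funext x
      rw [straightenLines_word]
      by_cases h1 : x = .inr j
      · rw [h1, addBlob_word_left, hD.word_bot]; rfl
      by_cases h2 : x = .inr j'
      · rw [h2, hD.word_bot']; simp [addBlob, hD.bot, hD.word_bot', hD.lt_bot.ne']; rfl
      · rw [addBlob_word_of_ne L h1 (by rwa [hD.bot]), (hn x).straightenWord_eq]
  have e2 : PreDiagram.straightenLines q ((d.reconnect i j).addBlob (.inr j) L) =
      d.reconnect i j := by
    ext1
    · rfl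
    · funext x
      rw [straightenLines_word]
      by_cases h1 : x = .inr j
      · rw [h1, addBlob_word_left, w2]; rfl
      by_cases h2 : x = .inl i
      · rw [h2, w1]; simp [addBlob, p2, w1]; rfl
      · rw [addBlob_word_of_ne L h1 (by rwa [p2]), (hn' x).straightenWord_eq]
  have := red_eq_of_reconnect (s := 1) (t := 1) q hv (e1.symm ▸ hD)
    (c := (d.reconnect i j).addBlob (.inr j) L) (by rw [e1, e2]) ?_
  · simpa using this
  · rw [lineScalar_addBlob q hd, lineScalar_addBlob q (hD.isMatching_reconnect hd), w2,
      restScalar_eq_one q (fun x _ => hn x), restScalar_eq_one q (fun x _ => hn' x), hD.word_bot]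
    simp [straightenWord, push]

theorem IsDouble.addBlob_right (hv : (d.addBlob (.inr j') R).IsLRBlob) :
    red q (d.addBlob (.inr j') R) = red q ((d.reconnect i j).addBlob (.inr j') R) ∧
    redScalar q (d.addBlob (.inr j') R) =
      q.κLR * redScalar q ((d.reconnect i j).addBlob (.inr j') R) := by
  have hd := h.isMatching
  have hn' := hD.normal_reconnect hn
  obtain ⟨p1, p2, p3, p4⟩ := hD.reconnect_partner
  obtain ⟨w1, w2, w3, w4⟩ := hD.reconnect_word
  have e1 : PreDiagram.straightenLines q (d.addBlob (.inr j') R) = d := by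
    ext1
    · rfl
    · funext x
      rw [straightenLines_word]
      by_cases h1 : x = .inr j'
      · rw [h1, addBlob_word_left, hD.word_bot']; rfl
      by_cases h2 : x = .inr j
      · rw [h2, hD.word_bot]; simp [addBlob, hD.bot', hD.word_bot, hD.lt_bot.ne]; rfl
      · rw [addBlob_word_of_ne R h1 (by rwa [hD.bot']), (hn x).straightenWord_eq]
  have e2 : PreDiagram.straightenLines q ((d.reconnect i j).addBlob (.inr j') R) =
      d.reconnect i j := by
    ext1
    · rfl
    · funext x
      rw [straightenLines_word]
      by_cases h1 : x = .inr j'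
      · rw [h1, addBlob_word_left, w4]; rfl
      by_cases h2 : x = .inl i'
      · rw [h2, w3]; simp [addBlob, p4, w3]; rfl
      · rw [addBlob_word_of_ne R h1 (by rwa [p4]), (hn' x).straightenWord_eq]
  have := red_eq_of_reconnect (s := 1) (t := 1) q hv (e1.symm ▸ hD)
    (c := (d.reconnect i j).addBlob (.inr j') R) (by rw [e1, e2]) ?_
  · simpa using this
  · rw [lineScalar_addBlob q hd, lineScalar_addBlob q (hD.isMatching_reconnect hd), w4,
      restScalar_eq_one q (fun x _ => hn x), restScalar_eq_one q (fun x _ => hn' x), hD.word_bot']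
    simp [straightenWord, push]

omit hn in
-- Before reconnecting, the join closes a loop with both blobs; afterwards it closes none and glues
-- the two propagating lines to the old line at the top. This is where the weight of such a loop has
-- to agree with the factor of the topological relation.
theorem IsDouble.join_self :
    (d.reconnect i j).join (.inr j) (.inr j') = d.join (.inr j) (.inr j') ∧
    joinWeight q d (.inr j) (.inr j') = q.κLR ∧
    joinWeight q (d.reconnect i j) (.inr j) (.inr j') = 1 := by
  have hd := h.isMatching
  have hl := hD.lt_top.ne'
  have hm := hD.isMatching_reconnect hd
  obtain ⟨p1, p2, p3, p4⟩ := hD.reconnect_partner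
  obtain ⟨w1, w2, w3, w4⟩ := hD.reconnect_word
  refine ⟨?_, ?_, ?_⟩
  · have key : ∀ x, ((d.reconnect i j).join (.inr j) (.inr j')).partner x =
        (d.join (.inr j) (.inr j')).partner x ∧
        ((d.reconnect i j).join (.inr j) (.inr j')).word x =
        (d.join (.inr j) (.inr j')).word x := by
      intro x
      rcases hD.reconnect_cases x with hu | hu | hu | hu | hu
      · rw [hu.1]; simp [join, p2, p4, w1, w4, hD.bot, hD.bot', hD.top, hD.word_top]
      · rw [hu.1]; simp
      · rw [hu.1]; simp [join, p2, p4, w2, w3, hD.bot, hD.bot', hD.top', hD.word_top', hl]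
      · rw [hu.1]; simp
      · obtain ⟨⟨h1, h2, h3, h4⟩, h5, h6⟩ := hu
        simp [join, h1, h2, h3, h4, p2, p4, hD.bot, hD.bot', h5, h6]
    ext1
    · funext x; exact (key x).1
    · funext x; exact (key x).2
  · rw [joinWeight, if_pos hD.bot, hD.word_bot]; simp [loopWeight]
  · rw [joinWeight, if_neg (by rw [p2]; simp)]

theorem IsDouble.join_of_ne {a b : Fin n} (hab : a ≠ b) (ha : a ≠ j) (ha' : a ≠ j') (hb : b ≠ j)
    (hb' : b ≠ j') (hv : (d.join (.inr a) (.inr b)).IsLRBlob) :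
    red q (d.join (.inr a) (.inr b)) = red q ((d.reconnect i j).join (.inr a) (.inr b)) ∧
    joinWeight q d (.inr a) (.inr b) * redScalar q (d.join (.inr a) (.inr b)) =
      q.κLR * (joinWeight q (d.reconnect i j) (.inr a) (.inr b) *
        redScalar q ((d.reconnect i j).join (.inr a) (.inr b))) := by
  have hd := h.isMatching
  have hm := hD.isMatching_reconnect hd
  have hn' := hD.normal_reconnect hn
  have hold : ∀ a, a ≠ j → a ≠ j' → (Sum.inr a : Pt n) ≠ .inl i ∧ Sum.inr a ≠ (Sum.inr j : Pt n) ∧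
      Sum.inr a ≠ (Sum.inl i' : Pt n) ∧ Sum.inr a ≠ (Sum.inr j' : Pt n) := by
    intro a h1 h2; simp [h1, h2]
  have hA : ∀ x : Pt n, x ≠ .inl i ∧ x ≠ .inr j ∧ x ≠ .inl i' ∧ x ≠ .inr j' →
      (d.reconnect i j).partner x = d.partner x ∧ (d.reconnect i j).word x = d.word x := by
    intro x hx
    rcases hD.reconnect_cases x with hu | hu | hu | hu | hu
    · exact absurd hu.1 hx.1
    · exact absurd hu.1 hx.2.1
    · exact absurd hu.1 hx.2.2.1
    · exact absurd hu.1 hx.2.2.2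
    · exact hu.2
  have oa := hold a ha ha'
  have ob := hold b hb hb'
  have oa' := hD.partner_ne hd oa
  have ob' := hD.partner_ne hd ob
  have hne : ∀ x, x = .inl i ∨ x = .inr j ∨ x = .inl i' ∨ x = .inr j' →
      (x ≠ .inr a ∧ x ≠ .inr b ∧ x ≠ d.partner (.inr a) ∧ x ≠ d.partner (.inr b)) := by
    rintro x (rfl | rfl | rfl | rfl)
    · exact ⟨oa.1.symm, ob.1.symm, oa'.1.symm, ob'.1.symm⟩
    · exact ⟨oa.2.1.symm, ob.2.1.symm, oa'.2.1.symm, ob'.2.1.symm⟩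
    · exact ⟨oa.2.2.1.symm, ob.2.2.1.symm, oa'.2.2.1.symm, ob'.2.2.1.symm⟩
    · exact ⟨oa.2.2.2.symm, ob.2.2.2.symm, oa'.2.2.2.symm, ob'.2.2.2.symm⟩
  have hw : ∀ x, x = .inl i ∨ x = .inr j ∨ x = .inl i' ∨ x = .inr j' →
      (d.join (.inr a) (.inr b)).partner x = d.partner x ∧
      (d.join (.inr a) (.inr b)).word x = d.word x := fun x hx =>
    have := hne x hx
    ⟨join_partner_of_ne this.1 this.2.1 this.2.2.1 this.2.2.2,
      join_word_of_ne this.1 this.2.1 this.2.2.1 this.2.2.2⟩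
  have hw' : ∀ x, x = .inl i ∨ x = .inr j ∨ x = .inl i' ∨ x = .inr j' →
      ((d.reconnect i j).join (.inr a) (.inr b)).partner x = (d.reconnect i j).partner x ∧
      ((d.reconnect i j).join (.inr a) (.inr b)).word x = (d.reconnect i j).word x := fun x hx => by
    have := hne x hx
    rw [← (hA _ oa).1, ← (hA _ ob).1] at this
    exact ⟨join_partner_of_ne this.1 this.2.1 this.2.2.1 this.2.2.2,
      join_word_of_ne this.1 this.2.1 this.2.2.1 this.2.2.2⟩
  have hD' : (d.join (.inr a) (.inr b)).IsDouble i i' j j' :=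
    ⟨hD.lt_top, hD.lt_bot, by rw [(hw _ (by simp)).1, hD.top],
      by rw [(hw _ (by simp)).1, hD.top'], by rw [(hw _ (by simp)).1, hD.bot],
      by rw [(hw _ (by simp)).1, hD.bot'], by rw [(hw _ (by simp)).2, hD.word_top],
      by rw [(hw _ (by simp)).2, hD.word_top'], by rw [(hw _ (by simp)).2, hD.word_bot],
      by rw [(hw _ (by simp)).2, hD.word_bot']⟩
  have hcomm : (d.reconnect i j).join (.inr a) (.inr b) =
      (d.join (.inr a) (.inr b)).reconnect i j := by
    obtain ⟨p1, p2, p3, p4⟩ := hD.reconnect_partner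
    obtain ⟨w1, w2, w3, w4⟩ := hD.reconnect_word
    refine hD'.eq_reconnect ?_ ?_ ?_ ?_ fun x h1 h2 h3 h4 => ?_
    · rw [(hw' _ (by simp)).1, (hw' _ (by simp)).2]; exact ⟨p1, w1⟩
    · rw [(hw' _ (by simp)).1, (hw' _ (by simp)).2]; exact ⟨p2, w2⟩
    · rw [(hw' _ (by simp)).1, (hw' _ (by simp)).2]; exact ⟨p3, w3⟩
    · rw [(hw' _ (by simp)).1, (hw' _ (by simp)).2]; exact ⟨p4, w4⟩
    · have hx := hA x ⟨h1, h2, h3, h4⟩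
      simp only [join, (hA _ oa).1, (hA _ oa).2, (hA _ ob).1, (hA _ ob).2, hx]
      exact ⟨trivial, trivial⟩
  refine red_eq_of_reconnect q hv (hD'.straightenLines q)
    (by rw [hcomm, hD'.straightenLines_reconnect q]) ?_
  have hab' : (Sum.inr a : Pt n) ≠ .inr b := by simpa using hab
  rw [joinWeight, joinWeight, (hA _ oa).1, (hA _ oa).2]
  by_cases he : d.partner (.inr a) = .inr b
  · rw [lineScalar_join_of_eq q hd he, lineScalar_join_of_eq q hm ((hA _ oa).1.trans he),
      restScalar_eq_one q (fun x _ => hn x), restScalar_eq_one q (fun x _ => hn' x)]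
  · rw [if_neg he, lineScalar_join_of_ne q hd hab' he,
      lineScalar_join_of_ne q hm hab' (by rwa [(hA _ oa).1]),
      restScalar_eq_one q (fun x _ => hn x), restScalar_eq_one q (fun x _ => hn' x),
      (hA _ oa).1, (hA _ oa').2, (hA _ ob).2]

end

end

end PreDiagram

end SympBlob

/-! ### Joining one end of a line with both blobs to another vertex -/

namespace SympBlob

open Blob

namespace PreDiagram

variable {n : ℕ}

section

variable {d : PreDiagram n} {k : Type*} [Field k] (q : Params k) {i i' j j' : Fin n}

theorem normal_of_not_mem_L {w : List Blob} (h : IsNormal w) (hL : L ∉ w) : w = [] ∨ w = [R] := by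
  rcases h with rfl | rfl | rfl | rfl | rfl <;> simp_all

theorem normal_of_not_mem_R {w : List Blob} (h : IsNormal w) (hR : R ∉ w) : w = [] ∨ w = [L] := by
  rcases h with rfl | rfl | rfl | rfl | rfl <;> simp_all

theorem joinWeight_comm {c : PreDiagram n} (hc : c.IsMatching) (α β : Pt n) :
    joinWeight q c α β = joinWeight q c β α := by
  unfold joinWeight
  by_cases h : c.partner α = β
  · rw [if_pos h, if_pos (hc.partner_eq_iff.1 h), ← h, hc.word_partner, List.count_reverse,
      List.count_reverse]
  · rw [if_neg h, if_neg (fun e => h (hc.partner_eq_iff.1 e))]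

section

variable (h : d.IsLRBlob) (hn : d.Normal) (hD : d.IsDouble i i' j j')

include h hD

theorem IsDouble.exists_partner_bot {a : Fin n} (ha : a ≠ j) (ha' : a ≠ j') :
    ∃ z, d.partner (.inr a) = .inr z ∧ d.partner (.inr z) = .inr a ∧ z ≠ a ∧ z ≠ j ∧ z ≠ j' := by
  have hd := h.isMatching
  rcases hz : d.partner (.inr a) with z | z
  · exact (hD.not_propagating' h hz).elim
  · have hz' := hd.partner_eq_iff.1 hz
    refine ⟨z, rfl, hz', ?_, ?_, ?_⟩
    · rintro rfl; exact hd.ne_self _ hz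
    · rintro rfl; rw [hD.bot] at hz'; simp [ha'.symm] at hz'
    · rintro rfl; rw [hD.bot'] at hz'; simp [ha.symm] at hz'

include hn

/-- The bottom line with both blobs is prolonged from `j'` to the other end `z` of the line at `a`.
Any blob picked up on the way is a right blob, absorbed with the same factor by `[L, R]` and by the
`[R]` of the reconnected line. So the relation still applies, now with right end `z`. -/
theorem IsDouble.join_right {a : Fin n} (ha : a ≠ j) (ha' : a ≠ j')
    (hv : (d.join (.inr j') (.inr a)).IsLRBlob) :
    red q (d.join (.inr j') (.inr a)) = red q ((d.reconnect i j).join (.inr j') (.inr a)) ∧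
    joinWeight q d (.inr j') (.inr a) * redScalar q (d.join (.inr j') (.inr a)) =
      q.κLR * (joinWeight q (d.reconnect i j) (.inr j') (.inr a) *
        redScalar q ((d.reconnect i j).join (.inr j') (.inr a))) := by
  have hd := h.isMatching
  have hm := hD.isMatching_reconnect hd
  have hn' := hD.normal_reconnect hn
  have hlt := hD.lt_top.ne'
  have hlb := hD.lt_bot.ne
  obtain ⟨p1, p2, p3, p4⟩ := hD.reconnect_partner
  obtain ⟨w1, w2, w3, w4⟩ := hD.reconnect_word
  obtain ⟨z, hz, hz', za, zj, zj'⟩ := hD.exists_partner_bot h ha ha'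
  have hA : ∀ x : Pt n, x ≠ .inl i → x ≠ .inr j → x ≠ .inl i' → x ≠ .inr j' →
      (d.reconnect i j).partner x = d.partner x ∧ (d.reconnect i j).word x = d.word x := by
    intro x h1 h2 h3 h4
    rcases hD.reconnect_cases x with hu | hu | hu | hu | hu
    · exact absurd hu.1 h1
    · exact absurd hu.1 h2
    · exact absurd hu.1 h3
    · exact absurd hu.1 h4
    · exact hu.2
  have hAa := hA (.inr a) (by simp) (by simpa using ha) (by simp) (by simpa using ha')
  have hAz := hA (.inr z) (by simp) (by simpa using zj) (by simp) (by simpa using zj')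
  have hwz : d.word (.inr z) = (d.word (.inr a)).reverse := by rw [← hz, hd.word_partner]
  have q1 : (d.join (.inr j') (.inr a)).partner (.inr j) = .inr z := by
    simp [join, hD.bot', hz, hlb, ha.symm]
  have q2 : (d.join (.inr j') (.inr a)).partner (.inr z) = .inr j := by
    simp [join, hD.bot', hz, zj, zj', za]
  have u1 : (d.join (.inr j') (.inr a)).word (.inr j) = [L, R] ++ d.word (.inr a) := by
    simp [join, hD.bot', hD.word_bot, hlb, ha.symm]
  have u2 : (d.join (.inr j') (.inr a)).word (.inr z) = (d.word (.inr a)).reverse ++ [R, L] := by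
    simp [join, hD.bot', hz, zj, zj', za, hwz, hD.word_bot']
  have hjz : j < z := by
    rcases lt_or_gt_of_ne zj with hlt | hlt
    · exact absurd (by rw [u2]; simp) (hv.ordered_bot.same_line z j q2 hlt)
    · exact hlt
  -- The prolonged word has to be sorted, so no left blob can follow `[L, R]`.
  have hw : d.word (.inr a) = [] ∨ d.word (.inr a) = [R] := by
    refine normal_of_not_mem_L (hn _) fun hL => hv.ordered_bot.same_line j z q1 hjz ?_
    rw [u1]
    exact .cons _ (.cons_cons _ (List.singleton_sublist.2 hL))
  have t1 : (straightenWord q ([L, R] ++ d.word (.inr a))).2 = [L, R] := by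
    rcases hw with hw | hw <;> rw [hw] <;> rfl
  have t2 : (straightenWord q ((d.word (.inr a)).reverse ++ [R, L])).2 = [R, L] := by
    rcases hw with hw | hw <;> rw [hw] <;> rfl
  have t3 : (straightenWord q ([R] ++ d.word (.inr a))).2 = [R] := by
    rcases hw with hw | hw <;> rw [hw] <;> rfl
  have t4 : (straightenWord q ((d.word (.inr a)).reverse ++ [R])).2 = [R] := by
    rcases hw with hw | hw <;> rw [hw] <;> rfl
  have hLL : (straightenWord q [L]).2 = [L] := rfl
  have hD' : (PreDiagram.straightenLines q (d.join (.inr j') (.inr a))).IsDouble i i' j z := by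
    refine ⟨hD.lt_top, hjz, ?_, ?_, q1, q2, ?_, ?_, ?_, ?_⟩
    · rw [straightenLines_partner]; simp [join, hD.bot', hz, hD.top]
    · rw [straightenLines_partner]; simp [join, hD.bot', hz, hD.top']
    · rw [straightenLines_word]; simp [join, hD.bot', hz, hD.word_top]; rfl
    · rw [straightenLines_word]; simp [join, hD.bot', hz, hD.word_top']; rfl
    · rw [straightenLines_word, u1, t1]
    · rw [straightenLines_word, u2, t2]
  refine red_eq_of_reconnect q hv hD' (hD'.eq_reconnect ?_ ?_ ?_ ?_ ?_) ?_
  · rw [straightenLines_partner, straightenLines_word]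
    simp [join, p4, hAa, hz, p1, w1, hlt.symm, hLL]
  · rw [straightenLines_partner, straightenLines_word]
    simp [join, p4, hAa, hz, p2, w2, hlb, hLL, ha.symm, zj.symm]
  · rw [straightenLines_partner, straightenLines_word]
    simp [join, p4, hAa, hz, w3]; exact t3
  · rw [straightenLines_partner, straightenLines_word]
    simp [join, p4, hAa, hz, w4, zj', za, hAz, hwz]; exact t4
  · intro x h1 h2 h3 h4
    simp only [straightenLines_partner, straightenLines_word]
    by_cases h5 : x = .inr j'
    · subst h5; simp
    · have hx := hA x h1 h2 h3 h5
      simp [join, p4, hAa, hz, hx, h2, h3, h4, hD.bot']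
  · have hja : (Sum.inr j' : Pt n) ≠ .inr a := by simpa using ha'.symm
    rw [joinWeight, joinWeight, p4, hD.bot', if_neg (by simpa using ha.symm), if_neg (by simp),
      lineScalar_join_of_ne q hd hja (by rw [hD.bot']; simpa using ha.symm),
      lineScalar_join_of_ne q hm hja (by rw [p4]; simp),
      restScalar_eq_one q (fun x _ => hn x), restScalar_eq_one q (fun x _ => hn' x), p4, hD.bot',
      w3, hD.word_bot, hAa.2]
    rcases hw with hw | hw <;> rw [hw] <;> simp [straightenWord, push]

/-- The mirror image of `join_right`: only left blobs can be picked up, and the left end moves to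
`z`. -/
theorem IsDouble.join_left {a : Fin n} (ha : a ≠ j) (ha' : a ≠ j')
    (hv : (d.join (.inr j) (.inr a)).IsLRBlob) :
    red q (d.join (.inr j) (.inr a)) = red q ((d.reconnect i j).join (.inr j) (.inr a)) ∧
    joinWeight q d (.inr j) (.inr a) * redScalar q (d.join (.inr j) (.inr a)) =
      q.κLR * (joinWeight q (d.reconnect i j) (.inr j) (.inr a) *
        redScalar q ((d.reconnect i j).join (.inr j) (.inr a))) := by
  have hd := h.isMatching
  have hm := hD.isMatching_reconnect hd
  have hn' := hD.normal_reconnect hn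
  have hlt := hD.lt_top.ne'
  have hlb := hD.lt_bot.ne
  obtain ⟨p1, p2, p3, p4⟩ := hD.reconnect_partner
  obtain ⟨w1, w2, w3, w4⟩ := hD.reconnect_word
  obtain ⟨z, hz, hz', za, zj, zj'⟩ := hD.exists_partner_bot h ha ha'
  have hA : ∀ x : Pt n, x ≠ .inl i → x ≠ .inr j → x ≠ .inl i' → x ≠ .inr j' →
      (d.reconnect i j).partner x = d.partner x ∧ (d.reconnect i j).word x = d.word x := by
    intro x h1 h2 h3 h4
    rcases hD.reconnect_cases x with hu | hu | hu | hu | hu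
    · exact absurd hu.1 h1
    · exact absurd hu.1 h2
    · exact absurd hu.1 h3
    · exact absurd hu.1 h4
    · exact hu.2
  have hAa := hA (.inr a) (by simp) (by simpa using ha) (by simp) (by simpa using ha')
  have hAz := hA (.inr z) (by simp) (by simpa using zj) (by simp) (by simpa using zj')
  have hwz : d.word (.inr z) = (d.word (.inr a)).reverse := by rw [← hz, hd.word_partner]
  have q1 : (d.join (.inr j) (.inr a)).partner (.inr j') = .inr z := by
    simp [join, hD.bot, hz, hlb.symm, ha'.symm]
  have q2 : (d.join (.inr j) (.inr a)).partner (.inr z) = .inr j' := by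
    simp [join, hD.bot, hz, zj, zj', za]
  have u1 : (d.join (.inr j) (.inr a)).word (.inr j') = [R, L] ++ d.word (.inr a) := by
    simp [join, hD.bot, hD.word_bot', hlb.symm, ha'.symm]
  have u2 : (d.join (.inr j) (.inr a)).word (.inr z) = (d.word (.inr a)).reverse ++ [L, R] := by
    simp [join, hD.bot, hz, zj, zj', za, hwz, hD.word_bot]
  have hjz : z < j' := by
    rcases lt_or_gt_of_ne zj' with hlt | hlt
    · exact hlt
    · exact absurd (by rw [u1]; simp) (hv.ordered_bot.same_line j' z q1 hlt)
  have hw : d.word (.inr a) = [] ∨ d.word (.inr a) = [L] := by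
    refine normal_of_not_mem_R (hn _) fun hR => hv.ordered_bot.same_line z j' q2 hjz ?_
    rw [u2]
    exact (List.singleton_sublist.2 (List.mem_reverse.2 hR)).append
      (List.singleton_sublist.2 (by simp : L ∈ [L, R]))
  have t1 : (straightenWord q ([R, L] ++ d.word (.inr a))).2 = [R, L] := by
    rcases hw with hw | hw <;> rw [hw] <;> rfl
  have t2 : (straightenWord q ((d.word (.inr a)).reverse ++ [L, R])).2 = [L, R] := by
    rcases hw with hw | hw <;> rw [hw] <;> rfl
  have t3 : (straightenWord q ([L] ++ d.word (.inr a))).2 = [L] := by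
    rcases hw with hw | hw <;> rw [hw] <;> rfl
  have t4 : (straightenWord q ((d.word (.inr a)).reverse ++ [L])).2 = [L] := by
    rcases hw with hw | hw <;> rw [hw] <;> rfl
  have hRR : (straightenWord q [R]).2 = [R] := rfl
  have hD' : (PreDiagram.straightenLines q (d.join (.inr j) (.inr a))).IsDouble i i' z j' := by
    refine ⟨hD.lt_top, hjz, ?_, ?_, q2, q1, ?_, ?_, ?_, ?_⟩
    · rw [straightenLines_partner]; simp [join, hD.bot, hz, hD.top]
    · rw [straightenLines_partner]; simp [join, hD.bot, hz, hD.top']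
    · rw [straightenLines_word]; simp [join, hD.bot, hz, hD.word_top]; rfl
    · rw [straightenLines_word]; simp [join, hD.bot, hz, hD.word_top']; rfl
    · rw [straightenLines_word, u2, t2]
    · rw [straightenLines_word, u1, t1]
  refine red_eq_of_reconnect q hv hD' (hD'.eq_reconnect ?_ ?_ ?_ ?_ ?_) ?_
  · rw [straightenLines_partner, straightenLines_word]
    simp [join, p2, hAa, hz, w1]; exact t3
  · rw [straightenLines_partner, straightenLines_word]
    simp [join, p2, hAa, hz, w2, zj, za, hAz, hwz]; exact t4
  · rw [straightenLines_partner, straightenLines_word]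
    simp [join, p2, hAa, hz, p3, w3, hlt, hRR]
  · rw [straightenLines_partner, straightenLines_word]
    simp [join, p2, hAa, hz, p4, w4, hlb.symm, hRR, ha'.symm, zj'.symm]
  · intro x h1 h2 h3 h4
    simp only [straightenLines_partner, straightenLines_word]
    by_cases h5 : x = .inr j
    · subst h5; simp
    · have hx := hA x h1 h5 h3 h4
      simp [join, p2, hAa, hz, hx, h1, h2, h4, hD.bot]
  · have hja : (Sum.inr j : Pt n) ≠ .inr a := by simpa using ha.symm
    rw [joinWeight, joinWeight, p2, hD.bot, if_neg (by simpa using ha'.symm), if_neg (by simp),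
      lineScalar_join_of_ne q hd hja (by rw [hD.bot]; simpa using ha'.symm),
      lineScalar_join_of_ne q hm hja (by rw [p2]; simp),
      restScalar_eq_one q (fun x _ => hn x), restScalar_eq_one q (fun x _ => hn' x), p2, hD.bot,
      w1, hD.word_bot', hAa.2]
    rcases hw with hw | hw <;> rw [hw] <;> simp [straightenWord, push]

theorem IsDouble.ract [NeZero n] (g : Fin (n + 1)) :
    red q (d.ract g) = red q ((d.reconnect i j).ract g) ∧
    rweight q d g * redScalar q (d.ract g) =
      q.κLR * (rweight q (d.reconnect i j) g * redScalar q ((d.reconnect i j).ract g)) := by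
  have hv := h.ract g
  have hm := hD.isMatching_reconnect h.isMatching
  have hlb := hD.lt_bot
  rcases ract_cases q g with ⟨-, h1, h2⟩ | ⟨-, h1, h2⟩ | ⟨a, b, hab, h1, h2⟩ <;>
    rw [h1] at hv <;> rw [h1, h1, h2, h2]
  · have hv : (d.addBlob (.inr 0) L).IsLRBlob := hv
    rw [one_mul, one_mul]
    have ne : 0 ≠ j' := by
      intro e
      rw [← e, Fin.lt_def, Fin.val_zero] at hlb
      omega
    by_cases e : 0 = j
    · rw [e] at hv ⊢; exact hD.addBlob_left q h hn hv
    · exact hD.addBlob_of_ne q h hn L e ne hv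
  · rw [one_mul, one_mul]
    have ne : Fin.rev 0 ≠ j := by
      intro e
      rw [← e, Fin.lt_def, Fin.val_rev, Fin.val_zero] at hlb
      omega
    by_cases e : Fin.rev 0 = j'
    · rw [e] at hv ⊢; exact hD.addBlob_right q h hn hv
    · exact hD.addBlob_of_ne q h hn R ne e hv
  · have hab' : a ≠ b := by intro e; rw [e] at hab; omega
    by_cases a1 : a = j
    · subst a1
      by_cases b1 : b = j'
      · subst b1
        obtain ⟨e1, e2, e3⟩ := hD.join_self q h
        rw [e1, e2, e3, one_mul]; exact ⟨rfl, rfl⟩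
      · exact hD.join_left q h hn hab'.symm b1 hv
    by_cases a2 : a = j'
    · subst a2
      have b1 : b ≠ j := by rintro rfl; rw [Fin.lt_def] at hlb; omega
      exact hD.join_right q h hn b1 hab'.symm hv
    by_cases b1 : b = j
    · subst b1
      rw [join_comm h.isMatching] at hv
      rw [join_comm h.isMatching, join_comm hm, joinWeight_comm q h.isMatching,
        joinWeight_comm q hm]
      exact hD.join_left q h hn a1 a2 hv
    by_cases b2 : b = j'
    · subst b2
      rw [join_comm h.isMatching] at hv
      rw [join_comm h.isMatching, join_comm hm, joinWeight_comm q h.isMatching,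
        joinWeight_comm q hm]
      exact hD.join_right q h hn a1 a2 hv
    · exact hD.join_of_ne q h hn hab' a1 a2 b1 b2 hv

end

/-! ### Reduction is compatible with right multiplication -/

variable [NeZero n]

/-- The key to associativity: a pseudo-diagram may be reduced before or after multiplication by a
generator, with the same diagram and the same total scalar. Lines come first, then the topological
relation where it applies. -/
theorem IsLRBlob.red_ract (h : d.IsLRBlob) (g : Fin (n + 1)) :
    red q (d.ract g) = red q ((red q d).ract g) ∧
    rweight q d g * redScalar q (d.ract g) =
      redScalar q d * (rweight q (red q d) g * redScalar q ((red q d).ract g)) := by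
  have hs := h.straightenLines q
  have e1 : red q (d.ract g) = red q ((PreDiagram.straightenLines q d).ract g) := by
    rw [red, red, straightenLines_ract]
  have e2 : rweight q d g * redScalar q (d.ract g) = lineScalar q d *
      (rweight q (PreDiagram.straightenLines q d) g *
        redScalar q ((PreDiagram.straightenLines q d).ract g)) := by
    rw [redScalar, redScalar, straightenLines_ract, ← mul_assoc, lineScalar_ract q h]
    ring
  rw [e1, e2]
  rcases hs.topological_cases q with hc | ⟨i, i', j, j', hD, hc⟩
  · have r1 : red q d = PreDiagram.straightenLines q d := by rw [red, hc.2]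
    have r2 : redScalar q d = lineScalar q d := by rw [redScalar, hc.2, mul_one]
    rw [r1, r2]; exact ⟨rfl, rfl⟩
  · have := hD.ract q hs (normal_straightenLines q) g
    have r1 : red q d = (PreDiagram.straightenLines q d).reconnect i j := by rw [red, hc]
    have r2 : redScalar q d = lineScalar q d * q.κLR := by rw [redScalar, hc]
    rw [r1, r2]
    refine ⟨this.1, ?_⟩
    rw [this.2, mul_assoc]

theorem IsLRBlob.red_ractList (h : d.IsLRBlob) (l : List (Fin (n + 1))) :
    red q (d.ractList l) = red q ((red q d).ractList l) ∧
    rweightList q d l * redScalar q (d.ractList l) =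
      redScalar q d * (rweightList q (red q d) l * redScalar q ((red q d).ractList l)) := by
  induction l generalizing d with
  | nil =>
    have hb := h.memB_red q
    simp [rweightList, hb.red_eq q, hb.redScalar_eq q]
  | cons g l ih =>
    obtain ⟨a1, a2⟩ := h.red_ract q g
    obtain ⟨b1, b2⟩ := ih (h.ract g)
    obtain ⟨c1, c2⟩ := ih ((h.memB_red q).toIsLRBlob.ract g)
    rw [ractList_cons, ractList_cons, rweightList, rweightList]
    refine ⟨by rw [b1, c1, a1], ?_⟩
    rw [mul_assoc, b2, mul_assoc, c2, ← a1, ← mul_assoc, a2]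
    ring

end

end PreDiagram

end SympBlob

namespace SympBlob

open Blob

namespace PreDiagram

variable {n : ℕ}

/-! ### Reflection in a horizontal line -/

section

variable {d : PreDiagram n} {k : Type*} [Field k] (q : Params k) {i i' j j' : Fin n}

theorem flip_partner (d : PreDiagram n) (x : Pt n) : d.flip.partner x = (d.partner x.swap).swap :=
  rfl

theorem flip_word (d : PreDiagram n) (x : Pt n) : d.flip.word x = d.word x.swap := rfl

theorem flip_straightenLines :
    straightenLines q d.flip = (straightenLines q d).flip := rfl

theorem posL_swap (x : Pt n) : posL x.swap + posL x + 1 = 2 * n := by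
  rcases x with i | i <;> simp only [Sum.swap_inl, Sum.swap_inr, posL_inl, posL_inr] <;> omega

theorem lineScalar_flip (hd : d.IsMatching) : lineScalar q d.flip = lineScalar q d := by
  unfold lineScalar
  -- Reflection reverses positions, so the first end of a line becomes its second end. The bijection
  -- therefore goes to the other end of the reflected line.
  refine Finset.prod_bij' (fun x _ => d.partner x.swap) (fun x _ => (d.partner x).swap) ?_ ?_ ?_ ?_
    ?_
  · intro x hx
    have hx' : posL x < posL (d.partner x.swap).swap := (Finset.mem_filter.1 hx).2
    refine Finset.mem_filter.2 ⟨Finset.mem_univ _, ?_⟩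
    rw [hd.invol]
    have h1 := posL_swap x
    have h2 := posL_swap (d.partner x.swap)
    omega
  · intro x hx
    have hx' : posL x < posL (d.partner x) := (Finset.mem_filter.1 hx).2
    refine Finset.mem_filter.2 ⟨Finset.mem_univ _, ?_⟩
    rw [flip_partner, Sum.swap_swap, hd.invol]
    have h1 := posL_swap x
    have h2 := posL_swap (d.partner x)
    omega
  · intro x _; simp [hd.invol]
  · intro x _; simp [hd.invol]
  · intro x _
    rw [flip_word, hd.word_partner, straightenWord_reverse]

theorem IsDouble.flip (hD : d.IsDouble i i' j j') : d.flip.IsDouble j j' i i' where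
  lt_top := hD.lt_bot
  lt_bot := hD.lt_top
  top := by simp [flip_partner, hD.bot]
  top' := by simp [flip_partner, hD.bot']
  bot := by simp [flip_partner, hD.top]
  bot' := by simp [flip_partner, hD.top']
  word_top := by simp [flip_word, hD.word_bot]
  word_top' := by simp [flip_word, hD.word_bot']
  word_bot := by simp [flip_word, hD.word_top]
  word_bot' := by simp [flip_word, hD.word_top']

theorem IsDouble.flip_reconnect (hD : d.IsDouble i i' j j') :
    (d.reconnect i j).flip = d.flip.reconnect j i := by
  obtain ⟨p1, p2, p3, p4⟩ := hD.reconnect_partner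
  obtain ⟨w1, w2, w3, w4⟩ := hD.reconnect_word
  refine hD.flip.eq_reconnect ?_ ?_ ?_ ?_ fun x h1 h2 h3 h4 => ?_
  · simp [flip_partner, flip_word, p2, w2]
  · simp [flip_partner, flip_word, p1, w1]
  · simp [flip_partner, flip_word, p4, w4]
  · simp [flip_partner, flip_word, p3, w3]
  · simp only [flip_partner, flip_word]
    rcases hD.reconnect_cases x.swap with hu | hu | hu | hu | hu
    · exact absurd (swap_eq_iff.1 hu.1) h2
    · exact absurd (swap_eq_iff.1 hu.1) h1
    · exact absurd (swap_eq_iff.1 hu.1) h4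
    · exact absurd (swap_eq_iff.1 hu.1) h3
    · rw [hu.2.1, hu.2.2]; exact ⟨rfl, rfl⟩

theorem doubleAt_flip : d.flip.DoubleAt Sum.inl i ↔ d.DoubleAt Sum.inr i := by
  simp [DoubleAt, flip_partner, flip_word, swap_eq_iff]

theorem doubleAt_flip' : d.flip.DoubleAt Sum.inr i ↔ d.DoubleAt Sum.inl i := by
  simp [DoubleAt, flip_partner, flip_word, swap_eq_iff]

theorem topological_flip (h : d.IsLRBlob) (h' : d.flip.IsLRBlob) :
    topological q d.flip = ((topological q d).1, (topological q d).2.flip) := by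
  rcases h.topological_cases q with hc | ⟨i, i', j, j', hD, hc⟩
  · rw [hc.2, topological_of_not q h']
    simp only [doubleAt_flip, doubleAt_flip']
    tauto
  · rw [hc, hD.flip.topological_eq q h', hD.flip_reconnect]

theorem red_flip (h : d.IsLRBlob) (h' : d.flip.IsLRBlob) : red q d.flip = (red q d).flip := by
  have h1 := h'.straightenLines q
  rw [flip_straightenLines] at h1
  rw [red, flip_straightenLines, topological_flip q (h.straightenLines q) h1, red]

theorem redScalar_flip (h : d.IsLRBlob) (h' : d.flip.IsLRBlob) :
    redScalar q d.flip = redScalar q d := by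
  have h1 := h'.straightenLines q
  rw [flip_straightenLines] at h1
  rw [redScalar, flip_straightenLines, topological_flip q (h.straightenLines q) h1, redScalar,
    lineScalar_flip q h.isMatching]

theorem loopProd_flip (a b : PreDiagram n) : loopProd q b.flip a.flip = loopProd q a b := by
  have h1 : ∀ u t, b.flip.partner (.inr u) = .inr t ↔ b.partner (.inl u) = .inl t := by
    simp [flip_partner, swap_eq_iff]
  have h2 : ∀ u t, a.flip.partner (.inl u) = .inl t ↔ a.partner (.inr u) = .inr t := by
    simp [flip_partner, swap_eq_iff]
  have hg : midGraph b.flip a.flip = midGraph a b := by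
    simp only [midGraph, h1, h2]
    congr 1
    funext u t
    exact propext or_comm
  have hs : loopSets b.flip a.flip = loopSets a b := by
    ext S
    simp only [mem_loopSets, IsLoopSet, hg, h1, h2, and_comm]
  have hb : ∀ S g, blobSum b.flip a.flip S g = blobSum a b S g := fun S g =>
    Finset.sum_congr rfl fun j _ => add_comm _ _
  rw [loopProd_eq, loopProd_eq, hs]
  simp only [hb]

end

/-! ### The value of a word in the generators -/

section

variable [NeZero n] {k : Type*} [Field k] (q : Params k)

theorem isLRBlob_raw (l : List (Fin (n + 1))) : (raw l).IsLRBlob := isLRBlob_one.ractList l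

/-- The diagram of a word in the generators. -/
def wdiag (l : List (Fin (n + 1))) : PreDiagram n := red q (raw l)

/-- The scalar of a word in the generators. -/
def wscalar (l : List (Fin (n + 1))) : k := rweightList q (one n) l * redScalar q (raw l)

theorem memB_wdiag (l : List (Fin (n + 1))) : (wdiag q l).MemB := (isLRBlob_raw l).memB_red q

theorem wdiag_append (u v : List (Fin (n + 1))) :
    wdiag q (u ++ v) = red q ((wdiag q u).ractList v) := by
  rw [wdiag, raw, ractList_append]
  exact ((isLRBlob_raw u).red_ractList q v).1

/-- The second factor depends on `u` only through its diagram. This makes `WEq` stable under right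
multiplication. -/
theorem wscalar_append (u v : List (Fin (n + 1))) :
    wscalar q (u ++ v) = wscalar q u *
      (rweightList q (wdiag q u) v * redScalar q ((wdiag q u).ractList v)) := by
  have h : raw (u ++ v) = (raw u).ractList v := ractList_append _ _ _
  rw [wscalar, h, rweightList_append, mul_assoc]
  change _ * (rweightList q (raw u) v * _) = _
  rw [((isLRBlob_raw u).red_ractList q v).2, wscalar, mul_assoc]
  rfl

theorem rweightList_one_append (u v : List (Fin (n + 1))) :
    rweightList q (one n) (u ++ v) = rweightList q (one n) u * loopProd q (raw u) (raw v) *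
      rweightList q (one n) v := by
  rw [rweightList_append, mul_assoc, loopProd_raw q (isMatching_raw u)]
  rfl

/-- Loop weights are collected from left to right, so symmetry is not visible in the definition.
Splitting words by `rweightList_one_append` expresses them by `loopProd`, which is symmetric. -/
theorem rweightList_reverse (l : List (Fin (n + 1))) :
    rweightList q (one n) l.reverse = rweightList q (one n) l := by
  induction l with
  | nil => rfl
  | cons i l ih =>
    have h : loopProd q (raw l.reverse) (raw [i]) = loopProd q (raw [i]) (raw l) := by
      rw [← flip_raw l, ← flip_raw_singleton i, loopProd_flip, flip_raw_singleton]
    have h' := rweightList_one_append q [i] l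
    rw [List.singleton_append] at h'
    rw [List.reverse_cons, rweightList_one_append, ih, h, h']
    ring

theorem wdiag_reverse (l : List (Fin (n + 1))) : wdiag q l.reverse = (wdiag q l).flip := by
  rw [wdiag, ← flip_raw, red_flip q (isLRBlob_raw l) (by rw [flip_raw]; exact isLRBlob_raw _)]
  rfl

theorem wscalar_reverse (l : List (Fin (n + 1))) : wscalar q l.reverse = wscalar q l := by
  rw [wscalar, ← flip_raw,
    redScalar_flip q (isLRBlob_raw l) (by rw [flip_raw]; exact isLRBlob_raw _),
    rweightList_reverse]
  rfl

/-- Two words have the same value, up to the factor `c`. -/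
def WEq (c : k) (u v : List (Fin (n + 1))) : Prop :=
  wdiag q u = wdiag q v ∧ wscalar q u = c * wscalar q v

section

variable {q} {c : k} {u v : List (Fin (n + 1))}

theorem WEq.append_right (h : WEq q c u v) (x : List (Fin (n + 1))) :
    WEq q c (u ++ x) (v ++ x) := by
  refine ⟨?_, ?_⟩
  · rw [wdiag_append, wdiag_append, h.1]
  · rw [wscalar_append, wscalar_append, h.1, h.2, mul_assoc]

theorem WEq.reverse (h : WEq q c u v) : WEq q c u.reverse v.reverse := by
  refine ⟨?_, ?_⟩
  · rw [wdiag_reverse, wdiag_reverse, h.1]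
  · rw [wscalar_reverse, wscalar_reverse, h.2]

/-- Left multiplication is right multiplication of the reversed words. -/
theorem WEq.append_left (h : WEq q c u v) (x : List (Fin (n + 1))) :
    WEq q c (x ++ u) (x ++ v) := by
  have := (h.reverse.append_right x.reverse).reverse
  simpa using this

theorem WEq.append (h : WEq q c u v) (x y : List (Fin (n + 1))) :
    WEq q c (x ++ u ++ y) (x ++ v ++ y) :=
  (h.append_left x).append_right y

theorem WEq.refl (u : List (Fin (n + 1))) : WEq q 1 u u := ⟨rfl, by simp⟩

theorem WEq.trans {c' : k} {w : List (Fin (n + 1))} (h : WEq q c u v) (h' : WEq q c' v w) :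
    WEq q (c * c') u w :=
  ⟨h.1.trans h'.1, by rw [h.2, h'.2, mul_assoc]⟩

theorem WEq.symm (h : WEq q c u v) (hc : c ≠ 0) : WEq q c⁻¹ v u :=
  ⟨h.1.symm, by rw [h.2]; field_simp⟩

/-- Words with the same loops and the same straightening have the same value. -/
theorem wEq_of_raw (h1 : raw u = raw v)
    (h2 : rweightList q (one n) u = c * rweightList q (one n) v) : WEq q c u v :=
  ⟨by rw [wdiag, wdiag, h1], by rw [wscalar, wscalar, h1, h2, mul_assoc]⟩

end

end

end PreDiagram

end SympBlob

namespace SympBlob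

open Blob

namespace PreDiagram

variable {n : ℕ}

/-! ### The relations between the generators that involve few of them -/

section

@[simp] theorem one_partner_inl (x : Fin n) : (one n).partner (.inl x) = .inr x := rfl

@[simp] theorem one_partner_inr (x : Fin n) : (one n).partner (.inr x) = .inl x := rfl

@[simp] theorem one_word (x : Pt n) : (one n).word x = [] := by
  rcases x with x | x <;> simp [one, vertical]

@[simp] theorem addBlob_partner (d : PreDiagram n) (α : Pt n) (g : Blob) (x : Pt n) :
    (d.addBlob α g).partner x = d.partner x := rfl

theorem comm_join_join {a b a' b' : Fin n} (h3 : a ≠ a')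
    (h4 : a ≠ b') (h5 : b ≠ a') (h6 : b ≠ b') :
    ((one n).join (.inr a) (.inr b)).join (.inr a') (.inr b') =
      ((one n).join (.inr a') (.inr b')).join (.inr a) (.inr b) := by
  ext1 <;> funext x <;> rcases x with x | x <;>
    simp [join, h3, h4, h5, h6, h3.symm, h4.symm, h5.symm, h6.symm] <;> grind

theorem comm_join_addBlob {a b c : Fin n} (g : Blob) (h1 : c ≠ a) (h2 : c ≠ b) :
    ((one n).join (.inr a) (.inr b)).addBlob (.inr c) g =
      ((one n).addBlob (.inr c) g).join (.inr a) (.inr b) := by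
  ext1 <;> funext x <;> rcases x with x | x <;>
    simp [join, addBlob, Fin.ext_iff] <;> grind

theorem comm_addBlob_addBlob {a b : Fin n} (g g' : Blob) (h : a ≠ b) :
    ((one n).addBlob (.inr a) g).addBlob (.inr b) g' =
      ((one n).addBlob (.inr b) g').addBlob (.inr a) g := by
  ext1 <;> funext x <;> rcases x with x | x <;>
    simp [addBlob, Fin.ext_iff] <;> grind

theorem join_join_same {a b : Fin n} (h : a ≠ b) :
    ((one n).join (.inr a) (.inr b)).join (.inr a) (.inr b) = (one n).join (.inr a) (.inr b) := by
  ext1 <;> funext x <;> rcases x with x | x <;>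
    simp [join, Fin.ext_iff] <;> grind

theorem join_join_join {a b c : Fin n} (h : a ≠ b) (h' : a ≠ c) (h'' : b ≠ c) :
    (((one n).join (.inr a) (.inr b)).join (.inr b) (.inr c)).join (.inr a) (.inr b) =
      (one n).join (.inr a) (.inr b) := by
  ext1 <;> funext x <;> rcases x with x | x <;>
    simp [join, Fin.ext_iff] <;> grind

theorem join_addBlob_join {a b c : Fin n} (g : Blob) (h : a ≠ b) (hc : c = a ∨ c = b) :
    (((one n).join (.inr a) (.inr b)).addBlob (.inr c) g).join (.inr a) (.inr b) =
      (one n).join (.inr a) (.inr b) := by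
  ext1 <;> funext x <;> rcases x with x | x <;> rcases hc with rfl | rfl <;>
    simp [join, addBlob, Fin.ext_iff] <;> grind

variable [NeZero n] {k : Type*} [Field k] (q : Params k)

theorem rweight_of_ne {d : PreDiagram n} {i : Fin (n + 1)}
    (h : ∀ a b : Fin n, (a : ℕ) + 1 = i → (b : ℕ) = i → d.partner (.inr a) ≠ .inr b) :
    rweight q d i = 1 := by
  rcases ract_cases q i with ⟨-, -, h1⟩ | ⟨-, -, h1⟩ | ⟨a, b, hab, -, h1⟩ <;> rw [h1]
  rw [joinWeight, if_neg (h a b hab.1 hab.2)]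

theorem rweight_one (i : Fin (n + 1)) : rweight q (one n) i = 1 :=
  rweight_of_ne q fun a b _ _ => by simp

theorem rweightList_singleton (i : Fin (n + 1)) : rweightList q (one n) [i] = 1 := by
  simp [rweightList, rweight_one]

theorem wEq_comm (i j : Fin (n + 1)) (h : (i : ℕ) + 1 < j) : WEq q 1 [i, j] [j, i] := by
  have hn := NeZero.pos n
  have hv0 : ((0 : Fin n) : ℕ) = 0 := Fin.val_zero n
  have hvl : ((Fin.rev 0 : Fin n) : ℕ) = n - 1 := by rw [Fin.val_rev, hv0]
  suffices hh : raw [i, j] = raw [j, i] ∧ rweightList q (one n) [i, j] = 1 ∧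
      rweightList q (one n) [j, i] = 1 by
    exact wEq_of_raw hh.1 (by rw [hh.2.1, hh.2.2, one_mul])
  simp only [raw, ractList_cons, ractList_nil, rweightList, rweight_one, mul_one, one_mul]
  rcases ract_cases q i with ⟨hi, h1, w1⟩ | ⟨hi, h1, w1⟩ | ⟨a, b, hab, h1, w1⟩ <;>
    rcases ract_cases q j with ⟨hj, h2, w2⟩ | ⟨hj, h2, w2⟩ | ⟨a', b', hab', h2, w2⟩ <;>
    simp only [h1, h2, w1, w2]
  · rw [hj] at h; simp at h
  · refine ⟨comm_addBlob_addBlob _ _ ?_, trivial, trivial⟩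
    rw [hi, hj] at h
    intro e
    rw [← e] at hvl
    simp at h; omega
  · refine ⟨(comm_join_addBlob _ ?_ ?_).symm, ?_, trivial⟩
    · intro e; rw [← e] at hab'; omega
    · intro e; rw [← e] at hab'; omega
    · simp [joinWeight]
  · rw [hj] at h; simp at h
  · rw [hi, hj] at h; simp at h
  · rw [hi] at h; simp at h; omega
  · rw [hj] at h; simp at h
  · rw [hj] at h; simp at h
    refine ⟨comm_join_addBlob _ ?_ ?_, trivial, ?_⟩
    · intro e; rw [← e] at hab; omega
    · intro e; rw [← e] at hab; omega
    · simp [joinWeight]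
  · have n3 : a ≠ a' := by intro e; rw [e] at hab; omega
    have n4 : a ≠ b' := by intro e; rw [e] at hab; omega
    have n5 : b ≠ a' := by intro e; rw [e] at hab; omega
    have n6 : b ≠ b' := by intro e; rw [e] at hab; omega
    refine ⟨comm_join_join n3 n4 n5 n6, ?_, ?_⟩
    · rw [joinWeight, if_neg]
      simp [join, n3.symm, n5.symm]
    · rw [joinWeight, if_neg]
      simp [join, n3, n4]

theorem exists_mid (i : Fin (n + 1)) (h₁ : 1 ≤ (i : ℕ)) (h₂ : (i : ℕ) < n) :
    ∃ a b : Fin n, ((a : ℕ) + 1 = i ∧ (b : ℕ) = i) ∧ a ≠ b ∧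
      (∀ d : PreDiagram n, d.ract i = d.join (.inr a) (.inr b)) ∧
      ∀ d : PreDiagram n, rweight q d i = joinWeight q d (.inr a) (.inr b) := by
  rcases ract_cases q i with ⟨hi, h1, w1⟩ | ⟨hi, h1, w1⟩ | ⟨a, b, hab, h1, w1⟩
  · rw [hi] at h₁; simp at h₁
  · rw [hi] at h₂; simp at h₂
  · exact ⟨a, b, hab, by intro e; rw [e] at hab; omega, h1, w1⟩

theorem wEq_sq_mid (i : Fin (n + 1)) (h₁ : 1 ≤ (i : ℕ)) (h₂ : (i : ℕ) < n) :
    WEq q q.δ [i, i] [i] := by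
  obtain ⟨a, b, hab, hne, h1, w1⟩ := exists_mid q i h₁ h₂
  refine wEq_of_raw ?_ ?_
  · simp only [raw, ractList_cons, ractList_nil, h1]
    exact join_join_same hne
  · simp only [rweightList, w1, h1, mul_one]
    simp [joinWeight, loopWeight]

theorem wEq_braid_up (i j : Fin (n + 1)) (h₁ : 1 ≤ (i : ℕ)) (h : (j : ℕ) = i + 1)
    (h₂ : (j : ℕ) < n) : WEq q 1 [i, j, i] [i] := by
  obtain ⟨a, b, hab, hne, h1, w1⟩ := exists_mid q i h₁ (by omega)
  obtain ⟨b', c, hbc, hne', h3, w3⟩ := exists_mid q j (by omega) h₂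
  obtain rfl : b = b' := Fin.ext (by omega)
  have hne'' : a ≠ c := by intro e; rw [e] at hab; omega
  refine wEq_of_raw ?_ ?_
  · simp only [raw, ractList_cons, ractList_nil, h1, h3]
    exact join_join_join hne hne'' hne'
  · simp only [rweightList, w1, h1, w3, h3, mul_one, one_mul]
    simp [joinWeight, join, hne, hne'', hne.symm, hne'.symm, hne''.symm]

theorem wEq_braid_down (i j : Fin (n + 1)) (h₁ : 1 ≤ (i : ℕ)) (h : (j : ℕ) = i + 1)
    (h₂ : (j : ℕ) < n) : WEq q 1 [j, i, j] [j] := by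
  obtain ⟨a, b, hab, hne, h1, w1⟩ := exists_mid q i h₁ (by omega)
  obtain ⟨b', c, hbc, hne', h3, w3⟩ := exists_mid q j (by omega) h₂
  obtain rfl : b = b' := Fin.ext (by omega)
  have hne'' : a ≠ c := by intro e; rw [e] at hab; omega
  refine wEq_of_raw ?_ ?_
  · simp only [raw, ractList_cons, ractList_nil, h1, h3]
    have h0 := isMatching_one (n := n)
    have hne1 : (Sum.inr b : Pt n) ≠ .inr c := by simpa using hne'
    have hne2 : (Sum.inr a : Pt n) ≠ .inr b := by simpa using hne
    rw [join_comm ((h0.join hne1).join hne2), join_comm (h0.join hne1), join_comm h0]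
    exact join_join_join hne'.symm hne''.symm hne.symm
  · simp only [rweightList, w1, h1, w3, h3, mul_one, one_mul]
    simp [joinWeight, join, hne, hne'', hne.symm]

theorem wEq_left (i : Fin (n + 1)) (h₁ : (i : ℕ) = 1) (h₂ : (i : ℕ) < n) :
    WEq q q.κL [i, 0, i] [i] := by
  obtain ⟨a, b, hab, hne, h1, w1⟩ := exists_mid q i (by omega) h₂
  have ha : a = 0 := Fin.ext (by rw [Fin.val_zero]; omega)
  refine wEq_of_raw ?_ ?_
  · simp only [raw, ractList_cons, ractList_nil, h1]
    simp only [ract, if_true]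
    exact join_addBlob_join L hne (.inl ha.symm)
  · simp only [rweightList, w1, h1, mul_one]
    simp [joinWeight, rweight, ract, ha, addBlob_word_left, loopWeight]

theorem ract_last (d : PreDiagram n) : d.ract (Fin.last n) = d.addBlob (.inr (Fin.rev 0)) R := by
  have hn := NeZero.ne n
  have h0 : Fin.last n ≠ 0 := by simpa [Fin.ext_iff] using hn
  simp [ract, h0]

theorem rweight_last (d : PreDiagram n) : rweight q d (Fin.last n) = 1 := by
  have hn := NeZero.ne n
  have h0 : Fin.last n ≠ 0 := by simpa [Fin.ext_iff] using hn
  simp [rweight, h0]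

theorem wEq_right (i : Fin (n + 1)) (h₁ : 1 ≤ (i : ℕ)) (h₂ : (i : ℕ) + 1 = n) :
    WEq q q.κR [i, Fin.last n, i] [i] := by
  obtain ⟨a, b, hab, hne, h1, w1⟩ := exists_mid q i (by omega) (by omega)
  have hb : Fin.rev 0 = b := Fin.ext (by rw [Fin.val_rev, Fin.val_zero]; omega)
  refine wEq_of_raw ?_ ?_
  · simp only [raw, ractList_cons, ractList_nil, h1, ract_last]
    exact join_addBlob_join R hne (.inr hb)
  · simp only [rweightList, w1, h1, mul_one, one_mul, ract_last, rweight_last, hb]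
    simp [joinWeight, addBlob, hne, loopWeight]

/-- Here and for the right blob the two sides differ as raw diagrams and agree only after
straightening; the other short relations hold before it. -/
theorem wEq_sq_left : WEq q q.δL [0, 0] [(0 : Fin (n + 1))] := by
  have e1 : raw [(0 : Fin (n + 1))] = (one n).addBlob (.inr 0) L := by simp [raw, ract]
  have e2 : raw [(0 : Fin (n + 1)), 0] = (raw [(0 : Fin (n + 1))]).addBlob (.inr 0) L := by
    simp [raw, ract]
  have hm := isMatching_raw [(0 : Fin (n + 1))]
  have hw : (raw [(0 : Fin (n + 1))]).word (.inr 0) = [L] := by simp [e1, addBlob]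
  have hN : (raw [(0 : Fin (n + 1))]).Normal := fun x => by
    rw [e1]; simp only [addBlob]; split_ifs <;> simp [IsNormal]
  have hs : straightenLines q (raw [(0 : Fin (n + 1)), 0]) = raw [(0 : Fin (n + 1))] := by
    rw [e2, e1]
    ext1
    · rfl
    · funext x
      rw [straightenLines_word]
      simp only [addBlob]
      split_ifs <;> simp [straightenWord, push]
  have hl : lineScalar q (raw [(0 : Fin (n + 1)), 0]) = q.δL := by
    rw [e2, lineScalar_addBlob q hm, hw, restScalar_eq_one q (fun x _ => hN x)]
    simp [straightenWord, push]
  refine ⟨?_, ?_⟩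
  · rw [wdiag, wdiag, red, red, hs, hN.straightenLines_eq]
  · simp only [wscalar, redScalar, hs, hN.straightenLines_eq, hl, hN.lineScalar_eq]
    simp [rweightList, rweight]

theorem wEq_sq_right : WEq q q.δR [Fin.last n, Fin.last n] [Fin.last n] := by
  have e1 : raw [Fin.last n] = (one n).addBlob (.inr (Fin.rev 0)) R := by simp [raw, ract_last]
  have e2 : raw [Fin.last n, Fin.last n] = (raw [Fin.last n]).addBlob (.inr (Fin.rev 0)) R := by
    simp [raw, ract_last]
  have hm := isMatching_raw [Fin.last n]
  have hw : (raw [Fin.last n]).word (.inr (Fin.rev 0)) = [R] := by simp [e1, addBlob]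
  have hN : (raw [Fin.last n]).Normal := fun x => by
    rw [e1]; simp only [addBlob]; split_ifs <;> simp [IsNormal]
  have hs : straightenLines q (raw [Fin.last n, Fin.last n]) = raw [Fin.last n] := by
    rw [e2, e1]
    ext1
    · rfl
    · funext x
      rw [straightenLines_word]
      simp only [addBlob]
      split_ifs <;> simp [straightenWord, push]
  have hl : lineScalar q (raw [Fin.last n, Fin.last n]) = q.δR := by
    rw [e2, lineScalar_addBlob q hm, hw, restScalar_eq_one q (fun x _ => hN x)]
    simp [straightenWord, push]
  refine ⟨?_, ?_⟩
  · rw [wdiag, wdiag, red, red, hs, hN.straightenLines_eq]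
  · simp only [wscalar, redScalar, hs, hN.straightenLines_eq, hl, hN.lineScalar_eq]
    simp [rweightList, rweight_last]

end

end PreDiagram

end SympBlob

namespace SympBlob

open Blob

namespace PreDiagram

/-! ### Adding a cup and a cap on the left -/

section

variable {n : ℕ} [NeZero n] {k : Type*} [Field k] (q : Params k)

theorem ract_zero (d : PreDiagram n) : d.ract 0 = d.addBlob (.inr 0) L := by simp [ract]

omit [NeZero n] in
theorem rweight_zero (d : PreDiagram n) : rweight q d 0 = 1 := by simp [rweight]

theorem ract_mid (d : PreDiagram n) {i : Fin (n + 1)} {a b : Fin n} (ha : (a : ℕ) + 1 = i)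
    (hb : (b : ℕ) = i) : d.ract i = d.join (.inr a) (.inr b) := by
  -- `ract` does not involve the parameters, so any will do.
  obtain ⟨a', b', h, -, h1, -⟩ := exists_mid (⟨0, 0, 0, 0, 0, 0⟩ : Params ℚ) i (by omega) (by omega)
  rw [h1, show a' = a from Fin.ext (by omega), show b' = b from Fin.ext (by omega)]

theorem rweight_mid (d : PreDiagram n) {i : Fin (n + 1)} {a b : Fin n} (ha : (a : ℕ) + 1 = i)
    (hb : (b : ℕ) = i) : rweight q d i = joinWeight q d (.inr a) (.inr b) := by
  obtain ⟨a', b', h, -, -, h1⟩ := exists_mid q i (by omega) (by omega)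
  rw [h1, show a' = a from Fin.ext (by omega), show b' = b from Fin.ext (by omega)]

end

variable {m : ℕ}

/-- The vertex two places to the right. -/
def sh (x : Pt m) : Pt (m + 2) := Sum.map (fun i => i.succ.succ) (fun i => i.succ.succ) x

theorem sh_inl (i : Fin m) : sh (.inl i) = .inl i.succ.succ := rfl

theorem sh_inr (i : Fin m) : sh (.inr i) = .inr i.succ.succ := rfl

theorem sh_injective : Function.Injective (sh : Pt m → Pt (m + 2)) := by
  rintro (i | i) (j | j) h <;> simp_all [sh]

@[simp] theorem sh_inj {x y : Pt m} : sh x = sh y ↔ x = y := sh_injective.eq_iff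

@[simp] theorem sh_ne (x : Pt m) : sh x ≠ .inl 0 ∧ sh x ≠ .inl 1 ∧ sh x ≠ .inr 0 ∧
    sh x ≠ .inr 1 := by
  rcases x with i | i <;> simp [sh, Fin.ext_iff]

theorem pt_cases (x : Pt (m + 2)) :
    x = .inl 0 ∨ x = .inl 1 ∨ x = .inr 0 ∨ x = .inr 1 ∨ ∃ y, x = sh y := by
  rcases x with i | i
  · induction i using Fin.cases with
    | zero => simp
    | succ i =>
      induction i using Fin.cases with
      | zero => exact .inr (.inl rfl)
      | succ i => exact .inr (.inr (.inr (.inr ⟨.inl i, rfl⟩)))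
  · induction i using Fin.cases with
    | zero => simp
    | succ i =>
      induction i using Fin.cases with
      | zero => exact .inr (.inr (.inr (.inl rfl)))
      | succ i => exact .inr (.inr (.inr (.inr ⟨.inr i, rfl⟩)))

/-- Add an undecorated cup and an undecorated cap to the left of a diagram. -/
def iota (d : PreDiagram m) : PreDiagram (m + 2) where
  partner
    | .inl i => Fin.cases (.inl 1) (fun i => Fin.cases (.inl 0) (fun i => sh (d.partner (.inl i))) i) i
    | .inr i => Fin.cases (.inr 1) (fun i => Fin.cases (.inr 0) (fun i => sh (d.partner (.inr i))) i) i
  word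
    | .inl i => Fin.cases [] (fun i => Fin.cases [] (fun i => d.word (.inl i)) i) i
    | .inr i => Fin.cases [] (fun i => Fin.cases [] (fun i => d.word (.inr i)) i) i

section

variable (d : PreDiagram m)

@[simp] theorem iota_partner_sh (x : Pt m) : d.iota.partner (sh x) = sh (d.partner x) := by
  rcases x with i | i <;> rfl

@[simp] theorem iota_word_sh (x : Pt m) : d.iota.word (sh x) = d.word x := by
  rcases x with i | i <;> rfl

@[simp] theorem iota_partner_inl_zero : d.iota.partner (.inl 0) = .inl 1 := rfl
@[simp] theorem iota_partner_inl_one : d.iota.partner (.inl 1) = .inl 0 := rfl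
@[simp] theorem iota_partner_inr_zero : d.iota.partner (.inr 0) = .inr 1 := rfl
@[simp] theorem iota_partner_inr_one : d.iota.partner (.inr 1) = .inr 0 := rfl
@[simp] theorem iota_word_inl_zero : d.iota.word (.inl 0) = [] := rfl
@[simp] theorem iota_word_inl_one : d.iota.word (.inl 1) = [] := rfl
@[simp] theorem iota_word_inr_zero : d.iota.word (.inr 0) = [] := rfl
@[simp] theorem iota_word_inr_one : d.iota.word (.inr 1) = [] := rfl

end

/-- A diagram with an undecorated cup and an undecorated cap on the left is determined by the
rest. -/
theorem eq_iota {c : PreDiagram (m + 2)} {d : PreDiagram m}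
    (h1 : c.partner (.inl 0) = .inl 1 ∧ c.word (.inl 0) = [])
    (h2 : c.partner (.inl 1) = .inl 0 ∧ c.word (.inl 1) = [])
    (h3 : c.partner (.inr 0) = .inr 1 ∧ c.word (.inr 0) = [])
    (h4 : c.partner (.inr 1) = .inr 0 ∧ c.word (.inr 1) = [])
    (h5 : ∀ y, c.partner (sh y) = sh (d.partner y) ∧ c.word (sh y) = d.word y) : c = d.iota := by
  have key : ∀ x, c.partner x = d.iota.partner x ∧ c.word x = d.iota.word x := by
    intro x
    rcases pt_cases x with rfl | rfl | rfl | rfl | ⟨y, rfl⟩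
    · simpa using h1
    · simpa using h2
    · simpa using h3
    · simpa using h4
    · simpa using h5 y
  ext1
  · funext x; exact (key x).1
  · funext x; exact (key x).2

theorem iota_injective : Function.Injective (iota : PreDiagram m → PreDiagram (m + 2)) := by
  intro d d' h
  ext1
  · funext x
    have := congrArg (fun c => c.partner (sh x)) h
    simpa using this
  · funext x
    have := congrArg (fun c => c.word (sh x)) h
    simpa using this

theorem iota_join (d : PreDiagram m) (α β : Pt m) :
    d.iota.join (sh α) (sh β) = (d.join α β).iota := by
  have e := fun x : Pt m => (sh_ne x).1.symm
  have e2 := fun x : Pt m => (sh_ne x).2.1.symm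
  have e3 := fun x : Pt m => (sh_ne x).2.2.1.symm
  have e4 := fun x : Pt m => (sh_ne x).2.2.2.symm
  refine eq_iota ?_ ?_ ?_ ?_ fun y => ?_
  · simp [join, e]
  · simp [join, e2]
  · simp [join, e3]
  · simp [join, e4]
  · simp only [join, sh_inj, iota_partner_sh, iota_word_sh]
    exact ⟨by split_ifs <;> rfl, trivial⟩

theorem iota_addBlob (d : PreDiagram m) (α : Pt m) (g : Blob) :
    d.iota.addBlob (sh α) g = (d.addBlob α g).iota := by
  have e := fun x : Pt m => (sh_ne x).1.symm
  have e2 := fun x : Pt m => (sh_ne x).2.1.symm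
  have e3 := fun x : Pt m => (sh_ne x).2.2.1.symm
  have e4 := fun x : Pt m => (sh_ne x).2.2.2.symm
  refine eq_iota ?_ ?_ ?_ ?_ fun y => ?_
  · simp [addBlob, e]
  · simp [addBlob, e2]
  · simp [addBlob, e3]
  · simp [addBlob, e4]
  · simp [addBlob]

variable [NeZero m]

/-- A left blob for the remaining vertices is first put on the left cap. Joining vertices 1 and 2
moves it to the line that ended at 2, whose end is then at 0; joining 0 and 1 brings this end back
to 2 and restores the cap. -/
theorem iota_addBlob_zero {d : PreDiagram m} (hd : d.IsMatching) :
    ((d.iota.addBlob (.inr 0) L).join (.inr 1) (.inr 2)).join (.inr 0) (.inr 1) =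
      (d.addBlob (.inr 0) L).iota := by
  have hm := NeZero.pos m
  have h2 : (Sum.inr 2 : Pt (m + 2)) = sh (.inr 0) := by
    obtain ⟨m, rfl⟩ : ∃ l, m = l + 1 := ⟨m - 1, by omega⟩
    rfl
  rw [h2]
  have e := fun x : Pt m => (sh_ne x).1.symm
  have e2 := fun x : Pt m => (sh_ne x).2.1.symm
  have e3 := fun x : Pt m => (sh_ne x).2.2.1.symm
  have e4 := fun x : Pt m => (sh_ne x).2.2.2.symm
  have e3' := fun x : Pt m => (sh_ne x).2.2.1
  have e4' := fun x : Pt m => (sh_ne x).2.2.2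
  have h0 := hd.ne_self (.inr 0)
  have h0' := h0.symm
  refine eq_iota ?_ ?_ ?_ ?_ fun y => ?_
  · simp [join, addBlob, e, e3]
  · simp [join, addBlob, e2, e3]
  · simp
  · simp
  · by_cases h1 : y = .inr 0
    · subst h1; simp [join, addBlob, e3, e4, e3', e4', h0']
    by_cases h3 : y = d.partner (.inr 0)
    · subst h3; simp [join, addBlob, e3, e4, e3', e4', h0, hd.invol]
    · simp [join, addBlob, e3, e4, e3', e4', h1, h3]

/-- The words for the products of the cup-cap on the left with the generators on the remaining
vertices. -/
def hatLetter (g : Fin (m + 1)) : List (Fin (m + 3)) := if g = 0 then [0, 2, 1] else [g.succ.succ]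

/-- The word for the product of the cup-cap on the left with a word in the generators on the
remaining vertices. -/
def hat (l : List (Fin (m + 1))) : List (Fin (m + 3)) := l.flatMap hatLetter

section

variable {k : Type*} [Field k] (q : Params k) {d : PreDiagram m}

omit [NeZero m] in
theorem joinWeight_iota (α β : Pt m) :
    joinWeight q d.iota (sh α) (sh β) = joinWeight q d α β := by
  simp [joinWeight]

theorem ract_hatLetter (hd : d.IsMatching) (g : Fin (m + 1)) :
    d.iota.ractList (hatLetter g) = (d.ract g).iota ∧
      rweightList q d.iota (hatLetter g) = rweight q d g := by
  have hm := NeZero.pos m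
  have v1 : ((1 : Fin (m + 3)) : ℕ) = 1 := rfl
  have v2 : ((2 : Fin (m + 3)) : ℕ) = 2 := by
    obtain ⟨m, rfl⟩ : ∃ l, m = l + 1 := ⟨m - 1, by omega⟩
    rfl
  have u1 : ((1 : Fin (m + 2)) : ℕ) = 1 := rfl
  -- The numeral is reduced modulo `m + 2`, so this needs `m` to be positive.
  have u2 : ((2 : Fin (m + 2)) : ℕ) = 2 := by
    obtain ⟨m, rfl⟩ : ∃ l, m = l + 1 := ⟨m - 1, by omega⟩
    rfl
  have hsh2 : (Sum.inr 2 : Pt (m + 2)) = sh (.inr 0) := by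
    obtain ⟨m, rfl⟩ : ∃ l, m = l + 1 := ⟨m - 1, by omega⟩
    rfl
  by_cases h0 : g = 0
  · subst h0
    have a1 : ∀ c : PreDiagram (m + 2), c.ract 2 = c.join (.inr 1) (.inr 2) := fun c =>
      ract_mid c (by rw [u1, v2]) (by rw [u2, v2])
    have a2 : ∀ c : PreDiagram (m + 2), c.ract 1 = c.join (.inr 0) (.inr 1) := fun c =>
      ract_mid c rfl rfl
    have b1 : ∀ c : PreDiagram (m + 2), rweight q c 2 = joinWeight q c (.inr 1) (.inr 2) :=
      fun c => rweight_mid q c (by rw [u1, v2]) (by rw [u2, v2])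
    have b2 : ∀ c : PreDiagram (m + 2), rweight q c 1 = joinWeight q c (.inr 0) (.inr 1) :=
      fun c => rweight_mid q c rfl rfl
    simp only [hatLetter, if_true, ractList_cons, ractList_nil, rweightList, ract_zero,
      rweight_zero, a1, a2, b1, b2]
    refine ⟨iota_addBlob_zero hd, ?_⟩
    have e4 := fun x : Pt m => (sh_ne x).2.2.2
    have e3 := fun x : Pt m => (sh_ne x).2.2.1.symm
    rw [hsh2]
    simp [joinWeight, join, e3, e4]
  · rcases ract_cases q g with ⟨hi, h1, w1⟩ | ⟨hi, h1, w1⟩ | ⟨a, b, hab, h1, w1⟩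
    · exact absurd hi h0
    · have hl : hatLetter g = [Fin.last (m + 2)] := by
        rw [hatLetter, if_neg h0, hi]; rfl
      rw [hl]
      simp only [ractList_cons, ractList_nil, rweightList, ract_last, rweight_last, h1, w1, mul_one]
      refine ⟨?_, trivial⟩
      rw [← iota_addBlob, sh_inr]
      congr 2
      simp [Fin.ext_iff, Fin.val_rev]
      omega
    · have hl : hatLetter g = [g.succ.succ] := by
        rw [hatLetter, if_neg h0]
      have hA : ((a.succ.succ : Fin (m + 2)) : ℕ) + 1 = (g.succ.succ : Fin (m + 3)) := by
        simp; omega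
      have hB : ((b.succ.succ : Fin (m + 2)) : ℕ) = (g.succ.succ : Fin (m + 3)) := by
        simp; omega
      rw [hl]
      simp only [ractList_cons, ractList_nil, rweightList, mul_one]
      rw [ract_mid _ hA hB, rweight_mid q _ hA hB, h1, w1, ← sh_inr, ← sh_inr, iota_join,
        joinWeight_iota]
      exact ⟨rfl, rfl⟩

theorem ractList_hat (hd : d.IsMatching) (l : List (Fin (m + 1))) :
    d.iota.ractList (hat l) = (d.ractList l).iota ∧
      rweightList q d.iota (hat l) = rweightList q d l := by
  induction l generalizing d with
  | nil => exact ⟨rfl, rfl⟩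
  | cons g l ih =>
    obtain ⟨h1, h2⟩ := ract_hatLetter q hd g
    obtain ⟨h3, h4⟩ := ih (hd.ract g)
    have : hat (g :: l) = hatLetter g ++ hat l := by simp [hat]
    rw [this, ractList_append, rweightList_append, h1, h2, h3, h4]
    exact ⟨rfl, rfl⟩

omit [NeZero m] in
theorem iota_one : (one m).iota = raw [1] := by
  have : raw [(1 : Fin (m + 3))] = (one (m + 2)).join (.inr 0) (.inr 1) := by
    rw [raw, ractList_cons, ractList_nil]
    exact ract_mid _ rfl rfl
  rw [this]
  symm
  have e3 := fun x : Pt m => (sh_ne x).2.2.1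
  have e4 := fun x : Pt m => (sh_ne x).2.2.2
  have e1 := fun x : Pt m => (sh_ne x).1
  have e2 := fun x : Pt m => (sh_ne x).2.1
  refine eq_iota ?_ ?_ ?_ ?_ fun y => ?_
  · simp [join]
  · simp [join]
  · simp
  · simp
  · simp only [join, e1, e2, e3, e4, one_partner_inr, one_word]
    rcases y with y | y <;> exact ⟨rfl, rfl⟩

theorem raw_hat (l : List (Fin (m + 1))) : raw (1 :: hat l) = (raw l).iota := by
  have : raw (1 :: hat l) = (raw [1]).ractList (hat l) := rfl
  rw [this, ← iota_one]
  exact (ractList_hat (⟨0, 0, 0, 0, 0, 0⟩ : Params ℚ) isMatching_one l).1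

theorem rweightList_hat (l : List (Fin (m + 1))) :
    rweightList q (one (m + 2)) (1 :: hat l) = rweightList q (one m) l := by
  rw [rweightList, rweight_one, one_mul]
  have : (one (m + 2)).ract 1 = (one m).iota := iota_one.symm
  rw [this]
  exact (ractList_hat q isMatching_one l).2

omit [NeZero m] in
theorem posL_sh (x : Pt m) : posL (sh x) = posL x + 2 := by
  rcases x with i | i
  · rfl
  · rw [sh_inr, posL_inr, posL_inr]; simp; omega

omit [NeZero m] in
theorem IsMatching.iota (hd : d.IsMatching) : d.iota.IsMatching := by
  have key : ∀ x, d.iota.partner (d.iota.partner x) = x ∧ d.iota.partner x ≠ x ∧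
      d.iota.word (d.iota.partner x) = (d.iota.word x).reverse := by
    intro x
    rcases pt_cases x with rfl | rfl | rfl | rfl | ⟨y, rfl⟩
    · simp
    · simp
    · simp
    · simp
    · simp [hd.invol, hd.ne_self, hd.word_partner]
  exact ⟨fun x => (key x).1, fun x => (key x).2.1, fun x => (key x).2.2⟩

omit [NeZero m] in
theorem straightenLines_iota : straightenLines q d.iota = (straightenLines q d).iota := by
  refine eq_iota ⟨rfl, rfl⟩ ⟨rfl, rfl⟩ ⟨rfl, rfl⟩ ⟨rfl, rfl⟩ fun y => ?_
  simp [straightenLines_partner, straightenLines_word]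

omit [NeZero m] in
theorem lineScalar_iota (hd : d.IsMatching) : lineScalar q d.iota = lineScalar q d := by
  have hi := hd.iota
  rw [lineScalar_split q hi (.inl 0), restScalar_split q hi (x := .inr 0) (by simp) (by simp)]
  simp only [iota_partner_inl_zero, iota_partner_inr_zero, iota_word_inl_zero, iota_word_inr_zero,
    straightenWord, one_mul]
  symm
  refine Finset.prod_bij (fun x _ => sh x) ?_ ?_ ?_ ?_
  · intro x hx
    have hx' := (Finset.mem_filter.1 hx).2
    obtain ⟨e1, e2, e3, e4⟩ := sh_ne x
    refine Finset.mem_filter.2 ⟨Finset.mem_univ _, ?_, ?_⟩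
    · rw [iota_partner_sh, posL_sh, posL_sh]; omega
    · simp [e1, e2, e3, e4]
  · intro x _ y _ h; exact sh_injective h
  · intro x hx
    obtain ⟨-, h1, h2⟩ := Finset.mem_filter.1 hx
    rcases pt_cases x with rfl | rfl | rfl | rfl | ⟨y, rfl⟩
    · simp at h2
    · simp at h2
    · simp at h2
    · simp at h2
    · rw [iota_partner_sh, posL_sh, posL_sh] at h1
      exact ⟨y, Finset.mem_filter.2 ⟨Finset.mem_univ _, by omega⟩, rfl⟩
  · intro x _; rw [iota_word_sh]

omit [NeZero m] in
theorem IsDouble.iota {i i' j j' : Fin m} (hD : d.IsDouble i i' j j') :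
    d.iota.IsDouble i.succ.succ i'.succ.succ j.succ.succ j'.succ.succ where
  lt_top := by simpa using hD.lt_top
  lt_bot := by simpa using hD.lt_bot
  top := by rw [← sh_inl, iota_partner_sh, hD.top]; rfl
  top' := by rw [← sh_inl, iota_partner_sh, hD.top']; rfl
  bot := by rw [← sh_inr, iota_partner_sh, hD.bot]; rfl
  bot' := by rw [← sh_inr, iota_partner_sh, hD.bot']; rfl
  word_top := by rw [← sh_inl, iota_word_sh, hD.word_top]
  word_top' := by rw [← sh_inl, iota_word_sh, hD.word_top']
  word_bot := by rw [← sh_inr, iota_word_sh, hD.word_bot]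
  word_bot' := by rw [← sh_inr, iota_word_sh, hD.word_bot']

omit [NeZero m] in
theorem IsDouble.iota_reconnect {i i' j j' : Fin m} (hD : d.IsDouble i i' j j') :
    (d.reconnect i j).iota = d.iota.reconnect i.succ.succ j.succ.succ := by
  obtain ⟨p1, p2, p3, p4⟩ := hD.reconnect_partner
  obtain ⟨w1, w2, w3, w4⟩ := hD.reconnect_word
  refine hD.iota.eq_reconnect ?_ ?_ ?_ ?_ fun x h1 h2 h3 h4 => ?_
  · rw [← sh_inl, iota_partner_sh, iota_word_sh, p1, w1]; exact ⟨rfl, rfl⟩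
  · rw [← sh_inr, iota_partner_sh, iota_word_sh, p2, w2]; exact ⟨rfl, rfl⟩
  · rw [← sh_inl, iota_partner_sh, iota_word_sh, p3, w3]; exact ⟨rfl, rfl⟩
  · rw [← sh_inr, iota_partner_sh, iota_word_sh, p4, w4]; exact ⟨rfl, rfl⟩
  · rcases pt_cases x with rfl | rfl | rfl | rfl | ⟨y, rfl⟩
    · simp
    · simp
    · simp
    · simp
    · rcases hD.reconnect_cases y with hu | hu | hu | hu | hu
      · exact absurd (by rw [hu.1]; rfl) h1
      · exact absurd (by rw [hu.1]; rfl) h2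
      · exact absurd (by rw [hu.1]; rfl) h3
      · exact absurd (by rw [hu.1]; rfl) h4
      · simp [hu.2]

omit [NeZero m] in
theorem DoubleAt.of_iota {side : ∀ m, Fin m → Pt m} (hs : side = (fun _ => Sum.inl) ∨
    side = fun _ => Sum.inr) {i : Fin (m + 2)} (h : d.iota.DoubleAt (side (m + 2)) i) :
    ∃ i, d.DoubleAt (side m) i := by
  obtain ⟨⟨j, hj⟩, hw⟩ := h
  rcases hs with rfl | rfl
  · rcases pt_cases (.inl i : Pt (m + 2)) with h | h | h | h | ⟨y, h⟩
    iterate 4 simp only [h] at hw; simp at hw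
    simp only [h, iota_word_sh, iota_partner_sh] at hw hj
    rcases y with y | y
    · refine ⟨y, ?_, hw⟩
      rcases hz : d.partner (.inl y) with z | z
      · exact ⟨z, rfl⟩
      · rw [hz] at hj; simp [sh] at hj
    · simp [sh] at h
  · rcases pt_cases (.inr i : Pt (m + 2)) with h | h | h | h | ⟨y, h⟩
    iterate 4 simp only [h] at hw; simp at hw
    simp only [h, iota_word_sh, iota_partner_sh] at hw hj
    rcases y with y | y
    · simp [sh] at h
    · refine ⟨y, ?_, hw⟩
      rcases hz : d.partner (.inr y) with z | z
      · rw [hz] at hj; simp [sh] at hj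
      · exact ⟨z, rfl⟩

omit [NeZero m] in
theorem topological_iota (h : d.IsLRBlob) (h' : d.iota.IsLRBlob) :
    topological q d.iota = ((topological q d).1, (topological q d).2.iota) := by
  rcases h.topological_cases q with hc | ⟨i, i', j, j', hD, hc⟩
  · rw [hc.2, topological_of_not q h']
    rintro ⟨⟨i, hi⟩, ⟨j, hj⟩⟩
    exact hc.1 ⟨DoubleAt.of_iota (side := fun _ => Sum.inl) (.inl rfl) hi,
      DoubleAt.of_iota (side := fun _ => Sum.inr) (.inr rfl) hj⟩
  · rw [hc, hD.iota.topological_eq q h', hD.iota_reconnect]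

theorem wdiag_hat (l : List (Fin (m + 1))) : wdiag q (1 :: hat l) = (wdiag q l).iota := by
  have h1 := (isLRBlob_raw (1 :: hat l)).straightenLines q
  rw [raw_hat, straightenLines_iota] at h1
  rw [wdiag, wdiag, red, red, raw_hat, straightenLines_iota,
    topological_iota q ((isLRBlob_raw l).straightenLines q) h1]

theorem wscalar_hat (l : List (Fin (m + 1))) : wscalar q (1 :: hat l) = wscalar q l := by
  have h1 := (isLRBlob_raw (1 :: hat l)).straightenLines q
  rw [raw_hat, straightenLines_iota] at h1
  rw [wscalar, wscalar, redScalar, redScalar, rweightList_hat, raw_hat, straightenLines_iota,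
    topological_iota q ((isLRBlob_raw l).straightenLines q) h1,
    lineScalar_iota q (isMatching_raw l)]

/-- Relations on `m` vertices become relations on `m + 2` vertices between words that begin with the
cup-cap on the left. -/
theorem WEq.hat {c : k} {u v : List (Fin (m + 1))} (h : WEq q c u v) :
    WEq q c (1 :: hat u) (1 :: PreDiagram.hat v) :=
  ⟨by rw [wdiag_hat, wdiag_hat, h.1], by rw [wscalar_hat, wscalar_hat, h.2]⟩

end

end PreDiagram

end SympBlob

namespace SympBlob

open Blob

namespace PreDiagram

/-! ### The relations that involve all generators -/

/-- The letters of `I`. -/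
def listI (n : ℕ) : List (Fin (n + 1)) :=
  (List.finRange (n + 1)).filter (fun i : Fin (n + 1) => (i : ℕ) % 2 = 1)

/-- The letters of `J`. -/
def listJ (n : ℕ) : List (Fin (n + 1)) :=
  (List.finRange (n + 1)).filter (fun i : Fin (n + 1) => (i : ℕ) % 2 = 0)

theorem finRange_add_three (m : ℕ) : List.finRange (m + 3) =
    0 :: 1 :: (List.finRange (m + 1)).map (fun i => i.succ.succ) := by
  rw [List.finRange_succ, List.finRange_succ]
  simp [Function.comp_def]

theorem listI_add_two (m : ℕ) : listI (m + 2) = 1 :: (listI m).map (fun i => i.succ.succ) := by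
  rw [listI, finRange_add_three, List.filter_cons_of_neg (by simp),
    List.filter_cons_of_pos (by simp), List.filter_map, listI]
  congr 3
  funext i
  simp
  omega

theorem listJ_add_two (m : ℕ) : listJ (m + 2) = 0 :: (listJ m).map (fun i => i.succ.succ) := by
  rw [listJ, finRange_add_three, List.filter_cons_of_pos (by simp),
    List.filter_cons_of_neg (by simp), List.filter_map, listJ]
  congr 3
  funext i
  simp
  omega

/-- The letters of `J` but the first. -/
def tailJ (n : ℕ) : List (Fin (n + 1)) :=
  (List.finRange (n + 1)).filter (fun i : Fin (n + 1) => (i : ℕ) % 2 = 0 ∧ 2 ≤ (i : ℕ))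

theorem listJ_eq (n : ℕ) : listJ n = 0 :: tailJ n := by
  rw [listJ, tailJ, List.finRange_succ, List.filter_cons_of_pos (by simp),
    List.filter_cons_of_neg (by simp)]
  congr 1
  refine List.filter_congr fun i hi => ?_
  obtain ⟨j, -, rfl⟩ := List.mem_map.1 hi
  simp
  omega

section

variable {n : ℕ} [NeZero n] {k : Type*} [Field k] {q : Params k}

theorem WEq.one_trans' {c : k} {u u' v w : List (Fin (n + 1))} (h : WEq q 1 u v) (hu : u' = u)
    (h' : WEq q c v w) : WEq q c u' w := by
  subst hu; simpa using h.trans h'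

theorem WEq.trans_one {c : k} {u v w : List (Fin (n + 1))} (h : WEq q c u v)
    (h' : WEq q 1 v w) : WEq q c u w := by
  simpa using h.trans h'

theorem WEq.symm_one {u v : List (Fin (n + 1))} (h : WEq q 1 u v) : WEq q 1 v u := by
  simpa using h.symm one_ne_zero

theorem WEq.congr {c : k} {u u' v v' : List (Fin (n + 1))} (h : WEq q c u v) (hu : u' = u)
    (hv : v' = v) : WEq q c u' v' := by
  subst hu hv; exact h

variable (q)

theorem wEq_comm_list (a : Fin (n + 1)) (l : List (Fin (n + 1)))
    (h : ∀ b ∈ l, (a : ℕ) + 1 < b ∨ (b : ℕ) + 1 < a) : WEq q 1 (a :: l) (l ++ [a]) := by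
  induction l with
  | nil => exact WEq.refl _
  | cons b l ih =>
    have h1 : WEq q 1 [a, b] [b, a] := by
      rcases h b (by simp) with h | h
      · exact wEq_comm q a b h
      · simpa using (wEq_comm q b a h).symm one_ne_zero
    have h2 := (h1.append_right l).trans
      ((ih fun b hb => h b (by simp [hb])).append_left [b])
    simpa using h2

theorem wEq_of_straightenLines {c : k} {u v : List (Fin (n + 1))}
    (h1 : straightenLines q (raw u) = straightenLines q (raw v))
    (h2 : rweightList q (one n) u * lineScalar q (raw u) =
      c * (rweightList q (one n) v * lineScalar q (raw v))) : WEq q c u v := by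
  refine ⟨by rw [wdiag, wdiag, red, red, h1], ?_⟩
  rw [wscalar, wscalar, redScalar, redScalar, h1, ← mul_assoc, h2]
  ring

end

section

variable {k : Type*} [Field k] (q : Params k)

/-- There is a single line, and the relations are the rules for `RLR` and `LRL`. -/
theorem wEq_IJI_JIJ_one :
    WEq q q.κLR (listI 1 ++ listJ 1 ++ listI 1) (listI 1) ∧
      WEq q q.κLR (listJ 1 ++ listI 1 ++ listJ 1) (listJ 1) := by
  have hI : listI 1 = [1] := by decide
  have hJ : listJ 1 = [0] := by decide
  have hr : ∀ d : PreDiagram 1, restScalar q d {.inr 0, .inl 0} = 1 := fun d =>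
    restScalar_eq_one q fun x hx => absurd (by revert x; decide) hx
  have hs : ∀ l, lineScalar q (raw l) = (straightenWord q ((raw l).word (.inr (0 : Fin 1)))).1 := by
    intro l
    have hp : (raw l).partner (.inr (0 : Fin 1)) = .inl 0 := by
      have := (isMatching_raw l).ne_self (.inr (0 : Fin 1))
      generalize (raw l).partner (.inr (0 : Fin 1)) = y at this
      revert y; decide
    rw [lineScalar_split q (isMatching_raw l) (.inr 0), hp, hr, mul_one]
  rw [hI, hJ]
  constructor
  · refine wEq_of_straightenLines q ?_ ?_
    · ext1
      · funext x; fin_cases x <;> rfl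
      · funext x; fin_cases x <;> rfl
    · rw [hs, hs]
      have e1 : (raw ([1] ++ [0] ++ [1])).word (.inr (0 : Fin 1)) = [R, L, R] := by decide
      have e2 : (raw [1]).word (.inr (0 : Fin 1)) = [R] := by decide
      rw [e1, e2]
      simp [straightenWord, push, rweightList, rweight]
  · refine wEq_of_straightenLines q ?_ ?_
    · ext1
      · funext x; fin_cases x <;> rfl
      · funext x; fin_cases x <;> rfl
    · rw [hs, hs]
      have e1 : (raw ([0] ++ [1] ++ [0])).word (.inr (0 : Fin 1)) = [L, R, L] := by decide
      have e2 : (raw [0]).word (.inr (0 : Fin 1)) = [L] := by decide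
      rw [e1, e2]
      simp [straightenWord, push, rweightList, rweight]

/-- `IJI` closes a loop with both blobs, while `JIJ` is an instance of the topological relation. -/
theorem wEq_IJI_JIJ_two :
    WEq q q.κLR (listI 2 ++ listJ 2 ++ listI 2) (listI 2) ∧
      WEq q q.κLR (listJ 2 ++ listI 2 ++ listJ 2) (listJ 2) := by
  have hI : listI 2 = [1] := by decide
  have hJ : listJ 2 = [0, 2] := by decide
  rw [hI, hJ]
  have w0 : ∀ d : PreDiagram 2, rweight q d 0 = 1 := rweight_zero q
  have w1 : ∀ d : PreDiagram 2, rweight q d 1 = joinWeight q d (.inr 0) (.inr 1) := fun d =>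
    rweight_mid q d rfl rfl
  have w2 : ∀ d : PreDiagram 2, rweight q d 2 = 1 := rweight_last q
  constructor
  · refine wEq_of_raw ?_ ?_
    · have h1 : ∀ x, (raw ([1] ++ [0, 2] ++ [1]) : PreDiagram 2).partner x = (raw [1]).partner x := by
        decide
      have h2 : ∀ x, (raw ([1] ++ [0, 2] ++ [1]) : PreDiagram 2).word x = (raw [1]).word x := by
        decide
      ext1
      · funext x; exact h1 x
      · funext x; exact h2 x
    · simp only [List.cons_append, List.nil_append, rweightList, w0, w1, w2, one_mul, mul_one]
      have e1 : joinWeight q (one 2) (.inr 0) (.inr 1) = 1 := by simp [joinWeight]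
      have e2 : (((one 2).ract 1).ract 0).ract 2 = raw [1, 0, 2] := rfl
      have e3 : (raw [1, 0, 2] : PreDiagram 2).partner (.inr 0) = .inr 1 := by decide
      have e4 : (raw [1, 0, 2] : PreDiagram 2).word (.inr 0) = [L, R] := by decide
      rw [e1, e2, joinWeight, if_pos e3, e4, one_mul, mul_one]
      simp [loopWeight]
  · set u : List (Fin 3) := [0, 2] ++ [1] ++ [0, 2] with hu
    have hD : (raw u : PreDiagram 2).IsDouble 0 1 0 1 := by
      constructor <;> decide
    have hN : (raw u : PreDiagram 2).Normal := fun x => by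
      fin_cases x
      · exact hD.word_top ▸ by simp [IsNormal]
      · exact hD.word_top' ▸ by simp [IsNormal]
      · exact hD.word_bot ▸ by simp [IsNormal]
      · exact hD.word_bot' ▸ by simp [IsNormal]
    have hr : raw [0, 2] = (raw u : PreDiagram 2).reconnect 0 0 := by
      have h1 : ∀ x, (raw [0, 2] : PreDiagram 2).partner x =
        ((raw u : PreDiagram 2).reconnect 0 0).partner x := by decide
      have h2 : ∀ x, (raw [0, 2] : PreDiagram 2).word x =
        ((raw u : PreDiagram 2).reconnect 0 0).word x := by decide
      ext1
      · funext x; exact h1 x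
      · funext x; exact h2 x
    have hN' : (raw [0, 2] : PreDiagram 2).Normal := by
      rw [hr]; exact hD.normal_reconnect hN
    have := red_eq_of_reconnect (c := raw [0, 2]) (s := 1) (t := 1) q (isLRBlob_raw u)
      (by rw [hN.straightenLines_eq]; exact hD)
      (by rw [hN.straightenLines_eq, hN'.straightenLines_eq, hr])
      (by rw [hN.lineScalar_eq, hN'.lineScalar_eq])
    refine ⟨this.1, ?_⟩
    have hw : rweightList q (one 2) u = 1 := by
      simp only [hu, List.cons_append, List.nil_append, rweightList, w0, w1, w2, one_mul, mul_one]
      have e3 : (((one 2).ract 0).ract 2).partner (.inr 0) = .inl 0 := by decide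
      rw [joinWeight, e3]; simp
    have hw' : rweightList q (one 2) [0, 2] = 1 := by
      simp only [rweightList, w0, w2, mul_one]
    rw [wscalar, wscalar, hw, hw']
    exact this.2

variable {m : ℕ}

theorem hat_eq_map {l : List (Fin (m + 1))} (hl : ∀ i ∈ l, i ≠ 0) :
    hat l = l.map fun i => i.succ.succ := by
  induction l with
  | nil => rfl
  | cons i l ih =>
    have h1 : hat (i :: l) = hatLetter i ++ hat l := by simp [hat]
    rw [h1, ih fun j hj => hl j (by simp [hj]), hatLetter, if_neg (hl i (by simp))]; rfl

theorem hat_append (u v : List (Fin (m + 1))) : hat (u ++ v) = hat u ++ hat v :=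
  List.flatMap_append

theorem hat_listI : hat (listI m) = (listI m).map fun i => i.succ.succ := by
  refine hat_eq_map fun i hi => ?_
  rintro rfl
  simp [listI] at hi

theorem hat_listJ : hat (listJ m) = [0, 2, 1] ++ (tailJ m).map fun i => i.succ.succ := by
  have h1 : hat (listJ m) = hatLetter 0 ++ hat (tailJ m) := by simp [hat, listJ_eq]
  rw [h1, hat_eq_map]
  · rfl
  · rintro i hi rfl
    simp [tailJ] at hi

/-- Write I = 1 O and J = 0 2 Ev for `m + 2`, where the letters of Ev are at least 4. Then `hat`
turns the I and J for `m` into O and 0 2 1 Ev. Since 1 commutes with Ev, `IJI` is immediate, and the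
relation `JIJ` for `m` gives 1 J I J 1 = κLR 1 J 1. The outer letters are removed by J = 2 1 J and J
= J 1 2. These use a braid relation between 1 and 2, which needs at least three vertices; therefore
both one and two vertices are base cases. -/
theorem wEq_IJI_JIJ_add_two [NeZero m]
    (h : WEq q q.κLR (listI m ++ listJ m ++ listI m) (listI m) ∧
      WEq q q.κLR (listJ m ++ listI m ++ listJ m) (listJ m)) :
    WEq q q.κLR (listI (m + 2) ++ listJ (m + 2) ++ listI (m + 2)) (listI (m + 2)) ∧
      WEq q q.κLR (listJ (m + 2) ++ listI (m + 2) ++ listJ (m + 2)) (listJ (m + 2)) := by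
  have hm := NeZero.pos m
  have v2 : ((2 : Fin (m + 3)) : ℕ) = 2 := by
    change 2 % (m + 3) = 2
    exact Nat.mod_eq_of_lt (by omega)
  have v1 : ((1 : Fin (m + 3)) : ℕ) = 1 := rfl
  have e2 : (0 : Fin (m + 1)).succ.succ = (2 : Fin (m + 3)) := Fin.ext (by rw [v2]; rfl)
  obtain ⟨h1, h2⟩ := h
  have hI := listI_add_two m
  have hJ := listJ_add_two m
  have hI' := hat_listI (m := m)
  have hJ' := hat_listJ (m := m)
  rw [listJ_eq m, List.map_cons, e2] at hJ
  have hO : ∀ b : Fin (m + 3), b ∈ (tailJ m).map (fun i => i.succ.succ) → 4 ≤ (b : ℕ) := by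
    intro b hb
    obtain ⟨i, hi, rfl⟩ := List.mem_map.1 hb
    simp [tailJ] at hi
    simp; omega
  generalize (listI m).map (fun i => i.succ.succ) = O at *
  generalize (tailJ m).map (fun i => i.succ.succ) = Ev at *
  have c1 : WEq q 1 (1 :: Ev) (Ev ++ [1]) :=
    wEq_comm_list q 1 Ev fun b hb => .inl (by rw [v1]; have := hO b hb; omega)
  have c2 : WEq q 1 (2 :: Ev) (Ev ++ [2]) :=
    wEq_comm_list q 2 Ev fun b hb => .inl (by rw [v2]; have := hO b hb; omega)
  have k1 := h1.hat q
  have k2 := h2.hat q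
  rw [hat_append, hat_append, hI', hJ'] at k1 k2
  rw [hI, hJ]
  constructor
  · refine (c1.append (1 :: (O ++ [0, 2])) O).symm_one.one_trans' (by simp) ?_
    exact k1.congr (by simp) (by simp)
  · have k3 : WEq q q.κLR ([1] ++ (0 :: 2 :: Ev ++ 1 :: O ++ 0 :: 2 :: Ev) ++ [1])
        ([1] ++ 0 :: 2 :: Ev ++ [1]) := by
      refine (c1.append [1, 0, 2] (O ++ [0, 2] ++ (Ev ++ [1]))).symm_one.one_trans' (by simp) ?_
      refine (c1.append_left ([1, 0, 2, 1] ++ Ev ++ O ++ [0, 2])).symm_one.one_trans' (by simp) ?_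
      refine WEq.trans_one (k2.congr (by simp) rfl) ?_
      exact (c1.append_left [1, 0, 2]).congr (by simp) (by simp)
    have b0 : WEq q 1 [0, 2] [(2 : Fin (m + 3)), 0] :=
      wEq_comm q (0 : Fin (m + 3)) 2 (by rw [v2]; simp)
    have b1 : WEq q 1 [2, 1, 2] [(2 : Fin (m + 3))] :=
      wEq_braid_down q 1 2 le_rfl (by rw [v2, v1]) (by rw [v2]; omega)
    -- 2 1 0 2 Ev = 2 1 2 0 Ev = 2 0 Ev = 0 2 Ev; the next claim is the analogue on the right.
    have b3 : WEq q 1 ([2, 1] ++ 0 :: 2 :: Ev) (0 :: 2 :: Ev) := by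
      refine (b0.append [2, 1] Ev).one_trans' (by simp) ?_
      refine (b1.append_right (0 :: Ev)).one_trans' (by simp) ?_
      exact (b0.append_right Ev).symm_one.congr (by simp) (by simp)
    have b4 : WEq q 1 (0 :: 2 :: Ev ++ [1, 2]) (0 :: 2 :: Ev) := by
      refine (c1.append [0, 2] [2]).symm_one.one_trans' (by simp) ?_
      refine (c2.append_left [0, 2, 1]).symm_one.one_trans' (by simp) ?_
      exact (b1.append [0] Ev).congr (by simp) (by simp)
    refine (b3.append_right (1 :: O ++ 0 :: 2 :: Ev)).symm_one.one_trans' (by simp) ?_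
    refine (b4.append_left ([2, 1] ++ 0 :: 2 :: Ev ++ 1 :: O)).symm_one.one_trans' (by simp) ?_
    refine WEq.trans_one ((k3.append [2] [2]).congr (by simp) rfl) ?_
    refine (b3.append_right [1, 2]).one_trans' (by simp) ?_
    exact b4.congr (by simp) rfl

theorem wEq_IJI_JIJ : ∀ (n : ℕ) [NeZero n],
    WEq q q.κLR (listI n ++ listJ n ++ listI n) (listI n) ∧
      WEq q q.κLR (listJ n ++ listI n ++ listJ n) (listJ n)
  | 0, h => absurd rfl h.ne
  | 1, _ => wEq_IJI_JIJ_one q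
  | 2, _ => wEq_IJI_JIJ_two q
  | m + 3, _ => wEq_IJI_JIJ_add_two (m := m + 1) q (wEq_IJI_JIJ (m + 1))

end

end PreDiagram

end SympBlob

namespace SympBlob

open PreDiagram

/-! ### The monoid version of the presentation -/

/-- The value of a word. -/
def eval {n : ℕ} {M : Type*} [Monoid M] (g : ℕ → M) (l : List (Fin (n + 1))) : M :=
  (l.map fun i => g i).prod

/-- The relations of the presentation, with all parameters equal to `1`. -/
structure MonRel (n : ℕ) {M : Type*} [Monoid M] (g : ℕ → M) : Prop where
  comm : ∀ i j, i + 1 < j → j ≤ n → g i * g j = g j * g i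
  idem : ∀ i, i ≤ n → g i * g i = g i
  left : 2 ≤ n → g 1 * g 0 * g 1 = g 1
  right : ∀ i, 1 ≤ i → i + 1 = n → g i * g n * g i = g i
  up : ∀ i, 1 ≤ i → i + 1 < n → g i * g (i + 1) * g i = g i
  down : ∀ i, 1 ≤ i → i + 1 < n → g (i + 1) * g i * g (i + 1) = g (i + 1)
  IJI : eval g (listI n) * eval g (listJ n) * eval g (listI n) = eval g (listI n)
  JIJ : eval g (listJ n) * eval g (listI n) * eval g (listJ n) = eval g (listJ n)

section

variable {n : ℕ} {M : Type*} [Monoid M] (g : ℕ → M)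

@[simp] theorem eval_nil : eval (n := n) g [] = 1 := rfl

@[simp] theorem eval_cons (i : Fin (n + 1)) (l : List (Fin (n + 1))) :
    eval g (i :: l) = g i * eval g l := by simp [eval]

@[simp] theorem eval_append (u v : List (Fin (n + 1))) :
    eval g (u ++ v) = eval g u * eval g v := by simp [eval]

theorem commute_eval {x : M} {l : List (Fin (n + 1))} (h : ∀ i ∈ l, x * g i = g i * x) :
    x * eval g l = eval g l * x := by
  induction l with
  | nil => simp
  | cons i l ih =>
    rw [eval_cons, ← mul_assoc, h i (by simp), mul_assoc, ih fun j hj => h j (by simp [hj]),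
      mul_assoc]

end

/-- The elements `x` with `e x = x = x e`, for an idempotent `e`. -/
structure CornerMonoid {M : Type*} [Monoid M] (e : M) (he : e * e = e) where
  val : M
  left : e * val = val
  right : val * e = val

namespace CornerMonoid

variable {M : Type*} [Monoid M] {e : M} {he : e * e = e}

theorem ext' {x y : CornerMonoid e he} (h : x.val = y.val) : x = y := by
  cases x; cases y; cases h; rfl

instance : Monoid (CornerMonoid e he) where
  mul x y := ⟨x.val * y.val, by rw [← mul_assoc, x.left], by rw [mul_assoc, y.right]⟩
  one := ⟨e, he, he⟩
  mul_assoc x y z := ext' (mul_assoc _ _ _)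
  one_mul x := ext' x.left
  mul_one x := ext' x.right

theorem val_mul (x y : CornerMonoid e he) : (x * y).val = x.val * y.val := rfl

theorem val_one : (1 : CornerMonoid e he).val = e := rfl

end CornerMonoid

/-- Multiplying by an idempotent that commutes with the elements preserves the braid-type relations.
-/
theorem corner_word {M : Type*} [Monoid M] {a y z : M} (ha : a * a = a) (hy : a * y = y * a)
    (hz : a * z = z * a) (h : y * z * y = y) : a * y * (a * z) * (a * y) = a * y := by
  have h1 : ∀ w, y * (a * w) = a * (y * w) := fun w => by rw [← mul_assoc, ← hy, mul_assoc]
  have h2 : ∀ w, z * (a * w) = a * (z * w) := fun w => by rw [← mul_assoc, ← hz, mul_assoc]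
  have h3 : ∀ w, a * (a * w) = a * w := fun w => by rw [← mul_assoc, ha]
  simp only [mul_assoc, h1, h2, h3]
  rw [← mul_assoc y, h]

namespace MonRel

theorem comm' {n : ℕ} {M : Type*} [Monoid M] {g : ℕ → M} (h : MonRel n g) {i j : ℕ}
    (hij : i + 1 < j ∨ j + 1 < i) (hi : i ≤ n) (hj : j ≤ n) : g i * g j = g j * g i := by
  rcases hij with hij | hij
  · exact h.comm i j hij hj
  · exact (h.comm j i hij hi).symm

section

variable {m : ℕ} {M : Type*} [Monoid M] {g : ℕ → M} (h : MonRel (m + 2) g)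

include h

theorem idem_one : g 1 * g 1 = g 1 := h.idem 1 (by omega)

/-- The generators on the vertices to the right of the cup-cap on the left. -/
def hatGen (h : MonRel (m + 2) g) (j : ℕ) : CornerMonoid (g 1) h.idem_one :=
  if h0 : j = 0 then ⟨g 1 * g 0 * g 2 * g 1, by simp only [← mul_assoc, h.idem_one],
    by simp only [mul_assoc, h.idem_one]⟩
  else if hj : j ≤ m then ⟨g 1 * g (j + 2), by simp only [← mul_assoc, h.idem_one],
    by rw [mul_assoc, h.comm' (i := j + 2) (j := 1) (by omega) (by omega) (by omega), ← mul_assoc,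
      h.idem_one]⟩
  -- An arbitrary value: the relations for `m` mention only indices up to `m`.
  else 1

theorem hatGen_zero : (h.hatGen 0).val = g 1 * g 0 * g 2 * g 1 := rfl

theorem hatGen_of_pos {j : ℕ} (h0 : 1 ≤ j) (hj : j ≤ m) :
    (h.hatGen j).val = g 1 * g (j + 2) := by
  rw [hatGen, dif_neg (by omega), dif_pos hj]

theorem one_mul_hatLetter (i : Fin (m + 1)) :
    (h.hatGen i).val = g 1 * eval g (hatLetter i) := by
  by_cases h0 : i = 0
  · subst h0
    by_cases hm : m = 0
    · subst hm
      rw [Fin.val_zero, hatGen_zero]; simp [hatLetter, mul_assoc]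
    · have v2 : ((2 : Fin (m + 3)) : ℕ) = 2 := by
        change 2 % (m + 3) = 2
        exact Nat.mod_eq_of_lt (by omega)
      rw [Fin.val_zero, hatGen_zero]; simp only [hatLetter, if_true, eval_cons, eval_nil, mul_assoc, v2, mul_one, Fin.val_zero, Fin.val_one]
  · have h1 : (i : ℕ) ≠ 0 := fun e => h0 (Fin.ext e)
    rw [h.hatGen_of_pos (by omega) (by omega), hatLetter, if_neg h0]
    simp

theorem eval_hat (l : List (Fin (m + 1))) :
    (eval h.hatGen l).val = g 1 * eval g (hat l) := by
  induction l with
  | nil => simp [hat, CornerMonoid.val_one]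
  | cons i l ih =>
    have h1 : hat (i :: l) = hatLetter i ++ hat l := by simp [hat]
    rw [eval_cons, CornerMonoid.val_mul, ih, ← mul_assoc, (h.hatGen i).right,
      h.one_mul_hatLetter, h1, eval_append, mul_assoc]

/-- For positive indices the relations are those for indices larger by two, multiplied by `g 1`.
Relations that involve index 0 come from `g 2 * g 1 * g 2 = g 2` and its neighbours. For the long
relations, the I of `m` is sent to that of `m + 2`, which absorbs `g 1`, and J to `g 1 * J * g 1`.
-/
theorem hatGen_monRel (hm : 1 ≤ m) : MonRel m h.hatGen := by
  have c02 := h.comm 0 2 (by omega) (by omega)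
  have i0 := h.idem 0 (by omega)
  have i1 := h.idem 1 (by omega)
  have i2 := h.idem 2 (by omega)
  have d12 := h.down 1 le_rfl (by omega)
  have l1 := h.left (by omega)
  have cc : ∀ i j, i + 1 < j ∨ j + 1 < i → i ≤ m + 2 → j ≤ m + 2 → g i * g j = g j * g i :=
    fun i j h1 h2 h3 => h.comm' h1 h2 h3
  have E : ∀ j, 1 ≤ j → j ≤ m → (h.hatGen j).val = g 1 * g (j + 2) :=
    fun j => h.hatGen_of_pos
  have c1 : ∀ j, 1 ≤ j → j ≤ m → g 1 * g (j + 2) = g (j + 2) * g 1 := fun j h1 h2 =>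
    cc _ _ (by omega) (by omega) (by omega)
  have hI : (eval h.hatGen (listI m)).val =
      eval g (listI (m + 2)) := by
    have := h.eval_hat (listI m)
    rw [hat_listI] at this
    rw [listI_add_two]
    simpa using this
  have v2 : ((2 : Fin (m + 3)) : ℕ) = 2 := by
    change 2 % (m + 3) = 2
    exact Nat.mod_eq_of_lt (by omega)
  have hJ : (eval h.hatGen (listJ m)).val =
      g 1 * eval g (listJ (m + 2)) * g 1 := by
    have := h.eval_hat (listJ m)
    rw [hat_listJ] at this
    rw [listJ_add_two, listJ_eq]
    have hc : g 1 * eval g ((tailJ m).map fun i => i.succ.succ) =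
        eval g ((tailJ m).map fun i => i.succ.succ) * g 1 := by
      refine commute_eval g fun i hi => ?_
      obtain ⟨j, hj, rfl⟩ := List.mem_map.1 hi
      simp [tailJ] at hj
      refine c1 _ (by omega) (by omega)
    simp only [eval_append, eval_cons, eval_nil, mul_one] at this
    rw [listJ_eq] at this
    rw [this]
    simp only [List.map_cons, eval_cons, mul_assoc, Fin.val_zero, Fin.val_one, v2, hc,
      Fin.val_succ, zero_add]
  have hI1 : g 1 * eval g (listI (m + 2)) =
      eval g (listI (m + 2)) := by
    rw [← hI]; exact CornerMonoid.left _
  have hI2 : eval g (listI (m + 2)) * g 1 =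
      eval g (listI (m + 2)) := by
    rw [← hI]; exact CornerMonoid.right _
  refine ⟨?_, ?_, ?_, ?_, ?_, ?_, ?_, ?_⟩
  · intro i j hij hj
    apply CornerMonoid.ext'
    rw [CornerMonoid.val_mul, CornerMonoid.val_mul, E j (by omega) hj]
    have e1 := c1 j (by omega) hj
    by_cases hi : i = 0
    · subst hi
      rw [h.hatGen_zero]
      have e2 := cc 0 (j + 2) (by omega) (by omega) (by omega)
      have e3 := cc 2 (j + 2) (by omega) (by omega) (by omega)
      have e4 := h.idem (j + 2) (by omega)
      generalize g (j + 2) = x at *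
      have hc : Commute (g 1 * g 0 * g 2 * g 1) x :=
        (((show Commute (g 1) x from e1).mul_left e2).mul_left e3).mul_left e1
      rw [e1, ← mul_assoc, hc.eq, mul_assoc, mul_assoc, mul_assoc, i1]
      simp only [← mul_assoc]
      rw [mul_assoc x (g 1) (g 1), i1]
    · rw [E i (by omega) (by omega)]
      have e2 := cc (i + 2) (j + 2) (by omega) (by omega) (by omega)
      have e3 := c1 i (by omega) (by omega)
      exact (show ∀ a x y : M, a * x = x * a → a * y = y * a → y * x = x * y → a * a = a →
        a * y * (a * x) = a * x * (a * y) by clear * -; intros; grind) _ _ _ e1 e3 e2 i1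
  · intro i hi
    apply CornerMonoid.ext'
    rw [CornerMonoid.val_mul]
    by_cases h0 : i = 0
    · subst h0
      rw [h.hatGen_zero]
      norm_num at d12
      clear hI hJ hI1 hI2 E c1 cc v2
      grind
    · rw [E i (by omega) (by omega)]
      have e3 := c1 i (by omega) (by omega)
      have e5 := h.idem (i + 2) (by omega)
      generalize g (i + 2) = y at *
      clear hI hJ hI1 hI2 E c1 cc v2
      grind
  · intro h2
    apply CornerMonoid.ext'
    rw [CornerMonoid.val_mul, CornerMonoid.val_mul, h.hatGen_zero, E 1 le_rfl (by omega)]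
    have e1 := h.down 2 (by omega) (by omega)
    have e2 := cc 1 3 (by omega) (by omega) (by omega)
    have e3 := cc 0 3 (by omega) (by omega) (by omega)
    have e4 := h.idem 3 (by omega)
    norm_num at d12 e1 ⊢
    clear hI hJ hI1 hI2 E c1 cc v2
    grind
  · intro i hi1 hi2
    apply CornerMonoid.ext'
    rw [CornerMonoid.val_mul, CornerMonoid.val_mul, E i (by omega) (by omega),
      E m (by omega) le_rfl]
    have e1 := h.right (i + 2) (by omega) (by omega)
    have e2 := c1 i (by omega) (by omega)
    have e3 := c1 m (by omega) (by omega)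
    exact corner_word i1 e2 e3 e1
  · intro i hi1 hi2
    apply CornerMonoid.ext'
    rw [CornerMonoid.val_mul, CornerMonoid.val_mul, E i (by omega) (by omega),
      E (i + 1) (by omega) (by omega)]
    have e1 := h.up (i + 2) (by omega) (by omega)
    have e2 := c1 i (by omega) (by omega)
    have e3 := c1 (i + 1) (by omega) (by omega)
    rw [show i + 1 + 2 = i + 2 + 1 by ring] at *
    exact corner_word i1 e2 e3 e1
  · intro i hi1 hi2
    apply CornerMonoid.ext'
    rw [CornerMonoid.val_mul, CornerMonoid.val_mul, E i (by omega) (by omega),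
      E (i + 1) (by omega) (by omega)]
    have e1 := h.down (i + 2) (by omega) (by omega)
    have e2 := c1 i (by omega) (by omega)
    have e3 := c1 (i + 1) (by omega) (by omega)
    rw [show i + 1 + 2 = i + 2 + 1 by ring] at *
    exact corner_word i1 e3 e2 e1
  · apply CornerMonoid.ext'
    have := h.IJI
    rw [CornerMonoid.val_mul, CornerMonoid.val_mul, hI, hJ]
    generalize eval g (listI (m + 2)) = I at *
    generalize eval g (listJ (m + 2)) = J at *
    simp only [mul_assoc, hI1]
    rw [← mul_assoc I (g 1), hI2, ← mul_assoc, this]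
  · apply CornerMonoid.ext'
    have := h.JIJ
    rw [CornerMonoid.val_mul, CornerMonoid.val_mul, hI, hJ]
    generalize eval g (listI (m + 2)) = I at *
    generalize eval g (listJ (m + 2)) = J at *
    -- Regrouped so that I absorbs both inner factors `g 1` and leaves `J * I * J`.
    have e : g 1 * J * g 1 * I * (g 1 * J * g 1) = g 1 * (J * (g 1 * I * g 1) * J) * g 1 := by
      simp only [mul_assoc]
    rw [e, hI1, hI2, this]

end

end MonRel

end SympBlob

/-! ### Opposites, products and the monoid of diagrams -/

namespace SympBlob

open PreDiagram MulOpposite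

section

variable {n : ℕ} {M : Type*} [Monoid M] {g : ℕ → M}

theorem eval_op (l : List (Fin (n + 1))) :
    eval (fun i => op (g i)) l = op (eval g l.reverse) := by
  induction l with
  | nil => rfl
  | cons i l ih => simp [ih]

theorem eval_reverse_of_commute {l : List (Fin (n + 1))}
    (h : ∀ i ∈ l, ∀ j ∈ l, g i * g j = g j * g i) : eval g l.reverse = eval g l := by
  induction l with
  | nil => rfl
  | cons i l ih =>
    rw [List.reverse_cons, eval_append,
      ih fun a ha b hb => h a (by simp [ha]) b (by simp [hb]), eval_cons, eval_nil, mul_one,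
      eval_cons, commute_eval g fun j hj => h i (by simp) j (by simp [hj])]

/-- The relations are symmetric under reversal, since I and J are products of commuting elements.
Statements about the right ends of words thus apply to left ends as well. -/
theorem MonRel.op (h : MonRel n g) : MonRel n fun i => op (g i) := by
  have c : ∀ i j, i % 2 = j % 2 → i ≤ n → j ≤ n → g i * g j = g j * g i := by
    intro i j hij hi hj
    rcases eq_or_ne i j with rfl | hne
    · rfl
    · exact h.comm' (by omega) hi hj
  have hI : eval g (listI n).reverse = eval g (listI n) :=
    eval_reverse_of_commute fun i hi j hj => c _ _ (by simp [listI] at hi hj; omega)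
      (by omega) (by omega)
  have hJ : eval g (listJ n).reverse = eval g (listJ n) :=
    eval_reverse_of_commute fun i hi j hj => c _ _ (by simp [listJ] at hi hj; omega)
      (by omega) (by omega)
  refine ⟨fun i j hij hj => ?_, fun i hi => ?_, fun h2 => ?_, fun i h1 h2 => ?_,
    fun i h1 h2 => ?_, fun i h1 h2 => ?_, ?_, ?_⟩
  · rw [← op_mul, ← op_mul, h.comm i j hij hj]
  · rw [← op_mul, h.idem i hi]
  · rw [← op_mul, ← op_mul, ← mul_assoc, h.left h2]
  · rw [← op_mul, ← op_mul, ← mul_assoc, h.right i h1 h2]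
  · rw [← op_mul, ← op_mul, ← mul_assoc, h.up i h1 h2]
  · rw [← op_mul, ← op_mul, ← mul_assoc, h.down i h1 h2]
  · rw [eval_op, eval_op, hI, hJ, ← op_mul, ← op_mul, ← mul_assoc, h.IJI]
  · rw [eval_op, eval_op, hI, hJ, ← op_mul, ← op_mul, ← mul_assoc, h.JIJ]

theorem eval_prod {N : Type*} [Monoid N] {g' : ℕ → N} (l : List (Fin (n + 1))) :
    eval (fun i => (g i, g' i)) l = (eval g l, eval g' l) := by
  induction l with
  | nil => rfl
  | cons i l ih => simp [ih]

theorem MonRel.prod {N : Type*} [Monoid N] {g' : ℕ → N} (h : MonRel n g) (h' : MonRel n g') :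
    MonRel n fun i => (g i, g' i) := by
  refine ⟨fun i j hij hj => ?_, fun i hi => ?_, fun h2 => ?_, fun i h1 h2 => ?_,
    fun i h1 h2 => ?_, fun i h1 h2 => ?_, ?_, ?_⟩
  · simp [h.comm i j hij hj, h'.comm i j hij hj]
  · simp [h.idem i hi, h'.idem i hi]
  · simp [h.left h2, h'.left h2]
  · simp [h.right i h1 h2, h'.right i h1 h2]
  · simp [h.up i h1 h2, h'.up i h1 h2]
  · simp [h.down i h1 h2, h'.down i h1 h2]
  · simp [eval_prod, h.IJI, h'.IJI]
  · simp [eval_prod, h.JIJ, h'.JIJ]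

end

section

variable {n : ℕ} [NeZero n] {k : Type*} [Field k] (q : Params k)

theorem wdiag_append_congr {u u' v v' : List (Fin (n + 1))} (h : wdiag q u = wdiag q u')
    (h' : wdiag q v = wdiag q v') : wdiag q (u ++ v) = wdiag q (u' ++ v') := by
  have h1 : wdiag q (u ++ v) = wdiag q (u' ++ v) := by rw [wdiag_append, wdiag_append, h]
  have h2 : wdiag q (v.reverse ++ u'.reverse) = wdiag q (v'.reverse ++ u'.reverse) := by
    rw [wdiag_append, wdiag_append, wdiag_reverse, wdiag_reverse, h']
  rw [h1]
  have h3 : wdiag q (u' ++ v).reverse = wdiag q (u' ++ v').reverse := by simpa using h2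
  rw [wdiag_reverse, wdiag_reverse] at h3
  simpa using congrArg PreDiagram.flip h3

/-- Words have equal diagrams. -/
def diagCon (n : ℕ) [NeZero n] : Con (FreeMonoid (Fin (n + 1))) where
  r u v := wdiag q u.toList = wdiag q v.toList
  iseqv := ⟨fun _ => rfl, fun h => h.symm, fun h h' => h.trans h'⟩
  mul' hu hv := wdiag_append_congr q hu hv

/-- The generators of the monoid of diagrams. -/
def diagGen (n : ℕ) [NeZero n] (i : ℕ) : (diagCon q n).Quotient :=
  ((FreeMonoid.of (Fin.ofNat (n + 1) i) : FreeMonoid (Fin (n + 1))) : (diagCon q n).Quotient)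

theorem eval_diagGen (l : List (Fin (n + 1))) :
    eval (diagGen q n) l = ((FreeMonoid.ofList l : FreeMonoid _) : (diagCon q n).Quotient) := by
  induction l with
  | nil => rfl
  | cons i l ih =>
    rw [eval_cons, ih, diagGen, Fin.ofNat_val_eq_self]
    rfl

theorem eval_diagGen_eq {u v : List (Fin (n + 1))} :
    eval (diagGen q n) u = eval (diagGen q n) v ↔ wdiag q u = wdiag q v := by
  rw [eval_diagGen, eval_diagGen]
  exact Con.eq _

theorem diagGen_monRel : MonRel n (diagGen q n) := by
  have hn := NeZero.pos n
  have W : ∀ {c : k} {u v : List (Fin (n + 1))}, WEq q c u v →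
      eval (diagGen q n) u = eval (diagGen q n) v := fun h => (eval_diagGen_eq q).2 h.1
  refine ⟨fun i j hij hj => ?_, fun i hi => ?_, fun h2 => ?_, fun i h1 h2 => ?_,
    fun i h1 h2 => ?_, fun i h1 h2 => ?_, ?_, ?_⟩
  · simpa using W (wEq_comm q (n := n) ⟨i, by omega⟩ ⟨j, by omega⟩ hij)
  · rcases Nat.eq_zero_or_pos i with rfl | h0
    · simpa using W (wEq_sq_left q (n := n))
    · rcases Nat.lt_or_ge i n with hlt | hge
      · simpa using W (wEq_sq_mid q (n := n) ⟨i, by omega⟩ h0 hlt)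
      · obtain rfl : i = n := by omega
        simpa using W (wEq_sq_right q (n := i))
  · simpa [mul_assoc] using W (wEq_left q (n := n) ⟨1, by omega⟩ rfl h2)
  · simpa [mul_assoc] using W (wEq_right q (n := n) ⟨i, by omega⟩ h1 h2)
  · simpa [mul_assoc] using W (wEq_braid_up q (n := n) ⟨i, by omega⟩ ⟨i + 1, by omega⟩ h1 rfl h2)
  · simpa [mul_assoc] using W (wEq_braid_down q (n := n) ⟨i, by omega⟩ ⟨i + 1, by omega⟩ h1 rfl h2)
  · simpa [mul_assoc] using W (wEq_IJI_JIJ q n).1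
  · simpa [mul_assoc] using W (wEq_IJI_JIJ q n).2

/-- Words with equal values have equal diagrams. -/
def Separating {M : Type*} [Monoid M] (g : ℕ → M) : Prop :=
  ∀ u v : List (Fin (n + 1)), eval g u = eval g v → wdiag q u = wdiag q v

theorem Separating.op {M : Type*} [Monoid M] {g : ℕ → M} (h : Separating (n := n) q g) :
    Separating (n := n) q fun i => op (g i) := by
  intro u v huv
  rw [eval_op, eval_op] at huv
  have := h _ _ (op_injective huv)
  rw [wdiag_reverse, wdiag_reverse] at this
  simpa using congrArg PreDiagram.flip this

/-- Words with equal diagrams have equal values in all monoids with elements that satisfy the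
relations. -/
def Presents.{u} (n : ℕ) [NeZero n] : Prop :=
  ∀ (M : Type u) [Monoid M] (g : ℕ → M), MonRel n g → ∀ u v : List (Fin (n + 1)),
    wdiag q u = wdiag q v → eval g u = eval g v

/-- Replace the monoid by its product with the monoid of diagrams. There the value of a word
determines its diagram, so an identity between values may be used to learn something about diagrams.
-/
theorem presents_of_separating.{u}
    (h : ∀ (M : Type u) [Monoid M] (g : ℕ → M), MonRel n g → Separating (n := n) q g →
      ∀ u v : List (Fin (n + 1)), wdiag q u = wdiag q v → eval g u = eval g v) :
    Presents.{_, u} q n := by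
  intro M _ g hg u v huv
  have := h _ _ (hg.prod (diagGen_monRel q)) (fun u v e => by
    rw [eval_prod, eval_prod] at e
    exact (eval_diagGen_eq q).1 (Prod.ext_iff.1 e).2) u v huv
  rw [eval_prod, eval_prod] at this
  exact (Prod.ext_iff.1 this).1

end

end SympBlob

/-! ### The corner of the monoid at `g 1` -/

namespace SympBlob

open PreDiagram

namespace MonRel

variable {m : ℕ} {M : Type*} [Monoid M] {g : ℕ → M} (h : MonRel (m + 2) g)

/-- The elements `g 1 * g 2 * ⋯ * g j`, and `g 1 * g 0` for `j = 0`. -/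
def run (g : ℕ → M) : ℕ → M
  | 0 => g 1 * g 0
  | 1 => g 1
  | j + 2 => run g (j + 1) * g (j + 2)

theorem run_succ {j : ℕ} (hj : 1 ≤ j) : run g (j + 1) = run g j * g (j + 1) := by
  obtain ⟨j, rfl⟩ : ∃ l, j = l + 1 := ⟨j - 1, by omega⟩
  rfl

/-- The values of the words on the vertices to the right of the cup-cap on the left. -/
def InCorner (x : M) : Prop := ∃ l : List (Fin (m + 1)), (eval h.hatGen l).val = x

section

include h

theorem one_mul_run (j : ℕ) : g 1 * run g j = run g j := by
  rcases j with - | j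
  · simp [run, ← mul_assoc, h.idem_one]
  · induction j with
    | zero => exact h.idem_one
    | succ j ih => rw [run_succ (by omega), ← mul_assoc, ih]

theorem run_comm {j a : ℕ} (hj : 1 ≤ j) (ha : j + 2 ≤ a) (ha' : a ≤ m + 2) :
    run g j * g a = g a * run g j := by
  induction j, hj using Nat.le_induction with
  | base => exact h.comm' (by omega) (by omega) ha'
  | succ j hj ih =>
    rw [run_succ hj, mul_assoc, h.comm' (i := j + 1) (j := a) (by omega) (by omega) ha',
      ← mul_assoc, ih (by omega), mul_assoc]

/-- If `j + 1` is the last index, the relation behind this is that of the right blob; with the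
parameters set to 1 it reads like the braid relation. -/
theorem run_succ_mul {j : ℕ} (hj : 1 ≤ j) (hj' : j + 1 ≤ m + 2) :
    run g (j + 1) * g j = run g j := by
  rw [run_succ hj]
  have e : g j * g (j + 1) * g j = g j := by
    rcases Nat.lt_or_ge (j + 1) (m + 2) with h1 | h1
    · exact h.up j hj h1
    · have h2 : j + 1 = m + 2 := by omega
      have := h.right j hj h2
      rwa [← h2] at this
  rcases Nat.eq_or_lt_of_le hj with rfl | hj
  · exact e
  · obtain ⟨j, rfl⟩ : ∃ l, j = l + 1 := ⟨j - 1, by omega⟩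
    rw [run_succ (by omega), mul_assoc, mul_assoc, ← mul_assoc (g (j + 1)), e]

theorem run_add_two_mul {j : ℕ} (hj : 1 ≤ j) (hj' : j + 2 ≤ m + 2) :
    run g (j + 2) * g j = run g j * g (j + 2) := by
  rw [run_succ (by omega), mul_assoc, h.comm' (i := j + 2) (j := j) (by omega) hj' (by omega),
    ← mul_assoc, h.run_succ_mul hj (by omega)]

/-- A run carries the cap on the left to the right and thereby shifts the vertices it passes by two
places; a generator that is moved through it becomes the corner generator with index larger by two.
-/
theorem run_mul_aux {a j : ℕ} (ha : 1 ≤ a) (ha' : a + 2 < m + 2) (haj : a + 2 ≤ j)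
    (hj : j ≤ m + 2) : run g j * g a = g 1 * g (a + 2) * run g j := by
  induction j, haj using Nat.le_induction with
  | base =>
    have e := h.down (a + 1) (by omega) ha'
    rw [h.run_add_two_mul ha (by omega), run_succ (by omega), run_succ ha]
    rw [mul_assoc (g 1), ← mul_assoc (g (a + 2)), ← mul_assoc (g (a + 2)),
      ← h.run_comm ha le_rfl (by omega)]
    rw [mul_assoc (run g a), mul_assoc (run g a), e, ← mul_assoc, h.one_mul_run]
  | succ j haj ih =>
    rw [run_succ (by omega), mul_assoc, h.comm' (i := j + 1) (j := a) (by omega) (by omega)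
      (by omega), ← mul_assoc, ih (by omega), mul_assoc]

theorem run_mul_zero (hm : 1 ≤ m) {j : ℕ} (hj : 2 ≤ j) (hj' : j ≤ m + 2) :
    run g j * g 0 = g 1 * g 0 * g 2 * g 1 * run g j := by
  induction j, hj using Nat.le_induction with
  | base =>
    have e := h.down 1 (by omega) (by omega)
    have e2 := h.comm 0 2 (by omega) (by omega)
    change g 1 * g 2 * g 0 = g 1 * g 0 * g 2 * g 1 * (g 1 * g 2)
    norm_num at e
    rw [mul_assoc, ← e2, ← mul_assoc (g 1 * g 0 * g 2 * g 1), mul_assoc (g 1 * g 0 * g 2),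
      h.idem_one, mul_assoc (g 1 * g 0) (g 2), mul_assoc (g 1 * g 0), e, mul_assoc]
  | succ j haj ih =>
    rw [run_succ (by omega), mul_assoc, h.comm' (i := j + 1) (j := 0) (by omega) (by omega)
      (by omega), ← mul_assoc, ih (by omega), mul_assoc]

end

theorem InCorner.mul {x y : M} (hx : h.InCorner x) (hy : h.InCorner y) : h.InCorner (x * y) := by
  obtain ⟨u, rfl⟩ := hx
  obtain ⟨v, rfl⟩ := hy
  exact ⟨u ++ v, by rw [eval_append, CornerMonoid.val_mul]⟩

theorem inCorner_one : h.InCorner (g 1) := ⟨[], rfl⟩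

theorem inCorner_zero : h.InCorner (g 1 * g 0 * g 2 * g 1) :=
  ⟨[0], by rw [eval_cons, eval_nil, mul_one]; exact h.hatGen_zero⟩

theorem inCorner_of_pos {j : ℕ} (hj : 3 ≤ j) (hj' : j ≤ m + 2) : h.InCorner (g 1 * g j) := by
  obtain ⟨j, rfl⟩ : ∃ l, j = l + 2 := ⟨j - 2, by omega⟩
  exact ⟨[⟨j, by omega⟩], by
    rw [eval_cons, eval_nil, mul_one]; exact h.hatGen_of_pos (j := j) (by omega) (by omega)⟩

theorem InCorner.mul_one {x : M} (hx : h.InCorner x) : x * g 1 = x := by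
  obtain ⟨u, rfl⟩ := hx
  exact CornerMonoid.right _

/-- As diagrams, runs have an undecorated cup at the top left and a cap somewhere at the bottom.
Another generator lengthens the run, shortens it, is absorbed, or passes through it and becomes a
corner element on its left. -/
theorem run_mul (hm : 1 ≤ m) {j a : ℕ} (hj : j ≤ m + 2) (ha : a ≤ m + 2) :
    ∃ x i, h.InCorner x ∧ i ≤ m + 2 ∧ run g j * g a = x * run g i := by
  rcases Nat.eq_zero_or_pos j with rfl | hj0
  · have r0 : run g 0 = g 1 * g 0 := rfl
    rcases Nat.lt_or_ge a 3 with ha3 | ha3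
    · interval_cases a
      · exact ⟨_, 0, h.inCorner_one, by omega, by
          rw [h.one_mul_run, r0, mul_assoc, h.idem 0 (by omega)]⟩
      · exact ⟨_, 1, h.inCorner_one, by omega, by
          rw [h.one_mul_run, r0, h.left (by omega)]; rfl⟩
      · refine ⟨_, 2, h.inCorner_zero, by omega, ?_⟩
        rw [← h.run_mul_zero hm le_rfl (by omega), r0, mul_assoc,
          h.comm' (i := 0) (j := 2) (by omega) (by omega) (by omega), ← mul_assoc]
        rfl
    · refine ⟨_, 0, h.inCorner_of_pos ha3 ha, by omega, ?_⟩
      rw [r0, mul_assoc, h.comm' (i := 0) (j := a) (by omega) (by omega) ha, ← mul_assoc,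
        ← mul_assoc, mul_assoc (g 1) (g a) (g 1), ← h.comm' (i := 1) (j := a) (by omega) (by omega)
        ha, ← mul_assoc, h.idem_one]
  · by_cases h0 : a = 0
    · subst h0
      rcases Nat.eq_or_lt_of_le hj0 with rfl | hj1
      · exact ⟨_, 0, h.inCorner_one, by omega, by rw [h.one_mul_run]; rfl⟩
      · exact ⟨_, j, h.inCorner_zero, hj, h.run_mul_zero hm hj1 hj⟩
    by_cases h1 : a = j + 1
    · subst h1
      exact ⟨_, j + 1, h.inCorner_one, ha, by rw [h.one_mul_run, run_succ hj0]⟩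
    by_cases h2 : a = j
    · subst h2
      refine ⟨_, a, h.inCorner_one, ha, ?_⟩
      rw [h.one_mul_run]
      obtain ⟨a, rfl⟩ : ∃ l, a = l + 1 := ⟨a - 1, by omega⟩
      rcases a with - | a
      · exact h.idem_one
      · rw [run_succ (by omega), mul_assoc, h.idem _ ha]
    by_cases h3 : a + 1 = j
    · subst h3
      exact ⟨_, a, h.inCorner_one, ha, by rw [h.one_mul_run, h.run_succ_mul (by omega) hj]⟩
    rcases Nat.lt_or_ge a j with h4 | h4
    · rcases Nat.lt_or_ge (a + 2) (m + 2) with h5 | h5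
      · exact ⟨_, j, h.inCorner_of_pos (by omega) (by omega), hj,
          h.run_mul_aux (by omega) h5 (by omega) hj⟩
      · obtain rfl : j = a + 2 := by omega
        refine ⟨_, a, h.inCorner_of_pos (j := a + 2) (by omega) (by omega), ha, ?_⟩
        rw [h.run_add_two_mul (by omega) hj, h.run_comm (by omega) le_rfl hj, ← h.one_mul_run a,
          ← mul_assoc, h.comm' (i := a + 2) (j := 1) (by omega) hj (by omega), mul_assoc,
          mul_assoc, h.one_mul_run]
    · refine ⟨_, j, h.inCorner_of_pos (j := a) (by omega) (by omega), hj, ?_⟩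
      rw [h.run_comm hj0 (by omega) ha, ← h.one_mul_run j,
        ← mul_assoc, h.comm' (i := a) (j := 1) (by omega) ha (by omega), mul_assoc, mul_assoc,
        h.one_mul_run]

theorem one_mul_eval (hm : 1 ≤ m) (l : List (Fin (m + 3))) :
    ∃ x i, h.InCorner x ∧ i ≤ m + 2 ∧ g 1 * eval g l = x * run g i := by
  induction l using List.reverseRecOn with
  | nil => exact ⟨_, 1, h.inCorner_one, by omega, by rw [h.one_mul_run, eval_nil, _root_.mul_one]; rfl⟩
  | append_singleton l a ih =>
    obtain ⟨x, i, hx, hi, e⟩ := ih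
    obtain ⟨y, j, hy, hj, e'⟩ := h.run_mul hm hi (a := a) (by omega)
    refine ⟨x * y, j, hx.mul h hy, hj, ?_⟩
    rw [eval_append, ← mul_assoc, e, eval_cons, eval_nil, _root_.mul_one, mul_assoc, e', mul_assoc]

theorem inCorner_run_mul_one {j : ℕ} (hj : j ≤ m + 2) : h.InCorner (run g j * g 1) := by
  rcases Nat.lt_or_ge j 2 with hj2 | hj2
  · interval_cases j
    · change h.InCorner (g 1 * g 0 * g 1)
      rw [h.left (by omega)]
      exact h.inCorner_one
    · change h.InCorner (g 1 * g 1)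
      rw [h.idem_one]
      exact h.inCorner_one
  · induction j, hj2 using Nat.le_induction with
    | base =>
      rw [h.run_succ_mul le_rfl (by omega)]
      exact h.inCorner_one
    | succ j hj2 ih =>
      have := ih (by omega)
      rw [run_succ (by omega), mul_assoc, h.comm' (i := j + 1) (j := 1) (by omega) (by omega)
        (by omega), ← mul_assoc, ← this.mul_one, mul_assoc]
      exact this.mul h (h.inCorner_of_pos (by omega) hj)

/-- Everything that starts with `g 1` is a corner element followed by a run, and a run followed by
`g 1` lies in the corner. -/
theorem inCorner_eval (hm : 1 ≤ m) (l : List (Fin (m + 3))) :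
    h.InCorner (g 1 * eval g l * g 1) := by
  obtain ⟨x, i, hx, hi, e⟩ := h.one_mul_eval hm l
  rw [e, mul_assoc]
  exact hx.mul h (h.inCorner_run_mul_one hi)

end MonRel

end SympBlob

/-! ### Words that end with a cap -/

namespace SympBlob

open PreDiagram MulOpposite

/-- A generator, given by its number. -/
def letter (n i : ℕ) : Fin (n + 1) := Fin.ofNat (n + 1) i

theorem letter_val {n i : ℕ} (h : i ≤ n) : (letter n i : ℕ) = i :=
  Nat.mod_eq_of_lt (by omega)

/-- The words for the bottom caps of the diagrams that have an innermost cap whose blob, if there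
is one, can be removed by a generator. -/
def capWord (n b : ℕ) : List (Fin (n + 1)) :=
  if b = 0 then [letter n 1, letter n 0]
  else if b = n then [letter n (n - 1), letter n n]
  else [letter n b]

namespace MonRel

variable {n : ℕ} {M : Type*} [Monoid M] {g : ℕ → M}

theorem eval_capWord_zero (hn : 3 ≤ n) : eval g (capWord n 0) = g 1 * g 0 := by
  simp [capWord, letter_val (show 1 ≤ n by omega), letter_val (show 0 ≤ n by omega)]

theorem eval_capWord_last (hn : 3 ≤ n) : eval g (capWord n n) = g (n - 1) * g n := by
  rw [capWord, if_neg (by omega), if_pos rfl]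
  simp [letter_val (show n - 1 ≤ n by omega), letter_val (le_refl n)]

theorem eval_capWord_mid {b : ℕ} (h1 : 1 ≤ b) (h2 : b < n) : eval g (capWord n b) = g b := by
  rw [capWord, if_neg (by omega), if_neg (by omega)]
  simp [letter_val (show b ≤ n by omega)]

variable (h : MonRel n g) (hn : 3 ≤ n)

include h hn

theorem last_pred : g (n - 1) * g n * g (n - 1) = g (n - 1) :=
  h.right (n - 1) (by omega) (by omega)

/-- By induction on the last letter. A cup-cap letter is idempotent and ends with its own cap. A
blob letter commutes with the present cap, or is absorbed by its blob, or decorates it if the cap is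
undecorated and at the edge. -/
theorem eval_mul_capWord (x : List (Fin (n + 1))) :
    (∀ i ∈ x, i = 0 ∨ i = Fin.last n) ∨
      ∃ b ≤ n, eval g x * eval g (capWord n b) = eval g x := by
  induction x using List.reverseRecOn with
  | nil => exact .inl (by simp)
  | append_singleton x a ih =>
    have l1 := h.left (by omega)
    have ll := h.last_pred hn
    have i0 := h.idem 0 (by omega)
    have il := h.idem n le_rfl
    simp only [eval_append, eval_cons, eval_nil, mul_one]
    by_cases ha0 : a = 0
    · subst ha0
      rcases ih with ih | ⟨b, hb, ih⟩
      · left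
        intro i hi
        rcases List.mem_append.1 hi with hi | hi
        · exact ih i hi
        · exact .inl (by simpa using hi)
      · right
        rw [Fin.val_zero]
        by_cases hb0 : b = 0
        · subst hb0
          refine ⟨0, hb, ?_⟩
          have e : eval g x * g 0 = eval g x := by
            rw [← ih, eval_capWord_zero hn, mul_assoc, mul_assoc, i0]
          rw [e, ih]
        by_cases hb1 : b = 1
        · subst hb1
          refine ⟨0, by omega, ?_⟩
          rw [eval_capWord_mid le_rfl (by omega)] at ih
          -- With `x = x * g 1`: `x * g 0 * (g 1 * g 0) = x * (g 1 * g 0 * g 1) * g 0 = x * g 0`.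
          rw [eval_capWord_zero hn, ← ih]
          simp only [mul_assoc] at l1 ⊢
          rw [← mul_assoc (g 0) (g 1), ← mul_assoc (g 1) (g 0 * g 1), l1]
        refine ⟨b, hb, ?_⟩
        have hc : g 0 * eval g (capWord n b) = eval g (capWord n b) * g 0 := by
          by_cases hbn : b = n
          · subst hbn
            rw [eval_capWord_last hn, ← mul_assoc, h.comm' (i := 0) (j := b - 1) (by omega)
              (by omega) (by omega), mul_assoc, h.comm' (i := 0) (j := b) (by omega) (by omega) hb,
              mul_assoc]
          · rw [eval_capWord_mid (by omega) (by omega),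
              h.comm' (i := 0) (j := b) (by omega) (by omega) hb]
        rw [mul_assoc, hc, ← mul_assoc, ih]
    by_cases han : a = Fin.last n
    · subst han
      rcases ih with ih | ⟨b, hb, ih⟩
      · left
        intro i hi
        rcases List.mem_append.1 hi with hi | hi
        · exact ih i hi
        · exact .inr (by simpa using hi)
      · right
        rw [Fin.val_last]
        by_cases hb0 : b = n
        · subst hb0
          refine ⟨b, hb, ?_⟩
          have e : eval g x * g b = eval g x := by
            rw [← ih, eval_capWord_last hn, mul_assoc, mul_assoc, il]
          rw [e, ih]
        by_cases hb1 : b = n - 1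
        · subst hb1
          refine ⟨n, by omega, ?_⟩
          rw [eval_capWord_mid (by omega) (by omega)] at ih
          rw [eval_capWord_last hn, ← ih]
          simp only [mul_assoc] at ll ⊢
          rw [← mul_assoc (g n) (g (n - 1)), ← mul_assoc (g (n - 1)) (g n * g (n - 1)), ll]
        refine ⟨b, hb, ?_⟩
        have hc : g n * eval g (capWord n b) = eval g (capWord n b) * g n := by
          by_cases hbn : b = 0
          · subst hbn
            rw [eval_capWord_zero hn, ← mul_assoc, h.comm' (i := n) (j := 1) (by omega)
              (by omega) (by omega), mul_assoc, h.comm' (i := n) (j := 0) (by omega) le_rfl hb,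
              mul_assoc]
          · rw [eval_capWord_mid (by omega) (by omega),
              h.comm' (i := n) (j := b) (by omega) le_rfl hb]
        rw [mul_assoc, hc, ← mul_assoc, ih]
    · right
      have h1 : (a : ℕ) ≠ 0 := fun e => ha0 (Fin.ext e)
      have h2 : (a : ℕ) ≠ n := fun e => han (Fin.ext e)
      exact ⟨a, by omega, by
        rw [eval_capWord_mid (by omega) (by omega), mul_assoc, h.idem _ (by omega)]⟩

/-- Multiplication by `g (b - 1)`, …, `g 1` moves the cap at `b` to the far left, and the same
letters in increasing order up to `b` move it back, by the braid relations. A decorated cap first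
loses its blob through one more cup-cap letter, and the blob letter restores it at the end. -/
theorem exists_transport {b : ℕ} (hb : b ≤ n) : ∃ u v : List (Fin (n + 1)),
    eval g (capWord n b) * eval g u * g 1 = eval g (capWord n b) * eval g u ∧
    eval g (capWord n b) * eval g u * eval g v = eval g (capWord n b) := by
  have mid : ∀ b, 1 ≤ b → b < n → ∃ u v : List (Fin (n + 1)),
      g b * eval g u * g 1 = g b * eval g u ∧ g b * eval g u * eval g v = g b := by
    intro b h1
    induction b, h1 using Nat.le_induction with
    | base => exact fun _ => ⟨[], [], by simp [h.idem 1 (by omega)], by simp⟩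
    | succ b hb ih =>
      intro hb'
      obtain ⟨u, v, e1, e2⟩ := ih (by omega)
      refine ⟨letter n b :: u, v ++ [letter n (b + 1)], ?_, ?_⟩
      · simp only [eval_cons, letter_val (show b ≤ n by omega)]
        rw [mul_assoc, e1]
      · simp only [eval_cons, eval_append, letter_val (show b ≤ n by omega),
          letter_val (show b + 1 ≤ n by omega), eval_nil, mul_one]
        rw [← mul_assoc, mul_assoc (g (b + 1)), e2, h.down b hb hb']
  by_cases hb0 : b = 0
  · subst hb0
    refine ⟨[letter n 1], [letter n 0], ?_, ?_⟩
    · simp only [eval_capWord_zero hn, eval_cons, letter_val (show 1 ≤ n by omega), eval_nil,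
        mul_one, h.left (by omega : 2 ≤ n), h.idem 1 (by omega : 1 ≤ n)]
    · simp only [eval_capWord_zero hn, eval_cons, letter_val (show 1 ≤ n by omega), eval_nil,
        letter_val (show 0 ≤ n by omega), mul_one, h.left (by omega : 2 ≤ n)]
  by_cases hbn : b = n
  · subst hbn
    obtain ⟨u, v, e1, e2⟩ := mid (b - 1) (by omega) (by omega)
    refine ⟨letter b (b - 1) :: u, v ++ [letter b b], ?_, ?_⟩
    · simp only [eval_capWord_last hn, eval_cons, letter_val (show b - 1 ≤ b by omega)]
      rw [← mul_assoc, h.last_pred hn, e1]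
    · simp only [eval_capWord_last hn, eval_cons, letter_val (show b - 1 ≤ b by omega), eval_append,
        eval_nil, mul_one, letter_val (le_refl b)]
      rw [← mul_assoc, ← mul_assoc, h.last_pred hn, e2]
  · rw [eval_capWord_mid (by omega) (by omega)]
    exact mid b (by omega) (by omega)

end MonRel

/-- The position of the left end of the cap of `capWord`. -/
def capPos (n b : ℕ) : ℕ := if b = 0 then 0 else if b = n then n - 2 else b - 1

/-- The blobs on the cap of `capWord`. -/
def capBlob (n b : ℕ) : List Blob := if b = 0 then [Blob.L] else if b = n then [Blob.R] else []

/-- Caps on disjoint pairs of vertices involve generators at distance at least two. -/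
theorem MonRel.capWord_comm {n : ℕ} {M : Type*} [Monoid M] {g : ℕ → M} (h : MonRel n g)
    (hn : 3 ≤ n) {b d : ℕ} (hb : b ≤ n) (hd : d ≤ n)
    (hbd : capPos n b + 2 ≤ capPos n d) :
    eval g (capWord n b) * eval g (capWord n d) = eval g (capWord n d) * eval g (capWord n b) := by
  have c : ∀ i j, i + 1 < j → j ≤ n → Commute (g i) (g j) := fun i j h1 h2 => h.comm i j h1 h2
  change Commute _ _
  unfold capPos at hbd
  by_cases b0 : b = 0
  · subst b0
    rw [if_pos rfl] at hbd
    by_cases dn : d = n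
    · subst dn
      rw [if_neg (by omega), if_pos rfl] at hbd
      rw [eval_capWord_zero hn, eval_capWord_last hn]
      exact ((c _ _ (by omega) (by omega)).mul_right (c _ _ (by omega) (by omega))).mul_left
        ((c _ _ (by omega) (by omega)).mul_right (c _ _ (by omega) (by omega)))
    · rw [if_neg dn] at hbd
      have d0 : d ≠ 0 := by rintro rfl; simp at hbd
      rw [if_neg d0] at hbd
      rw [eval_capWord_zero hn, eval_capWord_mid (by omega) (by omega)]
      exact (c _ _ (by omega) (by omega)).mul_left (c _ _ (by omega) (by omega))
  · rw [if_neg b0] at hbd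
    have d0 : d ≠ 0 := by rintro rfl; simp at hbd
    rw [if_neg d0] at hbd
    have bn : b ≠ n := by
      rintro rfl
      rw [if_pos rfl] at hbd
      split_ifs at hbd <;> omega
    rw [if_neg bn] at hbd
    by_cases dn : d = n
    · subst dn
      rw [if_pos rfl] at hbd
      rw [eval_capWord_last hn, eval_capWord_mid (by omega) (by omega)]
      exact (c _ _ (by omega) (by omega)).mul_right (c _ _ (by omega) (by omega))
    · rw [if_neg dn] at hbd
      rw [eval_capWord_mid (by omega) (by omega), eval_capWord_mid (by omega) (by omega)]
      exact c _ _ (by omega) (by omega)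

end SympBlob

/-! ### Reading the last cap off the diagram -/

namespace SympBlob

open PreDiagram MulOpposite Blob

section

variable {n : ℕ} {k : Type*} [Field k] (q : Params k)

/-- The topological relation changes only ends of lines with both blobs. -/
theorem PreDiagram.IsLRBlob.red_apply {d : PreDiagram n} (h : d.IsLRBlob) {x : Pt n}
    (h1 : (straightenWord q (d.word x)).2 ≠ [L, R])
    (h2 : (straightenWord q (d.word x)).2 ≠ [R, L]) :
    (red q d).partner x = d.partner x ∧ (red q d).word x = (straightenWord q (d.word x)).2 := by
  rcases (h.straightenLines q).topological_cases q with hc | ⟨i, i', j, j', hD, hc⟩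
  · rw [red, hc.2]; exact ⟨rfl, rfl⟩
  · rw [red, hc]
    rcases hD.reconnect_cases x with hx | hx | hx | hx | hx
    · rw [hx.1] at h1; exact absurd hD.word_top h1
    · rw [hx.1] at h1; exact absurd hD.word_bot h1
    · rw [hx.1] at h2; exact absurd hD.word_top' h2
    · rw [hx.1] at h2; exact absurd hD.word_bot' h2
    · exact hx.2

variable [NeZero n]

theorem wdiag_apply {x : List (Fin (n + 1))} {y z : Pt n} {w : List Blob}
    (h1 : (raw x).partner y = z) (h2 : (raw x).word y = w) (hw : w = [] ∨ w = [L] ∨ w = [R]) :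
    (wdiag q x).partner y = z ∧ (wdiag q x).word y = w := by
  have h3 : (straightenWord q ((raw x).word y)).2 = w := by
    rw [h2, IsNormal.straightenWord_eq]
    unfold IsNormal
    tauto
  have := (isLRBlob_raw x).red_apply q (x := y) (by rw [h3]; rintro rfl; simp at hw)
    (by rw [h3]; rintro rfl; simp at hw)
  rw [h3, h1] at this
  exact this

theorem wdiag_capWord (hn : 3 ≤ n) (x : List (Fin (n + 1))) {b : ℕ} (hb : b ≤ n)
    {p p' : Fin n} (hp : (p : ℕ) = capPos n b) (hp' : (p' : ℕ) = capPos n b + 1) :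
    (wdiag q (x ++ capWord n b)).partner (.inr p) = .inr p' ∧
      (wdiag q (x ++ capWord n b)).word (.inr p) = capBlob n b := by
  have hpp : p ≠ p' := by intro e; rw [e] at hp; omega
  have hr : raw (x ++ capWord n b) = (raw x).ractList (capWord n b) := ractList_append _ _ _
  suffices hs : (raw (x ++ capWord n b)).partner (.inr p) = .inr p' ∧
      (raw (x ++ capWord n b)).word (.inr p) = capBlob n b from
    wdiag_apply q hs.1 hs.2 (by unfold capBlob; split_ifs <;> simp)
  rw [hr]
  unfold capWord capBlob capPos at *
  split_ifs at * with h0 h1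
  · have e0 : letter n 0 = 0 := rfl
    rw [ractList_cons, ractList_cons, ractList_nil, e0, ract_zero,
      ract_mid (a := p) (b := p') _ (by rw [letter_val (by omega)]; omega)
        (by rw [letter_val (by omega)]; omega)]
    have : (0 : Fin n) = p := Fin.ext (by rw [Fin.val_zero]; omega)
    rw [this]
    simp [addBlob]
  · have e0 : letter n n = Fin.last n := Fin.ext (letter_val le_rfl)
    rw [ractList_cons, ractList_cons, ractList_nil, e0, ract_last,
      ract_mid (a := p) (b := p') _ (by rw [letter_val (by omega)]; omega)
        (by rw [letter_val (by omega)]; omega)]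
    have : (Fin.rev 0 : Fin n) = p' := Fin.ext (by rw [Fin.val_rev, Fin.val_zero]; omega)
    rw [this]
    simp [addBlob, hpp]
  · rw [ractList_cons, ractList_nil,
      ract_mid (a := p) (b := p') _ (by rw [letter_val (by omega)]; omega)
        (by rw [letter_val (by omega)]; omega)]
    simp

theorem capPos_lt {n b : ℕ} (hn : 3 ≤ n) (hb : b ≤ n) : capPos n b + 1 < n := by
  unfold capPos; split_ifs <;> omega

/-- Both caps occur in the same diagram. If they overlapped in one vertex, it would have two
partners; at the same place they would differ by a blob. -/
theorem capPos_separated (hn : 3 ≤ n) {x y : List (Fin (n + 1))} {b d : ℕ} (hb : b ≤ n)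
    (hd : d ≤ n) (hbd : b ≠ d) (h : wdiag q (x ++ capWord n b) = wdiag q (y ++ capWord n d)) :
    capPos n b + 2 ≤ capPos n d ∨ capPos n d + 2 ≤ capPos n b := by
  have lb := capPos_lt hn hb
  have ld := capPos_lt hn hd
  have h1 := wdiag_capWord q hn x hb (p := ⟨capPos n b, by omega⟩) (p' := ⟨_, lb⟩) rfl rfl
  have h2 := wdiag_capWord q hn y hd (p := ⟨capPos n d, by omega⟩) (p' := ⟨_, ld⟩) rfl rfl
  rw [h] at h1
  have hi := (memB_wdiag q (y ++ capWord n d)).invol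
  by_contra hc
  rcases lt_trichotomy (capPos n b) (capPos n d) with hlt | heq | hlt
  · have h3 := hi (.inr ⟨capPos n b, by omega⟩)
    have e : (⟨capPos n b + 1, lb⟩ : Fin n) = ⟨capPos n d, by omega⟩ := Fin.ext (by simp; omega)
    rw [h1.1, e, h2.1] at h3
    simp at h3
    omega
  · have e : (⟨capPos n b, by omega⟩ : Fin n) = ⟨capPos n d, by omega⟩ := Fin.ext heq
    have h3 := h1.2
    rw [e, h2.2] at h3
    unfold capBlob at h3
    unfold capPos at heq
    split_ifs at h3 heq <;> simp at h3 <;> omega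
  · have h3 := hi (.inr ⟨capPos n d, by omega⟩)
    have e : (⟨capPos n d + 1, ld⟩ : Fin n) = ⟨capPos n b, by omega⟩ := Fin.ext (by simp; omega)
    rw [h2.1, e, h1.1] at h3
    simp at h3
    omega

/-- The word for the identity diagram with at most one blob on the first and the last line. -/
def sideWord (n : ℕ) (a b : Bool) : List (Fin (n + 1)) :=
  (if a then [0] else []) ++ if b then [Fin.last n] else []

omit [NeZero n] in
-- The two blob generators are commuting idempotents, so only four values occur; `wdiag_sideWord`
-- tells them apart by their blobs.
theorem MonRel.exists_sideWord {M : Type*} [Monoid M] {g : ℕ → M} (h : MonRel n g) (hn : 2 ≤ n)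
    {x : List (Fin (n + 1))} (hx : ∀ i ∈ x, i = 0 ∨ i = Fin.last n) :
    ∃ a b, eval g x = eval g (sideWord n a b) := by
  induction x with
  | nil => exact ⟨false, false, rfl⟩
  | cons i x ih =>
    obtain ⟨a, b, e⟩ := ih fun j hj => hx j (by simp [hj])
    have i0 := h.idem 0 (by omega)
    have il := h.idem n le_rfl
    have c := h.comm 0 n (by omega) le_rfl
    rcases hx i (by simp) with rfl | rfl
    · refine ⟨true, b, ?_⟩
      rw [eval_cons, e]
      cases a <;> simp [sideWord, ← mul_assoc, i0]
    · refine ⟨a, true, ?_⟩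
      rw [eval_cons, e]
      cases a <;> cases b <;> simp [sideWord, ← mul_assoc, il, c]

theorem wdiag_sideWord (hn : 3 ≤ n) (a b : Bool) :
    (∀ i : Fin n, (wdiag q (sideWord n a b)).partner (.inr i) = .inl i) ∧
    (wdiag q (sideWord n a b)).word (.inr 0) = (if a then [L] else []) ∧
    (wdiag q (sideWord n a b)).word (.inr (Fin.rev 0)) = if b then [R] else [] := by
  have h0 : (Fin.rev 0 : Fin n) ≠ 0 := by
    rw [Ne, Fin.ext_iff, Fin.val_rev, Fin.val_zero]; omega
  have key : (∀ i : Fin n, (raw (sideWord n a b)).partner (.inr i) = .inl i) ∧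
      (∀ i : Fin n, (raw (sideWord n a b)).word (.inr i) =
        if i = 0 then (if a then [L] else []) else if i = Fin.rev 0 then (if b then [R] else [])
          else []) := by
    cases a <;> cases b <;>
      simp [sideWord, raw, ract_zero, ract_last, addBlob] <;> grind
  have h1 : ∀ i : Fin n, _ := fun i => wdiag_apply q (key.1 i) (key.2 i) (by
    cases a <;> cases b <;> simp only [if_true, Bool.false_eq_true, if_false] <;> split_ifs <;> simp)
  refine ⟨fun i => (h1 i).1, ?_, ?_⟩
  · rw [(h1 0).2, if_pos rfl]
  · rw [(h1 _).2, if_neg h0, if_pos rfl]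

end

end SympBlob

/-! ### The induction step for the presentation -/

namespace SympBlob

open PreDiagram MulOpposite Blob

variable {k : Type*} [Field k] {q : Params k}

/-- By `inCorner_eval`, `g 1 * x * g 1` is the value of a word in the corner generators. Since
values determine diagrams, the diagram of this word is that of `g 1 * x * g 1` without the cup-cap
on the left, so the induction hypothesis applies. -/
theorem Separating.corner_eq.{u} {m : ℕ} [NeZero m] {M : Type u} [Monoid M] {g : ℕ → M}
    (hs : Separating (n := m + 2) q g) (h : MonRel (m + 2) g) (ih : Presents.{_, u} q m)
    {x y : List (Fin (m + 3))} (hxy : wdiag q x = wdiag q y) :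
    g 1 * eval g x * g 1 = g 1 * eval g y * g 1 := by
  have hm : 1 ≤ m := NeZero.pos m
  have key : ∀ x : List (Fin (m + 3)), ∃ l : List (Fin (m + 1)),
      (eval h.hatGen l).val = g 1 * eval g x * g 1 ∧
      (wdiag q l).iota = wdiag q ([1] ++ x ++ [1]) := by
    intro x
    obtain ⟨l, hl⟩ := h.inCorner_eval hm x
    refine ⟨l, hl, ?_⟩
    rw [← wdiag_hat]
    refine hs _ _ ?_
    rw [eval_cons, Fin.val_one, ← h.eval_hat, hl]
    simp [mul_assoc]
  obtain ⟨l, h1, h2⟩ := key x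
  obtain ⟨l', h3, h4⟩ := key y
  have h5 : wdiag q ([1] ++ x ++ [1]) = wdiag q ([1] ++ y ++ [1]) :=
    wdiag_append_congr q (wdiag_append_congr q rfl hxy) rfl
  rw [← h2, ← h4] at h5
  rw [← h1, ← h3, ih _ _ (h.hatGen_monRel hm) l l' (iota_injective h5)]

section

universe u

variable {n : ℕ} [NeZero n] {M : Type u} [Monoid M] {g : ℕ → M}

/-- Words with the same diagram have the same value between two copies of the generator `g 1`. -/
def CornerEq (q : Params k) (n : ℕ) [NeZero n] {M : Type u} [Monoid M] (g : ℕ → M) : Prop :=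
  ∀ x y : List (Fin (n + 1)), wdiag q x = wdiag q y → g 1 * eval g x * g 1 = g 1 * eval g y * g 1

omit [NeZero n] in
theorem MonRel.exists_transport_left (h : MonRel n g) (hn : 3 ≤ n) {a : ℕ} (ha : a ≤ n) :
    ∃ u v : List (Fin (n + 1)),
      g 1 * (eval g u * eval g (capWord n a).reverse) = eval g u * eval g (capWord n a).reverse ∧
      eval g v * (eval g u * eval g (capWord n a).reverse) = eval g (capWord n a).reverse := by
  obtain ⟨u, v, h1, h2⟩ := h.op.exists_transport hn ha
  simp only [eval_op, ← op_mul] at h1 h2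
  exact ⟨u.reverse, v.reverse, op_injective h1, op_injective h2⟩

/-- With common caps at both ends, both words are moved to the corner by the same multiplications,
and these can be undone. -/
theorem eval_eq_of_caps (hc : CornerEq q n g) (h : MonRel n g) (hn : 3 ≤ n) {a b : ℕ}
    (ha : a ≤ n) (hb : b ≤ n) {x y : List (Fin (n + 1))}
    (hx : eval g (capWord n a).reverse * eval g x = eval g x)
    (hx' : eval g x * eval g (capWord n b) = eval g x)
    (hy : eval g (capWord n a).reverse * eval g y = eval g y)
    (hy' : eval g y * eval g (capWord n b) = eval g y) (hxy : wdiag q x = wdiag q y) :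
    eval g x = eval g y := by
  obtain ⟨u, v, e1, e2⟩ := h.exists_transport hn hb
  obtain ⟨u', v', e3, e4⟩ := h.exists_transport_left hn ha
  have key : ∀ x : List (Fin (n + 1)), eval g (capWord n a).reverse * eval g x = eval g x →
      eval g x * eval g (capWord n b) = eval g x →
      eval g x = eval g v' * (g 1 * eval g (u' ++ x ++ u) * g 1) * eval g v := by
    intro x hx hx'
    set c := eval g (capWord n a).reverse
    set c' := eval g (capWord n b)
    have h1 : g 1 * eval g (u' ++ x ++ u) = eval g (u' ++ x ++ u) := by
      simp only [eval_append]
      rw [← hx, ← mul_assoc (eval g u'), ← mul_assoc, ← mul_assoc, e3]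
    have h2 : eval g (u' ++ x ++ u) * g 1 = eval g (u' ++ x ++ u) := by
      simp only [eval_append]
      rw [← hx']
      simp only [mul_assoc] at e1 ⊢
      rw [e1]
    rw [h1, h2]
    simp only [eval_append]
    rw [← hx']
    simp only [mul_assoc] at e2 e4 ⊢
    rw [e2, hx', ← hx, ← mul_assoc (eval g u'), ← mul_assoc, e4]
  rw [key x hx hx', key y hy hy', hc (u' ++ x ++ u) (u' ++ y ++ u)
    (wdiag_append_congr q (wdiag_append_congr q rfl hxy) rfl)]

theorem Separating.capWord_comm (hs : Separating (n := n) q g) (h : MonRel n g) (hn : 3 ≤ n)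
    {b d : ℕ} (hb : b ≤ n) (hd : d ≤ n) {x y : List (Fin (n + 1))} (hbd : b ≠ d)
    (hx : eval g x * eval g (capWord n b) = eval g x)
    (hy : eval g y * eval g (capWord n d) = eval g y) (hxy : wdiag q x = wdiag q y) :
    eval g (capWord n b) * eval g (capWord n d) = eval g (capWord n d) * eval g (capWord n b) := by
  have h1 : wdiag q (x ++ capWord n b) = wdiag q x := hs _ _ (by rw [eval_append, hx])
  have h2 : wdiag q (y ++ capWord n d) = wdiag q y := hs _ _ (by rw [eval_append, hy])
  rcases capPos_separated q hn hb hd hbd (by rw [h1, h2, hxy]) with h3 | h3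
  · exact h.capWord_comm hn hb hd h3
  · exact (h.capWord_comm hn hd hb h3).symm

/-- Suppose that `x` ends with the cap `b` and `y` with `d`. The caps commute, so `x` times the cap
`d` still ends with `b`; it has the diagram of `x`, because `y` absorbs `d`. Hence it equals `x` by
the case of common caps, and both words end with `d`. -/
theorem eval_eq_of_left_cap (hs : Separating (n := n) q g) (hc : CornerEq q n g) (h : MonRel n g)
    (hn : 3 ≤ n) {a b d : ℕ} (ha : a ≤ n) (hb : b ≤ n) (hd : d ≤ n) {x y : List (Fin (n + 1))}
    (hx : eval g (capWord n a).reverse * eval g x = eval g x)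
    (hx' : eval g x * eval g (capWord n b) = eval g x)
    (hy : eval g (capWord n a).reverse * eval g y = eval g y)
    (hy' : eval g y * eval g (capWord n d) = eval g y) (hxy : wdiag q x = wdiag q y) :
    eval g x = eval g y := by
  rcases eq_or_ne b d with rfl | hbd
  · exact eval_eq_of_caps hc h hn ha hb hx hx' hy hy' hxy
  have hcomm := hs.capWord_comm h hn hb hd hbd hx' hy' hxy
  have hy2 : wdiag q (y ++ capWord n d) = wdiag q y := hs _ _ (by rw [eval_append, hy'])
  have hx2 : eval g (x ++ capWord n d) = eval g x := by
    refine eval_eq_of_caps hc h hn ha hb ?_ ?_ hx hx'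
      ((wdiag_append_congr q hxy rfl).trans (hy2.trans hxy.symm))
    · rw [eval_append, ← mul_assoc, hx]
    · rw [eval_append, mul_assoc, ← hcomm, ← mul_assoc, hx']
  exact eval_eq_of_caps hc h hn ha hd hx (by rw [← eval_append, hx2]) hy hy' hxy

/-- The same exchange of caps, now at the left ends of the words, through the opposite monoid. -/
theorem eval_eq_of_wdiag_eq (hs : Separating (n := n) q g) (hc : CornerEq q n g) (h : MonRel n g)
    (hn : 3 ≤ n) {a c b d : ℕ} (ha : a ≤ n) (hc' : c ≤ n) (hb : b ≤ n) (hd : d ≤ n)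
    {x y : List (Fin (n + 1))} (hx : eval g (capWord n a).reverse * eval g x = eval g x)
    (hx' : eval g x * eval g (capWord n b) = eval g x)
    (hy : eval g (capWord n c).reverse * eval g y = eval g y)
    (hy' : eval g y * eval g (capWord n d) = eval g y) (hxy : wdiag q x = wdiag q y) :
    eval g x = eval g y := by
  rcases eq_or_ne a c with rfl | hac
  · exact eval_eq_of_left_cap hs hc h hn ha hb hd hx hx' hy hy' hxy
  have hcomm := hs.op.capWord_comm h.op hn (x := x.reverse) (y := y.reverse) ha hc' hac
    (by rw [eval_op, eval_op, ← op_mul, List.reverse_reverse, hx])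
    (by rw [eval_op, eval_op, ← op_mul, List.reverse_reverse, hy])
    (by rw [wdiag_reverse, wdiag_reverse, hxy])
  rw [eval_op, eval_op, ← op_mul, ← op_mul] at hcomm
  replace hcomm := op_injective hcomm
  have hy2 : wdiag q ((capWord n c).reverse ++ y) = wdiag q y := hs _ _ (by rw [eval_append, hy])
  have hx2 : eval g ((capWord n c).reverse ++ x) = eval g x := by
    refine eval_eq_of_left_cap hs hc h hn ha hb hb ?_ ?_ hx hx'
      ((wdiag_append_congr q rfl hxy).trans (hy2.trans hxy.symm))
    · rw [eval_append, ← mul_assoc, ← hcomm, mul_assoc, hx]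
    · rw [eval_append, mul_assoc, hx']
  exact eval_eq_of_left_cap hs hc h hn hc' hb hd (by rw [← eval_append, hx2]) hx' hy hy' hxy

/-- One diagram has only propagating lines, the other one a cap at the bottom. -/
theorem wdiag_ne_of_sideWord (hs : Separating (n := n) q g) (h : MonRel n g) (hn : 3 ≤ n)
    {x y : List (Fin (n + 1))} (hx : ∀ i ∈ x, i = 0 ∨ i = Fin.last n) {d : ℕ} (hd : d ≤ n)
    (hy : eval g y * eval g (capWord n d) = eval g y) : wdiag q x ≠ wdiag q y := by
  intro hxy
  obtain ⟨a, b, e⟩ := h.exists_sideWord (by omega) hx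
  have h2 : wdiag q (y ++ capWord n d) = wdiag q y := hs _ _ (by rw [eval_append, hy])
  have ld := capPos_lt hn hd
  have h3 := (wdiag_capWord q hn y hd (p := ⟨capPos n d, by omega⟩) (p' := ⟨_, ld⟩) rfl rfl).1
  rw [h2, ← hxy, hs _ _ e, (wdiag_sideWord q hn a b).1] at h3
  simp at h3

theorem CornerEq.eval_eq (hs : Separating (n := n) q g) (hc : CornerEq q n g) (h : MonRel n g)
    (hn : 3 ≤ n) (x y : List (Fin (n + 1))) (hxy : wdiag q x = wdiag q y) :
    eval g x = eval g y := by
  rcases h.eval_mul_capWord hn x with hx | ⟨b, hb, hx⟩ <;>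
    rcases h.eval_mul_capWord hn y with hy | ⟨d, hd, hy⟩
  · obtain ⟨a, b, e⟩ := h.exists_sideWord (by omega) hx
    obtain ⟨a', b', e'⟩ := h.exists_sideWord (by omega) hy
    have h1 : wdiag q (sideWord n a b) = wdiag q (sideWord n a' b') := by
      rw [← hs _ _ e, ← hs _ _ e', hxy]
    have h2 := (wdiag_sideWord q hn a b).2
    rw [h1, (wdiag_sideWord q hn a' b').2.1, (wdiag_sideWord q hn a' b').2.2] at h2
    rw [e, e']
    cases a <;> cases a' <;> cases b <;> cases b' <;> first | rfl | simp at h2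
  · exact absurd hxy (wdiag_ne_of_sideWord hs h hn hx hd hy)
  · exact absurd hxy.symm (wdiag_ne_of_sideWord hs h hn hy hb hx)
  · have left : ∀ x : List (Fin (n + 1)), ∀ b ≤ n, eval g x * eval g (capWord n b) = eval g x →
        ∃ a ≤ n, eval g (capWord n a).reverse * eval g x = eval g x := by
      intro x b hb hx
      rcases h.op.eval_mul_capWord hn x.reverse with hx' | ⟨a, ha, hx'⟩
      -- Without a cap at the left end, `x` would be a word in the blob letters, in contradiction to
      -- the cap at its right end.
      · exact absurd rfl (wdiag_ne_of_sideWord hs h hn (fun i hi => hx' i (by simpa using hi)) hb hx)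
      · refine ⟨a, ha, ?_⟩
        rw [eval_op, eval_op, ← op_mul, List.reverse_reverse] at hx'
        exact op_injective hx'
    obtain ⟨a, ha, hx'⟩ := left x b hb hx
    obtain ⟨c, hc', hy'⟩ := left y d hd hy
    exact eval_eq_of_wdiag_eq hs hc h hn ha hc' hb hd hx' hx hy' hy hxy

end

theorem presents_add_two.{u} {m : ℕ} [NeZero m] (ih : Presents.{_, u} q m) :
    Presents.{_, u} q (m + 2) := by
  have hm : 1 ≤ m := NeZero.pos m
  refine presents_of_separating q fun M _ g h hs x y hxy => ?_
  exact CornerEq.eval_eq hs (fun x y hxy => hs.corner_eq h ih hxy) h (by omega) x y hxy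

end SympBlob

/-! ### One and two vertices, and the induction -/

namespace SympBlob

open PreDiagram Blob

variable {k : Type*} [Field k] (q : Params k)

/-- A family of words that represent all elements of the presented monoid and have different
diagrams yields a presentation. -/
theorem presents_of_list.{u} {n : ℕ} [NeZero n] (S : List (List (Fin (n + 1))))
    (h1 : ∀ (M : Type u) [Monoid M] (g : ℕ → M), MonRel n g → ∀ x : List (Fin (n + 1)),
      ∃ c ∈ S, eval g x = eval g c)
    (h2 : ∀ c ∈ S, (∀ x, IsNormal ((raw c).word x)) ∧
      ¬ ((∃ i, (raw c).DoubleAt Sum.inl i) ∧ ∃ i, (raw c).DoubleAt Sum.inr i))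
    (h3 : ∀ c ∈ S, ∀ c' ∈ S, (∀ x, (raw c).partner x = (raw c').partner x ∧
      (raw c).word x = (raw c').word x) → c = c') : Presents.{_, u} q n := by
  refine presents_of_separating q fun M _ g h hs x y hxy => ?_
  obtain ⟨c, hc, e⟩ := h1 M g h x
  obtain ⟨c', hc', e'⟩ := h1 M g h y
  have key : ∀ c ∈ S, wdiag q c = raw c := fun c hc =>
    (memB_iff.2 ⟨isLRBlob_raw c, (h2 c hc).1, (h2 c hc).2⟩).red_eq q
  have h4 : raw c = raw c' := by
    rw [← key c hc, ← key c' hc', ← hs _ _ e, ← hs _ _ e', hxy]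
  rw [e, e', h3 c hc c' hc' fun x => by rw [h4]; exact ⟨rfl, rfl⟩]

/-- With two idempotents and the relations `IJI` and `JIJ`, alternating words of length three
collapse, and five words remain. -/
theorem presents_one : Presents q 1 := by
  refine presents_of_list q [[], [0], [1], [0, 1], [1, 0]] ?_ ?_ ?_
  · intro M _ g h x
    have i0 := h.idem 0 (by omega)
    have i1 := h.idem 1 le_rfl
    have e1 : g 1 * g 0 * g 1 = g 1 := by
      have : g 1 * 1 * (g 0 * 1) * (g 1 * 1) = g 1 * 1 := h.IJI
      simpa using this
    have e0 : g 0 * g 1 * g 0 = g 0 := by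
      have : g 0 * 1 * (g 1 * 1) * (g 0 * 1) = g 0 * 1 := h.JIJ
      simpa using this
    induction x with
    | nil => exact ⟨[], by simp, rfl⟩
    | cons a x ih =>
      obtain ⟨c, hc, e⟩ := ih
      simp only [eval_cons, e]
      rw [mul_assoc] at e0 e1
      fin_cases a <;> simp at hc <;> rcases hc with rfl | rfl | rfl | rfl | rfl <;>
        simp [← mul_assoc, i0, i1] <;> simp [mul_assoc, e0, e1]
  · unfold IsNormal
    decide
  · decide

/-- The words for the diagrams on two vertices. -/
def wordsTwo : List (List (Fin 3)) :=
  [[], [0], [2], [0, 2],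
    [1], [1, 0], [1, 2], [1, 0, 2],
    [0, 1], [0, 1, 0], [0, 1, 2], [0, 1, 0, 2],
    [2, 1], [2, 1, 0], [2, 1, 2], [2, 1, 0, 2],
    [0, 2, 1], [0, 2, 1, 0], [0, 2, 1, 2]]

/-- Between two letters 1, everything on two vertices collapses to a single 1. So a word is a
product of blob letters, or two such products around one letter 1. Of the sixteen of the second
kind, the one with all four blobs equals `[0, 2]` by `JIJ`. -/
theorem MonRel.exists_wordsTwo {M : Type*} [Monoid M] {g : ℕ → M} (h : MonRel 2 g)
    (x : List (Fin 3)) : ∃ c ∈ wordsTwo, eval g x = eval g c := by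
  have i0 := h.idem 0 (by omega)
  have i1 := h.idem 1 (by omega)
  have i2 := h.idem 2 le_rfl
  have e0 := h.left le_rfl
  have e2 := h.right 1 le_rfl rfl
  have c02 := h.comm 0 2 (by omega) le_rfl
  have e02 : g 1 * (g 0 * g 2) * g 1 = g 1 := by
    have : g 1 * 1 * (g 0 * (g 2 * 1)) * (g 1 * 1) = g 1 * 1 := h.IJI
    simpa using this
  have eJ : g 0 * g 2 * g 1 * (g 0 * g 2) = g 0 * g 2 := by
    have : g 0 * (g 2 * 1) * (g 1 * 1) * (g 0 * (g 2 * 1)) = g 0 * (g 2 * 1) := h.JIJ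
    simpa using this
  have key : (∃ a b, eval g x = eval g (sideWord 2 a b)) ∨
      ∃ a b c d, eval g x = eval g (sideWord 2 a b ++ [1] ++ sideWord 2 c d) := by
    induction x using List.reverseRecOn with
    | nil => exact .inl ⟨false, false, rfl⟩
    | append_singleton x i ih =>
      rcases ih with ⟨a, b, e⟩ | ⟨a, b, c, d, e⟩
      · by_cases hi : i = 1
        · subst hi
          exact .inr ⟨a, b, false, false, by
            rw [eval_append, e, eval_append, eval_append]; simp [sideWord]⟩
        · left
          obtain ⟨a', b', e'⟩ := h.exists_sideWord le_rfl (x := sideWord 2 a b ++ [i]) (by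
            revert i; cases a <;> cases b <;> decide)
          exact ⟨a', b', by rw [eval_append, e, ← eval_append, e']⟩
      · right
        by_cases hi : i = 1
        · subst hi
          refine ⟨a, b, false, false, ?_⟩
          have : g 1 * eval g (sideWord 2 c d) * g 1 = g 1 := by
            cases c <;> cases d <;> simp [sideWord, e0, e2, i1, e02]
          rw [eval_append, e]
          simp only [eval_append, eval_cons, eval_nil, mul_one]
          rw [mul_assoc, mul_assoc, ← mul_assoc (g (1 : Fin 3))]
          erw [this]
          simp [sideWord]
        · obtain ⟨c', d', e'⟩ := h.exists_sideWord le_rfl (x := sideWord 2 c d ++ [i]) (by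
            revert i; cases c <;> cases d <;> decide)
          refine ⟨a, b, c', d', ?_⟩
          rw [eval_append, e, eval_append, mul_assoc, ← eval_append, e', ← eval_append]
  rcases key with ⟨a, b, e⟩ | ⟨a, b, c, d, e⟩
  · exact ⟨_, by cases a <;> cases b <;> decide, e⟩
  · by_cases hall : a && b && c && d
    · obtain ⟨⟨⟨rfl, rfl⟩, rfl⟩, rfl⟩ : ((a = true ∧ b = true) ∧ c = true) ∧ d = true := by
        simpa using hall
      refine ⟨[0, 2], by decide, ?_⟩
      rw [e, ← mul_one (eval g [0, 2])]
      simpa [sideWord, mul_assoc] using eJ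
    · refine ⟨_, ?_, e⟩
      revert hall
      cases a <;> cases b <;> cases c <;> cases d <;> decide

theorem presents_two : Presents q 2 := by
  refine presents_of_list q wordsTwo (fun M _ g h x => h.exists_wordsTwo x) ?_ ?_
  · unfold IsNormal
    decide +kernel
  · decide +kernel

/-- Two consecutive cases are carried along because the induction step adds two vertices. -/
theorem presents_aux.{u} (n : ℕ) : Presents.{_, u} q (n + 1) ∧ Presents.{_, u} q (n + 2) := by
  induction n with
  | zero => exact ⟨presents_one q, presents_two q⟩
  | succ n ih => exact ⟨ih.2, presents_add_two ih.1⟩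

theorem presents.{u} (n : ℕ) [NeZero n] : Presents.{_, u} q n := by
  obtain ⟨m, rfl⟩ : ∃ m, n = m + 1 := ⟨n - 1, by have := NeZero.pos n; omega⟩
  exact (presents_aux q m).1

end SympBlob

namespace SympBlob

open Blob

namespace PreDiagram

variable {n : ℕ} {d : PreDiagram n}

/-! ### All left-right blob diagrams are diagrams of words -/

theorem IsLRBlob.of_sublist {d' : PreDiagram n} (h : d.IsLRBlob) (hp : d'.partner = d.partner)
    (hs : ∀ x, (d'.word x).Sublist (d.word x))
    (hw : ∀ x, d'.word (d'.partner x) = (d'.word x).reverse) : d'.IsLRBlob where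
  invol x := by rw [hp, h.invol]
  ne_self x := by rw [hp]; exact h.ne_self x
  noncrossing x y := by rw [hp]; exact h.noncrossing x y
  word_partner := hw
  exposedL x hx := by
    have := h.exposedL x ((hs x).subset hx)
    unfold Exposed at *
    rwa [hp]
  exposedR x hx := by
    have := h.exposedR x ((hs x).subset hx)
    unfold Exposed at *
    rwa [hp]
  ordered_top := ⟨fun i j hij hlt hsub =>
    h.ordered_top.same_line i j (by rw [← hp, hij]) hlt (hsub.trans (hs _)),
    fun i j i' j' hij hij' h1 h2 h3 hh => h.ordered_top.two_lines i j i' j' (by rw [← hp, hij])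
      (by rw [← hp, hij']) h1 h2 h3 ⟨(hs _).subset hh.1, (hs _).subset hh.2⟩⟩
  ordered_bot := ⟨fun i j hij hlt hsub =>
    h.ordered_bot.same_line i j (by rw [← hp, hij]) hlt (hsub.trans (hs _)),
    fun i j i' j' hij hij' h1 h2 h3 hh => h.ordered_bot.two_lines i j i' j' (by rw [← hp, hij])
      (by rw [← hp, hij']) h1 h2 h3 ⟨(hs _).subset hh.1, (hs _).subset hh.2⟩⟩

theorem flip_btw {pos : Pt n → ℕ} (hpos : ∀ x y, pos x.swap < pos y.swap ↔ pos y < pos x)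
    (y u : Pt n) : d.flip.Btw pos y u ↔ d.Btw pos y.swap u.swap := by
  have hpos' : ∀ x y, pos x.swap < pos y ↔ pos y.swap < pos x := fun x y => by
    simpa using hpos x y.swap
  have h3 : ∀ x y, pos x < pos y.swap ↔ pos y < pos x.swap := fun x y => by
    simpa using hpos x.swap y
  simp only [Btw, flip_partner, hpos, hpos', h3]
  tauto

theorem posL_swap_lt (x y : Pt n) : posL x.swap < posL y.swap ↔ posL y < posL x := by
  have := posL_swap x; have := posL_swap y; omega

theorem posR_swap_lt (x y : Pt n) : posR x.swap < posR y.swap ↔ posR y < posR x := by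
  rcases x with x | x <;> rcases y with y | y <;>
    simp only [Sum.swap_inl, Sum.swap_inr, posR_inl, posR_inr] <;> omega

theorem IsLRBlob.flip (h : d.IsLRBlob) : d.flip.IsLRBlob := by
  have hm := h.isMatching.flip
  have hnc : d.flip.NonCross posL := by
    intro y u h1 h2
    rw [flip_btw posL_swap_lt, flip_btw posL_swap_lt, flip_partner, Sum.swap_swap]
    exact h.nonCross y.swap u.swap (fun e => h1 (by simpa using congrArg Sum.swap e))
      (fun e => h2 (by rw [flip_partner, ← e, Sum.swap_swap]))
  have hsw : ∀ {x y : Pt n}, x.swap = y ↔ x = y.swap := fun {x y} =>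
    ⟨fun e => by rw [← e, Sum.swap_swap], fun e => by rw [e, Sum.swap_swap]⟩
  refine { isTL_iff.2 ⟨hm, hnc⟩ with
    exposedL := ?_, exposedR := ?_, ordered_top := ⟨?_, ?_⟩, ordered_bot := ⟨?_, ?_⟩ }
  · intro x hx
    rw [exposed_iff hm hnc]
    intro y hy
    rw [flip_btw posL_swap_lt] at hy
    exact (exposed_iff h.isMatching h.nonCross).1 (h.exposedL x.swap hx) _ hy
  · intro x hx
    rw [exposed_iff hm (hnc.posR hm)]
    intro y hy
    rw [flip_btw posR_swap_lt] at hy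
    exact (exposed_iff h.isMatching (h.nonCross.posR h.isMatching)).1 (h.exposedR x.swap hx) _ hy
  · intro i j hij
    exact h.ordered_bot.same_line i j (hsw.1 hij)
  · intro i j i' j' hij hij'
    exact h.ordered_bot.two_lines i j i' j' (hsw.1 hij) (hsw.1 hij')
  · intro i j hij
    exact h.ordered_top.same_line i j (hsw.1 hij)
  · intro i j i' j' hij hkl
    exact h.ordered_top.two_lines i j i' j' (hsw.1 hij) (hsw.1 hkl)

/-- The number of blobs, counted at both ends of the lines. -/
def size (d : PreDiagram n) : ℕ := ∑ x, (d.word x).length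

/-- Remove the blob next to `α`. -/
def delBlob (d : PreDiagram n) (α : Pt n) : PreDiagram n where
  partner := d.partner
  word x := if x = α then (d.word α).tail else if x = d.partner α then (d.word x).dropLast
    else d.word x

theorem IsLRBlob.delBlob (h : d.IsLRBlob) (α : Pt n) : (d.delBlob α).IsLRBlob := by
  have hne := h.ne_self α
  refine h.of_sublist rfl (fun x => ?_) fun x => ?_
  · simp only [PreDiagram.delBlob]
    split_ifs with h1 h2
    · rw [h1]; exact List.tail_sublist _
    · exact List.dropLast_sublist _
    · exact List.Sublist.refl _
  · simp only [PreDiagram.delBlob]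
    by_cases h1 : x = α
    · subst h1
      rw [if_neg hne, if_pos rfl, if_pos rfl, h.word_partner, List.dropLast_reverse]
    by_cases h2 : x = d.partner α
    · subst h2
      rw [h.invol, if_pos rfl, if_neg hne, if_pos rfl, h.word_partner, List.dropLast_reverse,
        List.reverse_reverse]
    · rw [if_neg (fun e => h2 (by rw [← e, h.invol])), if_neg (fun e => h1
        (by rw [← h.invol x, e, h.invol])), if_neg h1, if_neg h2, h.word_partner]

theorem IsLRBlob.delBlob_addBlob (h : d.IsLRBlob) {α : Pt n} {g : Blob} {w : List Blob}
    (hw : d.word α = g :: w) : (d.delBlob α).addBlob α g = d := by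
  have hne := h.ne_self α
  ext1
  · rfl
  · funext x
    simp only [PreDiagram.addBlob, PreDiagram.delBlob]
    by_cases h1 : x = α
    · subst h1
      simp [hw]
    by_cases h2 : x = d.partner α
    · subst h2
      simp [hne, h.word_partner, hw]
    · simp [h1, h2]

theorem size_delBlob {α : Pt n} {g : Blob} {w : List Blob} (hw : d.word α = g :: w) :
    (d.delBlob α).size < d.size := by
  refine Finset.sum_lt_sum (fun x _ => ?_) ⟨α, Finset.mem_univ _, ?_⟩
  · simp only [delBlob]
    split_ifs with h1 h2
    · rw [h1]; simp
    · simp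
    · exact le_rfl
  · simp [delBlob, hw]

/-- An undecorated cap from `α` to `β` can be moved to `γ` and `α` and then back without loss. -/
theorem IsMatching.join_join_cancel (hd : d.IsMatching) {α β γ : Pt n} (h1 : d.partner α = β)
    (h2 : d.word α = []) (h3 : γ ≠ α) (h4 : γ ≠ β) : (d.join γ α).join α β = d := by
  have h5 : d.partner β = α := by rw [← h1, hd.invol]
  have h6 : d.word β = [] := by rw [← h1, hd.word_partner, h2]; rfl
  have h7 : α ≠ β := by rw [← h1]; exact (hd.ne_self α).symm
  have h8 := hd.ne_self γ
  have h9 := hd.invol γ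
  have h10 : d.partner γ ≠ α := fun e => h4 (by rw [← h1, ← e, h9])
  have h11 : d.partner γ ≠ β := fun e => h3 (by rw [← h5, ← e, h9])
  have h12 := hd.word_partner γ
  ext1 <;> funext x <;> simp only [PreDiagram.join, h1, h5, h6, h2] <;> grind

/-- Otherwise all `n` top vertices were joined to bottom vertices and would use up all of them. -/
theorem exists_top_cap (hd : d.IsMatching) {i j : Fin n} (h : d.partner (.inr i) = .inr j) :
    ∃ i j, d.partner (.inl i) = .inl j := by
  by_contra! hc
  have h1 : ∀ a, ∃ b, d.partner (.inl a) = .inr b := fun a => by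
    rcases e : d.partner (.inl a) with b | b
    · exact absurd e (hc a b)
    · exact ⟨b, rfl⟩
  choose f hf using h1
  have hinj : Function.Injective f := fun a b e => by
    have := hf a
    rw [e, ← hf b] at this
    simpa using hd.partner_inj.1 this
  obtain ⟨a, ha⟩ := (Finite.injective_iff_surjective.1 hinj) i
  have := hd.partner_eq_iff.1 (hf a)
  rw [ha, h] at this
  simp at this

end PreDiagram

end SympBlob

/-! ### Innermost caps and removable blobs -/

namespace SympBlob

open Blob

namespace PreDiagram

section

variable {n : ℕ} {d : PreDiagram n}

theorem IsLRBlob.not_btw_of_L (h : d.IsLRBlob) {x : Pt n} (hx : L ∈ d.word x) (y : Pt n) :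
    ¬ d.Btw posL y x :=
  (exposed_iff h.isMatching h.nonCross).1 (h.exposedL x hx) y

theorem IsLRBlob.not_btw_of_R (h : d.IsLRBlob) {x : Pt n} (hx : R ∈ d.word x) (y : Pt n) :
    ¬ d.Btw posR y x :=
  (exposed_iff h.isMatching (h.nonCross.posR h.isMatching)).1 (h.exposedR x hx) y

/-- The vertices below a cap at the bottom are joined among themselves. -/
theorem IsLRBlob.inside (h : d.IsLRBlob) {i j t : Fin n} (hij : d.partner (.inr i) = .inr j)
    (h1 : i < t) (h2 : t < j) : ∃ s, d.partner (.inr t) = .inr s ∧ i < s ∧ s < j := by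
  have hji := h.isMatching.partner_eq_iff.1 hij
  have := h.noncrossing (.inr j) (.inr t) (by rw [posL_inr, posL_inr]; omega)
    (by rw [hji, posL_inr, posL_inr]; omega)
  rcases e : d.partner (.inr t) with s | s
  · rw [e, hji, posL_inr, posL_inr, posL_inl] at this
    omega
  · rw [e, hji, posL_inr, posL_inr, posL_inr] at this
    exact ⟨s, rfl, by omega, by omega⟩

theorem exists_ordered_cap (hd : d.IsMatching) {i j : Fin n} (h : d.partner (.inr i) = .inr j) :
    ∃ i j, d.partner (.inr i) = .inr j ∧ i < j := by
  rcases lt_trichotomy i j with hlt | rfl | hlt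
  · exact ⟨i, j, h, hlt⟩
  · exact absurd h (hd.ne_self _)
  · exact ⟨j, i, hd.partner_eq_iff.1 h, hlt⟩

/-- Take the cap whose right end is leftmost. A vertex inside it would belong to a cap that ends
earlier, so it joins neighbours. Unless it starts at vertex 0, the line from there hides it from the
left side. -/
theorem IsLRBlob.exists_left_cap (h : d.IsLRBlob) {i j : Fin n}
    (hij : d.partner (.inr i) = .inr j) : ∃ a b : Fin n, d.partner (.inr a) = .inr b ∧
      (a : ℕ) + 1 = b ∧ (L ∈ d.word (.inr a) → (a : ℕ) = 0) ∧
      ∀ i j, d.partner (.inr i) = .inr j → i < j → b ≤ j := by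
  classical
  have hm := h.isMatching
  obtain ⟨i, j, hij, hlt⟩ := exists_ordered_cap hm hij
  obtain ⟨b, hb, hmin⟩ := Finset.exists_minimal
    (s := Finset.univ.filter fun j : Fin n => ∃ i, d.partner (.inr i) = .inr j ∧ i < j)
    ⟨j, by simp; exact ⟨i, hij, hlt⟩⟩
  simp only [Finset.mem_filter, Finset.mem_univ, true_and] at hb hmin
  obtain ⟨a, hab, halt⟩ := hb
  have hmin' : ∀ i j, d.partner (.inr i) = .inr j → i < j → b ≤ j := fun i j h1 h2 => by
    by_contra hc
    exact hc (hmin ⟨i, h1, h2⟩ (by omega))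
  have hba := hm.partner_eq_iff.1 hab
  refine ⟨a, b, hab, ?_, fun hL => ?_, hmin'⟩
  · by_contra hne
    obtain ⟨s, hs, h1, h2⟩ := h.inside hab (t := ⟨a + 1, by omega⟩) (by simp [Fin.lt_def])
      (by simp only [Fin.lt_def]; omega)
    obtain ⟨u, v, huv⟩ : ∃ u v, d.partner (.inr u) = .inr v ∧ u < v ∧ v < b := by
      rcases lt_trichotomy s ⟨a + 1, by omega⟩ with h3 | h3 | h3
      · exact ⟨s, _, hm.partner_eq_iff.1 hs, h3, by simp only [Fin.lt_def]; omega⟩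
      · rw [h3] at hs
        exact absurd hs (hm.ne_self _)
      · exact ⟨_, s, hs, h3, h2⟩
    have := hmin' u v huv.1 huv.2.1
    omega
  · by_contra hne
    have hnb := h.not_btw_of_L hL (.inr ⟨0, by omega⟩)
    -- The line at the bottom vertex 0 either propagates or, by minimality, ends to the right of
    -- `b`; in both cases it separates `a` from the left side.
    rcases e : d.partner (.inr ⟨0, by omega⟩) with s | s
    · refine hnb (.inr ?_)
      rw [e, posL_inl, posL_inr, posL_inr]
      simp only
      omega
    · have h0 : s ≠ ⟨0, by omega⟩ := by rintro rfl; exact hm.ne_self _ e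
      have h1 : (s : ℕ) ≠ 0 := fun e' => h0 (Fin.ext e')
      have h2 := hmin' _ s e (by simp only [Fin.lt_def]; omega)
      have h3 : s ≠ b := by
        rintro rfl
        have := hm.partner_eq_iff.1 e
        rw [hba] at this
        simp only [Sum.inr.injEq] at this
        rw [this] at hne
        exact hne rfl
      refine hnb (.inr ?_)
      rw [e, posL_inr, posL_inr, posL_inr]
      simp only
      omega

/-- The mirror image: the cap whose left end is rightmost. -/
theorem IsLRBlob.exists_right_cap (h : d.IsLRBlob) {i j : Fin n}
    (hij : d.partner (.inr i) = .inr j) : ∃ a b : Fin n, d.partner (.inr a) = .inr b ∧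
      (a : ℕ) + 1 = b ∧ (R ∈ d.word (.inr a) → (b : ℕ) + 1 = n) ∧
      ∀ i j, d.partner (.inr i) = .inr j → i < j → i ≤ a := by
  classical
  have hm := h.isMatching
  obtain ⟨i, j, hij, hlt⟩ := exists_ordered_cap hm hij
  obtain ⟨a, ha, hmax⟩ := Finset.exists_maximal
    (s := Finset.univ.filter fun i : Fin n => ∃ j, d.partner (.inr i) = .inr j ∧ i < j)
    ⟨i, by simp; exact ⟨j, hij, hlt⟩⟩
  simp only [Finset.mem_filter, Finset.mem_univ, true_and] at ha hmax
  obtain ⟨b, hab, halt⟩ := ha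
  have hmax' : ∀ i j, d.partner (.inr i) = .inr j → i < j → i ≤ a := fun i j h1 h2 => by
    by_contra hc
    exact hc (hmax ⟨j, h1, h2⟩ (by omega))
  have hba := hm.partner_eq_iff.1 hab
  refine ⟨a, b, hab, ?_, fun hR => ?_, hmax'⟩
  · by_contra hne
    obtain ⟨s, hs, h1, h2⟩ := h.inside hab (t := ⟨a + 1, by omega⟩) (by simp [Fin.lt_def])
      (by simp only [Fin.lt_def]; omega)
    obtain ⟨u, v, huv⟩ : ∃ u v, d.partner (.inr u) = .inr v ∧ u < v ∧ a < u := by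
      rcases lt_trichotomy s ⟨a + 1, by omega⟩ with h3 | h3 | h3
      · exact ⟨s, _, hm.partner_eq_iff.1 hs, h3, h1⟩
      · rw [h3] at hs
        exact absurd hs (hm.ne_self _)
      · exact ⟨_, s, hs, h3, by simp [Fin.lt_def]⟩
    have := hmax' u v huv.1 huv.2.1
    omega
  · by_contra hne
    have hnb := h.not_btw_of_R hR (.inr ⟨n - 1, by omega⟩)
    rcases e : d.partner (.inr ⟨n - 1, by omega⟩) with s | s
    · refine hnb (.inl ?_)
      rw [e, posR_inl, posR_inr, posR_inr]
      simp only
      omega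
    · have h0 : s ≠ ⟨n - 1, by omega⟩ := by rintro rfl; exact hm.ne_self _ e
      have h1 : (s : ℕ) ≠ n - 1 := fun e' => h0 (Fin.ext e')
      have h2 := hmax' s _ (hm.partner_eq_iff.1 e) (by simp only [Fin.lt_def]; omega)
      have h3 : s ≠ a := by
        rintro rfl
        have := hm.partner_eq_iff.1 e
        rw [hab] at this
        simp only [Sum.inr.injEq] at this
        rw [this] at hne
        simp only at hne
        omega
      refine hnb (.inl ?_)
      rw [e, posR_inr, posR_inr, posR_inr]
      simp only
      omega

theorem mem_of_not_L {w : List Blob} (h : w ≠ []) (hL : L ∉ w) : R ∈ w := by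
  obtain ⟨g, w, rfl⟩ := List.exists_cons_of_ne_nil h
  cases g
  · simp at hL
  · simp

theorem eq_L_cons {w : List Blob} (h : L ∈ w) (h' : ¬ [R, L].Sublist w) : ∃ w', w = L :: w' := by
  obtain ⟨g, w, rfl⟩ := List.exists_cons_of_ne_nil (List.ne_nil_of_mem h)
  cases g
  · exact ⟨w, rfl⟩
  · exact absurd (List.cons_sublist_cons.2 (List.singleton_sublist.2 (by simpa using h))) h'

theorem eq_concat_R {w : List Blob} (h : R ∈ w) (h' : ¬ [R, L].Sublist w) :
    ∃ w', w.reverse = R :: w' := by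
  rw [← List.reverse_reverse w] at h h'
  generalize w.reverse = v at *
  obtain ⟨g, v, rfl⟩ := List.exists_cons_of_ne_nil (l := v) (by rintro rfl; simp at h)
  cases g
  · rw [List.reverse_cons] at h'
    refine absurd ?_ h'
    exact List.Sublist.append (l₁ := [R]) (List.singleton_sublist.2 (by simpa using h))
      (List.Sublist.refl [L])
  · exact ⟨v, rfl⟩

/-- A diagram with a cap at the bottom has an undecorated cap there that joins neighbours, or a
blob that can be removed. -/
theorem IsLRBlob.cap_cases [NeZero n] (h : d.IsLRBlob) {i j : Fin n}
    (hij : d.partner (.inr i) = .inr j) :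
    (∃ a b : Fin n, d.partner (.inr a) = .inr b ∧ (a : ℕ) + 1 = b ∧ d.word (.inr a) = []) ∨
    (∃ w, d.word (.inr 0) = L :: w) ∨ ∃ w, d.word (.inr (Fin.rev 0)) = R :: w := by
  have hm := h.isMatching
  obtain ⟨a, b, hab, h1, h2, h3⟩ := h.exists_left_cap hij
  by_cases hw : d.word (.inr a) = []
  · exact .inl ⟨a, b, hab, h1, hw⟩
  by_cases hL : L ∈ d.word (.inr a)
  · right; left
    have ha : a = 0 := Fin.ext (by rw [h2 hL, Fin.val_zero])
    rw [← ha]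
    exact eq_L_cons hL (h.ordered_bot.same_line a b hab (by omega))
  have hR := mem_of_not_L hw hL
  obtain ⟨a', b', hab', h1', h2', h3'⟩ := h.exists_right_cap hij
  by_cases hw' : d.word (.inr a') = []
  · exact .inl ⟨a', b', hab', h1', hw'⟩
  by_cases hR' : R ∈ d.word (.inr a')
  · right; right
    have hb : (Fin.rev 0) = b' := Fin.ext (by rw [Fin.val_rev, Fin.val_zero]; have := h2' hR'; omega)
    rw [hb, ← hab', hm.word_partner]
    exact eq_concat_R hR' (h.ordered_bot.same_line a' b' hab' (by omega))
  -- The leftmost cap has a right blob and the rightmost cap a left blob, against the order of the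
  -- blobs.
  · exfalso
    have hL' : L ∈ d.word (.inr a') := by
      obtain ⟨g, w, e⟩ := List.exists_cons_of_ne_nil hw'
      cases g
      · rw [e]; simp
      · rw [e] at hR'; simp at hR'
    have ne1 : a ≠ a' := by rintro rfl; exact hL hL'
    have ne2 : b ≠ a' := by
      rintro rfl
      have := hm.partner_eq_iff.1 hab
      rw [hab'] at this
      simp only [Sum.inr.injEq] at this
      omega
    have := h3' a b hab (by omega)
    exact h.ordered_bot.two_lines a b a' b' hab hab' (by omega) (by omega) (by omega) ⟨hR, hL'⟩

/-- Without caps all lines propagate, and since they do not cross they are vertical. By exposure, a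
left blob can only be on the first line and a right blob only on the last one. -/
theorem IsLRBlob.eq_one [NeZero n] (h : d.IsLRBlob) (hc : ∀ i j, d.partner (.inr i) ≠ .inr j)
    (hL : ∀ w, d.word (.inr 0) ≠ L :: w) (hR : ∀ w, d.word (.inr (Fin.rev 0)) ≠ R :: w) :
    d = one n := by
  have hm := h.isMatching
  have h1 : ∀ a, ∃ b, d.partner (.inr a) = .inl b := fun a => by
    rcases e : d.partner (.inr a) with b | b
    · exact ⟨b, rfl⟩
    · exact absurd e (hc a b)
  choose f hf using h1
  have hf' : ∀ a, d.partner (.inl (f a)) = .inr a := fun a => hm.partner_eq_iff.1 (hf a)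
  have hmono : StrictMono f := by
    intro i j hij
    by_contra hc
    have hne : f i ≠ f j := fun e => by
      have := hf' i
      rw [e, hf' j] at this
      simp only [Sum.inr.injEq] at this
      omega
    have := h.noncrossing (.inl (f j)) (.inl (f i)) (by rw [posL_inl, posL_inl]; omega)
      (by rw [hf', posL_inl, posL_inr]; omega)
    rw [hf', hf', posL_inr, posL_inr] at this
    omega
  -- A strictly increasing map of `Fin n` to itself is the identity.
  have hid : ∀ a, f a = a := fun a => le_antisymm hmono.apply_le hmono.le_apply
  simp only [hid] at hf hf'
  have v0 : ((0 : Fin n) : ℕ) = 0 := Fin.val_zero n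
  have vl : ((Fin.rev 0 : Fin n) : ℕ) + 1 = n := by
    rw [Fin.val_rev, v0]; have := NeZero.pos n; omega
  have hw : ∀ i, d.word (.inr i) = [] := by
    intro i
    rcases e : d.word (.inr i) with - | ⟨g, w⟩
    · rfl
    · exfalso
      cases g
      · have := h.not_btw_of_L (x := .inr i) (by rw [e]; simp) (.inr 0)
        refine hL w ?_
        rw [← e]
        congr 2
        ext
        by_contra hne
        refine this (.inr ?_)
        rw [hf, posL_inl, posL_inr, posL_inr]
        omega
      · have := h.not_btw_of_R (x := .inr i) (by rw [e]; simp) (.inr (Fin.rev 0))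
        refine hR w ?_
        rw [← e]
        congr 2
        ext
        by_contra hne
        refine this (.inl ?_)
        rw [hf, posR_inl, posR_inr, posR_inr]
        omega
  ext1
  · funext x
    rcases x with x | x
    · exact hf' x
    · exact hf x
  · funext x
    rw [one_word]
    rcases x with x | x
    · rw [← hf x, hm.word_partner, hw]; rfl
    · exact hw x

end

end PreDiagram

end SympBlob

/-! ### Every left-right blob diagram is the diagram of a word -/

namespace SympBlob

open Blob

namespace PreDiagram

section

variable {m : ℕ} {d : PreDiagram (m + 2)}

/-- The diagram `d` arises from a diagram with an undecorated cap on the left at the bottom, and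
with the same lines at the top. -/
def Standardizes (d : PreDiagram (m + 2)) : Prop :=
  ∃ (d' : PreDiagram (m + 2)) (v : List (Fin (m + 3))), d'.IsLRBlob ∧ d = d'.ractList v ∧
    (d'.partner (.inr 0) = .inr 1 ∧ d'.word (.inr 0) = []) ∧
    ∀ i j, d.partner (.inl i) = .inl j →
      d'.partner (.inl i) = .inl j ∧ d'.word (.inl i) = d.word (.inl i)

theorem Standardizes.of_ract {d' : PreDiagram (m + 2)} (h : d'.Standardizes) (i : Fin (m + 3))
    (h' : d'.ract i = d) (ht : ∀ i j, d.partner (.inl i) = .inl j →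
      d'.partner (.inl i) = .inl j ∧ d'.word (.inl i) = d.word (.inl i)) : d.Standardizes := by
  obtain ⟨d'', v, h1, h2, h3, h4⟩ := h
  refine ⟨d'', v ++ [i], h1, ?_, h3, fun a b hab => ?_⟩
  · rw [ractList_append, ← h2, ← h']; rfl
  · have := ht a b hab
    have h5 := h4 a b this.1
    exact ⟨h5.1, h5.2.trans this.2⟩

/-- The cap is moved one place to the left at a time; each move is undone by a generator. -/
theorem IsLRBlob.standardizes_of_cap (h : d.IsLRBlob) {a b : Fin (m + 2)}
    (hab : d.partner (.inr a) = .inr b) (hs : (a : ℕ) + 1 = b) (hw : d.word (.inr a) = []) :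
    d.Standardizes := by
  obtain ⟨t, ht⟩ : ∃ t, t = (a : ℕ) := ⟨_, rfl⟩
  induction t generalizing d a b with
  | zero =>
    have h0 : a = 0 := Fin.ext (by rw [← ht]; rfl)
    have h1 : b = 1 := Fin.ext (by rw [← hs, ← ht]; rfl)
    subst h0 h1
    exact ⟨d, [], h, rfl, ⟨hab, hw⟩, fun i j hij => ⟨hij, rfl⟩⟩
  | succ t ih =>
    have hm := h.isMatching
    obtain ⟨c, hc⟩ : ∃ c : Fin (m + 2), (c : ℕ) = t := ⟨⟨t, by omega⟩, rfl⟩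
    have e1 := ract_mid d (i := ⟨a, by omega⟩) (a := c) (b := a) (by simp only; omega) rfl
    have hst := ih (h.ract ⟨a, by omega⟩) (a := c) (b := a) (by rw [e1, join_partner_left])
      (by omega) (by rw [e1, join_word_left]) hc.symm
    refine hst.of_ract ⟨b, by omega⟩ ?_ fun i j hij => ?_
    · rw [ract_mid _ (a := a) (b := b) (by simp only; omega) rfl, e1]
      refine hm.join_join_cancel hab hw ?_ ?_
      · intro e; simp only [Sum.inr.injEq] at e; omega
      · intro e; simp only [Sum.inr.injEq] at e; omega
    · rw [e1]
      exact join_inl_of_inner hm hij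

/-- Removable blobs are peeled off by induction on their number, until an undecorated cap between
neighbours appears, as `cap_cases` guarantees. -/
theorem IsLRBlob.standardizes (h : d.IsLRBlob) {i j : Fin (m + 2)}
    (hij : d.partner (.inr i) = .inr j) : d.Standardizes := by
  obtain ⟨N, hN⟩ : ∃ N, N = d.size := ⟨_, rfl⟩
  induction N using Nat.strong_induction_on generalizing d with
  | _ N ih =>
    have key : ∀ (l : Fin (m + 3)) (a : Fin (m + 2)) (g : Blob) (w : List Blob),
        (∀ d : PreDiagram (m + 2), d.ract l = d.addBlob (.inr a) g) → d.word (.inr a) = g :: w →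
        d.Standardizes := by
      intro l a g w hl hw
      have h1 := ih _ (by rw [hN]; exact size_delBlob hw) (h.delBlob (.inr a)) hij rfl
      refine h1.of_ract l (by rw [hl, h.delBlob_addBlob hw]) fun i j hij => ⟨hij, ?_⟩
      simp only [PreDiagram.delBlob]
      rw [if_neg (by simp), if_neg]
      intro e
      rw [e, h.invol] at hij
      simp at hij
    rcases h.cap_cases hij with ⟨a, b, hab, hs, hw⟩ | ⟨w, hw⟩ | ⟨w, hw⟩
    · exact h.standardizes_of_cap hab hs hw
    · exact key 0 0 L w (fun d => ract_zero d) hw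
    · exact key (Fin.last _) (Fin.rev 0) R w (fun d => ract_last d) hw

theorem posR_sh_lt (x y : Pt m) : posR (sh x) < posR (sh y) ↔ posR x < posR y := by
  rcases x with i | i <;> rcases y with j | j <;>
    simp only [sh_inr, sh_inl, posR_inl, posR_inr, Fin.val_succ] <;> omega

theorem isLRBlob_of_iota {c : PreDiagram m} (h : c.iota.IsLRBlob) : c.IsLRBlob where
  invol x := sh_injective (by rw [← iota_partner_sh, ← iota_partner_sh, h.invol])
  ne_self x e := h.ne_self (sh x) (by rw [iota_partner_sh, e])
  noncrossing x y := by
    have := h.noncrossing (sh x) (sh y)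
    simpa only [iota_partner_sh, posL_sh, add_lt_add_iff_right] using this
  word_partner x := by
    have := h.word_partner (sh x)
    rwa [iota_partner_sh, iota_word_sh, iota_word_sh] at this
  exposedL x hx y := by
    have := h.exposedL (sh x) (by rwa [iota_word_sh]) (sh y)
    simpa only [iota_partner_sh, posL_sh, add_lt_add_iff_right] using this
  exposedR x hx y := by
    have := h.exposedR (sh x) (by rwa [iota_word_sh]) (sh y)
    simpa only [iota_partner_sh, posR_sh_lt] using this
  ordered_top := ⟨fun i j hij hlt => by
    have := h.ordered_top.same_line i.succ.succ j.succ.succ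
      (by rw [← sh_inl, iota_partner_sh, hij]; rfl) (by simpa using hlt)
    rwa [← sh_inl, iota_word_sh] at this,
    fun i j i' j' hij hij' h1 h2 h3 => by
    have := h.ordered_top.two_lines i.succ.succ j.succ.succ i'.succ.succ j'.succ.succ
      (by rw [← sh_inl, iota_partner_sh, hij]; rfl) (by rw [← sh_inl, iota_partner_sh, hij']; rfl)
      (by simpa using h1) (by simpa using h2) (by simpa using h3)
    rwa [← sh_inl, ← sh_inl, iota_word_sh, iota_word_sh] at this⟩
  ordered_bot := ⟨fun i j hij hlt => by
    have := h.ordered_bot.same_line i.succ.succ j.succ.succ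
      (by rw [← sh_inr, iota_partner_sh, hij]; rfl) (by simpa using hlt)
    rwa [← sh_inr, iota_word_sh] at this,
    fun i j i' j' hij hij' h1 h2 h3 => by
    have := h.ordered_bot.two_lines i.succ.succ j.succ.succ i'.succ.succ j'.succ.succ
      (by rw [← sh_inr, iota_partner_sh, hij]; rfl) (by rw [← sh_inr, iota_partner_sh, hij']; rfl)
      (by simpa using h1) (by simpa using h2) (by simpa using h3)
    rwa [← sh_inr, ← sh_inr, iota_word_sh, iota_word_sh] at this⟩

theorem IsMatching.exists_iota (hd : d.IsMatching)
    (h1 : d.partner (.inl 0) = .inl 1 ∧ d.word (.inl 0) = [])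
    (h2 : d.partner (.inr 0) = .inr 1 ∧ d.word (.inr 0) = []) : ∃ c : PreDiagram m, d = c.iota := by
  have h1' := hd.partner_eq_iff.1 h1.1
  have h2' := hd.partner_eq_iff.1 h2.1
  have key : ∀ y : Pt m, ∃ z, d.partner (sh y) = sh z := by
    intro y
    have hy := sh_ne y
    rcases pt_cases (d.partner (sh y)) with e | e | e | e | ⟨z, e⟩
    · rw [hd.partner_eq_iff, h1.1] at e; exact absurd e.symm hy.2.1
    · rw [hd.partner_eq_iff, h1'] at e; exact absurd e.symm hy.1
    · rw [hd.partner_eq_iff, h2.1] at e; exact absurd e.symm hy.2.2.2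
    · rw [hd.partner_eq_iff, h2'] at e; exact absurd e.symm hy.2.2.1
    · exact ⟨z, e⟩
  choose f hf using key
  refine ⟨⟨f, fun y => d.word (sh y)⟩, eq_iota h1 ⟨h1', ?_⟩ h2 ⟨h2', ?_⟩ fun y => ⟨hf y, rfl⟩⟩
  · rw [← h1.1, hd.word_partner, h1.2]; rfl
  · rw [← h2.1, hd.word_partner, h2.2]; rfl

/-- A diagram with an undecorated cap at the bottom and one at the top, both on the left, is the
diagram of a word, by induction on the number of vertices. -/
theorem IsLRBlob.exists_raw_of_iota {c : PreDiagram m} (h : c.iota.IsLRBlob)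
    (ih : ∀ _ : NeZero m, ∀ c : PreDiagram m, c.IsLRBlob → ∃ w, raw w = c) :
    ∃ w, raw w = c.iota := by
  rcases Nat.eq_zero_or_pos m with rfl | hm
  · refine ⟨[1], ?_⟩
    rw [← iota_one]
    congr 1
    ext1 <;> funext x <;> rcases x with x | x <;> exact x.elim0
  · have : NeZero m := ⟨by omega⟩
    obtain ⟨w, rfl⟩ := ih this c (isLRBlob_of_iota h)
    exact ⟨_, raw_hat w⟩

end

theorem IsLRBlob.exists_raw_of_no_cap {n : ℕ} [NeZero n] {d : PreDiagram n} (h : d.IsLRBlob)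
    (hc : ∀ i j, d.partner (.inr i) ≠ .inr j) : ∃ w, raw w = d := by
  obtain ⟨N, hN⟩ : ∃ N, N = d.size := ⟨_, rfl⟩
  induction N using Nat.strong_induction_on generalizing d with
  | _ N ih =>
    have key : ∀ (l : Fin (n + 1)) (a : Fin n) (g : Blob) (w : List Blob),
        (∀ d : PreDiagram n, d.ract l = d.addBlob (.inr a) g) → d.word (.inr a) = g :: w →
        ∃ w, raw w = d := by
      intro l a g w hl hw
      obtain ⟨v, hv⟩ := ih _ (by rw [hN]; exact size_delBlob hw) (h.delBlob (.inr a)) hc rfl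
      refine ⟨v ++ [l], ?_⟩
      rw [raw, ractList_append, ractList_cons, ractList_nil, ← raw, hv, hl, h.delBlob_addBlob hw]
    by_cases hL : ∃ w, d.word (.inr 0) = L :: w
    · obtain ⟨w, hw⟩ := hL
      exact key 0 0 L w (fun d => ract_zero d) hw
    by_cases hR : ∃ w, d.word (.inr (Fin.rev 0)) = R :: w
    · obtain ⟨w, hw⟩ := hR
      exact key (Fin.last _) (Fin.rev 0) R w (fun d => ract_last d) hw
    · exact ⟨[], (h.eq_one hc (by simpa using hL) (by simpa using hR)).symm⟩

/-- A cap at the bottom forces one at the top. Both are brought to the left, the second one after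
reflection, and what remains is a diagram on two vertices fewer with a cup and a cap added. -/
theorem IsLRBlob.exists_raw {n : ℕ} [hn : NeZero n] {d : PreDiagram n} (h : d.IsLRBlob) :
    ∃ w, raw w = d := by
  induction n using Nat.strong_induction_on generalizing hn with
  | _ n ih =>
    by_cases hc : ∀ i j, d.partner (.inr i) ≠ .inr j
    · exact h.exists_raw_of_no_cap hc
    push Not at hc
    obtain ⟨i, j, hij⟩ := hc
    have hne : i ≠ j := by rintro rfl; exact h.ne_self _ hij
    obtain ⟨m, rfl⟩ : ∃ m, n = m + 2 := ⟨n - 2, by omega⟩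
    obtain ⟨i', j', hij'⟩ := exists_top_cap h.isMatching hij
    obtain ⟨d₁, v₁, h₁, e₁, c₁, t₁⟩ := h.standardizes hij
    have hj := (t₁ i' j' hij').1
    obtain ⟨d₂, v₂, h₂, e₂, c₂, t₂⟩ := h₁.flip.standardizes (i := i') (j := j')
      (by rw [flip_partner, Sum.swap_inr, hj, Sum.swap_inl])
    -- After the reflection the first cap lies at the top. Moving the second cap keeps the lines at
    -- the top, so the first one is still there.
    have c₃ := t₂ 0 1 (by rw [flip_partner, Sum.swap_inl, c₁.1, Sum.swap_inr])
    rw [flip_word, Sum.swap_inl, c₁.2] at c₃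
    obtain ⟨c, rfl⟩ := h₂.isMatching.exists_iota c₃ c₂
    obtain ⟨w, hw⟩ := h₂.exists_raw_of_iota fun _ c hc => ih m (by omega) hc
    refine ⟨(w ++ v₂).reverse ++ v₁, ?_⟩
    have h3 : raw (w ++ v₂).reverse = d₁ := by
      rw [← flip_raw, raw, ractList_append, ← raw, hw, ← e₂, flip_flip]
    rw [raw, ractList_append, ← raw, h3, e₁]

end PreDiagram

end SympBlob

/-! ### Nonzero scalars, and P_n up to scalars -/

namespace SympBlob

open Blob PreDiagram

section Scalars

variable {k : Type*} [Field k] {q : Params k}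

/-- All parameters are different from zero. -/
structure Params.Nonzero (q : Params k) : Prop where
  δ : q.δ ≠ 0
  δL : q.δL ≠ 0
  δR : q.δR ≠ 0
  κL : q.κL ≠ 0
  κR : q.κR ≠ 0
  κLR : q.κLR ≠ 0

variable (hq : q.Nonzero) {n : ℕ}

include hq

theorem loopWeight_ne_zero (l r : ℕ) : loopWeight q l r ≠ 0 := by
  rcases l with - | l <;> rcases r with - | r <;>
    simp [loopWeight, hq.δ, hq.δL, hq.δR, hq.κL, hq.κR, hq.κLR]

theorem straightenWord_ne_zero (w : List Blob) : (straightenWord q w).1 ≠ 0 := by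
  induction w with
  | nil => simp [straightenWord]
  | cons g w ih =>
    refine mul_ne_zero ih ?_
    unfold push
    split <;> simp [hq.δL, hq.δR, hq.κLR]

theorem redScalar_ne_zero (d : PreDiagram n) : redScalar q d ≠ 0 := by
  refine mul_ne_zero (Finset.prod_ne_zero_iff.2 fun x _ => straightenWord_ne_zero hq _) ?_
  unfold topological
  split <;> simp [hq.κLR]

theorem rweightList_ne_zero [NeZero n] (d : PreDiagram n) (l : List (Fin (n + 1))) :
    rweightList q d l ≠ 0 := by
  induction l generalizing d with
  | nil => simp [rweightList]
  | cons i l ih =>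
    refine mul_ne_zero ?_ (ih _)
    unfold rweight joinWeight
    split_ifs <;> simp [loopWeight_ne_zero hq]

theorem wscalar_ne_zero [NeZero n] (l : List (Fin (n + 1))) : wscalar q l ≠ 0 :=
  mul_ne_zero (rweightList_ne_zero hq _ _) (redScalar_ne_zero hq _)

end Scalars

section

variable {k : Type*} [Field k] (q : Params k) {n : ℕ}

/-- The value of a word in `P_n`. -/
def Ew (l : List (Fin (n + 1))) : P q n := (l.map (E q)).prod

theorem Ew_append (u v : List (Fin (n + 1))) : Ew q (u ++ v) = Ew q u * Ew q v := by simp [Ew]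

theorem mk_word (l : List (Fin (n + 1))) :
    RingQuot.mkAlgHom k (Rel q n) (l.map (gen k)).prod = Ew q l := by
  rw [map_list_prod, List.map_map]; rfl

theorem span_Ew : Submodule.span k (Set.range (Ew q (n := n))) = ⊤ := by
  rw [eq_top_iff]
  rintro x -
  obtain ⟨a, rfl⟩ := RingQuot.mkAlgHom_surjective k (Rel q n) x
  induction a using FreeAlgebra.induction with
  | grade0 r =>
    rw [AlgHom.commutes, Algebra.algebraMap_eq_smul_one]
    exact Submodule.smul_mem _ _ (Submodule.subset_span ⟨[], rfl⟩)
  | grade1 i => exact Submodule.subset_span ⟨[i], by simp [Ew, E]⟩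
  | mul a b ha hb =>
    rw [map_mul]
    have := Submodule.mul_mem_mul ha hb
    rw [Submodule.span_mul_span] at this
    refine Submodule.span_mono ?_ this
    rintro _ ⟨_, ⟨u, rfl⟩, _, ⟨v, rfl⟩, rfl⟩
    exact ⟨u ++ v, Ew_append q u v⟩
  | add a b ha hb => rw [map_add]; exact Submodule.add_mem _ ha hb

/-- Equality up to a nonzero scalar. -/
def scalarCon (n : ℕ) : Con (P q n) where
  r x y := ∃ c : k, c ≠ 0 ∧ x = c • y
  iseqv := ⟨fun x => ⟨1, one_ne_zero, (one_smul _ _).symm⟩,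
    fun ⟨c, hc, h⟩ => ⟨c⁻¹, inv_ne_zero hc, by rw [h, smul_smul, inv_mul_cancel₀ hc, one_smul]⟩,
    fun ⟨c, hc, h⟩ ⟨c', hc', h'⟩ => ⟨c * c', mul_ne_zero hc hc', by rw [h, h', smul_smul]⟩⟩
  mul' := fun ⟨c, hc, h⟩ ⟨c', hc', h'⟩ => ⟨c * c', mul_ne_zero hc hc', by
    rw [h, h', smul_mul_smul_comm]⟩

/-- The generators of `P_n`, up to nonzero scalars. -/
def scalarGen (n i : ℕ) : (scalarCon q n).Quotient := (E q (letter n i) : P q n)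

theorem eval_scalarGen (l : List (Fin (n + 1))) :
    eval (scalarGen q n) l = ((Ew q l : P q n) : (scalarCon q n).Quotient) := by
  induction l with
  | nil => rfl
  | cons i l ih =>
    rw [eval_cons, ih, scalarGen, letter, Fin.ofNat_val_eq_self, ← Con.coe_mul]
    simp [Ew]

variable {q} (hq : q.Nonzero)

include hq

/-- Every relation of P_n equates two words up to a parameter, and nonzero parameters disappear in
the quotient. -/
theorem scalarGen_monRel : MonRel n (scalarGen q n) := by
  have W : ∀ {c : k} {u v : List (Fin (n + 1))}, c ≠ 0 →
      Rel q n (u.map (gen k)).prod (c • (v.map (gen k)).prod) →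
      eval (scalarGen q n) u = eval (scalarGen q n) v := by
    intro c u v hc hr
    rw [eval_scalarGen, eval_scalarGen, Con.eq]
    refine ⟨c, hc, ?_⟩
    have := RingQuot.mkAlgHom_rel k hr
    rwa [map_smul, mk_word, mk_word] at this
  have W1 : ∀ {u v : List (Fin (n + 1))},
      Rel q n (u.map (gen k)).prod (v.map (gen k)).prod →
      eval (scalarGen q n) u = eval (scalarGen q n) v := fun h =>
    W one_ne_zero (by rwa [one_smul])
  refine ⟨fun i j hij hj => ?_, fun i hi => ?_, fun h2 => ?_, fun i h1 h2 => ?_,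
    fun i h1 h2 => ?_, fun i h1 h2 => ?_, ?_, ?_⟩
  · simpa using W1 (u := [⟨i, by omega⟩, ⟨j, by omega⟩]) (v := [⟨j, by omega⟩, ⟨i, by omega⟩])
      (by simpa using Rel.comm _ _ hij)
  · rcases Nat.eq_zero_or_pos i with rfl | h0
    · simpa using W hq.δL (u := [0, 0]) (v := [0]) (by simpa using Rel.sq_left)
    · rcases Nat.lt_or_ge i n with hlt | hge
      · simpa using W hq.δ (u := [⟨i, by omega⟩, ⟨i, by omega⟩]) (v := [⟨i, by omega⟩])
          (by simpa using Rel.sq_mid (q := q) (n := n) ⟨i, by omega⟩ h0 hlt)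
      · obtain rfl : i = n := by omega
        simpa using W hq.δR (u := [Fin.last i, Fin.last i]) (v := [Fin.last i])
          (by simpa using Rel.sq_right)
  · simpa [mul_assoc] using W hq.κL (u := [⟨1, by omega⟩, 0, ⟨1, by omega⟩]) (v := [⟨1, by omega⟩])
      (by simpa [mul_assoc] using Rel.left (q := q) (n := n) ⟨1, by omega⟩ rfl h2)
  · simpa [mul_assoc] using W hq.κR (u := [⟨i, by omega⟩, Fin.last n, ⟨i, by omega⟩])
      (v := [⟨i, by omega⟩])
      (by simpa [mul_assoc] using Rel.right (q := q) (n := n) ⟨i, by omega⟩ h1 h2)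
  · have hr := Rel.braid_up (q := q) (n := n) ⟨i, by omega⟩ ⟨i + 1, by omega⟩ h1 rfl h2
    simpa [mul_assoc] using W1 (u := [⟨i, by omega⟩, ⟨i + 1, by omega⟩, ⟨i, by omega⟩])
      (v := [⟨i, by omega⟩]) (by simpa [mul_assoc] using hr)
  · have hr := Rel.braid_down (q := q) (n := n) ⟨i, by omega⟩ ⟨i + 1, by omega⟩ h1 rfl h2
    simpa [mul_assoc] using W1 (u := [⟨i + 1, by omega⟩, ⟨i, by omega⟩, ⟨i + 1, by omega⟩])
      (v := [⟨i + 1, by omega⟩]) (by simpa [mul_assoc] using hr)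
  · simpa [mul_assoc] using W hq.κLR (u := listI n ++ listJ n ++ listI n) (v := listI n)
      (by rw [List.map_append, List.map_append, List.prod_append, List.prod_append]
          exact Rel.IJI)
  · simpa [mul_assoc] using W hq.κLR (u := listJ n ++ listI n ++ listJ n) (v := listJ n)
      (by rw [List.map_append, List.map_append, List.prod_append, List.prod_append]
          exact Rel.JIJ)

/-- The factor is not identified here; it is found later by comparing the vectors of the two words.
-/
theorem exists_smul_Ew [NeZero n] {u v : List (Fin (n + 1))} (h : wdiag q u = wdiag q v) :
    ∃ c : k, c ≠ 0 ∧ Ew q u = c • Ew q v := by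
  have := presents q n _ _ (scalarGen_monRel hq) u v h
  rw [eval_scalarGen, eval_scalarGen, Con.eq] at this
  exact this

end

end SympBlob

/-! ### The action of P_n on diagrams and the isomorphism -/

namespace SympBlob

open Blob PreDiagram MulOpposite

section

variable {k : Type*} [Field k] (q : Params k) {n : ℕ} [NeZero n]

/-- The diagrams in `B_n`. -/
abbrev BDiagram (n : ℕ) : Type := {d : PreDiagram n // d.MemB}

/-- Right multiplication by a generator on linear combinations of diagrams. -/
noncomputable def act (i : Fin (n + 1)) : Module.End k (BDiagram n →₀ k) :=
  Finsupp.lift _ k _ fun d => Finsupp.single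
    ⟨red q (d.1.ract i), (d.2.toIsLRBlob.ract i).memB_red q⟩
    (rweight q d.1 i * redScalar q (d.1.ract i))

/-- The diagram of a word, with its scalar. -/
noncomputable def wordVec (l : List (Fin (n + 1))) : BDiagram n →₀ k :=
  Finsupp.single ⟨wdiag q l, memB_wdiag q l⟩ (wscalar q l)

omit [NeZero n] in
theorem single_congr {d d' : PreDiagram n} {hd : d.MemB} {hd' : d'.MemB} {c c' : k} (h : d = d')
    (h' : c = c') : (Finsupp.single ⟨d, hd⟩ c : BDiagram n →₀ k) = Finsupp.single ⟨d', hd'⟩ c' := by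
  subst h h'; rfl

theorem act_wordVec (i : Fin (n + 1)) (l : List (Fin (n + 1))) :
    act q i (wordVec q l) = wordVec q (l ++ [i]) := by
  rw [act, wordVec, Finsupp.lift_apply, Finsupp.sum_single_index (by simp), Finsupp.smul_single]
  refine single_congr (wdiag_append q l [i]).symm ?_
  rw [wscalar_append]
  simp [rweightList]

theorem exists_word {d : PreDiagram n} (hd : d.MemB) : ∃ w : List (Fin (n + 1)), raw w = d :=
  hd.toIsLRBlob.exists_raw

theorem wdiag_of_memB {w : List (Fin (n + 1))} (h : (raw w).MemB) : wdiag q w = raw w := h.red_eq q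

theorem wordVec_eq_smul {c : k} {u v : List (Fin (n + 1))} (h : WEq q c u v) :
    wordVec q u = c • wordVec q v := by
  rw [wordVec, wordVec, Finsupp.smul_single]
  exact single_congr h.1 h.2

/-- The right action of the free algebra on linear combinations of diagrams. -/
noncomputable def freeAction (n : ℕ) [NeZero n] :
    FreeAlgebra k (Fin (n + 1)) →ₐ[k] (Module.End k (BDiagram n →₀ k))ᵐᵒᵖ :=
  FreeAlgebra.lift k fun i => op (act q i)

theorem freeAction_word (u l : List (Fin (n + 1))) :
    (freeAction q n (l.map (gen k)).prod).unop (wordVec q u) = wordVec q (u ++ l) := by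
  induction l generalizing u with
  | nil => simp
  | cons i l ih =>
    have : freeAction q n (gen k i) = op (act q i) := FreeAlgebra.lift_ι_apply _ _
    rw [List.map_cons, List.prod_cons, map_mul, unop_mul, Module.End.mul_apply, this, unop_op,
      act_wordVec, ih]
    simp

variable {q} (hq : q.Nonzero)

include hq

theorem single_eq_smul_wordVec (d : BDiagram n) :
    ∃ (w : List (Fin (n + 1))) (c : k), Finsupp.single d 1 = c • wordVec q w := by
  obtain ⟨w, hw⟩ := exists_word d.2
  have h1 := wscalar_ne_zero hq w
  refine ⟨w, (wscalar q w)⁻¹, ?_⟩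
  rw [wordVec, Finsupp.smul_single, smul_eq_mul, inv_mul_cancel₀ h1]
  exact single_congr (by rw [wdiag_of_memB q (by rw [hw]; exact d.2), hw]) rfl

/-- Each basis vector is a multiple of the vector of a word `w`, on which the two sides act as `w ++
u` and `w ++ v`. So a relation checked on the identity diagram holds on all diagrams. -/
theorem freeAction_rel {c : k} {u v : List (Fin (n + 1))} (h : WEq q c u v) :
    freeAction q n (u.map (gen k)).prod = c • freeAction q n (v.map (gen k)).prod := by
  refine unop_injective (Finsupp.lhom_ext' fun d => LinearMap.ext_ring ?_)
  obtain ⟨w, a, e⟩ := single_eq_smul_wordVec hq d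
  rw [LinearMap.comp_apply, LinearMap.comp_apply, Finsupp.lsingle_apply, e, map_smul, map_smul,
    freeAction_word, unop_smul, LinearMap.smul_apply, freeAction_word, wordVec_eq_smul q (h.append_left w)]

theorem freeAction_eq_of_rel {a b : FreeAlgebra k (Fin (n + 1))} (h : Rel q n a b) :
    freeAction q n a = freeAction q n b := by
  have W : ∀ {c : k} {u v : List (Fin (n + 1))}, WEq q c u v → freeAction q n (u.map (gen k)).prod =
      freeAction q n (c • (v.map (gen k)).prod) := fun h => by
    rw [freeAction_rel hq h, map_smul]
  rcases h with ⟨i, j, h⟩ | _ | ⟨i, h1, h2⟩ | _ | ⟨i, h1, h2⟩ | ⟨i, h1, h2⟩ | ⟨i, j, h1, h2, h3⟩ |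
    ⟨i, j, h1, h2, h3⟩ | _ | _
  · simpa using W (wEq_comm q i j h)
  · simpa using W (wEq_sq_left q (n := n))
  · simpa using W (wEq_sq_mid q i h1 h2)
  · simpa using W (wEq_sq_right q (n := n))
  · simpa [mul_assoc] using W (wEq_left q i h1 h2)
  · simpa [mul_assoc] using W (wEq_right q i h1 h2)
  · simpa [mul_assoc] using W (wEq_braid_up q i j h1 h2 h3)
  · simpa [mul_assoc] using W (wEq_braid_down q i j h1 h2 h3)
  · have := W (wEq_IJI_JIJ q n).1
    rwa [List.map_append, List.map_append, List.prod_append, List.prod_append] at this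
  · have := W (wEq_IJI_JIJ q n).2
    rwa [List.map_append, List.map_append, List.prod_append, List.prod_append] at this

/-- The right action of `P_n` on linear combinations of diagrams. -/
noncomputable def action : P q n →ₐ[k] (Module.End k (BDiagram n →₀ k))ᵐᵒᵖ :=
  RingQuot.liftAlgHom k ⟨freeAction q n, fun _ _ h => freeAction_eq_of_rel hq h⟩

/-- The action of `P_n` on the identity diagram. -/
noncomputable def toVec : P q n →ₗ[k] (BDiagram n →₀ k) :=
  (LinearMap.applyₗ (wordVec q [])).comp
    ((opLinearEquiv k).symm.toLinearMap.comp (action hq).toLinearMap)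

theorem toVec_Ew (l : List (Fin (n + 1))) : toVec hq (Ew q l) = wordVec q l := by
  have h1 : action hq (Ew q l) = freeAction q n (l.map (gen k)).prod := by
    rw [← mk_word]; exact RingQuot.liftAlgHom_mkAlgHom_apply ..
  change (action hq (Ew q l)).unop (wordVec q []) = _
  rw [h1, freeAction_word, List.nil_append]

/-- The inverse of `toVec`. -/
noncomputable def ofVec (q : Params k) : (BDiagram n →₀ k) →ₗ[k] P q n :=
  Finsupp.lift _ k _ fun d => (wscalar q (exists_word d.2).choose)⁻¹ • Ew q (exists_word d.2).choose

omit hq in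
theorem ofVec_single (d : BDiagram n) : ∃ w : List (Fin (n + 1)), raw w = d.1 ∧
    ∀ c, ofVec q (Finsupp.single d c) = c • (wscalar q w)⁻¹ • Ew q w := by
  refine ⟨_, (exists_word d.2).choose_spec, fun c => ?_⟩
  rw [ofVec, Finsupp.lift_apply, Finsupp.sum_single_index (by simp)]

theorem toVec_ofVec (x : BDiagram n →₀ k) : toVec hq (ofVec q x) = x := by
  induction x using Finsupp.induction_linear with
  | zero => simp
  | add x y hx hy => rw [map_add, map_add, hx, hy]
  | single d c =>
    obtain ⟨w, hw, e⟩ := ofVec_single (q := q) d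
    rw [e, map_smul, map_smul, toVec_Ew, wordVec, Finsupp.smul_single, Finsupp.smul_single,
      smul_eq_mul, smul_eq_mul, inv_mul_cancel₀ (wscalar_ne_zero hq w), mul_one]
    exact single_congr (by rw [wdiag_of_memB q (by rw [hw]; exact d.2), hw]) rfl

theorem ofVec_toVec (x : P q n) : ofVec q (toVec hq x) = x := by
  have hx : x ∈ Submodule.span k (Set.range (Ew q (n := n))) := by rw [span_Ew]; trivial
  induction hx using Submodule.span_induction with
  | mem x hx =>
    obtain ⟨u, rfl⟩ := hx
    obtain ⟨w, hw, e⟩ := ofVec_single (q := q) ⟨wdiag q u, memB_wdiag q u⟩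
    have h1 : wdiag q w = wdiag q u := by
      rw [wdiag_of_memB q (by rw [hw]; exact memB_wdiag q u), hw]
    obtain ⟨c, hc, hcu⟩ := exists_smul_Ew hq h1.symm
    -- The diagrams agree, so the coefficients of the two vectors determine the factor `c`.
    have h2 : wscalar q u = c * wscalar q w := by
      have := congrArg (toVec hq) hcu
      rw [map_smul, toVec_Ew, toVec_Ew, wordVec, wordVec, Finsupp.smul_single, smul_eq_mul] at this
      have h3 := congrArg (fun v => v ⟨wdiag q u, memB_wdiag q u⟩) this
      simpa [h1] using h3
    rw [toVec_Ew, wordVec, e, h2, hcu, smul_smul, mul_assoc,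
      mul_inv_cancel₀ (wscalar_ne_zero hq w), mul_one]
  | zero => simp
  | add x y _ _ hx hy => rw [map_add, map_add, hx, hy]
  | smul c x _ hx => rw [map_smul, map_smul, hx]

omit hq

/-- Linear combinations of diagrams in `B_n`, as elements of the space of `b_n`. -/
noncomputable def vecEquiv (k : Type*) [Field k] (n : ℕ) : (BDiagram n →₀ k) ≃ₗ[k] B k n :=
  (Finsupp.supportedEquivFinsupp (R := k) (M := k) {d : PreDiagram n | d.MemB}).symm

omit [NeZero n] in
theorem vecEquiv_single (d : BDiagram n) (c : k) :
    (vecEquiv k n (Finsupp.single d c) : PreDiagram n →₀ k) = Finsupp.single d.1 c :=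
  Finsupp.supportedEquivFinsupp_symm_single ..

theorem vecEquiv_wordVec (l : List (Fin (n + 1))) :
    (vecEquiv k n (wordVec q l) : PreDiagram n →₀ k) = Finsupp.single (wdiag q l) (wscalar q l) :=
  vecEquiv_single ..

omit [NeZero n] in
theorem mul_single (a b : PreDiagram n) (c c' : k) :
    mul q (Finsupp.single a c) (Finsupp.single b c') =
      Finsupp.single (mulDiagram q a b) (c * c' * mulScalar q a b) := by
  simp only [mul, Finsupp.lift_apply]
  rw [Finsupp.sum_single_index (by simp), LinearMap.smul_apply, Finsupp.lift_apply,
    Finsupp.sum_single_index (by simp), Finsupp.smul_single, Finsupp.smul_single, smul_eq_mul,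
    smul_eq_mul, mul_assoc]

/-- If the raw diagram of `v` needs no straightening, concatenation with it is the action of `v`
letter by letter, and the loops are accounted for by `loopProd_raw`. -/
theorem mul_wordVec_of_memB (u : List (Fin (n + 1))) {v : List (Fin (n + 1))} (hv : (raw v).MemB) :
    mul q (vecEquiv k n (wordVec q u) : PreDiagram n →₀ k)
      (vecEquiv k n (wordVec q v) : PreDiagram n →₀ k) =
      (vecEquiv k n (wordVec q (u ++ v)) : PreDiagram n →₀ k) := by
  have hm := (memB_wdiag q u).toIsLRBlob.isMatching
  rw [vecEquiv_wordVec, vecEquiv_wordVec, vecEquiv_wordVec, mul_single, wdiag_of_memB q hv]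
  have h1 : mulDiagram q (wdiag q u) (raw v) = wdiag q (u ++ v) := by
    rw [wdiag_append, mulDiagram, concat_raw hm]; rfl
  have h2 : mulScalar q (wdiag q u) (raw v) = loopProd q (wdiag q u) (raw v) *
      redScalar q ((wdiag q u).ractList v) := by
    rw [mulScalar, concat_raw hm, mul_assoc]; rfl
  rw [h1, h2, wscalar_append, ← loopProd_raw q hm, wscalar, wscalar, hv.redScalar_eq q]
  congr 1
  ring

include hq

/-- The isomorphism of `P_n` with the space of linear combinations of diagrams. -/
noncomputable def vecIso : P q n ≃ₗ[k] (BDiagram n →₀ k) :=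
  { toVec hq with
    invFun := ofVec q
    left_inv := ofVec_toVec hq
    right_inv := toVec_ofVec hq }

/-- The isomorphism of `P_n` with `b_n`. -/
noncomputable def isoB : P q n ≃ₗ[k] B k n := (vecIso hq).trans (vecEquiv k n)

theorem mul_toVec (x y : P q n) :
    (vecEquiv k n (toVec hq (x * y)) : PreDiagram n →₀ k) =
      mul q (vecEquiv k n (toVec hq x)) (vecEquiv k n (toVec hq y)) := by
  have top : ∀ x : P q n, x ∈ Submodule.span k (Set.range (Ew q (n := n))) := fun x => by
    rw [span_Ew]; trivial
  induction top x using Submodule.span_induction with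
  | zero => simp
  | add x x' _ _ hx hx' => rw [add_mul]; simp only [map_add, Submodule.coe_add, hx, hx',
      LinearMap.add_apply]
  | smul c x _ hx => rw [smul_mul_assoc]; simp only [map_smul, Submodule.coe_smul, hx,
      LinearMap.smul_apply]
  | mem x hx =>
    obtain ⟨u, rfl⟩ := hx
    induction top y using Submodule.span_induction with
    | zero => simp
    | add x x' _ _ hx hx' => rw [mul_add]; simp only [map_add, Submodule.coe_add, hx, hx']
    | smul c x _ hx => rw [mul_smul_comm]; simp only [map_smul, Submodule.coe_smul, hx]
    | mem x hx =>
      obtain ⟨v, rfl⟩ := hx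
      -- The word `v` is replaced by a proportional one whose raw diagram lies in B_n, as
      -- `mul_wordVec_of_memB` requires.
      obtain ⟨w, hw⟩ := exists_word (memB_wdiag q v)
      have hwB : (raw w).MemB := by rw [hw]; exact memB_wdiag q v
      obtain ⟨c, -, e⟩ := exists_smul_Ew hq (u := v) (v := w) (by rw [wdiag_of_memB q hwB, hw])
      rw [e, mul_smul_comm, ← Ew_append]
      simp only [map_smul, Submodule.coe_smul, toVec_Ew, mul_wordVec_of_memB u hwB]

omit hq

omit [NeZero n] in
theorem memB_of_word {d : PreDiagram n} (h : d.IsLRBlob)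
    (hw : ∀ x, d.word x = [] ∨ d.word x = [L] ∨ d.word x = [R]) : d.MemB := by
  refine memB_iff.2 ⟨h, fun x => ?_, ?_⟩
  · unfold IsNormal
    have := hw x
    tauto
  · rintro ⟨⟨i, hi⟩, -⟩
    have := hw (.inl i)
    rw [hi.2] at this
    simp at this

theorem memB_raw_singleton (i : Fin (n + 1)) : (raw [i]).MemB := by
  refine memB_of_word (isLRBlob_raw [i]) fun x => ?_
  have h1 : raw [i] = (one n).ract i := rfl
  rw [h1]
  rcases ract_cases (⟨0, 0, 0, 0, 0, 0⟩ : Params ℚ) i with ⟨-, h, -⟩ | ⟨-, h, -⟩ | ⟨a, b, -, h, -⟩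
  · rw [h, addBlob]
    simp only [one_word]
    split_ifs <;> simp
  · rw [h, addBlob]
    simp only [one_word]
    split_ifs <;> simp
  · rw [h, join]
    simp only [one_word]
    split_ifs <;> simp

omit [NeZero n] in
theorem memB_one : (one n).MemB := memB_of_word isLRBlob_one fun x => by simp

theorem vecEquiv_wordVec_singleton (i : Fin (n + 1)) :
    (vecEquiv k n (wordVec q [i]) : PreDiagram n →₀ k) = diag k (raw [i]) := by
  have h := memB_raw_singleton i
  rw [vecEquiv_wordVec, wdiag_of_memB q h, wscalar, h.redScalar_eq q, rweightList_singleton,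
    one_mul]

theorem vecEquiv_wordVec_nil :
    (vecEquiv k n (wordVec q []) : PreDiagram n →₀ k) = diag k (one n) := by
  have h := memB_one (n := n)
  have hr : raw [] = one n := rfl
  rw [vecEquiv_wordVec, wdiag_of_memB q (by rwa [hr]), wscalar, hr, h.redScalar_eq q, rweightList,
    one_mul]

end

end SympBlob

theorem theorem3p4 {k : Type*} [Field k] (n : ℕ) (hn : 1 ≤ n) (q : SympBlob.Params k)
    (hδ : q.δ ≠ 0) (hδL : q.δL ≠ 0) (hδR : q.δR ≠ 0)
    (hκL : q.κL ≠ 0) (hκR : q.κR ≠ 0) (hκLR : q.κLR ≠ 0) :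
    ∃ φ : SympBlob.P q n ≃ₗ[k] SympBlob.B k n,
      (φ 1 : SympBlob.PreDiagram n →₀ k) = SympBlob.diag k (SympBlob.PreDiagram.one n) ∧
      (∀ x y, (φ (x * y) : SympBlob.PreDiagram n →₀ k) = SympBlob.mul q (φ x) (φ y)) ∧
      (φ (SympBlob.E q 0) : SympBlob.PreDiagram n →₀ k) =
        SympBlob.diag k (SympBlob.PreDiagram.e n) ∧
      (∀ (i : Fin (n + 1)) (h₁ : 1 ≤ (i : ℕ)) (h₂ : (i : ℕ) < n),
        (φ (SympBlob.E q i) : SympBlob.PreDiagram n →₀ k) =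
          SympBlob.diag k (SympBlob.PreDiagram.ei (i : ℕ) h₁ h₂)) ∧
      (φ (SympBlob.E q (Fin.last n)) : SympBlob.PreDiagram n →₀ k) =
        SympBlob.diag k (SympBlob.PreDiagram.f n) := by
  have : NeZero n := ⟨by omega⟩
  have hq : q.Nonzero := ⟨hδ, hδL, hδR, hκL, hκR, hκLR⟩
  have gen : ∀ i : Fin (n + 1),
      (SympBlob.vecEquiv k n (SympBlob.toVec hq (SympBlob.E q i)) : SympBlob.PreDiagram n →₀ k) =
        SympBlob.diag k (SympBlob.PreDiagram.raw [i]) := fun i => by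
    rw [← SympBlob.vecEquiv_wordVec_singleton (q := q), ← SympBlob.toVec_Ew hq]
    simp [SympBlob.Ew]
  refine ⟨SympBlob.isoB hq, ?_, fun x y => SympBlob.mul_toVec hq x y, ?_, ?_, ?_⟩
  · rw [← SympBlob.vecEquiv_wordVec_nil (q := q), ← SympBlob.toVec_Ew hq]
    rfl
  · rw [← SympBlob.PreDiagram.raw_zero]
    exact gen 0
  · intro i h₁ h₂
    rw [← SympBlob.PreDiagram.raw_mid i h₁ h₂]
    exact gen i
  · rw [← SympBlob.PreDiagram.raw_last]
    exact gen _
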